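/- Let $q\in\mathbb{C}$ with $0<|q|<1$, and write $(a;q)_\infty=\prod_{n\ge 0}(1-aq^n)$, $(a_1,\dots,a_m;q)_\infty=\prod_{i}(a_i;q)_\infty$, $(az^{\pm1};q)_\infty=(az,az^{-1};q)_\infty$, $\theta(a;q)=(a,q/a;q)_\infty$ and $\theta(a,b;q)=\theta(a;q)\theta(b;q)$. Let $\widetilde{\mathcal H}_1=\{t\in\mathbb{C}^8 : \prod_{j=1}^8t_j=1\}$ and $\mathcal H_1=\widetilde{\mathcal H}_1/\{\pm1\}$. Put $$I_t(t;z)=\frac{(z^{\pm2},t_1^{-1}z^{\pm1},t_8^{-1}z^{\pm1};q)_\infty}{\prod_{j=2}^7(t_jz^{\pm1};q)_\infty},$$ $$J_t^\mu(t;z)=2\,\frac{\theta(t_1t_8/\mu z,\,z/\mu;q)}{\theta(t_1/\mu,\,t_8/\mu;q)}\Bigl(1-\frac{z^2}{q}\Bigr)\prod_{i=2}^7\frac{(z/t_i;q)_\infty}{(t_iz;q)_\infty}\prod_{j=1,8}\frac{1}{(t_jz/q,\,t_j/z;q)_\infty}.$$ Let $t\in\widetilde{\mathcal H}_1$. If $t_jt_k\notin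 q^{\mathbb{Z}_{\le0}}$ for all $2\le j,k\le7$ (possibly equal), define $$S_t(t)=\int_{\mathcal C}I_t(t;z)\frac{dz}{2\pi iz}.$$ If $t_jt_k\notin q^{\mathbb{Z}_{\le1}}$ for all $j,k\in\{1,8\}$ (possibly equal) and $t_jt_i\notin q^{\mathbb{Z}_{\le0}}$ for all $j\in\{1,8\}$, $2\le i\le7$, define $$U_t(t)=\int_{\mathcal C'}J^\mu_t(t;z)\frac{dz}{2\pi iz},$$ where $\mu\in\mathbb{C}\setminus\{0\}$ is any number with $\theta(t_1/\mu,t_8/\mu;q)\neq0$. Here $\mathcal C$ (respectively $\mathcal C'$) is a deformation of the positively oriented unit circle, i.e. a closed piecewise $C^1$ curve in $\mathbb{C}\setminus\{0\}$ with winding number $1$ around $0$, which includes (winding number $1$) the points $t_jq^{\mathbb{Z}_{\ge0}}$, $2\le j\le7$, and excludes (winding number $0$) their reciprocals (respectively includes $t_jq^{\mathbb{Z}_{\ge0}}$ for $j=1,8$, and excludes $t_j^{-1}q^{\mathbb{Z}_{\le1}}$ for $j=1,8$ and $t_i^{-1}q^{\mathbb{Z}_{\le0}}$ for $2\le i\le7$).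 Such contours exist, the integrals do not depend on the choice of the contours or of $\mu$, and the functions $S_t$ and $U_t$, defined on the above dense open subsets of $\widetilde{\mathcal H}_1$, are holomorphic there, extend to meromorphic functions on $\widetilde{\mathcal H}_1$, and are invariant under $t\mapsto-t$; so they are meromorphic functions on $\mathcal H_1$. Both $S_t(t)$ and $U_t(t)$ are invariant under permutations of $(t_1,t_8)$ and of $(t_2,\dots,t_7)$. Moreover, with $w(\pm t)=\pm(st_1,st_2,st_3,st_4,s^{-1}t_5,s^{-1}t_6,s^{-1}t_7,s^{-1}t_8)$, where $s^2=1/t_1t_2t_3t_4=t_5t_6t_7t_8$, $$S_t(t)=S_t(wt)\,\frac{(1/t_1t_2,\,1/t_1t_3,\,1/t_1t_4,\,1/t_8t_5,\,1/t_8t_6,\,1/t_8t_7;q)_\infty}{(t_2t_3,\,t_2t_4,\,t_3t_4,\,t_5t_6,\,t_5t_7,\,t_6t_7;q)_\infty},$$ $$U_t(t)=U_t(wt)\,\frac{(1/t_2t_3,\,1/t_2t_4,\,1/t_3t_4,\,1/t_5t_6,\,1/t_5t_7,\,1/t_6t_7;q)_\infty}{(t_1t_2,\,t_1t_3,\,t_1t_4,\,t_5t_8,\,t_6t_8,\,t_7t_8;q)_\infty}$$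 as meromorphic functions of $t\in\mathcal H_1$; the two identities hold at every $t$ for which both $t$ and $wt$ belong to the above domain of definition of $S_t$, respectively $U_t$. -/

import Mathlib

open Filter Topology

noncomputable section

namespace TrigHyp

/-! The coordinates `t_1, …, t_8` of a parameter `t` are written `t 0, …, t 7`. -/

/-- The q-shifted factorial `(a;q)_∞ = ∏_{n ≥ 0} (1 - a qⁿ)`. -/
def qPoch (q a : ℂ) : ℂ := ∏' n : ℕ, (1 - a * q ^ n)

/-- The renormalized Jacobi theta function `θ(a;q) = (a, q/a; q)_∞`. -/
def theta (q a : ℂ) : ℂ := qPoch q a * qPoch q (q / a)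

/-- The index set `{1, 8}`. -/
def endIdx : Finset (Fin 8) := {0, 7}

/-- The index set `{2, …, 7}`. -/
def midIdx : Finset (Fin 8) := {1, 2, 3, 4, 5, 6}

/-! ### Contours -/

/-- `γ`, restricted to `[0,1]`, is a closed piecewise continuously differentiable curve
(continuous, `C¹` with bounded derivative off a finite set of parameters). -/
structure IsClosedCurve (γ : ℝ → ℂ) : Prop where
  continuousOn : ContinuousOn γ (Set.Icc 0 1)
  closed : γ 0 = γ 1
  piecewise : ∃ P : Finset ℝ, ∃ M : ℝ, ∀ x ∈ Set.Ioo (0 : ℝ) 1, x ∉ P →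
    ContDiffAt ℝ 1 γ x ∧ ‖deriv γ x‖ ≤ M

/-- `∫_γ f(z) dz / (2πi)`. -/
def contourIntegral (f : ℂ → ℂ) (γ : ℝ → ℂ) : ℂ :=
  (2 * (Real.pi : ℂ) * Complex.I)⁻¹ * ∫ x in (0 : ℝ)..1, f (γ x) * deriv γ x

/-- `γ` does not pass through `p` and has winding number `m` around `p`. -/
def HasWinding (γ : ℝ → ℂ) (p : ℂ) (m : ℤ) : Prop :=
  (∀ x ∈ Set.Icc (0 : ℝ) 1, γ x ≠ p) ∧ contourIntegral (fun z => (z - p)⁻¹) γ = m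

/-- `γ` is a deformation of the positively oriented unit circle in `ℂ \ {0}` (that is, a closed
curve in `ℂ \ {0}` with winding number one around the origin) which includes the points of `A`
and excludes the points of `B`. -/
structure IsDeformedCircle (γ : ℝ → ℂ) (A B : Set ℂ) : Prop where
  curve : IsClosedCurve γ
  origin : HasWinding γ 0 1
  includes : ∀ p ∈ A, HasWinding γ p 1
  excludes : ∀ p ∈ B, HasWinding γ p 0

/-! ### The parameter space and meromorphic functions on it -/

/-- The parameter space `{t ∈ ℂ⁸ | t_1 ⋯ t_8 = 1}`; `H_1` is its quotient by `t ↦ -t`. -/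
def paramSpace : Set (Fin 8 → ℂ) := {t | ∏ j, t j = 1}

/-- `F`, considered on the subset `D` of `paramSpace`, represents a meromorphic function on
`paramSpace`: `D` is relatively open and dense, `F` is holomorphic on `D`, and near every point
of `paramSpace` the function `F` is a quotient `f / g` of holomorphic functions with `g` not
identically zero on `paramSpace` near that point (as `paramSpace` is a complex manifold, the zero
set of `g` is then nowhere dense near the point). As `D` is dense, the meromorphic extension is
determined by the restriction of `F` to `D`. -/
structure RepresentsMeromorphic (D : Set (Fin 8 → ℂ)) (F : (Fin 8 → ℂ) → ℂ) : Prop where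
  isOpen : ∃ O : Set (Fin 8 → ℂ), IsOpen O ∧ D = O ∩ paramSpace
  dense : paramSpace ⊆ closure D
  holomorphic : ∀ τ ∈ D, ∃ f : (Fin 8 → ℂ) → ℂ, AnalyticAt ℂ f τ ∧
    ∀ᶠ t in 𝓝[paramSpace] τ, F t = f t
  quotient : ∀ τ ∈ paramSpace, ∃ f g : (Fin 8 → ℂ) → ℂ, AnalyticAt ℂ f τ ∧ AnalyticAt ℂ g τ ∧
    (∃ᶠ t in 𝓝[paramSpace] τ, g t ≠ 0) ∧ ∀ᶠ t in 𝓝[D] τ, g t * F t = f t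

/-- A representative `(s t_1, s t_2, s t_3, s t_4, t_5/s, t_6/s, t_7/s, t_8/s)` of `w(±t)`, where
`s² t_1 t_2 t_3 t_4 = 1`; the two choices of `s` give the two representatives. -/
def wAct (s : ℂ) (t : Fin 8 → ℂ) : Fin 8 → ℂ :=
  fun j => if (j : ℕ) < 4 then s * t j else s⁻¹ * t j

/-! ### The integral `S_t` -/

/-- The integrand `I_t(t;z)`. -/
def integrandS (q : ℂ) (t : Fin 8 → ℂ) (z : ℂ) : ℂ :=
  qPoch q (z ^ 2) * qPoch q ((z ^ 2)⁻¹) *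
    (∏ j ∈ endIdx, qPoch q ((t j)⁻¹ * z) * qPoch q ((t j)⁻¹ * z⁻¹)) /
    ∏ j ∈ midIdx, qPoch q (t j * z) * qPoch q (t j * z⁻¹)

/-- The pole sequences `t_j q^n` (`2 ≤ j ≤ 7`, `n ≥ 0`). -/
def polesInS (q : ℂ) (t : Fin 8 → ℂ) : Set ℂ :=
  {p | ∃ j ∈ midIdx, ∃ n : ℕ, p = t j * q ^ n}

/-- The reciprocals of the points `t_j q^n` (`2 ≤ j ≤ 7`, `n ≥ 0`). -/
def polesOutS (q : ℂ) (t : Fin 8 → ℂ) : Set ℂ :=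
  {p | ∃ j ∈ midIdx, ∃ n : ℕ, p = (t j * q ^ n)⁻¹}

/-- The parameters for which no point to be included is also to be excluded. -/
def genericS (q : ℂ) : Set (Fin 8 → ℂ) :=
  {t | t ∈ paramSpace ∧ ∀ j ∈ midIdx, ∀ k ∈ midIdx, ∀ n : ℕ, t j * t k * q ^ n ≠ 1}

/-- Admissible contours for `S_t(t)`. -/
def IsContourS (q : ℂ) (t : Fin 8 → ℂ) (γ : ℝ → ℂ) : Prop :=
  IsDeformedCircle γ (polesInS q t) (polesOutS q t)

/-- `∫_γ I_t(t;z) dz / (2πi z)`. -/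
def integralS (q : ℂ) (t : Fin 8 → ℂ) (γ : ℝ → ℂ) : ℂ :=
  contourIntegral (fun z => integrandS q t z / z) γ

open Classical in
/-- `S_t(t)`, computed with an admissible contour (for `t` in `genericS q`; the value `0` is used
at the remaining points). -/
def trigS (q : ℂ) (t : Fin 8 → ℂ) : ℂ :=
  if h : ∃ γ, IsContourS q t γ then integralS q t h.choose else 0

/-! ### The integral `U_t` -/

/-- The integrand `J_t^μ(t;z)`. -/
def integrandU (q μ : ℂ) (t : Fin 8 → ℂ) (z : ℂ) : ℂ :=
  2 * (theta q (t 0 * t 7 / (μ * z)) * theta q (z / μ) /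
      (theta q (t 0 / μ) * theta q (t 7 / μ))) * (1 - z ^ 2 / q) *
    (∏ i ∈ midIdx, qPoch q (z / t i) / qPoch q (t i * z)) *
    ∏ j ∈ endIdx, 1 / (qPoch q (t j * z / q) * qPoch q (t j / z))

/-- The pole sequences `t_j q^n` (`j = 1, 8`, `n ≥ 0`). -/
def polesInU (q : ℂ) (t : Fin 8 → ℂ) : Set ℂ :=
  {p | ∃ j ∈ endIdx, ∃ n : ℕ, p = t j * q ^ n}

/-- The pole sequences `t_j⁻¹ q^m` (`j = 1, 8`, `m ≤ 1`) and `t_i⁻¹ q^m` (`2 ≤ i ≤ 7`, `m ≤ 0`). -/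
def polesOutU (q : ℂ) (t : Fin 8 → ℂ) : Set ℂ :=
  {p | (∃ j ∈ endIdx, ∃ m : ℤ, m ≤ 1 ∧ p = (t j)⁻¹ * q ^ m) ∨
    ∃ i ∈ midIdx, ∃ m : ℤ, m ≤ 0 ∧ p = (t i)⁻¹ * q ^ m}

/-- The parameters for which no point to be included is also to be excluded. -/
def genericU (q : ℂ) : Set (Fin 8 → ℂ) :=
  {t | t ∈ paramSpace ∧ (∀ j ∈ endIdx, ∀ k ∈ endIdx, ∀ n : ℕ, t j * t k * q ^ n ≠ q) ∧
    ∀ j ∈ endIdx, ∀ i ∈ midIdx, ∀ n : ℕ, t j * t i * q ^ n ≠ 1}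

/-- `μ` is a generic auxiliary parameter and `γ` an admissible contour for `U_t^μ(t)`. -/
def IsContourU (q : ℂ) (t : Fin 8 → ℂ) (μ : ℂ) (γ : ℝ → ℂ) : Prop :=
  μ ≠ 0 ∧ theta q (t 0 / μ) * theta q (t 7 / μ) ≠ 0 ∧
    IsDeformedCircle γ (polesInU q t) (polesOutU q t)

/-- `∫_γ J_t^μ(t;z) dz / (2πi z)`. -/
def integralU (q μ : ℂ) (t : Fin 8 → ℂ) (γ : ℝ → ℂ) : ℂ :=
  contourIntegral (fun z => integrandU q μ t z / z) γ

open Classical in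
/-- `U_t(t)`, computed with a generic `μ` and an admissible contour (for `t` in `genericU q`; the
value `0` is used at the remaining points). -/
def trigU (q : ℂ) (t : Fin 8 → ℂ) : ℂ :=
  if h : ∃ c : ℂ × (ℝ → ℂ), IsContourU q t c.1 c.2 then
    integralU q h.choose.1 t h.choose.2 else 0

end TrigHyp

end

noncomputable section
namespace TrigHyp

/-! ### The q-shifted factorial -/

/-! Both `w`-symmetries come from evaluating a double integral in two orders. The inner integral in
either order is a beta integral with an explicit product value, and the double integrand is
symmetric under exchanging the variables together with two triples of parameters. Integrating out
one variable leaves the integrand at `t`, integrating out the other leaves the integrand at `wt`,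
and the two prefactors give the quotient of products.

For `S_t` the beta integral is that of Nassrallah and Rahman. Its normalized value is unchanged
under `a ↦ aq`, because the difference of the two integrands has the form `ψ(z) - ψ(z/q)` with `ψ`
holomorphic on the annulus between the two circles (`circleMean_nrIntegrand_step`). Iterating with
`a qⁿ → 0` shows independence of `a`, and by symmetry of every parameter. The remaining constant
cancels between the two orders of integration, so only its non-vanishing matters.

For `U_t` the inner integral contains theta functions and an auxiliary parameter. The three-term
theta relation (`thetaPair_three_term`) is used twice. As `theta_interchange` it shows that changing
the auxiliary parameter changes the integrand by a function without poles inside the contour. As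
`theta_quartic` it shows that, for a special auxiliary parameter, the sum over `y ↔ 1/y` is the
Nassrallah–Rahman integrand. This evaluates the beta integral (`circleMean_betaIntegrand`), and the
double integral argument then applies with suitably coupled auxiliary parameters.

These computations take place on circles, for parameters of restricted size. The general case
follows by analytic continuation along curves `t_j exp(u d_j)` in the parameter space: the values of
`u` to be avoided form a countable set, whose complement in the plane is connected
(`eq_mul_of_eq_near_one`). Holomorphy on the generic set and meromorphy elsewhere come from a Bézout
identity that splits a multiple of the integrand into one part whose contour can be a fixed small
circle and one whose contour can be a fixed large circle
(`exists_analyticAt_prod_mul_contourIntegral`).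

Contours are described by winding numbers only. Independence of the contour is therefore a residue
argument by partial fractions (`contourIntegral_eq_of_winding`), and existence is obtained by
attaching lassos around finitely many points to a small circle (`exists_lasso`). -/

theorem summable_qPoch {q : ℂ} (hq : ‖q‖ < 1) (a : ℂ) : Summable fun n : ℕ => ‖-(a * q ^ n)‖ := by
  simpa [norm_mul, norm_pow] using
    (summable_geometric_of_lt_one (norm_nonneg q) hq).mul_left ‖a‖

theorem multipliable_qPoch {q : ℂ} (hq : ‖q‖ < 1) (a : ℂ) :
    Multipliable fun n : ℕ => 1 - a * q ^ n := by
  simpa [sub_eq_add_neg] using multipliable_one_add_of_summable (summable_qPoch hq a)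

theorem qPoch_succ {q : ℂ} (hq : ‖q‖ < 1) (a : ℂ) :
    qPoch q a = (1 - a) * qPoch q (a * q) := by
  have h := tprod_eq_zero_mul' (f := fun n : ℕ => 1 - a * q ^ n)
    (by simpa [pow_succ', mul_assoc] using multipliable_qPoch hq (a * q))
  simpa [qPoch, pow_succ', mul_assoc] using h

theorem qPoch_eq_prod_mul {q : ℂ} (hq : ‖q‖ < 1) (a : ℂ) (N : ℕ) :
    qPoch q a = (∏ n ∈ Finset.range N, (1 - a * q ^ n)) * qPoch q (a * q ^ N) := by
  induction N with
  | zero => simp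
  | succ N ih =>
    rw [ih, Finset.prod_range_succ, qPoch_succ hq (a * q ^ N)]; ring_nf

/-- An absolutely convergent product without vanishing factors is nonzero. All locations of poles
are read off from this. -/
theorem qPoch_eq_zero_iff {q : ℂ} (hq : ‖q‖ < 1) {a : ℂ} :
    qPoch q a = 0 ↔ ∃ n : ℕ, a * q ^ n = 1 := by
  constructor
  · intro h
    by_contra! hn
    refine tprod_one_add_ne_zero_of_summable (f := fun n : ℕ => -(a * q ^ n)) (fun n hz => ?_)
      (summable_qPoch hq a) (by simpa [qPoch, sub_eq_add_neg] using h)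
    exact hn n (by linear_combination -hz)
  · rintro ⟨n, hn⟩
    rw [qPoch_eq_prod_mul hq a (n + 1), Finset.prod_range_succ, hn]
    simp

theorem qPoch_ne_zero_iff {q : ℂ} (hq : ‖q‖ < 1) {a : ℂ} :
    qPoch q a ≠ 0 ↔ ∀ n : ℕ, a * q ^ n ≠ 1 := by
  rw [Ne, qPoch_eq_zero_iff hq]; push Not; rfl

theorem mul_pow_ne_one_of_norm_lt {q a : ℂ} (hq : ‖q‖ < 1) (ha : ‖a‖ < 1) (n : ℕ) :
    a * q ^ n ≠ 1 := by
  intro h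
  have h1 : ‖a * q ^ n‖ < 1 := by
    rw [norm_mul, norm_pow]
    exact (mul_le_of_le_one_right (norm_nonneg _) (pow_le_one₀ (norm_nonneg _) hq.le)).trans_lt ha
  rw [h] at h1; simp at h1

theorem qPoch_ne_zero_of_norm_lt {q a : ℂ} (hq : ‖q‖ < 1) (ha : ‖a‖ < 1) : qPoch q a ≠ 0 :=
  (qPoch_ne_zero_iff hq).2 (mul_pow_ne_one_of_norm_lt hq ha)

/-- On the ball of radius `‖a‖ + 1` the factors are dominated by a geometric series, so the product
converges locally uniformly and its limit is entire. -/
theorem differentiable_qPoch {q : ℂ} (hq : ‖q‖ < 1) : Differentiable ℂ (qPoch q) := by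
  intro a
  have hu : Summable fun n : ℕ => (‖a‖ + 1) * ‖q‖ ^ n :=
    (summable_geometric_of_lt_one (norm_nonneg q) hq).mul_left _
  have h := Summable.hasProdLocallyUniformlyOn_nat_one_add
    (f := fun n x => -(x * q ^ n)) (Metric.isOpen_ball (x := (0 : ℂ)) (ε := ‖a‖ + 1)) hu
    (.of_forall fun n x hx => by
      rw [norm_neg, norm_mul, norm_pow]
      have : ‖x‖ ≤ ‖a‖ + 1 := by simpa using (Metric.mem_ball.1 hx).le
      gcongr)
    (fun n => by fun_prop)
  have h2 := h.differentiableOn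
    (.of_forall fun _ => by
      simpa [Finset.prod_fn] using DifferentiableOn.finsetProd (fun _ _ => by fun_prop))
    Metric.isOpen_ball
  have h3 : DifferentiableAt ℂ (fun x => ∏' n : ℕ, (1 + -(x * q ^ n))) a :=
    h2.differentiableAt (Metric.isOpen_ball.mem_nhds (by simp))
  have h4 : (fun x => ∏' n : ℕ, (1 + -(x * q ^ n))) = qPoch q := by
    funext x; simp [qPoch, sub_eq_add_neg]
  rwa [h4] at h3

theorem continuous_qPoch {q : ℂ} (hq : ‖q‖ < 1) : Continuous (qPoch q) :=
  (differentiable_qPoch hq).continuous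

theorem analyticAt_qPoch {q : ℂ} (hq : ‖q‖ < 1) (a : ℂ) : AnalyticAt ℂ (qPoch q) a :=
  (differentiable_qPoch hq).analyticAt a

theorem _root_.AnalyticAt.qPoch {E : Type*} [NormedAddCommGroup E] [NormedSpace ℂ E] {q : ℂ}
    (hq : ‖q‖ < 1) {f : E → ℂ} {x : E} (hf : AnalyticAt ℂ f x) :
    AnalyticAt ℂ (fun y => TrigHyp.qPoch q (f y)) x :=
  (analyticAt_qPoch hq (f x)).fun_comp hf

theorem qPoch_zero {q : ℂ} : qPoch q 0 = 1 := by simp [qPoch]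

/-! ### The theta function -/

theorem theta_q_div {q a : ℂ} (hq0 : q ≠ 0) : theta q (q / a) = theta q a := by
  rw [theta, theta, div_div_cancel₀ hq0, mul_comm]

theorem theta_mul_q {q a : ℂ} (hq0 : q ≠ 0) (hq : ‖q‖ < 1) (ha : a ≠ 0) :
    theta q (a * q) = -a⁻¹ * theta q a := by
  have h1 : q / (a * q) = a⁻¹ := by field_simp
  rw [theta, theta, qPoch_succ hq a, h1, qPoch_succ hq a⁻¹, inv_mul_eq_div]
  field_simp
  ring

theorem theta_inv {q a : ℂ} (hq0 : q ≠ 0) (hq : ‖q‖ < 1) (ha : a ≠ 0) :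
    theta q a⁻¹ = -a⁻¹ * theta q a := by
  rw [← theta_mul_q hq0 hq ha, ← theta_q_div hq0, div_inv_eq_mul, mul_comm]

theorem theta_div_q {q a : ℂ} (hq0 : q ≠ 0) (hq : ‖q‖ < 1) (ha : a ≠ 0) :
    theta q (a / q) = -(a / q) * theta q a := by
  have h := theta_mul_q hq0 hq (div_ne_zero ha hq0)
  rw [div_mul_cancel₀ _ hq0] at h
  rw [h]; field_simp

theorem theta_ne_zero_iff {q a : ℂ} (hq0 : q ≠ 0) (hq : ‖q‖ < 1) (ha : a ≠ 0) :
    theta q a ≠ 0 ↔ ∀ n : ℤ, a ≠ q ^ n := by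
  rw [theta, mul_ne_zero_iff, qPoch_ne_zero_iff hq, qPoch_ne_zero_iff hq]
  constructor
  · rintro ⟨h1, h2⟩ n rfl
    -- The powers `q ^ n` with `n ≤ 0` are the zeros of `(a;q)_∞`, those with `n ≥ 1` the zeros of
    -- `(q/a;q)_∞`.
    rcases le_or_gt n 0 with hn | hn
    · obtain ⟨k, hk⟩ := Int.eq_ofNat_of_zero_le (neg_nonneg.2 hn)
      apply h1 k
      rw [← zpow_natCast, ← hk, ← zpow_add₀ hq0]; simp
    · obtain ⟨k, hk⟩ := Int.eq_ofNat_of_zero_le (Int.sub_nonneg_of_le hn)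
      apply h2 k
      rw [← zpow_natCast, ← hk, zpow_sub₀ hq0]
      have := zpow_ne_zero n hq0
      field_simp
      simp
  · intro h
    refine ⟨fun n hn => h (-n) ?_, fun n hn => h (n + 1) ?_⟩
    · rw [zpow_neg, zpow_natCast]
      exact eq_inv_of_mul_eq_one_left hn
    · rw [zpow_add₀ hq0, zpow_natCast, zpow_one, mul_comm]
      field_simp at hn
      rw [hn]

theorem differentiableAt_theta {q a : ℂ} (hq : ‖q‖ < 1) (ha : a ≠ 0) :
    DifferentiableAt ℂ (theta q) a := by
  unfold theta
  exact ((differentiable_qPoch hq) a).mul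
    (((differentiable_qPoch hq) (q / a)).comp a (by fun_prop (disch := assumption)))

theorem _root_.AnalyticAt.theta {E : Type*} [NormedAddCommGroup E] [NormedSpace ℂ E] {q : ℂ}
    (hq : ‖q‖ < 1) {f : E → ℂ} {x : E} (hf : AnalyticAt ℂ f x) (h0 : f x ≠ 0) :
    AnalyticAt ℂ (fun y => TrigHyp.theta q (f y)) x :=
  (hf.qPoch hq).mul ((analyticAt_const.div hf h0).qPoch hq)

end TrigHyp
end

noncomputable section
namespace TrigHyp

/-! ### Integrals along closed curves -/

open MeasureTheory in
theorem IsClosedCurve.ae_bound {γ : ℝ → ℂ} (hγ : IsClosedCurve γ) :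
    ∃ M : ℝ, ∀ᵐ x ∂(volume.restrict (Set.Ioc (0 : ℝ) 1)), ‖deriv γ x‖ ≤ M := by
  obtain ⟨P, M, hM⟩ := hγ.piecewise
  refine ⟨M, ?_⟩
  -- The derivative is bounded only on the open interval off `P`, so the endpoint `1` of `Ioc` is
  -- discarded as well.
  have hnull : ∀ᵐ x ∂(volume.restrict (Set.Ioc (0 : ℝ) 1)), x ∉ (insert 1 P : Finset ℝ) :=
    ae_restrict_of_ae (by
      exact compl_mem_ae_iff.2 (Finset.measure_zero (insert (1 : ℝ) P) volume))
  filter_upwards [hnull, ae_restrict_mem measurableSet_Ioc] with x hx hx1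
  simp only [Finset.mem_insert, not_or] at hx
  exact (hM x ⟨hx1.1, lt_of_le_of_ne hx1.2 hx.1⟩ hx.2).2

open MeasureTheory in
theorem IsClosedCurve.intervalIntegrable {γ : ℝ → ℂ} (hγ : IsClosedCurve γ) {f : ℂ → ℂ}
    (hf : ContinuousOn f (γ '' Set.Icc 0 1)) :
    IntervalIntegrable (fun x => f (γ x) * deriv γ x) volume 0 1 := by
  rw [intervalIntegrable_iff_integrableOn_Ioc_of_le zero_le_one]
  obtain ⟨M, hM⟩ := hγ.ae_bound
  have hc : ContinuousOn (fun x => f (γ x)) (Set.Icc 0 1) :=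
    hf.comp hγ.continuousOn (Set.mapsTo_image _ _)
  have h1 : IntegrableOn (fun x => f (γ x)) (Set.Ioc 0 1) :=
    (hc.integrableOn_compact isCompact_Icc).mono_set Set.Ioc_subset_Icc_self
  exact h1.mul_bdd (c := M) (stronglyMeasurable_deriv γ).aestronglyMeasurable hM

theorem contourIntegral_congr {f g : ℂ → ℂ} {γ : ℝ → ℂ}
    (h : ∀ x ∈ Set.Icc (0 : ℝ) 1, f (γ x) = g (γ x)) :
    contourIntegral f γ = contourIntegral g γ := by
  unfold contourIntegral
  congr 1
  refine intervalIntegral.integral_congr fun x hx => ?_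
  rw [Set.uIcc_of_le zero_le_one] at hx
  simp only [h x hx]

theorem contourIntegral_lin {γ : ℝ → ℂ} (hγ : IsClosedCurve γ) {f g h : ℂ → ℂ} {a b : ℂ}
    (hg : ContinuousOn g (γ '' Set.Icc 0 1)) (hh : ContinuousOn h (γ '' Set.Icc 0 1))
    (hf : ∀ x ∈ Set.Icc (0 : ℝ) 1, f (γ x) = a * g (γ x) + b * h (γ x)) :
    contourIntegral f γ = a * contourIntegral g γ + b * contourIntegral h γ := by
  rw [contourIntegral_congr (g := fun z => a * g z + b * h z) hf]
  unfold contourIntegral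
  have h1 := hγ.intervalIntegrable hg
  have h2 := hγ.intervalIntegrable hh
  rw [show (fun x => (fun z => a * g z + b * h z) (γ x) * deriv γ x) = fun x =>
    a * (g (γ x) * deriv γ x) + b * (h (γ x) * deriv γ x) by funext x; ring,
    intervalIntegral.integral_add (h1.const_mul a) (h2.const_mul b),
    intervalIntegral.integral_const_mul, intervalIntegral.integral_const_mul]
  ring

/-- The fundamental theorem of calculus with finitely many exceptional parameters. The primitive
only has to exist along the trace of the curve, which allows logarithms below. -/
theorem contourIntegral_eq_zero_of_hasDerivAt {γ : ℝ → ℂ} (hγ : IsClosedCurve γ) {f F : ℂ → ℂ}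
    (hf : ContinuousOn f (γ '' Set.Icc 0 1))
    (hF : ∀ x ∈ Set.Icc (0 : ℝ) 1, HasDerivAt F (f (γ x)) (γ x)) :
    contourIntegral f γ = 0 := by
  obtain ⟨P, M, hM⟩ := hγ.piecewise
  have h := MeasureTheory.integral_eq_of_hasDerivAt_off_countable (fun x => F (γ x))
    (fun x => f (γ x) * deriv γ x) (a := 0) (b := 1) (s := P) P.countable_toSet
    (by
      rw [Set.uIcc_of_le zero_le_one]
      intro x hx
      exact (hF x hx).continuousAt.comp_continuousWithinAt (hγ.continuousOn x hx))
    (fun x hx => by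
      rw [min_eq_left zero_le_one, max_eq_right zero_le_one] at hx
      exact (hF x (Set.Ioo_subset_Icc_self hx.1)).comp x
        ((hM x hx.1 hx.2).1.differentiableAt (by simp)).hasDerivAt)
    (hγ.intervalIntegrable hf)
  rw [contourIntegral, h, hγ.closed]; simp

theorem continuousOn_inv_sub {s : Set ℂ} {p : ℂ} (h : ∀ z ∈ s, z ≠ p) :
    ContinuousOn (fun z => (z - p)⁻¹) s :=
  (continuousOn_id.sub continuousOn_const).inv₀ fun z hz => sub_ne_zero.2 (h z hz)

/-- The quotient `(z - p)/(z - p') = 1 + (p' - p)/(z - p')` stays in the unit disc around `1`, so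
its principal logarithm is a primitive of the difference of the two integrands. -/
theorem winding_eq_of_near {γ : ℝ → ℂ} (hγ : IsClosedCurve γ) {p p' : ℂ}
    (h : ∀ x ∈ Set.Icc (0 : ℝ) 1, ‖p' - p‖ < ‖γ x - p'‖) :
    contourIntegral (fun z => (z - p)⁻¹) γ = contourIntegral (fun z => (z - p')⁻¹) γ := by
  have h' : ∀ x ∈ Set.Icc (0 : ℝ) 1, γ x - p' ≠ 0 := fun x hx =>
    norm_pos_iff.1 ((norm_nonneg _).trans_lt (h x hx))
  have h1 : ∀ x ∈ Set.Icc (0 : ℝ) 1, γ x - p ≠ 0 := fun x hx h0 => by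
    have := h x hx
    rw [sub_eq_zero.1 h0, norm_sub_rev] at this
    exact lt_irrefl _ this
  have c1 : ContinuousOn (fun z => (z - p)⁻¹) (γ '' Set.Icc 0 1) := continuousOn_inv_sub (by
    rintro _ ⟨x, hx, rfl⟩; exact sub_ne_zero.1 (h1 x hx))
  have c2 : ContinuousOn (fun z => (z - p')⁻¹) (γ '' Set.Icc 0 1) := continuousOn_inv_sub (by
    rintro _ ⟨x, hx, rfl⟩; exact sub_ne_zero.1 (h' x hx))
  have key : contourIntegral (fun z => (z - p)⁻¹ - (z - p')⁻¹) γ = 0 := by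
    refine contourIntegral_eq_zero_of_hasDerivAt hγ (F := fun z => Complex.log ((z - p) / (z - p')))
      (c1.sub c2) fun x hx => ?_
    have hs : (γ x - p) / (γ x - p') ∈ Complex.slitPlane := by
      have : (γ x - p) / (γ x - p') = 1 + (p' - p) / (γ x - p') := by
        field_simp [h' x hx]; ring
      rw [this]
      refine Complex.mem_slitPlane_of_norm_lt_one ?_
      rw [norm_div, div_lt_one (norm_pos_iff.2 (h' x hx))]
      exact h x hx
    have hd : HasDerivAt (fun z => (z - p) / (z - p'))
        ((1 * (γ x - p') - (γ x - p) * 1) / (γ x - p') ^ 2) (γ x) :=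
      ((hasDerivAt_id (γ x)).sub_const p).div ((hasDerivAt_id (γ x)).sub_const p') (h' x hx)
    convert hd.clog hs using 1
    have := h1 x hx
    have := h' x hx
    field_simp

  rw [contourIntegral_lin hγ (f := fun z => (z - p)⁻¹ - (z - p')⁻¹) (a := 1) (b := -1) c1 c2
    (fun x _ => by ring)] at key
  linear_combination key

theorem winding_eq_zero_of_far {γ : ℝ → ℂ} (hγ : IsClosedCurve γ) {p : ℂ}
    (h : ∀ x ∈ Set.Icc (0 : ℝ) 1, ‖γ x‖ < ‖p‖) :
    contourIntegral (fun z => (z - p)⁻¹) γ = 0 := by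
  have hp : p ≠ 0 := norm_pos_iff.1 ((norm_nonneg _).trans_lt (h 0 (by simp)))
  have h1 : ∀ x ∈ Set.Icc (0 : ℝ) 1, γ x - p ≠ 0 := fun x hx h0 => by
    have := h x hx
    rw [sub_eq_zero.1 h0] at this
    exact lt_irrefl _ this
  refine contourIntegral_eq_zero_of_hasDerivAt hγ (F := fun z => Complex.log (1 + -(z / p)))
    (continuousOn_inv_sub (by rintro _ ⟨x, hx, rfl⟩; exact sub_ne_zero.1 (h1 x hx)))
    fun x hx => ?_
  have hs : 1 + -(γ x / p) ∈ Complex.slitPlane := by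
    refine Complex.mem_slitPlane_of_norm_lt_one ?_
    rw [norm_neg, norm_div, div_lt_one (norm_pos_iff.2 hp)]
    exact h x hx
  have hd : HasDerivAt (fun z => 1 + -(z / p)) (-(1 / p)) (γ x) :=
    (((hasDerivAt_id (γ x)).div_const p).neg).const_add 1
  convert hd.clog hs using 1
  have := h1 x hx
  have h2 : 1 + -(γ x / p) = -(γ x - p) / p := by field_simp; ring
  rw [h2]
  field_simp

/-! ### Holomorphic functions on an annulus -/

open MeasureTheory in
-- Fubini for the Cauchy kernel, which is continuous because the curve avoids the circle. After the
-- exchange the inner integral is minus a winding number of `γ`. The integrability statement is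
-- needed to subtract two such integrals later.
theorem contour_circle_swap {γ : ℝ → ℂ} (hγ : IsClosedCurve γ) {h : ℂ → ℂ} {ρ : ℝ} (hρ : 0 < ρ)
    (hh : ContinuousOn h (Metric.sphere 0 ρ)) (hne : ∀ x ∈ Set.Icc (0 : ℝ) 1, ‖γ x‖ ≠ ρ) :
    IntervalIntegrable (fun x => (∮ w in C(0, ρ), (w - γ x)⁻¹ * h w) * deriv γ x) volume 0 1 ∧
    contourIntegral (fun z => ∮ w in C(0, ρ), (w - z)⁻¹ * h w) γ =
      ∮ w in C(0, ρ), -(contourIntegral (fun z => (z - w)⁻¹) γ) * h w := by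
  obtain ⟨M, hM⟩ := hγ.ae_bound
  have hmem : ∀ θ, circleMap 0 ρ θ ∈ Metric.sphere (0 : ℂ) ρ := circleMap_mem_sphere 0 hρ.le
  have hsub : ∀ x ∈ Set.Icc (0 : ℝ) 1, ∀ θ, circleMap 0 ρ θ - γ x ≠ 0 := fun x hx θ h0 => by
    apply hne x hx
    rw [← sub_eq_zero.1 h0]
    simpa using hmem θ
  have hcont : ContinuousOn (fun y : ℝ × ℝ => deriv (circleMap 0 ρ) y.2 *
      ((circleMap 0 ρ y.2 - γ y.1)⁻¹ * h (circleMap 0 ρ y.2)))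
      (Set.Icc (0 : ℝ) 1 ×ˢ Set.Icc 0 (2 * Real.pi)) := by
    have h1 : ContinuousOn (fun y : ℝ × ℝ => γ y.1) (Set.Icc (0 : ℝ) 1 ×ˢ Set.Icc 0 (2 * Real.pi)) :=
      hγ.continuousOn.comp continuousOn_fst fun y hy => hy.1
    have h2 : ContinuousOn (fun y : ℝ × ℝ => h (circleMap 0 ρ y.2))
        (Set.Icc (0 : ℝ) 1 ×ˢ Set.Icc 0 (2 * Real.pi)) :=
      hh.comp ((continuous_circleMap 0 ρ).comp continuous_snd).continuousOn fun y _ => hmem _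
    have h3 : Continuous (fun y : ℝ × ℝ => circleMap 0 ρ y.2) :=
      (continuous_circleMap 0 ρ).comp continuous_snd
    simp only [deriv_circleMap]
    exact (h3.mul continuous_const).continuousOn.mul
      (((h3.continuousOn.sub h1).inv₀ fun y hy => hsub _ hy.1 _).mul h2)
  have hint : Integrable (fun y : ℝ × ℝ => (deriv (circleMap 0 ρ) y.2 *
      ((circleMap 0 ρ y.2 - γ y.1)⁻¹ * h (circleMap 0 ρ y.2))) * deriv γ y.1)
      ((volume.restrict (Set.Ioc (0 : ℝ) 1)).prod
        (volume.restrict (Set.Ioc 0 (2 * Real.pi)))) := by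
    have h1 : Integrable (fun y : ℝ × ℝ => (deriv (circleMap 0 ρ) y.2 *
      ((circleMap 0 ρ y.2 - γ y.1)⁻¹ * h (circleMap 0 ρ y.2))))
      ((volume.restrict (Set.Ioc (0 : ℝ) 1)).prod
        (volume.restrict (Set.Ioc 0 (2 * Real.pi)))) := by
      rw [Measure.prod_restrict]
      exact (hcont.integrableOn_compact (isCompact_Icc.prod isCompact_Icc)).mono_set
        (Set.prod_mono Set.Ioc_subset_Icc_self Set.Ioc_subset_Icc_self)
    refine h1.mul_bdd (c := M) ((stronglyMeasurable_deriv γ).comp_measurable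
      measurable_fst).aestronglyMeasurable ?_
    exact Measure.quasiMeasurePreserving_fst.ae hM
  have hswap := integral_integral_swap (f := fun x θ => (deriv (circleMap 0 ρ) θ *
      ((circleMap 0 ρ θ - γ x)⁻¹ * h (circleMap 0 ρ θ))) * deriv γ x) hint
  constructor
  · rw [intervalIntegrable_iff_integrableOn_Ioc_of_le zero_le_one]
    have := hint.integral_prod_left
    simp only [MeasureTheory.integral_mul_const] at this
    unfold IntegrableOn
    simpa only [circleIntegral, smul_eq_mul, intervalIntegral.integral_of_le Real.two_pi_pos.le]
      using this
  simp only [contourIntegral, circleIntegral, smul_eq_mul,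
    intervalIntegral.integral_of_le zero_le_one,
    intervalIntegral.integral_of_le Real.two_pi_pos.le]
  simp_rw [← MeasureTheory.integral_mul_const]
  rw [hswap, ← MeasureTheory.integral_const_mul]
  refine integral_congr_ae (ae_of_all _ fun θ => ?_)
  simp only
  rw [show (∫ x in Set.Ioc (0:ℝ) 1, deriv (circleMap 0 ρ) θ *
      ((circleMap 0 ρ θ - γ x)⁻¹ * h (circleMap 0 ρ θ)) * deriv γ x) =
      ∫ x in Set.Ioc (0:ℝ) 1, (-(deriv (circleMap 0 ρ) θ) * h (circleMap 0 ρ θ)) *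
        ((γ x - circleMap 0 ρ θ)⁻¹ * deriv γ x) by
    congr 1; funext x; rw [← neg_sub (γ x), inv_neg]; ring, MeasureTheory.integral_const_mul]
  ring

/-- The divided difference `dslope h z` is holomorphic across `z`, so its integrals over the two
circles agree. What is left is `h z` times `∮ dw/(w - z)`, which is `2πi` on the outer circle and
`0` on the inner one. -/
theorem cauchy_annulus {h : ℂ → ℂ} {r R : ℝ} (hr : 0 < r) {z : ℂ} (hrz : r < ‖z‖) (hzR : ‖z‖ < R)
    {U : Set ℂ} (hU : ∀ w : ℂ, r ≤ ‖w‖ → ‖w‖ ≤ R → U ∈ 𝓝 w) (hh : DifferentiableOn ℂ h U) :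
    (∮ w in C(0, R), (w - z)⁻¹ * h w) - (∮ w in C(0, r), (w - z)⁻¹ * h w) =
      2 * Real.pi * Complex.I * h z := by
  have hR : 0 < R := hr.trans (hrz.trans hzR)
  have hd : DifferentiableOn ℂ (dslope h z) U :=
    (Complex.differentiableOn_dslope (hU z hrz.le hzR.le)).2 hh
  have hann : (∮ w in C(0, R), dslope h z w) = ∮ w in C(0, r), dslope h z w := by
    refine Complex.circleIntegral_eq_of_differentiable_on_annulus_off_countable hr
      (hrz.trans hzR).le Set.countable_empty (fun w hw => ?_) fun w hw => ?_
    · have : U ∈ 𝓝 w := hU w (by simpa using hw.2) (by simpa using hw.1)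
      exact (hd.differentiableAt this).continuousAt.continuousWithinAt
    · have : U ∈ 𝓝 w := hU w (by simpa using (not_le.1 (by simpa using hw.1.2)).le)
        (by simpa using (Metric.mem_ball.1 hw.1.1).le)
      exact hd.differentiableAt this
  have hsplit : ∀ ρ : ℝ, 0 < ρ → r ≤ ρ → ρ ≤ R → ρ ≠ ‖z‖ → (∮ w in C(0, ρ), dslope h z w) =
      (∮ w in C(0, ρ), (w - z)⁻¹ * h w) - (∮ w in C(0, ρ), (w - z)⁻¹) * h z := by
    intro ρ hρ h1 h2 h3
    have hne : ∀ w ∈ Metric.sphere (0 : ℂ) ρ, w ≠ z := by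
      rintro w hw rfl; exact h3 (by simpa using hw.symm)
    have c1 : ContinuousOn (fun w => (w - z)⁻¹) (Metric.sphere (0 : ℂ) ρ) :=
      continuousOn_inv_sub hne
    have c2 : ContinuousOn h (Metric.sphere (0 : ℂ) ρ) := fun w hw => by
      have hw' : ‖w‖ = ρ := by simpa using hw
      exact (hh.differentiableAt (hU w (by rw [hw']; exact h1)
        (by rw [hw']; exact h2))).continuousAt.continuousWithinAt
    have e := circleIntegral.integral_sub (f := fun w => (w - z)⁻¹ * h w)
      (g := fun w => (w - z)⁻¹ • h z) ((c1.mul c2).circleIntegrable hρ.le)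
        ((c1.smul continuousOn_const).circleIntegrable hρ.le)
    rw [← smul_eq_mul (∮ w in C(0, ρ), (w - z)⁻¹), ← circleIntegral.integral_smul_const, ← e]
    refine circleIntegral.integral_congr hρ.le fun w hw => ?_
    simp only [dslope_of_ne _ (hne w hw), slope_def_module, smul_eq_mul]
    ring
  have e1 : (∮ w in C(0, R), (w - z)⁻¹) = 2 * Real.pi * Complex.I :=
    circleIntegral.integral_sub_inv_of_mem_ball (by simpa using hzR)
  have e2 : (∮ w in C(0, r), (w - z)⁻¹) = 0 := by
    have hne : ∀ w ∈ Metric.closedBall (0 : ℂ) r, w ≠ z := by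
      rintro w hw rfl
      have : ‖w‖ ≤ r := by simpa using hw
      linarith
    refine Complex.circleIntegral_eq_zero_of_differentiable_on_off_countable hr.le
      Set.countable_empty (continuousOn_inv_sub hne) fun w hw => ?_
    have := sub_ne_zero.2 (hne w (Metric.ball_subset_closedBall hw.1))
    fun_prop (disch := assumption)
  rw [hsplit R hR (hrz.trans hzR).le le_rfl hzR.ne', hsplit r hr le_rfl (hrz.trans hzR).le hrz.ne,
    e1, e2] at hann
  linear_combination hann

/-- Insert Cauchy's formula for the annulus and exchange the integrals. The outer circle is weighted
by winding numbers around far points, which vanish. The inner circle is weighted by winding numbers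
around points near the origin, which equal the one around `0`; the bound `2 * r < ‖γ x‖` guarantees
this through `winding_eq_of_near`. -/
theorem contourIntegral_annulus {γ : ℝ → ℂ} (hγ : IsClosedCurve γ) {h : ℂ → ℂ} {r R : ℝ}
    (hr : 0 < r) (hγr : ∀ x ∈ Set.Icc (0 : ℝ) 1, 2 * r < ‖γ x‖ ∧ ‖γ x‖ < R)
    {U : Set ℂ} (hU : ∀ w : ℂ, r ≤ ‖w‖ → ‖w‖ ≤ R → U ∈ 𝓝 w) (hh : DifferentiableOn ℂ h U) :
    contourIntegral h γ = contourIntegral (fun z => (z - 0)⁻¹) γ *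
      ((2 * Real.pi * Complex.I)⁻¹ * ∮ w in C(0, r), h w) := by
  have h0 : (0 : ℝ) ∈ Set.Icc (0 : ℝ) 1 := by simp
  have hrR : r < R := by have := hγr 0 h0; linarith
  have hR : 0 < R := hr.trans hrR
  have hcs : ∀ ρ, r ≤ ρ → ρ ≤ R → ContinuousOn h (Metric.sphere (0 : ℂ) ρ) := fun ρ h1 h2 w hw => by
    have hw' : ‖w‖ = ρ := by simpa using hw
    exact (hh.differentiableAt (hU w (by rw [hw']; exact h1)
      (by rw [hw']; exact h2))).continuousAt.continuousWithinAt
  have hpi : (2 * Real.pi * Complex.I : ℂ) ≠ 0 := Complex.two_pi_I_ne_zero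
  have hlow : ∀ x ∈ Set.Icc (0 : ℝ) 1, r < ‖γ x‖ := fun x hx => by have := (hγr x hx).1; linarith
  obtain ⟨i1, s1⟩ := contour_circle_swap hγ hR (hcs R hrR.le le_rfl) fun x hx => (hγr x hx).2.ne
  obtain ⟨i2, s2⟩ := contour_circle_swap hγ hr (hcs r le_rfl hrR.le) fun x hx => (hlow x hx).ne'
  have w1 : (∮ w in C(0, R), -(contourIntegral (fun z => (z - w)⁻¹) γ) * h w) = 0 := by
    rw [circleIntegral.integral_congr (g := fun _ => 0) hR.le]
    · simp [circleIntegral]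
    · intro w hw
      simp only
      rw [winding_eq_zero_of_far hγ fun x hx => ?_]
      · simp
      · rw [show ‖w‖ = R by simpa using hw]
        exact (hγr x hx).2
  have w2 : (∮ w in C(0, r), -(contourIntegral (fun z => (z - w)⁻¹) γ) * h w) =
      -contourIntegral (fun z => (z - 0)⁻¹) γ * ∮ w in C(0, r), h w := by
    rw [← smul_eq_mul, ← circleIntegral.integral_smul]
    refine circleIntegral.integral_congr hr.le fun w hw => ?_
    have hw' : ‖w‖ = r := by simpa using hw
    simp only [smul_eq_mul]
    rw [winding_eq_of_near hγ (p := 0) (p' := w) fun x hx => ?_]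
    have h1 := (hγr x hx).1
    have h2 := norm_sub_norm_le (γ x) w
    rw [sub_zero, hw'] at *
    linarith
  have key : contourIntegral (fun z => 2 * Real.pi * Complex.I * h z) γ =
      contourIntegral (fun z => ∮ w in C(0, R), (w - z)⁻¹ * h w) γ -
      contourIntegral (fun z => ∮ w in C(0, r), (w - z)⁻¹ * h w) γ := by
    rw [← contourIntegral_congr (f := fun z => (∮ w in C(0, R), (w - z)⁻¹ * h w) -
      ∮ w in C(0, r), (w - z)⁻¹ * h w) fun x hx => cauchy_annulus hr (hlow x hx) (hγr x hx).2 hU hh]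
    simp only [contourIntegral, sub_mul]
    rw [intervalIntegral.integral_sub i1 i2, mul_sub]
  have key2 : contourIntegral (fun z => 2 * Real.pi * Complex.I * h z) γ =
      2 * Real.pi * Complex.I * contourIntegral h γ := by
    simp only [contourIntegral, mul_assoc, intervalIntegral.integral_const_mul]
    ring
  rw [key2, s1, s2, w1, w2] at key
  linear_combination (2 * Real.pi * Complex.I : ℂ)⁻¹ * key + contourIntegral h γ *
    (-inv_mul_cancel₀ hpi)

end TrigHyp
end

noncomputable section
namespace TrigHyp

/-! ### Integrals along curves with the same winding numbers -/

/-- Two curves have the same winding number around `p`. -/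
def SameWinding (γ₁ γ₂ : ℝ → ℂ) (p : ℂ) : Prop :=
  ∃ m : ℤ, HasWinding γ₁ p m ∧ HasWinding γ₂ p m

/-- The union of the images of two curves. -/
def traces (γ₁ γ₂ : ℝ → ℂ) : Set ℂ := γ₁ '' Set.Icc 0 1 ∪ γ₂ '' Set.Icc 0 1

theorem SameWinding.notMem {γ₁ γ₂ : ℝ → ℂ} {p : ℂ} (h : SameWinding γ₁ γ₂ p) :
    ∀ z ∈ traces γ₁ γ₂, z ≠ p := by
  obtain ⟨m, h1, h2⟩ := h
  rintro z (⟨x, hx, rfl⟩ | ⟨x, hx, rfl⟩)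
  · exact h1.1 x hx
  · exact h2.1 x hx

theorem SameWinding.eq {γ₁ γ₂ : ℝ → ℂ} {p : ℂ} (h : SameWinding γ₁ γ₂ p) :
    contourIntegral (fun z => (z - p)⁻¹) γ₁ = contourIntegral (fun z => (z - p)⁻¹) γ₂ := by
  obtain ⟨m, h1, h2⟩ := h
  rw [h1.2, h2.2]

section

variable {γ₁ γ₂ : ℝ → ℂ} (c₁ : IsClosedCurve γ₁) (c₂ : IsClosedCurve γ₂)
include c₁ c₂

theorem contourIntegral_eq_of_lin {f g h : ℂ → ℂ} {a b : ℂ}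
    (hg : ContinuousOn g (traces γ₁ γ₂)) (hh : ContinuousOn h (traces γ₁ γ₂))
    (hf : ∀ z ∈ traces γ₁ γ₂, f z = a * g z + b * h z)
    (eg : contourIntegral g γ₁ = contourIntegral g γ₂)
    (eh : contourIntegral h γ₁ = contourIntegral h γ₂) :
    contourIntegral f γ₁ = contourIntegral f γ₂ := by
  rw [contourIntegral_lin c₁ (hg.mono Set.subset_union_left) (hh.mono Set.subset_union_left)
      fun x hx => hf _ (Or.inl ⟨x, hx, rfl⟩),
    contourIntegral_lin c₂ (hg.mono Set.subset_union_right) (hh.mono Set.subset_union_right)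
      fun x hx => hf _ (Or.inr ⟨x, hx, rfl⟩), eg, eh]

omit c₁ c₂ in
theorem contourIntegral_eq_of_congr {f g : ℂ → ℂ} (hf : ∀ z ∈ traces γ₁ γ₂, f z = g z)
    (eg : contourIntegral g γ₁ = contourIntegral g γ₂) :
    contourIntegral f γ₁ = contourIntegral f γ₂ := by
  rw [contourIntegral_congr (g := g) fun x hx => hf _ (Or.inl ⟨x, hx, rfl⟩),
    contourIntegral_congr (g := g) fun x hx => hf _ (Or.inr ⟨x, hx, rfl⟩), eg]

/-- Only `k = 1` carries winding information; every other power has a primitive, so both integrals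
vanish. -/
theorem contourIntegral_pow_inv_eq {p : ℂ} (hp : SameWinding γ₁ γ₂ p) (k : ℕ) :
    contourIntegral (fun z => ((z - p) ^ k)⁻¹) γ₁ =
      contourIntegral (fun z => ((z - p) ^ k)⁻¹) γ₂ := by
  have hc : ContinuousOn (fun z => ((z - p) ^ k)⁻¹) (traces γ₁ γ₂) :=
    ((continuousOn_id.sub continuousOn_const).pow k).inv₀ fun z hz =>
      pow_ne_zero _ (sub_ne_zero.2 (hp.notMem z hz))
  match k with
  | 0 =>
    rw [contourIntegral_eq_zero_of_hasDerivAt c₁ (F := fun z => z)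
      (hc.mono Set.subset_union_left) fun x _ => by simpa using hasDerivAt_id' (γ₁ x),
      contourIntegral_eq_zero_of_hasDerivAt c₂ (F := fun z => z)
      (hc.mono Set.subset_union_right) fun x _ => by simpa using hasDerivAt_id' (γ₂ x)]
  | 1 => simpa using hp.eq
  | k + 2 =>
    have key : ∀ z ∈ traces γ₁ γ₂, HasDerivAt (fun z => -((k + 1 : ℂ)⁻¹) * ((z - p) ^ (k + 1))⁻¹)
        (((z - p) ^ (k + 2))⁻¹) z := by
      intro z hz
      have hz0 : z - p ≠ 0 := sub_ne_zero.2 (hp.notMem z hz)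
      have h1 := (((hasDerivAt_id' z).sub_const p).fun_pow (k + 1)).fun_inv (pow_ne_zero _ hz0)
      have h2 := h1.const_mul (-((k + 1 : ℂ)⁻¹))
      have hk : (k + 1 : ℂ) ≠ 0 := by exact_mod_cast k.succ_ne_zero
      refine h2.congr_deriv ?_
      push_cast
      field_simp
      ring
    rw [contourIntegral_eq_zero_of_hasDerivAt c₁ (hc.mono Set.subset_union_left)
        fun x hx => key _ (Or.inl ⟨x, hx, rfl⟩),
      contourIntegral_eq_zero_of_hasDerivAt c₂ (hc.mono Set.subset_union_right)
        fun x hx => key _ (Or.inr ⟨x, hx, rfl⟩)]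

omit c₁ c₂ in
theorem continuousOn_prod_inv {s : Set ℂ} (L : List ℂ) (hL : ∀ p ∈ L, ∀ z ∈ s, z ≠ p) :
    ContinuousOn (fun z => (L.map fun p => (z - p)⁻¹).prod) s := by
  induction L with
  | nil => simpa using continuousOn_const
  | cons p L ih =>
    simp only [List.map_cons, List.prod_cons]
    exact (continuousOn_inv_sub (hL p (by simp))).mul (ih fun p' hp' => hL p' (by simp [hp']))

/-- Partial fractions, one pole at a time. A pole of the list equal to `p` raises the power `k`; a
different pole `p'` is separated by `1/((z-p)(z-p')) = (1/(z-p) - 1/(z-p'))/(p-p')`, which lowers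
`k`. Carrying the power along makes repeated poles harmless. -/
theorem contourIntegral_rational_eq (L : List ℂ) (hL : ∀ p ∈ L, SameWinding γ₁ γ₂ p) {p : ℂ}
    (hp : SameWinding γ₁ γ₂ p) (k : ℕ) :
    contourIntegral (fun z => ((z - p) ^ k)⁻¹ * (L.map fun p => (z - p)⁻¹).prod) γ₁ =
      contourIntegral (fun z => ((z - p) ^ k)⁻¹ * (L.map fun p => (z - p)⁻¹).prod) γ₂ := by
  induction L generalizing p k with
  | nil => simpa using contourIntegral_pow_inv_eq c₁ c₂ hp k
  | cons p' L ih =>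
    have hp' : SameWinding γ₁ γ₂ p' := hL p' (by simp)
    have hL' : ∀ p ∈ L, SameWinding γ₁ γ₂ p := fun x hx => hL x (by simp [hx])
    have hLc := continuousOn_prod_inv (s := traces γ₁ γ₂) L fun x hx => (hL' x hx).notMem
    have hpow : ∀ k, ContinuousOn (fun z => ((z - p) ^ k)⁻¹) (traces γ₁ γ₂) := fun k =>
      ((continuousOn_id.sub continuousOn_const).pow k).inv₀ fun z hz =>
        pow_ne_zero _ (sub_ne_zero.2 (hp.notMem z hz))
    simp only [List.map_cons, List.prod_cons]
    by_cases hpp : p' = p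
    · subst hpp
      refine contourIntegral_eq_of_congr (fun z hz => ?_) (ih hL' hp (k + 1))
      rw [pow_succ, mul_inv, mul_assoc]
    · induction k with
      | zero =>
        refine contourIntegral_eq_of_congr (fun z hz => ?_) (ih hL' hp' 1)
        simp
      | succ k ihk =>
        refine contourIntegral_eq_of_lin c₁ c₂ (a := (p - p')⁻¹) (b := -(p - p')⁻¹)
          ((hpow (k + 1)).mul hLc)
          ((hpow k).mul ((continuousOn_inv_sub hp'.notMem).mul hLc)) (fun z hz => ?_)
          (ih hL' hp (k + 1)) ihk
        have h1 := sub_ne_zero.2 (hp.notMem z hz)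
        have h2 := sub_ne_zero.2 (hp'.notMem z hz)
        have h3 : p - p' ≠ 0 := sub_ne_zero.2 (Ne.symm hpp)
        simp only [Pi.mul_apply]
        field_simp
        ring

/-- Writing `h = h(p) + (z - p) · dslope h p` removes the pole `p` from the product at the cost of a
rational function. If `p` lies outside `U`, the factor `1/(z - p)` is itself holomorphic there and
is absorbed into `h`. -/
theorem contourIntegral_holomorphic_mul_eq {U : Set ℂ} (hUo : IsOpen U) (hU : traces γ₁ γ₂ ⊆ U)
    (hbase : ∀ h : ℂ → ℂ, DifferentiableOn ℂ h U → contourIntegral h γ₁ = contourIntegral h γ₂)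
    (L : List ℂ) (hL : ∀ p ∈ L, SameWinding γ₁ γ₂ p) {h : ℂ → ℂ} (hh : DifferentiableOn ℂ h U) :
    contourIntegral (fun z => h z * (L.map fun p => (z - p)⁻¹).prod) γ₁ =
      contourIntegral (fun z => h z * (L.map fun p => (z - p)⁻¹).prod) γ₂ := by
  induction L generalizing h with
  | nil => simpa using hbase h hh
  | cons p L ih =>
    have hp : SameWinding γ₁ γ₂ p := hL p (by simp)
    have hL' : ∀ p ∈ L, SameWinding γ₁ γ₂ p := fun x hx => hL x (by simp [hx])
    have hLc := continuousOn_prod_inv (s := traces γ₁ γ₂) L fun x hx => (hL' x hx).notMem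
    simp only [List.map_cons, List.prod_cons]
    by_cases hpU : p ∈ U
    · have hd : DifferentiableOn ℂ (dslope h p) U :=
        (Complex.differentiableOn_dslope (hUo.mem_nhds hpU)).2 hh
      refine contourIntegral_eq_of_lin c₁ c₂ (a := 1) (b := h p)
        ((hd.continuousOn.mono hU).mul hLc) ((continuousOn_inv_sub hp.notMem).mul hLc)
        (fun z hz => ?_) (ih hL' hd) ?_
      · have h1 := sub_ne_zero.2 (hp.notMem z hz)
        simp only [Pi.mul_apply, dslope_of_ne _ (hp.notMem z hz), slope_def_field]
        field_simp
        ring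
      · refine contourIntegral_eq_of_congr (fun z _ => ?_) (contourIntegral_rational_eq c₁ c₂ L hL' hp 1)
        simp
    · have hd : DifferentiableOn ℂ (fun z => h z * (z - p)⁻¹) U := by
        refine hh.mul (((differentiableOn_id).sub_const p).inv fun z hz => ?_)
        exact sub_ne_zero.2 (fun h => hpU (h ▸ hz))
      refine contourIntegral_eq_of_congr (fun z hz => ?_) (ih hL' hd)
      rw [mul_assoc]

theorem exists_annulus (h₁ : ∀ x ∈ Set.Icc (0 : ℝ) 1, γ₁ x ≠ 0)
    (h₂ : ∀ x ∈ Set.Icc (0 : ℝ) 1, γ₂ x ≠ 0) :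
    ∃ r R : ℝ, 0 < r ∧ 0 < R ∧ ∀ z ∈ traces γ₁ γ₂, 2 * r < ‖z‖ ∧ ‖z‖ < R := by
  have hK : IsCompact (traces γ₁ γ₂) :=
    (isCompact_Icc.image_of_continuousOn c₁.continuousOn).union
      (isCompact_Icc.image_of_continuousOn c₂.continuousOn)
  have hne : (traces γ₁ γ₂).Nonempty := ⟨γ₁ 0, Or.inl ⟨0, by simp, rfl⟩⟩
  obtain ⟨z₀, hz₀, hmin⟩ := hK.exists_isMinOn hne continuous_norm.continuousOn
  obtain ⟨z₁, hz₁, hmax⟩ := hK.exists_isMaxOn hne continuous_norm.continuousOn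
  have h0 : 0 < ‖z₀‖ := by
    rw [norm_pos_iff]
    rcases hz₀ with ⟨x, hx, rfl⟩ | ⟨x, hx, rfl⟩
    exacts [h₁ x hx, h₂ x hx]
  refine ⟨‖z₀‖ / 4, ‖z₁‖ + 1, by positivity, by positivity, fun z hz => ⟨?_, ?_⟩⟩
  · have : ‖z₀‖ ≤ ‖z‖ := hmin hz
    linarith
  · have : ‖z‖ ≤ ‖z₁‖ := hmax hz
    linarith

omit c₁ c₂ in
theorem exists_pow_norm_lt {ι : Type*} {q : ℂ} (hq : ‖q‖ < 1) (I : Finset ι) (α : ι → ℂ) {r : ℝ}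
    (hr : 0 < r) : ∀ᶠ N : ℕ in atTop, ∀ i ∈ I, ‖α i * q ^ N‖ < r := by
  rw [Filter.eventually_all_finset]
  intro i _
  have : Tendsto (fun N : ℕ => ‖α i * q ^ N‖) atTop (𝓝 0) := by
    simpa [norm_mul, norm_pow] using
      (tendsto_pow_atTop_nhds_zero_of_lt_one (norm_nonneg q) hq).const_mul ‖α i‖
  exact this.eventually (gt_mem_nhds hr)

/-- The integral of a function with poles in sequences `α qⁿ` and `(β qⁿ)⁻¹` depends only on the
winding numbers of the curve. -/
theorem contourIntegral_eq_of_winding {ι κ : Type*} {q : ℂ} (hq0 : q ≠ 0) (hq : ‖q‖ < 1)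
    (I : Finset ι) (J : Finset κ) (α : ι → ℂ) (β : κ → ℂ) (hβ : ∀ k ∈ J, β k ≠ 0) {H : ℂ → ℂ}
    (hH : ∀ z, z ≠ 0 → DifferentiableAt ℂ H z) (w0 : SameWinding γ₁ γ₂ 0)
    (wα : ∀ i ∈ I, ∀ n : ℕ, SameWinding γ₁ γ₂ (α i * q ^ n))
    (wβ : ∀ k ∈ J, ∀ n : ℕ, SameWinding γ₁ γ₂ ((β k * q ^ n)⁻¹)) :
    contourIntegral (fun z => H z / ((∏ i ∈ I, qPoch q (α i / z)) * ∏ k ∈ J, qPoch q (β k * z))) γ₁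
    = contourIntegral
      (fun z => H z / ((∏ i ∈ I, qPoch q (α i / z)) * ∏ k ∈ J, qPoch q (β k * z))) γ₂ := by
  obtain ⟨r, R, hr, hR, hK⟩ := exists_annulus c₁ c₂
    (fun x hx => w0.notMem _ (Or.inl ⟨x, hx, rfl⟩)) (fun x hx => w0.notMem _ (Or.inr ⟨x, hx, rfl⟩))
  -- Beyond index `N` the factors have no zeros in the annulus `r/2 < ‖z‖ < 2R`, so only finitely
  -- many poles matter.
  obtain ⟨N, hNα, hNβ⟩ := ((exists_pow_norm_lt hq I α (half_pos hr)).and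
    (exists_pow_norm_lt hq J β (inv_pos.2 (mul_pos two_pos hR)))).exists
  set U : Set ℂ := {z | r / 2 < ‖z‖ ∧ ‖z‖ < 2 * R} with hUdef
  have hUo : IsOpen U := (isOpen_lt continuous_const continuous_norm).inter
    (isOpen_lt continuous_norm continuous_const)
  have hKU : traces γ₁ γ₂ ⊆ U := fun z hz => ⟨by linarith [(hK z hz).1], by linarith [(hK z hz).2]⟩
  have hU0 : ∀ z ∈ U, z ≠ 0 := fun z hz => norm_pos_iff.1 ((half_pos hr).trans hz.1)
  have hbase : ∀ h : ℂ → ℂ, DifferentiableOn ℂ h U →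
      contourIntegral h γ₁ = contourIntegral h γ₂ := fun h hh => by
    have hUn : ∀ w : ℂ, r ≤ ‖w‖ → ‖w‖ ≤ R → U ∈ 𝓝 w := fun w h1 h2 =>
      hUo.mem_nhds ⟨by linarith, by linarith⟩
    rw [contourIntegral_annulus c₁ hr (fun x hx => hK _ (Or.inl ⟨x, hx, rfl⟩)) hUn hh,
      contourIntegral_annulus c₂ hr (fun x hx => hK _ (Or.inr ⟨x, hx, rfl⟩)) hUn hh, w0.eq]
  set s : Finset (ι × ℕ ⊕ κ × ℕ) := (I ×ˢ Finset.range N).disjSum (J ×ˢ Finset.range N) with hs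
  set p : (ι × ℕ ⊕ κ × ℕ) → ℂ :=
    Sum.elim (fun x => α x.1 * q ^ x.2) (fun x => (β x.1 * q ^ x.2)⁻¹) with hp
  have hps : ∀ x ∈ s, SameWinding γ₁ γ₂ (p x) := by
    rintro (⟨i, n⟩ | ⟨k, n⟩) hx
    · simp only [hs, Finset.inl_mem_disjSum, Finset.mem_product] at hx
      exact wα i hx.1 n
    · simp only [hs, Finset.inr_mem_disjSum, Finset.mem_product] at hx
      exact wβ k hx.1 n
  -- The holomorphic part of the integrand. The powers of `z` and the constants arise from `1 -
  -- αqⁿ/z = (z - αqⁿ)/z` and `1 - βqⁿz = -βqⁿ(z - (βqⁿ)⁻¹)`.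
  set h : ℂ → ℂ := fun z => H z * (∏ x ∈ I ×ˢ Finset.range N, z) *
    (∏ x ∈ J ×ˢ Finset.range N, (-(β x.1 * q ^ x.2))⁻¹) *
    ((∏ i ∈ I, qPoch q (α i * q ^ N / z)) * ∏ k ∈ J, qPoch q (β k * q ^ N * z))⁻¹ with hh
  have hhd : DifferentiableOn ℂ h U := by
    intro z hz
    have hz0 := hU0 z hz
    have hQ := differentiable_qPoch hq
    have d1 : DifferentiableAt ℂ (fun z => (∏ i ∈ I, qPoch q (α i * q ^ N / z)) *
        ∏ k ∈ J, qPoch q (β k * q ^ N * z)) z := by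
      refine (DifferentiableAt.fun_finsetProd fun i _ => ?_).mul
        (DifferentiableAt.fun_finsetProd fun k _ => ?_)
      · exact DifferentiableAt.fun_comp' z (hQ _) (by fun_prop (disch := assumption))
      · exact DifferentiableAt.fun_comp' z (hQ _) (by fun_prop)
    refine DifferentiableAt.differentiableWithinAt ?_
    refine (((hH z hz0).mul (by fun_prop)).mul (by fun_prop)).mul (d1.fun_inv ?_)
    refine mul_ne_zero (Finset.prod_ne_zero_iff.2 fun i hi => ?_)
      (Finset.prod_ne_zero_iff.2 fun k hk => ?_)
    · refine qPoch_ne_zero_of_norm_lt hq ?_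
      rw [norm_div, div_lt_one (norm_pos_iff.2 hz0)]
      exact (hNα i hi).trans hz.1
    · refine qPoch_ne_zero_of_norm_lt hq ?_
      rw [norm_mul]
      calc ‖β k * q ^ N‖ * ‖z‖ < (2 * R)⁻¹ * (2 * R) :=
            mul_lt_mul'' (hNβ k hk) hz.2 (norm_nonneg _) (norm_nonneg _)
        _ = 1 := inv_mul_cancel₀ (by positivity)
  refine contourIntegral_eq_of_congr (fun z hz => ?_)
    (contourIntegral_holomorphic_mul_eq c₁ c₂ hUo hKU hbase (s.toList.map p) (by
      intro y hy
      obtain ⟨x, hx, rfl⟩ := List.mem_map.1 hy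
      exact hps x (by simpa using hx)) hhd)
  have hz0 := hU0 z (hKU hz)
  rw [List.map_map, Finset.prod_map_toList, hs, Finset.prod_disjSum]
  have e1 : ∏ i ∈ I, qPoch q (α i / z) = (∏ x ∈ I ×ˢ Finset.range N, (z - α x.1 * q ^ x.2)) *
      (∏ x ∈ I ×ˢ Finset.range N, z)⁻¹ * ∏ i ∈ I, qPoch q (α i * q ^ N / z) := by
    rw [← Finset.prod_inv_distrib, ← Finset.prod_mul_distrib, Finset.prod_product,
      ← Finset.prod_mul_distrib]
    refine Finset.prod_congr rfl fun i _ => ?_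
    rw [qPoch_eq_prod_mul hq _ N]
    congr 1
    · refine Finset.prod_congr rfl fun n _ => ?_
      field_simp
    · congr 1; ring
  have e2 : ∏ k ∈ J, qPoch q (β k * z) = (∏ x ∈ J ×ˢ Finset.range N, (z - (β x.1 * q ^ x.2)⁻¹)) *
      (∏ x ∈ J ×ˢ Finset.range N, (-(β x.1 * q ^ x.2))⁻¹)⁻¹ *
      ∏ k ∈ J, qPoch q (β k * q ^ N * z) := by
    rw [← Finset.prod_inv_distrib, ← Finset.prod_mul_distrib, Finset.prod_product,
      ← Finset.prod_mul_distrib]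
    refine Finset.prod_congr rfl fun k hk => ?_
    rw [qPoch_eq_prod_mul hq _ N]
    congr 1
    · refine Finset.prod_congr rfl fun n _ => ?_
      have := hβ k hk
      field_simp
      ring
    · congr 1; ring
  rw [e1, e2, hh]
  simp only [hp, Function.comp_def, Sum.elim_inl, Sum.elim_inr, Finset.prod_inv_distrib, div_eq_mul_inv,
    mul_inv, inv_inv]
  ring

end

end TrigHyp
end

noncomputable section
namespace TrigHyp

/-! ### Circles, reversal and concatenation -/

/-- The circle with centre `c` through `b`, starting at `b`. -/
def circ (c b : ℂ) : ℝ → ℂ := fun x => c + (b - c) * Complex.exp (2 * Real.pi * Complex.I * x)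

theorem hasDerivAt_circ (c b : ℂ) (x : ℝ) : HasDerivAt (circ c b)
    ((b - c) * (Complex.exp (2 * Real.pi * Complex.I * x) * (2 * Real.pi * Complex.I))) x := by
  have h1 : HasDerivAt (fun x : ℝ => (2 * Real.pi * Complex.I : ℂ) * x)
      (2 * Real.pi * Complex.I) x := by
    simpa using (Complex.ofRealCLM.hasDerivAt (x := x)).const_mul (2 * Real.pi * Complex.I : ℂ)
  exact (h1.cexp.const_mul (b - c)).const_add c

theorem circ_zero (c b : ℂ) : circ c b 0 = b := by simp [circ]

theorem norm_exp_two_pi_I (x : ℝ) : ‖Complex.exp (2 * Real.pi * Complex.I * x)‖ = 1 := by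
  rw [show (2 * Real.pi * Complex.I * x : ℂ) = ((2 * Real.pi * x : ℝ) : ℂ) * Complex.I by
    push_cast; ring]
  exact Complex.norm_exp_ofReal_mul_I _

theorem norm_circ_sub (c b : ℂ) (x : ℝ) : ‖circ c b x - c‖ = ‖b - c‖ := by
  simp only [circ, add_sub_cancel_left, norm_mul, norm_exp_two_pi_I, mul_one]

theorem contDiff_circ (c b : ℂ) : ContDiff ℝ 1 (circ c b) := by
  unfold circ
  have : ContDiff ℝ 1 (fun x : ℝ => (x : ℂ)) := Complex.ofRealCLM.contDiff
  fun_prop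

theorem isClosedCurve_circ (c b : ℂ) : IsClosedCurve (circ c b) where
  continuousOn := (contDiff_circ c b).continuous.continuousOn
  closed := by simp [circ, Complex.exp_two_pi_mul_I]
  piecewise := ⟨∅, ‖b - c‖ * (2 * Real.pi), fun x _ _ => ⟨(contDiff_circ c b).contDiffAt, by
    rw [(hasDerivAt_circ c b x).deriv]
    simp [norm_exp_two_pi_I, abs_of_pos Real.pi_pos]⟩⟩

theorem contourIntegral_circ (f : ℂ → ℂ) (c b : ℂ) : contourIntegral f (circ c b) =
    (2 * Real.pi * Complex.I)⁻¹ * ∮ w in C(0, 1), (b - c) * f (c + (b - c) * w) := by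
  have h := intervalIntegral.integral_comp_mul_left (a := 0) (b := 1)
    (fun θ : ℝ => deriv (circleMap 0 1) θ • ((b - c) * f (c + (b - c) * circleMap 0 1 θ)))
    Real.two_pi_pos.ne'
  rw [contourIntegral, circleIntegral]
  congr 1
  rw [mul_zero, mul_one] at h
  have h2 := (inv_smul_eq_iff₀ Real.two_pi_pos.ne').1 h.symm
  rw [h2, ← intervalIntegral.integral_smul]
  refine intervalIntegral.integral_congr fun x _ => ?_
  simp only [(hasDerivAt_circ c b x).deriv, deriv_circleMap, smul_eq_mul, circ]
  have : circleMap 0 1 (2 * Real.pi * x) = Complex.exp (2 * Real.pi * Complex.I * x) := by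
    simp only [circleMap, Complex.ofReal_one, one_mul, zero_add]
    congr 1; push_cast; ring
  rw [this, Complex.real_smul]
  push_cast
  ring

theorem hasWinding_circ_of_lt {c b p : ℂ} (h : ‖p - c‖ < ‖b - c‖) : HasWinding (circ c b) p 1 := by
  have hbc : b - c ≠ 0 := norm_pos_iff.1 ((norm_nonneg _).trans_lt h)
  refine ⟨fun x _ hx => ?_, ?_⟩
  · rw [← hx, norm_circ_sub] at h; exact lt_irrefl _ h
  · rw [contourIntegral_circ]
    have e : ∀ w : ℂ, (b - c) * (c + (b - c) * w - p)⁻¹ = (w - (p - c) / (b - c))⁻¹ := fun w => by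
      rw [show c + (b - c) * w - p = (b - c) * (w - (p - c) / (b - c)) by field_simp; ring,
        mul_inv, mul_inv_cancel_left₀ hbc]
    simp only [e]
    rw [circleIntegral.integral_sub_inv_of_mem_ball, inv_mul_cancel₀ Complex.two_pi_I_ne_zero]
    · simp
    · simpa [div_lt_one (norm_pos_iff.2 hbc)] using h

theorem hasWinding_circ_of_gt {c b p : ℂ} (h : ‖b - c‖ < ‖p - c‖) : HasWinding (circ c b) p 0 := by
  refine ⟨fun x _ hx => ?_, ?_⟩
  · rw [← hx, norm_circ_sub] at h; exact lt_irrefl _ h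
  · have hne : ∀ w ∈ Metric.closedBall (0 : ℂ) 1, c + (b - c) * w - p ≠ 0 := by
      intro w hw h0
      have h1 : p - c = (b - c) * w := by linear_combination -h0
      rw [h1, norm_mul] at h
      have h2 : ‖w‖ ≤ 1 := by simpa using hw
      exact absurd (mul_le_of_le_one_right (norm_nonneg (b - c)) h2) (not_le.2 h)
    have hd : ∀ w ∈ Metric.closedBall (0 : ℂ) 1,
        DifferentiableAt ℂ (fun w => (b - c) * (c + (b - c) * w - p)⁻¹) w := fun w hw => by
      have := hne w hw
      fun_prop (disch := assumption)
    rw [contourIntegral_circ, Complex.circleIntegral_eq_zero_of_differentiable_on_off_countable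
      zero_le_one Set.countable_empty
      (fun w hw => (hd w hw).continuousAt.continuousWithinAt)
      fun w hw => hd w (Metric.ball_subset_closedBall hw.1)]
    simp

/-- The reversed curve. -/
def revCurve (γ : ℝ → ℂ) : ℝ → ℂ := fun x => γ (1 - x)

theorem deriv_revCurve (γ : ℝ → ℂ) (x : ℝ) : deriv (revCurve γ) x = -deriv γ (1 - x) := by
  unfold revCurve
  exact deriv_comp_const_sub γ 1 x

theorem IsClosedCurve.rev {γ : ℝ → ℂ} (hγ : IsClosedCurve γ) : IsClosedCurve (revCurve γ) where
  continuousOn := hγ.continuousOn.comp (by fun_prop)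
    fun x hx => ⟨by linarith [hx.2], by linarith [hx.1]⟩
  closed := by simp [revCurve, hγ.closed]
  piecewise := by
    obtain ⟨P, M, hM⟩ := hγ.piecewise
    refine ⟨P.image fun x => 1 - x, M, fun x hx hxP => ?_⟩
    have hP : 1 - x ∉ P := fun h => hxP (Finset.mem_image.2 ⟨1 - x, h, by ring⟩)
    obtain ⟨h1, h2⟩ := hM (1 - x) ⟨by linarith [hx.2], by linarith [hx.1]⟩ hP
    refine ⟨ContDiffAt.comp x h1 (by fun_prop), ?_⟩
    rwa [deriv_revCurve, norm_neg]

theorem contourIntegral_rev (f : ℂ → ℂ) (γ : ℝ → ℂ) :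
    contourIntegral f (revCurve γ) = -contourIntegral f γ := by
  have h := intervalIntegral.integral_comp_sub_left (a := 0) (b := 1)
    (fun x => f (γ x) * deriv γ x) 1
  simp only [sub_self, sub_zero] at h
  simp only [contourIntegral, deriv_revCurve, revCurve, mul_neg, intervalIntegral.integral_neg, h]

theorem HasWinding.rev {γ : ℝ → ℂ} {p : ℂ} {m : ℤ} (h : HasWinding γ p m) :
    HasWinding (revCurve γ) p (-m) :=
  ⟨fun x hx => h.1 (1 - x) ⟨by linarith [hx.2], by linarith [hx.1]⟩, by
    rw [contourIntegral_rev, h.2]; simp⟩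

/-- The concatenation of two curves. -/
def concat (γ₁ γ₂ : ℝ → ℂ) : ℝ → ℂ := fun x => if x ≤ 1 / 2 then γ₁ (2 * x) else γ₂ (2 * x - 1)

theorem concat_eventuallyEq_left (γ₁ γ₂ : ℝ → ℂ) {x : ℝ} (hx : x < 1 / 2) :
    concat γ₁ γ₂ =ᶠ[𝓝 x] fun y => γ₁ (2 * y) := by
  filter_upwards [gt_mem_nhds hx] with y hy
  simp only [concat, if_pos hy.le]

theorem concat_eventuallyEq_right (γ₁ γ₂ : ℝ → ℂ) {x : ℝ} (hx : 1 / 2 < x) :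
    concat γ₁ γ₂ =ᶠ[𝓝 x] fun y => γ₂ (2 * y - 1) := by
  filter_upwards [lt_mem_nhds hx] with y hy
  simp only [concat, if_neg (not_le.2 hy)]

theorem deriv_concat_left (γ₁ γ₂ : ℝ → ℂ) {x : ℝ} (hx : x < 1 / 2) :
    deriv (concat γ₁ γ₂) x = 2 * deriv γ₁ (2 * x) := by
  rw [(concat_eventuallyEq_left γ₁ γ₂ hx).deriv_eq, deriv_comp_mul_left (2 : ℝ) γ₁ x,
    Complex.real_smul]
  simp

theorem deriv_concat_right (γ₁ γ₂ : ℝ → ℂ) {x : ℝ} (hx : 1 / 2 < x) :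
    deriv (concat γ₁ γ₂) x = 2 * deriv γ₂ (2 * x - 1) := by
  rw [(concat_eventuallyEq_right γ₁ γ₂ hx).deriv_eq,
    deriv_comp_mul_left (2 : ℝ) (fun y => γ₂ (y - 1)) x, Complex.real_smul, deriv_comp_sub_const]
  simp

theorem IsClosedCurve.concat {γ₁ γ₂ : ℝ → ℂ} (h₁ : IsClosedCurve γ₁) (h₂ : IsClosedCurve γ₂)
    (h : γ₁ 0 = γ₂ 0) : IsClosedCurve (concat γ₁ γ₂) where
  continuousOn := by
    have e : (Set.Icc (0 : ℝ) 1) = Set.Icc 0 (1 / 2) ∪ Set.Icc (1 / 2) 1 :=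
      (Set.Icc_union_Icc_eq_Icc (by norm_num) (by norm_num)).symm
    rw [e]
    refine ContinuousOn.union_of_isClosed ?_ ?_ isClosed_Icc isClosed_Icc
    · refine ContinuousOn.congr (f := fun y => γ₁ (2 * y)) ?_ fun x hx => if_pos hx.2
      exact h₁.continuousOn.comp (by fun_prop)
        fun x hx => ⟨by linarith [hx.1], by linarith [hx.2]⟩
    · refine ContinuousOn.congr (f := fun y => γ₂ (2 * y - 1)) ?_ fun x hx => ?_
      · exact h₂.continuousOn.comp (by fun_prop)
          fun x hx => ⟨by linarith [hx.1], by linarith [hx.2]⟩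
      · rcases hx.1.eq_or_lt with rfl | hx'
        · simp [TrigHyp.concat, ← h, h₁.closed]
        · simp only [TrigHyp.concat, if_neg (not_le.2 hx')]
  closed := by
    norm_num [TrigHyp.concat]
    rw [h, h₂.closed]
  piecewise := by
    obtain ⟨P₁, M₁, hM₁⟩ := h₁.piecewise
    obtain ⟨P₂, M₂, hM₂⟩ := h₂.piecewise
    refine ⟨insert (1 / 2) (P₁.image (fun x => x / 2) ∪ P₂.image fun x => (x + 1) / 2),
      2 * max M₁ M₂, fun x hx hxP => ?_⟩
    simp only [Finset.mem_insert, Finset.mem_union, Finset.mem_image, not_or, not_exists,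
      not_and] at hxP
    rcases lt_or_gt_of_ne hxP.1 with hlt | hgt
    · obtain ⟨a, b⟩ := hM₁ (2 * x) ⟨by linarith [hx.1], by linarith⟩
        fun hm => hxP.2.1 _ hm (by ring)
      refine ⟨(ContDiffAt.comp x a (by fun_prop)).congr_of_eventuallyEq
        (concat_eventuallyEq_left γ₁ γ₂ hlt), ?_⟩
      rw [deriv_concat_left _ _ hlt, norm_mul, Complex.norm_ofNat]
      exact mul_le_mul_of_nonneg_left (b.trans (le_max_left _ _)) zero_le_two
    · obtain ⟨a, b⟩ := hM₂ (2 * x - 1) ⟨by linarith, by linarith [hx.2]⟩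
        fun hm => hxP.2.2 _ hm (by ring)
      refine ⟨(ContDiffAt.comp x a (by fun_prop)).congr_of_eventuallyEq
        (concat_eventuallyEq_right γ₁ γ₂ hgt), ?_⟩
      rw [deriv_concat_right _ _ hgt, norm_mul, Complex.norm_ofNat]
      exact mul_le_mul_of_nonneg_left (b.trans (le_max_right _ _)) zero_le_two

theorem image_concat {γ₁ γ₂ : ℝ → ℂ} {x : ℝ} (hx : x ∈ Set.Icc (0 : ℝ) 1) :
    concat γ₁ γ₂ x ∈ traces γ₁ γ₂ := by
  unfold concat
  split_ifs with h
  · exact Or.inl ⟨2 * x, ⟨by linarith [hx.1], by linarith⟩, rfl⟩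
  · exact Or.inr ⟨2 * x - 1, ⟨by linarith, by linarith [hx.2]⟩, rfl⟩

theorem contourIntegral_concat {γ₁ γ₂ : ℝ → ℂ} (h₁ : IsClosedCurve γ₁) (h₂ : IsClosedCurve γ₂)
    (h : γ₁ 0 = γ₂ 0) {f : ℂ → ℂ} (hf : ContinuousOn f (traces γ₁ γ₂)) :
    contourIntegral f (concat γ₁ γ₂) = contourIntegral f γ₁ + contourIntegral f γ₂ := by
  have hint := (h₁.concat h₂ h).intervalIntegrable (f := f) (hf.mono (by
    rintro _ ⟨x, hx, rfl⟩; exact image_concat hx))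
  have hsplit := intervalIntegral.integral_add_adjacent_intervals
    (hint.mono_set (c := 0) (d := 1 / 2) (by
      rw [Set.uIcc_of_le (by norm_num), Set.uIcc_of_le zero_le_one]
      exact Set.Icc_subset_Icc le_rfl (by norm_num)))
    (hint.mono_set (c := 1 / 2) (d := 1) (by
      rw [Set.uIcc_of_le (by norm_num), Set.uIcc_of_le zero_le_one]
      exact Set.Icc_subset_Icc (by norm_num) le_rfl))
  have e1 : (∫ x in (0 : ℝ)..1 / 2, f (concat γ₁ γ₂ x) * deriv (concat γ₁ γ₂) x) =
      ∫ x in (0 : ℝ)..1, f (γ₁ x) * deriv γ₁ x := by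
    have hs := intervalIntegral.integral_comp_mul_left (a := 0) (b := 1 / 2)
      (fun x : ℝ => f (γ₁ x) * deriv γ₁ x) (c := 2) two_ne_zero
    norm_num at hs
    trans 2 * ∫ x in (0 : ℝ)..1 / 2, f (γ₁ (2 * x)) * deriv γ₁ (2 * x)
    swap
    · rw [hs]; ring
    rw [← intervalIntegral.integral_const_mul]
    refine intervalIntegral.integral_congr_ae ?_
    -- At the junction the concatenation need not be differentiable, so the formula for its
    -- derivative is used almost everywhere only.
    have : ∀ᵐ x : ℝ, x ≠ 1 / 2 := by simp [MeasureTheory.ae_iff]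
    filter_upwards [this] with x hx hmem
    rw [Set.uIoc_of_le (by norm_num)] at hmem
    have hlt : x < 1 / 2 := lt_of_le_of_ne hmem.2 hx
    rw [deriv_concat_left _ _ hlt, concat, if_pos hlt.le]
    ring
  have e2 : (∫ x in (1 / 2 : ℝ)..1, f (concat γ₁ γ₂ x) * deriv (concat γ₁ γ₂) x) =
      ∫ x in (0 : ℝ)..1, f (γ₂ x) * deriv γ₂ x := by
    have hs := intervalIntegral.integral_comp_mul_sub (a := 1 / 2) (b := 1)
      (fun x : ℝ => f (γ₂ x) * deriv γ₂ x) (c := 2) two_ne_zero 1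
    norm_num at hs
    trans 2 * ∫ x in (1 / 2 : ℝ)..1, f (γ₂ (2 * x - 1)) * deriv γ₂ (2 * x - 1)
    swap
    · rw [hs]; ring
    rw [← intervalIntegral.integral_const_mul]
    refine intervalIntegral.integral_congr_ae (MeasureTheory.ae_of_all _ fun x hmem => ?_)
    rw [Set.uIoc_of_le (by norm_num)] at hmem
    rw [deriv_concat_right _ _ hmem.1, concat, if_neg (not_le.2 hmem.1)]
    ring
  rw [contourIntegral, ← hsplit, e1, e2, mul_add]
  rfl

theorem HasWinding.concat {γ₁ γ₂ : ℝ → ℂ} (h₁ : IsClosedCurve γ₁) (h₂ : IsClosedCurve γ₂)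
    (h : γ₁ 0 = γ₂ 0) {p : ℂ} {m₁ m₂ : ℤ} (w₁ : HasWinding γ₁ p m₁) (w₂ : HasWinding γ₂ p m₂) :
    HasWinding (concat γ₁ γ₂) p (m₁ + m₂) := by
  have hne : ∀ z ∈ traces γ₁ γ₂, z ≠ p := by
    rintro z (⟨x, hx, rfl⟩ | ⟨x, hx, rfl⟩)
    exacts [w₁.1 x hx, w₂.1 x hx]
  refine ⟨fun x hx => hne _ (image_concat hx), ?_⟩
  rw [contourIntegral_concat h₁ h₂ h (continuousOn_inv_sub hne), w₁.2, w₂.2]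
  simp

/-! ### Existence of contours -/

/-- The lasso is the difference of two nearly equal circles through `b`, one passing just beyond `a`
and one just short of it. Every other point of `Z` is on the same side of both circles and has total
winding number zero. Since `Z` is countable, the common limiting circle through `a` and `b` can
avoid `Z \ {a}`, and since `Z \ {a}` is closed, it does so by a positive margin. -/
theorem exists_lasso {Z : Set ℂ} (hZ : Z.Countable) {a b : ℂ} (hb : b ∉ Z)
    (ha : a ∈ Z) (hcl : IsClosed (Z \ {a})) :
    ∃ γ : ℝ → ℂ, IsClosedCurve γ ∧ γ 0 = b ∧ HasWinding γ a 1 ∧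
      ∀ p ∈ Z \ {a}, HasWinding γ p 0 := by
  have hab : a - b ≠ 0 := sub_ne_zero.2 fun h => hb (h ▸ ha)
  -- In the coordinate `w` with `b` at `0` and `a` at `1`, `φ p` is the height `s` of the centre
  -- `1/2 + is` of the circle through `0`, `1` and `w`. Points with `w.im = 0` get a meaningless
  -- value and are treated separately.
  set φ : ℂ → ℝ := fun p => let w := (p - b) / (a - b)
    (w.re ^ 2 - w.re + w.im ^ 2) / (2 * w.im) with hφ
  obtain ⟨s, hs⟩ : ∃ s : ℝ, s ∉ φ '' Z := by
    by_contra! h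
    exact Set.not_countable_univ ((hZ.image φ).mono fun x _ => h x)
  have hdec : ∀ (p : ℂ) (u : ℝ), p - (b + (a - b) * (1 / 2 + u + Complex.I * s)) =
      (a - b) * ((p - b) / (a - b) - (1 / 2 + u + Complex.I * s)) := fun p u => by
    field_simp; ring
  -- For `u = 0` the centre is equidistant from `a` and `b`; a positive `u` puts `a` inside the
  -- circle through `b`, a negative one outside.
  set c : ℝ → ℂ := fun u => b + (a - b) * (1 / 2 + u + Complex.I * s) with hc
  have hbc : ∀ u : ℝ, ‖b - c u‖ = ‖a - b‖ * ‖(1 / 2 + u + Complex.I * s : ℂ)‖ := fun u => by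
    rw [hc, hdec b u, norm_mul, sub_self, zero_div, zero_sub, norm_neg]
  have hne : ∀ p ∈ Z \ {a}, ‖p - c 0‖ ≠ ‖b - c 0‖ := by
    intro p hp heq
    have hpw : p = b + (a - b) * ((p - b) / (a - b)) := by field_simp; ring
    rw [hbc, hc, hdec p 0, norm_mul] at heq
    have heq2 := mul_left_cancel₀ (norm_ne_zero_iff.2 hab) heq
    set w := (p - b) / (a - b) with hw
    have h2 : Complex.normSq (w - (1 / 2 + (0 : ℝ) + Complex.I * s)) =
        Complex.normSq (1 / 2 + (0 : ℝ) + Complex.I * s) := by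
      rw [Complex.normSq_eq_norm_sq, Complex.normSq_eq_norm_sq, heq2]
    simp [Complex.normSq_apply] at h2
    have h3 : w.re ^ 2 - w.re + w.im ^ 2 = 2 * w.im * s := by ring_nf at h2 ⊢; linarith
    by_cases hy : w.im = 0
    · rw [hy] at h3
      have h4 : w.re * (w.re - 1) = 0 := by linarith
      rcases mul_eq_zero.1 h4 with h5 | h5
      · have : w = 0 := Complex.ext h5 hy
        rw [this] at hpw
        exact hb (by rw [show b = p by rw [hpw]; ring]; exact hp.1)
      · have : w = 1 := Complex.ext (by simpa using sub_eq_zero.1 h5) (by simpa using hy)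
        rw [this] at hpw
        exact hp.2 (by rw [Set.mem_singleton_iff, hpw]; ring)
    · refine hs ⟨p, hp.1, ?_⟩
      simp only [hφ, ← hw]
      rw [h3]
      field_simp
  obtain ⟨δ, hδ, hδp⟩ : ∃ δ > 0, ∀ p ∈ Z \ {a}, δ ≤ |‖p - c 0‖ - ‖b - c 0‖| := by
    have hcomp : IsCompact ((Z \ {a}) ∩ Metric.closedBall (c 0) (‖b - c 0‖ + 1)) :=
      (isCompact_closedBall _ _).inter_left hcl
    have hcont : ContinuousOn (fun p => |‖p - c 0‖ - ‖b - c 0‖|)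
        ((Z \ {a}) ∩ Metric.closedBall (c 0) (‖b - c 0‖ + 1)) := by fun_prop
    have hout : ∀ p, p ∉ Metric.closedBall (c 0) (‖b - c 0‖ + 1) →
        1 ≤ |‖p - c 0‖ - ‖b - c 0‖| := fun p hp => by
      rw [Metric.mem_closedBall, dist_eq_norm, not_le] at hp
      exact le_trans (by linarith) (le_abs_self _)
    rcases ((Z \ {a}) ∩ Metric.closedBall (c 0) (‖b - c 0‖ + 1)).eq_empty_or_nonempty with he | he
    · refine ⟨1, one_pos, fun p hp => hout p fun hp' => ?_⟩
      exact Set.eq_empty_iff_forall_notMem.1 he p ⟨hp, hp'⟩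
    · obtain ⟨p₀, hp₀, hmin⟩ := hcomp.exists_isMinOn he hcont
      refine ⟨min 1 |‖p₀ - c 0‖ - ‖b - c 0‖|, lt_min one_pos
        (abs_pos.2 (sub_ne_zero.2 (hne p₀ hp₀.1))), fun p hp => ?_⟩
      by_cases hp' : p ∈ Metric.closedBall (c 0) (‖b - c 0‖ + 1)
      · exact (min_le_right _ _).trans (hmin ⟨hp, hp'⟩)
      · exact (min_le_left _ _).trans (hout p hp')
  -- The centre moves by `δ/4`, so each of the two distances to be compared changes by less than
  -- `δ/2`.
  set ε : ℝ := δ / (4 * ‖a - b‖) with hε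
  have hab' : 0 < ‖a - b‖ := norm_pos_iff.2 hab
  have hε0 : 0 < ε := by positivity
  have hcc : ∀ u : ℝ, |u| = ε → ‖c u - c 0‖ < δ / 2 := fun u hu => by
    have : c u - c 0 = (a - b) * u := by simp only [hc]; push_cast; ring
    rw [this, norm_mul, Complex.norm_real, Real.norm_eq_abs, hu, hε]
    field_simp
    linarith
  have hside : ∀ u : ℝ, |u| = ε → ∀ p ∈ Z \ {a},
      (‖p - c 0‖ < ‖b - c 0‖ → ‖p - c u‖ < ‖b - c u‖) ∧
      (‖b - c 0‖ < ‖p - c 0‖ → ‖b - c u‖ < ‖p - c u‖) := fun u hu p hp => by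
    have h1 := hδp p hp
    have h2 := hcc u hu
    have h3 := abs_le.1 (abs_norm_sub_norm_le (p - c u) (p - c 0))
    have h4 := abs_le.1 (abs_norm_sub_norm_le (b - c u) (b - c 0))
    rw [show p - c u - (p - c 0) = -(c u - c 0) by ring, norm_neg] at h3
    rw [show b - c u - (b - c 0) = -(c u - c 0) by ring, norm_neg] at h4
    constructor
    · intro h; rw [abs_of_neg (by linarith)] at h1; linarith [h3.1, h3.2, h4.1, h4.2]
    · intro h; rw [abs_of_pos (by linarith)] at h1; linarith [h3.1, h3.2, h4.1, h4.2]
  have hac : ∀ u : ℝ, ‖a - c u‖ = ‖a - b‖ * ‖(1 / 2 - u - Complex.I * s : ℂ)‖ := fun u => by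
    rw [hc, hdec a u, norm_mul, div_self hab]
    congr 2; ring
  have hsq : ∀ u : ℝ, ‖(1 / 2 + u + Complex.I * s : ℂ)‖ ^ 2 = (1 / 2 + u) ^ 2 + s ^ 2 ∧
      ‖(1 / 2 - u - Complex.I * s : ℂ)‖ ^ 2 = (1 / 2 - u) ^ 2 + s ^ 2 := fun u => by
    rw [← Complex.normSq_eq_norm_sq, ← Complex.normSq_eq_norm_sq]
    constructor <;> simp [Complex.normSq_apply] <;> ring
  have k₁ := isClosedCurve_circ (c ε) b
  have k₂ := (isClosedCurve_circ (c (-ε)) b).rev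
  -- Both circles start and end at `b`, so they can be concatenated; reversing the second subtracts
  -- its winding numbers.
  have hbase : circ (c ε) b 0 = revCurve (circ (c (-ε)) b) 0 := by
    rw [circ_zero, revCurve, sub_zero, ← (isClosedCurve_circ _ b).closed, circ_zero]
  refine ⟨concat (circ (c ε) b) (revCurve (circ (c (-ε)) b)), k₁.concat k₂ hbase, ?_, ?_, ?_⟩
  · simp [concat, circ_zero]
  · have w₁ : HasWinding (circ (c ε) b) a 1 := hasWinding_circ_of_lt (by
      rw [hac, hbc]
      refine mul_lt_mul_of_pos_left (lt_of_pow_lt_pow_left₀ 2 (norm_nonneg _) ?_) hab'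
      rw [(hsq ε).1, (hsq ε).2]; nlinarith)
    have w₂ : HasWinding (circ (c (-ε)) b) a 0 := hasWinding_circ_of_gt (by
      rw [hac, hbc]
      refine mul_lt_mul_of_pos_left (lt_of_pow_lt_pow_left₀ 2 (norm_nonneg _) ?_) hab'
      rw [(hsq (-ε)).1, (hsq (-ε)).2]; nlinarith)
    simpa using HasWinding.concat k₁ k₂ hbase w₁ w₂.rev
  · intro p hp
    have e1 : |ε| = ε := abs_of_pos hε0
    have e2 : |-ε| = ε := by rw [abs_neg, e1]
    rcases lt_or_gt_of_ne (hne p hp) with h | h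
    · simpa using HasWinding.concat k₁ k₂ hbase
        (hasWinding_circ_of_lt ((hside ε e1 p hp).1 h))
        (hasWinding_circ_of_lt ((hside (-ε) e2 p hp).1 h)).rev
    · simpa using HasWinding.concat k₁ k₂ hbase
        (hasWinding_circ_of_gt ((hside ε e1 p hp).2 h))
        (hasWinding_circ_of_gt ((hside (-ε) e2 p hp).2 h)).rev

open Classical in
-- Start from the circle of radius `r` and attach, at its base point `r`, one lasso for each point
-- of `F`.
theorem exists_curve_of_finset {Z : Set ℂ} (hZ : Z.Countable) (hcl : ∀ a ∈ Z, a ≠ 0 → IsClosed (Z \ {a}))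
    {r : ℝ} (hr : 0 < r) (hZr : ∀ p ∈ Z, ‖p‖ ≠ r) (F : Finset ℂ) (hF : ∀ a ∈ F, a ∈ Z ∧ a ≠ 0) :
    ∃ γ : ℝ → ℂ, IsClosedCurve γ ∧ γ 0 = r ∧ ∀ p ∈ Z,
      HasWinding γ p ((if ‖p‖ < r then 1 else 0) + if p ∈ F then 1 else 0) := by
  have hrZ : (r : ℂ) ∉ Z := fun h => hZr _ h (by simp [abs_of_pos hr])
  induction F using Finset.induction_on with
  | empty =>
    refine ⟨circ 0 r, isClosedCurve_circ _ _, circ_zero _ _, fun p hp => ?_⟩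
    have hn : ‖(r : ℂ) - 0‖ = r := by simp [abs_of_pos hr]
    split_ifs with h h'
    · simp at h'
    · exact hasWinding_circ_of_lt (by rwa [hn, sub_zero])
    · simp at *
    · exact hasWinding_circ_of_gt (by rw [hn, sub_zero]; exact lt_of_le_of_ne (not_lt.1 h) (hZr p hp).symm)
  | insert a F haF ih =>
    obtain ⟨γ, h1, h2, h3⟩ := ih fun x hx => hF x (Finset.mem_insert_of_mem hx)
    obtain ⟨haZ, ha0⟩ := hF a (Finset.mem_insert_self _ _)
    obtain ⟨l, l1, l2, l3, l4⟩ := exists_lasso hZ hrZ haZ (hcl a haZ ha0)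
    refine ⟨concat γ l, h1.concat l1 (h2.trans l2.symm), by simp [concat, h2], fun p hp => ?_⟩
    have hl : HasWinding l p (if p = a then 1 else 0) := by
      split_ifs with h
      · rw [h]; exact l3
      · exact l4 p ⟨hp, h⟩
    have := HasWinding.concat h1 l1 (h2.trans l2.symm) (h3 p hp) hl
    convert this using 1
    by_cases hpa : p = a
    · subst hpa; simp [haF]
    · simp [hpa]

/-- A point other than `0` in the closure lies in an annulus that meets `S` in a finite, hence
closed, set. -/
theorem isClosed_of_finite_annuli {S : Set ℂ} (h0 : (0 : ℂ) ∈ S)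
    (hfin : ∀ ρ M : ℝ, 0 < ρ → (S ∩ {z | ρ ≤ ‖z‖ ∧ ‖z‖ ≤ M}).Finite) : IsClosed S := by
  refine isClosed_of_closure_subset fun x hx => ?_
  by_cases hx0 : x = 0
  · rwa [hx0]
  have hpos : 0 < ‖x‖ := norm_pos_iff.2 hx0
  have hcl := (hfin (‖x‖ / 2) (2 * ‖x‖) (half_pos hpos)).isClosed
  have hU : {z : ℂ | ‖x‖ / 2 < ‖z‖ ∧ ‖z‖ < 2 * ‖x‖} ∈ 𝓝 x :=
    ((isOpen_lt continuous_const continuous_norm).inter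
      (isOpen_lt continuous_norm continuous_const)).mem_nhds
      ⟨half_lt_self hpos, lt_two_mul_self hpos⟩
  have : x ∈ closure (S ∩ {z | ‖x‖ / 2 ≤ ‖z‖ ∧ ‖z‖ ≤ 2 * ‖x‖}) := by
    rw [mem_closure_iff_nhds] at hx ⊢
    intro t ht
    obtain ⟨y, hy1, hy2⟩ := hx _ (inter_mem ht hU)
    exact ⟨y, hy1.1, hy2, hy1.2.1.le, hy1.2.2.le⟩
  rw [hcl.closure_eq] at this
  exact this.1

/-- There is a deformation of the unit circle which separates the sequences `α qⁿ` from the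
sequences `(β qⁿ)⁻¹`, as soon as these are disjoint. -/
theorem exists_isDeformedCircle {ι κ : Type*} {q : ℂ} (hq0 : q ≠ 0) (hq : ‖q‖ < 1)
    (I : Finset ι) (J : Finset κ) (α : ι → ℂ) (β : κ → ℂ) (hα : ∀ i ∈ I, α i ≠ 0)
    (hβ : ∀ k ∈ J, β k ≠ 0) (hαβ : ∀ i ∈ I, ∀ k ∈ J, ∀ n : ℕ, α i * β k * q ^ n ≠ 1) :
    ∃ γ, IsDeformedCircle γ {p | ∃ i ∈ I, ∃ n : ℕ, p = α i * q ^ n}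
      {p | ∃ k ∈ J, ∃ n : ℕ, p = (β k * q ^ n)⁻¹} := by
  classical
  set A : Set ℂ := {p | ∃ i ∈ I, ∃ n : ℕ, p = α i * q ^ n} with hA
  set B : Set ℂ := {p | ∃ k ∈ J, ∃ n : ℕ, p = (β k * q ^ n)⁻¹} with hB
  have hA0 : ∀ p ∈ A, p ≠ 0 := by
    rintro p ⟨i, hi, n, rfl⟩; exact mul_ne_zero (hα i hi) (pow_ne_zero _ hq0)
  have hB0 : ∀ p ∈ B, p ≠ 0 := by
    rintro p ⟨k, hk, n, rfl⟩; exact inv_ne_zero (mul_ne_zero (hβ k hk) (pow_ne_zero _ hq0))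
  have hAB : ∀ p ∈ A, p ∉ B := by
    rintro p ⟨i, hi, n, rfl⟩ ⟨k, hk, m, h⟩
    apply hαβ i hi k hk (n + m)
    have h1 := hβ k hk
    have h2 := pow_ne_zero m hq0
    field_simp at h
    rw [pow_add]; linear_combination h
  have hAc : A.Countable := by
    have : A ⊆ ⋃ i ∈ I, Set.range fun n : ℕ => α i * q ^ n := by
      rintro p ⟨i, hi, n, rfl⟩; simp only [Set.mem_iUnion]; exact ⟨i, hi, n, rfl⟩
    exact (I.countable_toSet.biUnion fun i _ => Set.countable_range _).mono this
  have hBc : B.Countable := by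
    have : B ⊆ ⋃ k ∈ J, Set.range fun n : ℕ => (β k * q ^ n)⁻¹ := by
      rintro p ⟨i, hi, n, rfl⟩; simp only [Set.mem_iUnion]; exact ⟨i, hi, n, rfl⟩
    exact (J.countable_toSet.biUnion fun i _ => Set.countable_range _).mono this
  have hmono : ∀ {x : ℂ} {m n : ℕ}, m ≤ n → ‖x * q ^ n‖ ≤ ‖x * q ^ m‖ := fun {x m n} h => by
    rw [norm_mul, norm_mul, norm_pow, norm_pow]
    exact mul_le_mul_of_nonneg_left (pow_le_pow_of_le_one (norm_nonneg _) hq.le h) (norm_nonneg _)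
  have hAfin : ∀ ρ : ℝ, 0 < ρ → (A ∩ {z | ρ ≤ ‖z‖}).Finite := fun ρ hρ => by
    obtain ⟨N, hN⟩ := (exists_pow_norm_lt hq I α hρ).exists
    refine ((I ×ˢ Finset.range N).image fun x => α x.1 * q ^ x.2).finite_toSet.subset ?_
    rintro _ ⟨⟨i, hi, n, rfl⟩, hn⟩
    simp only [Finset.coe_image, Set.mem_image, Finset.mem_coe, Finset.mem_product, Finset.mem_range]
    refine ⟨(i, n), ⟨hi, ?_⟩, rfl⟩
    by_contra! hle
    exact absurd ((hmono hle).trans_lt (hN i hi)) (not_lt.2 hn)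
  have hBfin : ∀ M : ℝ, (B ∩ {z | ‖z‖ ≤ M}).Finite := fun M => by
    have hM : 0 < (max M 1)⁻¹ := inv_pos.2 (lt_max_of_lt_right one_pos)
    obtain ⟨N, hN⟩ := (exists_pow_norm_lt hq J β hM).exists
    refine ((J ×ˢ Finset.range N).image fun x => (β x.1 * q ^ x.2)⁻¹).finite_toSet.subset ?_
    rintro _ ⟨⟨k, hk, n, rfl⟩, hn⟩
    simp only [Finset.coe_image, Set.mem_image, Finset.mem_coe, Finset.mem_product, Finset.mem_range]
    refine ⟨(k, n), ⟨hk, ?_⟩, rfl⟩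
    by_contra! hle
    have h1 := (hmono hle).trans_lt (hN k hk)
    have h2 : ‖(β k * q ^ n)⁻¹‖ ≤ max M 1 := le_trans hn (le_max_left _ _)
    rw [norm_inv] at h2
    exact absurd h1 (not_lt.2 (inv_le_of_inv_le₀
      (norm_pos_iff.2 (mul_ne_zero (hβ k hk) (pow_ne_zero _ hq0))) h2))
  set Z : Set ℂ := insert 0 (A ∪ B) with hZ
  have hZc : Z.Countable := (hAc.union hBc).insert 0
  have hZfin : ∀ ρ M : ℝ, 0 < ρ → (Z ∩ {z | ρ ≤ ‖z‖ ∧ ‖z‖ ≤ M}).Finite := fun ρ M hρ => by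
    refine ((hAfin ρ hρ).union (hBfin M)).subset ?_
    rintro z ⟨rfl | hz | hz, h1, h2⟩
    · simp at h1; linarith
    · exact Or.inl ⟨hz, h1⟩
    · exact Or.inr ⟨hz, h2⟩
  have hcl : ∀ a ∈ Z, a ≠ 0 → IsClosed (Z \ {a}) := fun a _ ha0 =>
    isClosed_of_finite_annuli ⟨Or.inl rfl, fun h => ha0 h.symm⟩ fun ρ M hρ =>
      (hZfin ρ M hρ).subset (Set.inter_subset_inter_left _ Set.sdiff_subset)
  obtain ⟨r₀, hr₀, hBr⟩ : ∃ r₀ > 0, ∀ p ∈ B, r₀ ≤ ‖p‖ := by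
    have hfin := hBfin 1
    have hpos : ∃ r₀ > 0, ∀ p ∈ B ∩ {z | ‖z‖ ≤ 1}, r₀ ≤ ‖p‖ := by
      rcases (B ∩ {z | ‖z‖ ≤ 1}).eq_empty_or_nonempty with he | he
      · exact ⟨1, one_pos, fun p hp => by rw [he] at hp; exact absurd hp (by simp)⟩
      · obtain ⟨p, hp, hmin⟩ := Set.exists_min_image _ norm hfin he
        exact ⟨‖p‖, norm_pos_iff.2 (hB0 p hp.1), hmin⟩
    obtain ⟨r, hr, h⟩ := hpos
    refine ⟨min r 1, lt_min hr one_pos, fun p hp => ?_⟩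
    by_cases h1 : ‖p‖ ≤ 1
    · exact (min_le_left _ _).trans (h p ⟨hp, h1⟩)
    · exact (min_le_right _ _).trans (not_le.1 h1).le
  -- The initial circle is smaller than every excluded point and avoids the countably many moduli of
  -- the points of `Z`.
  obtain ⟨r, hrI, hrZ⟩ : ∃ r ∈ Set.Ioo 0 r₀, r ∈ (norm '' Z)ᶜ :=
    ((hZc.image norm).dense_compl ℝ).exists_mem_open isOpen_Ioo (Set.nonempty_Ioo.2 hr₀) |>.imp
      fun x hx => ⟨hx.2, hx.1⟩
  have hZr : ∀ p ∈ Z, ‖p‖ ≠ r := fun p hp h => hrZ ⟨p, hp, h⟩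
  -- The points to be included that the circle misses are finitely many, because `A` accumulates
  -- only at `0`. Each of them receives a lasso.
  have hF := hAfin r hrI.1
  obtain ⟨γ, g1, g2, g3⟩ := exists_curve_of_finset hZc hcl hrI.1 hZr hF.toFinset fun a ha => by
    rw [Set.Finite.mem_toFinset] at ha
    exact ⟨Or.inr (Or.inl ha.1), hA0 a ha.1⟩
  refine ⟨γ, g1, ?_, fun p hp => ?_, fun p hp => ?_⟩
  · have h0 : (0 : ℂ) ∉ hF.toFinset := fun h => by
      rw [Set.Finite.mem_toFinset] at h; exact hA0 0 h.1 rfl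
    have := g3 0 (Or.inl rfl)
    simpa only [norm_zero, hrI.1, if_true, h0, if_false, add_zero] using this
  · have := g3 p (Or.inr (Or.inl hp))
    by_cases h : ‖p‖ < r
    · have h0 : p ∉ hF.toFinset := fun h' => by
        rw [Set.Finite.mem_toFinset] at h'; exact absurd h (not_lt.2 h'.2)
      simpa only [h, if_true, h0, if_false, add_zero] using this
    · have h0 : p ∈ hF.toFinset := by
        rw [Set.Finite.mem_toFinset]; exact ⟨hp, not_lt.1 h⟩
      simpa only [h, if_true, h0, if_false, zero_add] using this
  · have := g3 p (Or.inr (Or.inr hp))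
    have h : ¬ ‖p‖ < r := not_lt.2 (hrI.2.le.trans (hBr p hp))
    have h0 : p ∉ hF.toFinset := fun h' => by
      rw [Set.Finite.mem_toFinset] at h'; exact hAB p h'.1 hp
    simpa only [h, h0, if_false, zero_add] using this

end TrigHyp
end

noncomputable section
namespace TrigHyp

/-! ### Integrals depending analytically on parameters -/

section

variable {E X : Type*} [NormedAddCommGroup E] [NormedSpace ℂ E] [TopologicalSpace X]
  [CompactSpace X]

/-- The superposition operator on `C(X, E)` defined by a formal multilinear series. -/
def superposition (X : Type*) [TopologicalSpace X] [CompactSpace X]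
    (p : FormalMultilinearSeries ℂ E ℂ) : FormalMultilinearSeries ℂ C(X, E) C(X, ℂ) := fun n =>
  MultilinearMap.mkContinuous
    { toFun := fun v => ⟨fun x => p n fun i => v i x, (p n).cont.comp (by fun_prop)⟩
      map_update_add' := fun v i a b => by
        ext x
        have h : ∀ w : C(X, E), (fun j => Function.update v i w j x) =
            Function.update (fun j => v j x) i (w x) := fun w => by
          funext j; by_cases hj : j = i
          · subst hj; simp
          · simp [hj]
        simp [h]
      map_update_smul' := fun v i c a => by
        ext x
        have h : ∀ w : C(X, E), (fun j => Function.update v i w j x) =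
            Function.update (fun j => v j x) i (w x) := fun w => by
          funext j; by_cases hj : j = i
          · subst hj; simp
          · simp [hj]
        simp [h] }
    ‖p n‖ fun v => (ContinuousMap.norm_le _ (by positivity)).2 fun x =>
      ((p n).le_opNorm _).trans (mul_le_mul_of_nonneg_left
        (Finset.prod_le_prod (fun _ _ => norm_nonneg _) fun i _ => (v i).norm_coe_le_norm x)
        (norm_nonneg _))

/-- Pointwise application does not increase the norms of the coefficients, so the radius of
convergence for continuous functions in the sup norm is at least that of `p`. -/
theorem radius_le_superposition (p : FormalMultilinearSeries ℂ E ℂ) :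
    p.radius ≤ (superposition X p).radius := by
  refine ENNReal.le_of_forall_nnreal_lt fun r hr => ?_
  obtain ⟨C, _, hC⟩ := p.norm_mul_pow_le_of_lt_radius hr
  refine (superposition X p).le_radius_of_bound C fun n => le_trans ?_ (hC n)
  gcongr
  exact MultilinearMap.mkContinuous_norm_le _ (norm_nonneg _) _

/-- Evaluation at `x` is continuous and linear, so it commutes with the sum of the series. -/
theorem superposition_sum_apply {p : FormalMultilinearSeries ℂ E ℂ} {F : E → ℂ} {y : E}
    {r : ENNReal} (h : HasFPowerSeriesOnBall F p y r) {v : C(X, E)} (hv : ENNReal.ofReal ‖v‖ < r)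
    (x : X) : (superposition X p).sum v x = F (y + v x) := by
  have hv' : v ∈ Metric.eball (0 : C(X, E)) (superposition X p).radius := by
    rw [Metric.mem_eball, edist_zero_right, ← ofReal_norm]
    exact hv.trans_le (h.r_le.trans (radius_le_superposition p))
  have hs := (superposition X p).hasSum hv'
  have h1 := hs.mapL (ContinuousMap.evalCLM ℂ x)
  have h2 := h.hasSum (y := v x) (by
    rw [Metric.mem_eball, edist_zero_right, ← ofReal_norm]
    exact (ENNReal.ofReal_le_ofReal (v.norm_coe_le_norm x)).trans_lt hv)
  exact h1.unique h2

end

variable {E : Type*} [NormedAddCommGroup E] [NormedSpace ℂ E]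

/-- Integration over `[a, b]` as a continuous linear functional. -/
def integralCLM {a b : ℝ} (hab : a ≤ b) : C(Set.Icc a b, ℂ) →L[ℂ] ℂ :=
  LinearMap.mkContinuous
    { toFun := fun g => ∫ x in a..b, g (Set.projIcc a b hab x)
      map_add' := fun f g => intervalIntegral.integral_add
        (Continuous.intervalIntegrable (by fun_prop) _ _)
        (Continuous.intervalIntegrable (by fun_prop) _ _)
      map_smul' := fun c g => intervalIntegral.integral_smul c _ }
    |b - a| fun g => by
      rw [mul_comm]
      exact intervalIntegral.norm_integral_le_of_norm_le_const fun x _ => g.norm_coe_le_norm _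

/-- The integral is a composition of three analytic maps: the affine map sending `t` to the function
`x ↦ (t - τ, c x - z₀)`, the superposition operator of the power series of `F`, and integration as a
continuous linear functional. This works for parameters in any normed space. -/
theorem analyticAt_integral_of_ball {F : E × ℂ → ℂ} {τ : E} {z₀ : ℂ}
    {p : FormalMultilinearSeries ℂ (E × ℂ) ℂ} {r : ℝ} (hr : 0 < r)
    (hF : HasFPowerSeriesOnBall F p (τ, z₀) (ENNReal.ofReal r)) {c : ℝ → ℂ} (hc : Continuous c)
    {a b : ℝ} (hab : a ≤ b) (hball : ∀ x ∈ Set.Icc a b, ‖c x - z₀‖ < r / 2) :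
    AnalyticAt ℂ (fun t => ∫ x in a..b, F (t, c x)) τ ∧
    ∀ᶠ t in 𝓝 τ, IntervalIntegrable (fun x => F (t, c x)) MeasureTheory.volume a b := by
  set L : E →L[ℂ] C(Set.Icc a b, E × ℂ) := LinearMap.mkContinuous
    { toFun := fun e => ContinuousMap.const _ (e, 0)
      map_add' := fun e f => by ext x <;> simp
      map_smul' := fun k e => by ext x <;> simp } 1 fun e => by
        rw [one_mul]
        exact (ContinuousMap.norm_le _ (norm_nonneg _)).2 fun x => by simp [Prod.norm_def] with hL
  set v₀ : C(Set.Icc a b, E × ℂ) := ⟨fun x => (0, c x - z₀), by fun_prop⟩ with hv₀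
  set ι : E → C(Set.Icc a b, E × ℂ) := fun t => L (t - τ) + v₀ with hι
  have hιx : ∀ t x, (τ, z₀) + ι t x = (t, c x) := fun t x => by
    ext <;> simp [hι, hL, hv₀]
  have hv₀n : ‖v₀‖ < r := by
    refine lt_of_le_of_lt ((ContinuousMap.norm_le _ (half_pos hr).le).2 fun x => ?_) (half_lt_self hr)
    simpa [hv₀, Prod.norm_def] using (hball x x.2).le
  have hιa : AnalyticAt ℂ ι τ :=
    ((L.analyticAt _).comp (analyticAt_id.sub analyticAt_const)).add analyticAt_const
  have hιτ : ι τ = v₀ := by simp [hι]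
  have hnear : ∀ᶠ t in 𝓝 τ, ‖ι t‖ < r := by
    have := hιa.continuousAt.norm
    rw [ContinuousAt, hιτ] at this
    exact this.eventually (gt_mem_nhds hv₀n)
  have hP0 : 0 < (superposition (Set.Icc a b) p).radius :=
    (hF.r_pos.trans_le hF.r_le).trans_le (radius_le_superposition p)
  have hΦ : AnalyticAt ℂ (superposition (Set.Icc a b) p).sum (ι τ) := by
    refine ((superposition (Set.Icc a b) p).hasFPowerSeriesOnBall hP0).analyticAt_of_mem ?_
    rw [hιτ, Metric.mem_eball, edist_zero_right, ← ofReal_norm]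
    exact ((ENNReal.ofReal_lt_ofReal_iff hr).2 hv₀n).trans_le
      (hF.r_le.trans (radius_le_superposition p))
  have hval : ∀ᶠ t in 𝓝 τ, ∀ x ∈ Set.Icc a b,
      F (t, c x) = (superposition (Set.Icc a b) p).sum (ι t) (Set.projIcc a b hab x) := by
    filter_upwards [hnear] with t ht x hx
    rw [superposition_sum_apply hF ((ENNReal.ofReal_lt_ofReal_iff hr).2 ht), hιx,
      Set.projIcc_of_mem hab hx]
  constructor
  · refine (((integralCLM hab).analyticAt _).comp (hΦ.comp hιa)).congr ?_
    filter_upwards [hval] with t ht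
    refine intervalIntegral.integral_congr fun x hx => ?_
    rw [Set.uIcc_of_le hab] at hx
    exact (ht x hx).symm
  · filter_upwards [hval] with t ht
    have h1 : Continuous fun x =>
        (superposition (Set.Icc a b) p).sum (ι t) (Set.projIcc a b hab x) := by fun_prop
    refine (h1.continuousOn.congr fun x hx => ?_).intervalIntegrable
    rw [Set.uIcc_of_le hab] at hx
    exact ht x hx

/-- By compactness the interval splits into finitely many pieces, each mapped by `c` into half of a
ball of convergence of `F`; the integrals over the pieces are added. -/
theorem analyticAt_integral {F : E × ℂ → ℂ} {τ : E} {c : ℝ → ℂ} (hc : Continuous c) {a b : ℝ}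
    (hab : a ≤ b) (hF : ∀ x ∈ Set.Icc a b, AnalyticAt ℂ F (τ, c x)) :
    AnalyticAt ℂ (fun t => ∫ x in a..b, F (t, c x)) τ := by
  have hloc : ∀ x : Set.Icc a b, ∃ p : FormalMultilinearSeries ℂ (E × ℂ) ℂ, ∃ r : ℝ, 0 < r ∧
      HasFPowerSeriesOnBall F p (τ, c x) (ENNReal.ofReal r) := fun x => by
    obtain ⟨p, r, h⟩ := hF x x.2
    obtain ⟨s, hs0, hsr⟩ := ENNReal.lt_iff_exists_nnreal_btwn.1 h.r_pos
    refine ⟨p, s, by simpa using hs0, h.mono (by simpa using hs0) (by simpa using hsr.le)⟩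
  choose p r hr hp using hloc
  obtain ⟨t, ht0, htm, ⟨m, hm⟩, hsub⟩ := exists_monotone_Icc_subset_open_cover_Icc hab
    (c := fun x : Set.Icc a b => {y : Set.Icc a b | ‖c y - c x‖ < r x / 2})
    (fun x => isOpen_lt (by fun_prop) continuous_const)
    (fun y _ => Set.mem_iUnion.2 ⟨y, by simpa using half_pos (hr y)⟩)
  have hpiece : ∀ n, AnalyticAt ℂ (fun s => ∫ x in (t n : ℝ)..t (n + 1), F (s, c x)) τ ∧
      ∀ᶠ s in 𝓝 τ, IntervalIntegrable (fun x => F (s, c x)) MeasureTheory.volume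
        (t n : ℝ) (t (n + 1)) := fun n => by
    obtain ⟨i, hi⟩ := hsub n
    refine analyticAt_integral_of_ball (hr i) (hp i) hc (htm (Nat.le_succ n)) fun x hx => ?_
    exact hi (show (⟨x, (t n).2.1.trans hx.1, hx.2.trans (t (n + 1)).2.2⟩ : Set.Icc a b) ∈ _ from
      ⟨hx.1, hx.2⟩)
  have hsum : AnalyticAt ℂ
      (fun s => ∑ n ∈ Finset.range m, ∫ x in (t n : ℝ)..t (n + 1), F (s, c x)) τ :=
    Finset.analyticAt_fun_sum _ fun n _ => (hpiece n).1
  refine hsum.congr ?_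
  have hall : ∀ᶠ s in 𝓝 τ, ∀ n ∈ Finset.range m, IntervalIntegrable (fun x => F (s, c x))
      MeasureTheory.volume (t n : ℝ) (t (n + 1)) :=
    (Filter.eventually_all_finset _).2 fun n _ => (hpiece n).2
  filter_upwards [hall] with s hs
  have := intervalIntegral.sum_integral_adjacent_intervals (a := fun n => (t n : ℝ)) (n := m)
    (f := fun x => F (s, c x)) (μ := MeasureTheory.volume)
    fun k hk => hs k (Finset.mem_range.2 hk)
  rw [this, ht0, hm m le_rfl]

end TrigHyp
end

noncomputable section
namespace TrigHyp

/-! ### Meromorphic dependence on parameters -/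

/-- In terms of ideals: if each `g x` lies in `(α x, β)`, then their product lies in `(∏ α x, β)`.
-/
theorem exists_prod_eq_of_forall_left {R ι : Type*} [CommRing R] (s : Finset ι) (α g : ι → R) (β : R)
    (h : ∀ x ∈ s, ∃ c d, g x = c * α x + d * β) :
    ∃ c d, ∏ x ∈ s, g x = c * ∏ x ∈ s, α x + d * β := by
  classical
  induction s using Finset.induction_on with
  | empty => exact ⟨1, 0, by simp⟩
  | insert a s ha ih =>
    obtain ⟨c, d, hcd⟩ := ih fun x hx => h x (Finset.mem_insert_of_mem hx)
    obtain ⟨c', d', hcd'⟩ := h a (Finset.mem_insert_self _ _)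
    refine ⟨c' * c, c' * α a * d + d' * (c * ∏ x ∈ s, α x + d * β), ?_⟩
    rw [Finset.prod_insert ha, Finset.prod_insert ha, hcd, hcd']
    ring

/-- The preceding statement applied in each of the two variables. It yields a Bézout identity for
two finite products of linear factors whose left side is a product of pairwise resultants. -/
theorem exists_prod_prod_eq {R ι κ : Type*} [CommRing R] (s : Finset ι) (s' : Finset κ)
    (α : ι → R) (β : κ → R) (g : ι → κ → R)
    (h : ∀ x ∈ s, ∀ y ∈ s', ∃ c d, g x y = c * α x + d * β y) :
    ∃ c d, ∏ y ∈ s', ∏ x ∈ s, g x y = c * ∏ x ∈ s, α x + d * ∏ y ∈ s', β y := by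
  obtain ⟨c, d, hcd⟩ := exists_prod_eq_of_forall_left s' β (fun y => ∏ x ∈ s, g x y)
    (∏ x ∈ s, α x) fun y hy => by
      obtain ⟨c, d, hcd⟩ := exists_prod_eq_of_forall_left s α (fun x => g x y) (β y)
        fun x hx => h x hx y hy
      exact ⟨d, c, by rw [hcd, add_comm]⟩
  exact ⟨d, c, by rw [hcd, add_comm]⟩

variable {E : Type*} [NormedAddCommGroup E] [NormedSpace ℂ E]

/-- The ring of functions which are analytic at the points of a set. -/
def analyticRing (S : Set E) : Subring (E → ℂ) where
  carrier := {F | ∀ y ∈ S, AnalyticAt ℂ F y}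
  mul_mem' := fun hf hg y hy => (hf y hy).mul (hg y hy)
  one_mem' := fun _ _ => analyticAt_const
  add_mem' := fun hf hg y hy => (hf y hy).add (hg y hy)
  zero_mem' := fun _ _ => analyticAt_const
  neg_mem' := fun hf y hy => (hf y hy).neg

theorem contourIntegral_circ_zero (f : ℂ → ℂ) (b : ℂ) :
    contourIntegral f (circ 0 b) = ∫ x in (0 : ℝ)..1, f (circ 0 b x) * circ 0 b x := by
  rw [contourIntegral, ← intervalIntegral.integral_const_mul]
  refine intervalIntegral.integral_congr fun x _ => ?_
  simp only [(hasDerivAt_circ 0 b x).deriv, circ]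
  field_simp [Complex.two_pi_I_ne_zero]
  ring

theorem norm_circ_zero (b : ℂ) (x : ℝ) : ‖circ 0 b x‖ = ‖b‖ := by
  simpa using norm_circ_sub 0 b x

/-! ### Separating curves and meromorphic continuation of contour integrals -/

section

variable {ι κ : Type*} {q : ℂ}

theorem qPoch_div_ne_zero (hq : ‖q‖ < 1) {a z : ℂ} (hz : z ≠ 0)
    (h : ∀ n : ℕ, z ≠ a * q ^ n) : qPoch q (a / z) ≠ 0 := by
  rw [qPoch_ne_zero_iff hq]
  intro n hn
  refine h n ?_
  field_simp at hn
  exact hn.symm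

theorem qPoch_mul_ne_zero (hq : ‖q‖ < 1) {b z : ℂ}
    (h : ∀ n : ℕ, z ≠ (b * q ^ n)⁻¹) : qPoch q (b * z) ≠ 0 := by
  rw [qPoch_ne_zero_iff hq]
  intro n hn
  refine h n (eq_inv_of_mul_eq_one_left ?_)
  rw [← hn]; ring

theorem continuousOn_div_qPoch (hq : ‖q‖ < 1) (I : Finset ι) (J : Finset κ) (α : ι → ℂ) (β : κ → ℂ)
    {H : ℂ → ℂ} (hH : ∀ z, z ≠ 0 → DifferentiableAt ℂ H z) {s : Set ℂ} (h0 : ∀ z ∈ s, z ≠ 0)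
    (hα : ∀ z ∈ s, ∀ i ∈ I, ∀ n : ℕ, z ≠ α i * q ^ n)
    (hβ : ∀ z ∈ s, ∀ k ∈ J, ∀ n : ℕ, z ≠ (β k * q ^ n)⁻¹) :
    ContinuousOn
      (fun z => H z / ((∏ i ∈ I, qPoch q (α i / z)) * ∏ k ∈ J, qPoch q (β k * z))) s := by
  intro z hz
  have hz0 := h0 z hz
  have hQ := continuous_qPoch hq
  refine ContinuousAt.continuousWithinAt ((hH z hz0).continuousAt.div
    ((tendsto_finsetProd _ fun i _ => ?_).mul (tendsto_finsetProd _ fun k _ => ?_)) ?_)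
  · exact hQ.continuousAt.comp' (f := fun z => α i / z) (by fun_prop (disch := assumption))
  · exact (hQ.comp (continuous_const.mul continuous_id)).continuousAt
  · exact mul_ne_zero
      (Finset.prod_ne_zero_iff.2 fun i hi => qPoch_div_ne_zero hq hz0 (hα z hz i hi))
      (Finset.prod_ne_zero_iff.2 fun k hk => qPoch_mul_ne_zero hq (hβ z hz k hk))

/-- A closed curve which winds once around zero and around the points `α qⁿ`, and does not wind
around the points `(β qⁿ)⁻¹`. -/
structure Separates (q : ℂ) (I : Finset ι) (J : Finset κ) (α : ι → ℂ) (β : κ → ℂ) (γ : ℝ → ℂ) :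
    Prop where
  curve : IsClosedCurve γ
  origin : HasWinding γ 0 1
  inside : ∀ i ∈ I, ∀ n : ℕ, HasWinding γ (α i * q ^ n) 1
  outside : ∀ k ∈ J, ∀ n : ℕ, HasWinding γ ((β k * q ^ n)⁻¹) 0

theorem separates_circ (hq0 : q ≠ 0) (hq : ‖q‖ < 1) {I : Finset ι} {J : Finset κ} {α : ι → ℂ}
    {β : κ → ℂ} {r : ℂ} (hr : r ≠ 0) (hβ0 : ∀ k ∈ J, β k ≠ 0) (hα : ∀ i ∈ I, ‖α i‖ < ‖r‖)
    (hβ : ∀ k ∈ J, ‖β k‖ * ‖r‖ < 1) : Separates q I J α β (circ 0 r) where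
  curve := isClosedCurve_circ _ _
  origin := hasWinding_circ_of_lt (by simpa using hr)
  inside := fun i hi n => hasWinding_circ_of_lt (by
    rw [sub_zero, sub_zero, norm_mul, norm_pow]
    exact (mul_le_of_le_one_right (norm_nonneg _) (pow_le_one₀ (norm_nonneg _) hq.le)).trans_lt
      (hα i hi))
  outside := fun k hk n => hasWinding_circ_of_gt (by
    have h1 : 0 < ‖β k * q ^ n‖ := norm_pos_iff.2 (mul_ne_zero (hβ0 k hk) (pow_ne_zero _ hq0))
    rw [sub_zero, sub_zero, norm_inv, lt_inv_comm₀ (norm_pos_iff.2 hr) h1, norm_mul, norm_pow]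
    refine (mul_le_of_le_one_right (norm_nonneg _) (pow_le_one₀ (norm_nonneg _) hq.le)).trans_lt ?_
    rw [← one_div, lt_div_iff₀ (norm_pos_iff.2 hr)]
    exact hβ k hk)

theorem Separates.contourIntegral_eq (hq0 : q ≠ 0) (hq : ‖q‖ < 1) {I : Finset ι} {J : Finset κ}
    {α : ι → ℂ} {β : κ → ℂ} (hβ : ∀ k ∈ J, β k ≠ 0) {H : ℂ → ℂ}
    (hH : ∀ z, z ≠ 0 → DifferentiableAt ℂ H z) {γ₁ γ₂ : ℝ → ℂ} (h₁ : Separates q I J α β γ₁)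
    (h₂ : Separates q I J α β γ₂) :
    contourIntegral (fun z => H z / ((∏ i ∈ I, qPoch q (α i / z)) * ∏ k ∈ J, qPoch q (β k * z))) γ₁
    = contourIntegral
      (fun z => H z / ((∏ i ∈ I, qPoch q (α i / z)) * ∏ k ∈ J, qPoch q (β k * z))) γ₂ :=
  contourIntegral_eq_of_winding h₁.curve h₂.curve hq0 hq I J α β hβ hH ⟨1, h₁.origin, h₂.origin⟩
    (fun i hi n => ⟨1, h₁.inside i hi n, h₂.inside i hi n⟩)
    (fun k hk n => ⟨0, h₁.outside k hk n, h₂.outside k hk n⟩)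

/-- Discarding initial terms of the sequences only weakens the conditions. The shifted sequences
leave room to move the contour to a circle. -/
theorem Separates.shift {I : Finset ι} {J : Finset κ} {α : ι → ℂ} {β : κ → ℂ} {γ : ℝ → ℂ}
    (h : Separates q I J α β γ) (M N : ℕ) :
    Separates q I J (fun i => α i * q ^ M) (fun k => β k * q ^ N) γ where
  curve := h.curve
  origin := h.origin
  inside := fun i hi n => by simpa [mul_assoc, pow_add] using h.inside i hi (M + n)
  outside := fun k hk n => by simpa only [mul_assoc, pow_add] using h.outside k hk (N + n)

theorem Separates.ne {I : Finset ι} {J : Finset κ} {α : ι → ℂ} {β : κ → ℂ} {γ : ℝ → ℂ}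
    (h : Separates q I J α β γ) :
    (∀ z ∈ γ '' Set.Icc 0 1, z ≠ 0) ∧
    (∀ z ∈ γ '' Set.Icc 0 1, ∀ i ∈ I, ∀ n : ℕ, z ≠ α i * q ^ n) ∧
    ∀ z ∈ γ '' Set.Icc 0 1, ∀ k ∈ J, ∀ n : ℕ, z ≠ (β k * q ^ n)⁻¹ := by
  refine ⟨?_, ?_, ?_⟩
  · rintro _ ⟨x, hx, rfl⟩; exact h.origin.1 x hx
  · rintro _ ⟨x, hx, rfl⟩ i hi n; exact (h.inside i hi n).1 x hx
  · rintro _ ⟨x, hx, rfl⟩ k hk n; exact (h.outside k hk n).1 x hx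

/-- On a fixed circle that strictly separates the sequences at `τ`, the denominator does not vanish,
so the integrand is jointly analytic and the integral is analytic in the parameter. -/
theorem analyticAt_contourIntegral_circ (hq : ‖q‖ < 1) {I : Finset ι} {J : Finset κ}
    {a : ι → E → ℂ} {b : κ → E → ℂ} {H : E × ℂ → ℂ} {τ : E} (ha : ∀ i ∈ I, AnalyticAt ℂ (a i) τ)
    (hb : ∀ k ∈ J, AnalyticAt ℂ (b k) τ) {r : ℂ} (hr : r ≠ 0)
    (hH : ∀ z, ‖z‖ = ‖r‖ → AnalyticAt ℂ H (τ, z)) (har : ∀ i ∈ I, ‖a i τ‖ < ‖r‖)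
    (hbr : ∀ k ∈ J, ‖b k τ‖ * ‖r‖ < 1) :
    AnalyticAt ℂ (fun t => contourIntegral (fun z => H (t, z) /
      ((∏ i ∈ I, qPoch q (a i t / z)) * ∏ k ∈ J, qPoch q (b k t * z))) (circ 0 r)) τ := by
  simp only [contourIntegral_circ_zero]
  refine analyticAt_integral (F := fun y : E × ℂ => H y /
      ((∏ i ∈ I, qPoch q (a i y.1 / y.2)) * ∏ k ∈ J, qPoch q (b k y.1 * y.2)) * y.2)
    (contDiff_circ 0 r).continuous zero_le_one fun x _ => ?_
  set z := circ 0 r x with hz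
  have hzn : ‖z‖ = ‖r‖ := norm_circ_zero r x
  have hz0 : z ≠ 0 := norm_pos_iff.1 (by rw [hzn]; exact norm_pos_iff.2 hr)
  have hfst : AnalyticAt ℂ (Prod.fst : E × ℂ → E) (τ, z) := analyticAt_fst
  have hsnd : AnalyticAt ℂ (Prod.snd : E × ℂ → ℂ) (τ, z) := analyticAt_snd
  refine ((hH z hzn).div ((Finset.analyticAt_fun_prod _ fun i hi => ?_).mul
    (Finset.analyticAt_fun_prod _ fun k hk => ?_)) ?_).mul hsnd
  · exact ((AnalyticAt.fun_comp (x := (τ, z)) (ha i hi) hfst).div hsnd hz0).qPoch hq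
  · exact ((AnalyticAt.fun_comp (x := (τ, z)) (hb k hk) hfst).mul hsnd).qPoch hq
  · refine mul_ne_zero (Finset.prod_ne_zero_iff.2 fun i hi => qPoch_ne_zero_of_norm_lt hq ?_)
      (Finset.prod_ne_zero_iff.2 fun k hk => qPoch_ne_zero_of_norm_lt hq ?_)
    · simp only [norm_div, hzn]
      exact (div_lt_one (norm_pos_iff.2 hr)).2 (har i hi)
    · simp only [norm_mul, hzn]
      exact hbr k hk

/-- Contour integrals of functions with poles in sequences `a(t) qⁿ` and `(b(t) qⁿ)⁻¹` depend
meromorphically on `t`. -/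
theorem exists_analyticAt_prod_mul_contourIntegral (hq0 : q ≠ 0) (hq : ‖q‖ < 1) (I : Finset ι)
    (J : Finset κ) (a : ι → E → ℂ) (b : κ → E → ℂ) (H : E × ℂ → ℂ) {O : Set E} (hO : IsOpen O)
    (ha : ∀ t ∈ O, ∀ i ∈ I, AnalyticAt ℂ (a i) t) (hb : ∀ t ∈ O, ∀ k ∈ J, AnalyticAt ℂ (b k) t)
    (hb0 : ∀ t ∈ O, ∀ k ∈ J, b k t ≠ 0)
    (hH : ∀ t ∈ O, ∀ z, z ≠ 0 → AnalyticAt ℂ H (t, z)) {τ : E} (hτ : τ ∈ O) :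
    ∃ N : ℕ, ∃ f : E → ℂ, AnalyticAt ℂ f τ ∧ ∀ᶠ t in 𝓝 τ, ∀ γ,
      Separates q I J (fun i => a i t) (fun k => b k t) γ →
      (∏ k ∈ J ×ˢ Finset.range N, ∏ i ∈ I ×ˢ Finset.range N,
        (1 - a i.1 t * b k.1 t * q ^ (i.2 + k.2))) *
        contourIntegral (fun z => H (t, z) /
          ((∏ i ∈ I, qPoch q (a i t / z)) * ∏ k ∈ J, qPoch q (b k t * z))) γ = f t := by
  -- The circle of radius `ε` lies inside all points `(b qⁿ)⁻¹`, and the circle of radius `R` below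
  -- lies outside all points `a qⁿ`. In general no circle does both.
  obtain ⟨ε, hε, hεb⟩ : ∃ ε : ℝ, 0 < ε ∧ ∀ k ∈ J, ‖b k τ‖ * ε < 1 := by
    have : ∀ᶠ ε : ℝ in 𝓝[>] 0, ∀ k ∈ J, ‖b k τ‖ * ε < 1 := by
      rw [Filter.eventually_all_finset]
      intro k _
      have : Tendsto (fun ε : ℝ => ‖b k τ‖ * ε) (𝓝[>] 0) (𝓝 (‖b k τ‖ * 0)) :=
        (tendsto_nhdsWithin_of_tendsto_nhds tendsto_id).const_mul _
      exact this.eventually (gt_mem_nhds (by simp))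
    exact (this.and self_mem_nhdsWithin).exists.imp fun x hx => ⟨hx.2, hx.1⟩
  obtain ⟨R, hR, hRa⟩ : ∃ R : ℝ, 0 < R ∧ ∀ i ∈ I, ‖a i τ‖ < R := by
    have : ∀ᶠ R : ℝ in atTop, ∀ i ∈ I, ‖a i τ‖ < R := by
      rw [Filter.eventually_all_finset]
      exact fun i _ => eventually_gt_atTop _
    exact (this.and (eventually_gt_atTop 0)).exists.imp fun x hx => ⟨hx.2, hx.1⟩
  -- Once the first `N` terms of one family are dropped, its remaining points are on the correct
  -- side of the circle chosen for the other family.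
  obtain ⟨N, hNa, hNb⟩ := ((exists_pow_norm_lt hq I (fun i => a i τ) hε).and
    (exists_pow_norm_lt hq J (fun k => b k τ) (inv_pos.2 hR))).exists
  have hεn : ‖(ε : ℂ)‖ = ε := by simp [abs_of_pos hε]
  have hRn : ‖(R : ℂ)‖ = R := by simp [abs_of_pos hR]
  have hε0 : (ε : ℂ) ≠ 0 := by exact_mod_cast hε.ne'
  have hR0 : (R : ℂ) ≠ 0 := by exact_mod_cast hR.ne'
  have hNb' : ∀ k ∈ J, ‖b k τ * q ^ N‖ * R < 1 := fun k hk =>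
    (lt_div_iff₀ hR).1 (by simpa only [one_div] using hNb k hk)
  have haτ := ha τ hτ
  have hbτ := hb τ hτ
  set S : Set (E × ℂ) := {y | y.1 ∈ O ∧ y.2 ≠ 0} with hS
  have hbS : ∀ k ∈ J, (fun y : E × ℂ => b k y.1) ∈ analyticRing S := fun k hk y hy =>
    AnalyticAt.fun_comp (f := Prod.fst) (x := y) (hb y.1 hy.1 k hk) analyticAt_fst
  -- The basic identity is `1 - a b qⁱ⁺ᵏ = b qᵏ (z - a qⁱ) + (1 - b qᵏ z)`. Working in a ring of
  -- analytic functions keeps the cofactors `U` and `V` analytic in `t` and `z`.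
  obtain ⟨U, V, hUV⟩ := exists_prod_prod_eq (R := analyticRing S) ((I ×ˢ Finset.range N).attach)
    ((J ×ˢ Finset.range N).attach)
    (fun x => ⟨fun y => y.2 - a x.1.1 y.1 * q ^ x.1.2, fun y hy => analyticAt_snd.sub
      ((AnalyticAt.fun_comp (f := Prod.fst) (x := y) (ha y.1 hy.1 x.1.1
        (Finset.mem_product.1 x.2).1) analyticAt_fst).mul analyticAt_const)⟩)
    (fun x => ⟨fun y => 1 - b x.1.1 y.1 * q ^ x.1.2 * y.2, fun y hy => analyticAt_const.sub
      (((hbS x.1.1 (Finset.mem_product.1 x.2).1 y hy).mul analyticAt_const).mul analyticAt_snd)⟩)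
    (fun x x' => ⟨fun y => 1 - a x.1.1 y.1 * b x'.1.1 y.1 * q ^ (x.1.2 + x'.1.2),
      fun y hy => analyticAt_const.sub (((AnalyticAt.fun_comp (f := Prod.fst) (x := y)
        (ha y.1 hy.1 x.1.1 (Finset.mem_product.1 x.2).1) analyticAt_fst).mul
          (hbS x'.1.1 (Finset.mem_product.1 x'.2).1 y hy)).mul analyticAt_const)⟩)
    (fun x _ x' _ => ⟨⟨fun y => b x'.1.1 y.1 * q ^ x'.1.2, fun y hy =>
      (hbS x'.1.1 (Finset.mem_product.1 x'.2).1 y hy).mul analyticAt_const⟩, 1, by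
        ext y
        simp only [Subring.coe_add, Subring.coe_mul, Subring.coe_one, Pi.add_apply, Pi.mul_apply,
          Pi.one_apply]
        ring⟩)
  have hUV' : ∀ y : E × ℂ, ∏ k ∈ J ×ˢ Finset.range N, ∏ i ∈ I ×ˢ Finset.range N,
        (1 - a i.1 y.1 * b k.1 y.1 * q ^ (i.2 + k.2)) =
      U.1 y * ∏ i ∈ I ×ˢ Finset.range N, (y.2 - a i.1 y.1 * q ^ i.2) +
      V.1 y * ∏ k ∈ J ×ˢ Finset.range N, (1 - b k.1 y.1 * q ^ k.2 * y.2) := fun y => by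
    have h := congrFun (congrArg Subtype.val hUV) y
    simp only [Subring.coe_add, Subring.coe_mul, SubmonoidClass.coe_finsetProd, Pi.add_apply,
      Pi.mul_apply, Finset.prod_apply] at h
    rw [← Finset.prod_attach (J ×ˢ Finset.range N), ← Finset.prod_attach (J ×ˢ Finset.range N)]
    simp only [← Finset.prod_attach (I ×ˢ Finset.range N)]
    exact h
  clear hUV
  -- In the part with `U` the first `N` poles of each inner sequence are cancelled, so its contour
  -- may be the small circle; in the part with `V` the outer ones are, and the large circle serves.
  -- The power of `z` compensates `1 - a qⁿ/z = (z - a qⁿ)/z`.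
  set H₁ : E × ℂ → ℂ := fun y => H y * U.1 y * y.2 ^ (I ×ˢ Finset.range N).card with hH₁
  set H₂ : E × ℂ → ℂ := fun y => H y * V.1 y with hH₂
  have hH₁a : ∀ t ∈ O, ∀ z, z ≠ 0 → AnalyticAt ℂ H₁ (t, z) := fun t ht z hz =>
    ((hH t ht z hz).mul (U.2 _ ⟨ht, hz⟩)).mul (analyticAt_snd.pow _)
  have hH₂a : ∀ t ∈ O, ∀ z, z ≠ 0 → AnalyticAt ℂ H₂ (t, z) := fun t ht z hz =>
    (hH t ht z hz).mul (V.2 _ ⟨ht, hz⟩)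
  have hne : ∀ {z r : ℂ}, r ≠ 0 → ‖z‖ = ‖r‖ → z ≠ 0 := fun hr h =>
    norm_pos_iff.1 (by rw [h]; exact norm_pos_iff.2 hr)
  refine ⟨N, fun t => contourIntegral (fun z => H₁ (t, z) /
      ((∏ i ∈ I, qPoch q (a i t * q ^ N / z)) * ∏ k ∈ J, qPoch q (b k t * q ^ 0 * z))) (circ 0 ε) +
    contourIntegral (fun z => H₂ (t, z) /
      ((∏ i ∈ I, qPoch q (a i t * q ^ 0 / z)) * ∏ k ∈ J, qPoch q (b k t * q ^ N * z))) (circ 0 R),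
    ?_, ?_⟩
  · refine AnalyticAt.add (analyticAt_contourIntegral_circ hq (a := fun i t => a i t * q ^ N)
        (b := fun k t => b k t * q ^ 0) (fun i hi => (haτ i hi).mul analyticAt_const)
        (fun k hk => (hbτ k hk).mul analyticAt_const) hε0
        (fun z hz => hH₁a τ hτ z (hne hε0 hz)) ?_ ?_)
      (analyticAt_contourIntegral_circ hq (a := fun i t => a i t * q ^ 0)
        (b := fun k t => b k t * q ^ N) (fun i hi => (haτ i hi).mul analyticAt_const)
        (fun k hk => (hbτ k hk).mul analyticAt_const) hR0
        (fun z hz => hH₂a τ hτ z (hne hR0 hz)) ?_ ?_)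
    · simpa only [hεn] using hNa
    · simpa only [hεn, pow_zero, mul_one] using hεb
    · simpa only [hRn, pow_zero, mul_one] using hRa
    · simpa only [hRn] using hNb'
  · have e1 : ∀ᶠ t in 𝓝 τ, ∀ i ∈ I, ‖a i t * q ^ N‖ < ε := (Filter.eventually_all_finset _).2
      fun i hi => ((haτ i hi).continuousAt.mul continuousAt_const).norm.eventually
        (gt_mem_nhds (hNa i hi))
    have e2 : ∀ᶠ t in 𝓝 τ, ∀ i ∈ I, ‖a i t‖ < R := (Filter.eventually_all_finset _).2
      fun i hi => (haτ i hi).continuousAt.norm.eventually (gt_mem_nhds (hRa i hi))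
    have e3 : ∀ᶠ t in 𝓝 τ, ∀ k ∈ J, ‖b k t‖ * ε < 1 := (Filter.eventually_all_finset _).2
      fun k hk => ((hbτ k hk).continuousAt.norm.mul continuousAt_const).eventually
        (gt_mem_nhds (hεb k hk))
    have e4 : ∀ᶠ t in 𝓝 τ, ∀ k ∈ J, ‖b k t * q ^ N‖ * R < 1 := (Filter.eventually_all_finset _).2
      fun k hk => (((hbτ k hk).continuousAt.mul continuousAt_const).norm.mul
        continuousAt_const).eventually (gt_mem_nhds (hNb' k hk))
    filter_upwards [e1, e2, e3, e4, hO.mem_nhds hτ] with t t1 t2 t3 t4 tO γ hγ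
    have hpow : ∀ n : ℕ, q ^ n ≠ 0 := fun n => pow_ne_zero n hq0
    have s1 := hγ.shift N 0
    have s2 := hγ.shift 0 N
    have d1 : ∀ z, z ≠ 0 → DifferentiableAt ℂ (fun z => H₁ (t, z)) z := fun z hz =>
      (AnalyticAt.fun_comp (f := fun z => (t, z)) (hH₁a t tO z hz)
        (analyticAt_const.prod analyticAt_id)).differentiableAt
    have d2 : ∀ z, z ≠ 0 → DifferentiableAt ℂ (fun z => H₂ (t, z)) z := fun z hz =>
      (AnalyticAt.fun_comp (f := fun z => (t, z)) (hH₂a t tO z hz)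
        (analyticAt_const.prod analyticAt_id)).differentiableAt
    have c1 : Separates q I J (fun i => a i t * q ^ N) (fun k => b k t * q ^ 0) (circ 0 ε) :=
      separates_circ hq0 hq hε0 (fun k hk => mul_ne_zero (hb0 t tO k hk) (hpow 0))
        (by simpa only [hεn] using t1) (by simpa only [hεn, pow_zero, mul_one] using t3)
    have c2 : Separates q I J (fun i => a i t * q ^ 0) (fun k => b k t * q ^ N) (circ 0 R) :=
      separates_circ hq0 hq hR0 (fun k hk => mul_ne_zero (hb0 t tO k hk) (hpow N))
        (by simpa only [hRn, pow_zero, mul_one] using t2) (by simpa only [hRn] using t4)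
    -- Both fixed circles are traded back for the given curve `γ`, which separates the shifted
    -- sequences too. There the two parts can be added pointwise.
    rw [← s1.contourIntegral_eq hq0 hq (fun k hk => mul_ne_zero (hb0 t tO k hk) (hpow 0)) d1 c1,
      ← s2.contourIntegral_eq hq0 hq (fun k hk => mul_ne_zero (hb0 t tO k hk) (hpow N)) d2 c2]
    obtain ⟨n0, nα, nβ⟩ := hγ.ne
    have k1 := continuousOn_div_qPoch hq I J _ _ d1 s1.ne.1 s1.ne.2.1 s1.ne.2.2
    have k2 := continuousOn_div_qPoch hq I J _ _ d2 s2.ne.1 s2.ne.2.1 s2.ne.2.2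
    have hg : ∀ (g : ℂ) (f : ℂ → ℂ), g * contourIntegral f γ =
        contourIntegral (fun z => g * f z) γ := fun g f => by
      simp only [contourIntegral, mul_assoc, intervalIntegral.integral_const_mul]
      ring
    rw [hg, ← one_mul (contourIntegral _ γ), ← one_mul (contourIntegral (fun z => H₁ (t, z) / _) γ),
      ← one_mul (contourIntegral (fun z => H₂ (t, z) / _) γ), one_mul]
    refine contourIntegral_lin hγ.curve k1 k2 fun x hx => ?_
    have hm : γ x ∈ γ '' Set.Icc 0 1 := ⟨x, hx, rfl⟩
    set z := γ x with hz
    have hz0 := n0 z hm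
    rw [hUV' (t, z)]
    have q1 : ∏ i ∈ I, qPoch q (a i t / z) =
        (∏ i ∈ I ×ˢ Finset.range N, (z - a i.1 t * q ^ i.2)) *
        (z ^ (I ×ˢ Finset.range N).card)⁻¹ * ∏ i ∈ I, qPoch q (a i t * q ^ N / z) := by
      rw [← Finset.prod_const, ← Finset.prod_inv_distrib, ← Finset.prod_mul_distrib,
        Finset.prod_product, ← Finset.prod_mul_distrib]
      refine Finset.prod_congr rfl fun i _ => ?_
      rw [qPoch_eq_prod_mul hq _ N]
      congr 1
      · refine Finset.prod_congr rfl fun n _ => ?_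
        field_simp
      · congr 1; ring
    have q2 : ∏ k ∈ J, qPoch q (b k t * z) =
        (∏ k ∈ J ×ˢ Finset.range N, (1 - b k.1 t * q ^ k.2 * z)) *
        ∏ k ∈ J, qPoch q (b k t * q ^ N * z) := by
      rw [Finset.prod_product, ← Finset.prod_mul_distrib]
      refine Finset.prod_congr rfl fun k _ => ?_
      rw [qPoch_eq_prod_mul hq _ N]
      congr 1
      · exact Finset.prod_congr rfl fun n _ => by ring
      · congr 1; ring
    have p1 : ∏ i ∈ I, qPoch q (a i t / z) ≠ 0 :=
      Finset.prod_ne_zero_iff.2 fun i hi => qPoch_div_ne_zero hq hz0 (nα z hm i hi)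
    have p2 : ∏ k ∈ J, qPoch q (b k t * z) ≠ 0 :=
      Finset.prod_ne_zero_iff.2 fun k hk => qPoch_mul_ne_zero hq (nβ z hm k hk)
    simp only [pow_zero, mul_one, hH₁, hH₂]
    rw [q1] at p1 ⊢
    rw [q2] at p2 ⊢
    have r1 := left_ne_zero_of_mul (left_ne_zero_of_mul p1)
    have r2 := right_ne_zero_of_mul p1
    have r3 := left_ne_zero_of_mul p2
    have r4 := right_ne_zero_of_mul p2
    have r5 := pow_ne_zero (I ×ˢ Finset.range N).card hz0
    generalize (∏ i ∈ I ×ˢ Finset.range N, (z - a i.1 t * q ^ i.2)) = A at *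
    generalize (∏ k ∈ J ×ˢ Finset.range N, (1 - b k.1 t * q ^ k.2 * z)) = B at *
    generalize (∏ i ∈ I, qPoch q (a i t * q ^ N / z)) = A' at *
    generalize (∏ k ∈ J, qPoch q (b k t * q ^ N * z)) = B' at *
    generalize z ^ (I ×ˢ Finset.range N).card = Z at *
    field_simp

end

end TrigHyp
end

noncomputable section
namespace TrigHyp

/-! ### The three-term relation for theta functions -/

/-- The space of holomorphic functions on `ℂ \ {0}` with `f (q z) = c z⁻² f z`. -/
def thetaSpace (q c : ℂ) : Submodule ℂ (ℂ → ℂ) where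
  carrier := {f | (∀ z, z ≠ 0 → DifferentiableAt ℂ f z) ∧ ∀ z, z ≠ 0 → f (q * z) = c * (z ^ 2)⁻¹ * f z}
  add_mem' := fun hf hg => ⟨fun z hz => (hf.1 z hz).add (hg.1 z hz), fun z hz => by
    simp only [Pi.add_apply, hf.2 z hz, hg.2 z hz]; ring⟩
  zero_mem' := ⟨fun _ _ => differentiableAt_const _, fun _ _ => by simp⟩
  smul_mem' := fun a f hf => ⟨fun z hz => (hf.1 z hz).const_smul a, fun z hz => by
    simp only [Pi.smul_apply, smul_eq_mul, hf.2 z hz]; ring⟩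

/-- The coefficient of `z ^ n` in the Laurent expansion of `f`. -/
def laurentCoeff (f : ℂ → ℂ) (n : ℤ) : ℂ :=
  contourIntegral (fun z => f z * z ^ (-n - 1)) (circ 0 1)

theorem circ_zero_eq_mul (b : ℂ) (x : ℝ) : circ 0 b x = b * circ 0 1 x := by
  simp [circ]

/-- A function holomorphic on `ℂ \ {0}` has the same Laurent coefficients on every circle around the
origin. -/
theorem laurentCoeff_eq {f : ℂ → ℂ} (hf : ∀ z, z ≠ 0 → DifferentiableAt ℂ f z) (n : ℤ) {r : ℂ}
    (hr : r ≠ 0) : laurentCoeff f n = ∫ x in (0 : ℝ)..1, f (circ 0 r x) * circ 0 r x ^ (-n) := by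
  have hs : ∀ {b : ℂ}, b ≠ 0 → Separates (1 / 2 : ℂ) (∅ : Finset ℕ) (∅ : Finset ℕ) (fun _ => 0)
      (fun _ => 0) (circ 0 b) := fun hb =>
    separates_circ (by norm_num) (by norm_num) hb (by simp) (by simp) (by simp)
  have h := Separates.contourIntegral_eq (q := 1 / 2) (by norm_num) (by norm_num) (by simp)
    (H := fun z => f z * z ^ (-n - 1))
    (fun z hz => (hf z hz).fun_mul (differentiableAt_zpow.2 (Or.inl hz)))
    (hs one_ne_zero) (hs hr)
  simp only [Finset.prod_empty, mul_one, div_one] at h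
  rw [laurentCoeff, h, contourIntegral_circ_zero]
  refine intervalIntegral.integral_congr fun x _ => ?_
  have h0 : circ 0 r x ≠ 0 := norm_pos_iff.1 (by rw [norm_circ_zero]; exact norm_pos_iff.2 hr)
  rw [zpow_sub_one₀ h0]
  field_simp

theorem laurentCoeff_lin {f g : ℂ → ℂ} (hf : ∀ z, z ≠ 0 → DifferentiableAt ℂ f z)
    (hg : ∀ z, z ≠ 0 → DifferentiableAt ℂ g z) (a b : ℂ) (n : ℤ) :
    laurentCoeff (a • f + b • g) n = a * laurentCoeff f n + b * laurentCoeff g n := by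
  have hc : ∀ {f : ℂ → ℂ}, (∀ z, z ≠ 0 → DifferentiableAt ℂ f z) →
      ContinuousOn (fun z => f z * z ^ (-n - 1)) (circ 0 1 '' Set.Icc 0 1) := by
    rintro f hf _ ⟨x, _, rfl⟩
    have h0 : circ 0 1 x ≠ 0 := norm_pos_iff.1 (by rw [norm_circ_zero]; simp)
    exact ((hf _ h0).fun_mul
      (differentiableAt_zpow.2 (Or.inl h0))).continuousAt.continuousWithinAt
  refine contourIntegral_lin (isClosedCurve_circ _ _) (hc hf) (hc hg) fun x _ => ?_
  simp only [Pi.add_apply, Pi.smul_apply, smul_eq_mul]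
  ring

/-- A holomorphic function on `ℂ \ {0}` is determined by its Laurent coefficients. -/
theorem eq_zero_of_laurentCoeff_eq_zero {f : ℂ → ℂ} (hf : ∀ z, z ≠ 0 → DifferentiableAt ℂ f z)
    (h : ∀ n, laurentCoeff f n = 0) {r : ℂ} (hr : r ≠ 0) : f r = 0 := by
  -- On the circle through `r` the Laurent coefficients are, up to powers of `r`, Fourier
  -- coefficients. If all vanish, the Fourier series is trivially summable and its pointwise sum is
  -- `f`.
  have hc : Continuous fun x : AddCircle (1 : ℝ) => f (r * (AddCircle.toCircle x : ℂ)) := by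
    refine continuous_iff_continuousAt.2 fun x => ContinuousAt.comp' (g := f)
      (hf _ (mul_ne_zero hr (Circle.coe_ne_zero _))).continuousAt ?_
    exact (continuous_const.mul
      (continuous_subtype_val.comp AddCircle.continuous_toCircle)).continuousAt
  have hcirc : ∀ x : ℝ, (AddCircle.toCircle (x : AddCircle (1 : ℝ)) : ℂ) = circ 0 1 x := fun x => by
    rw [AddCircle.toCircle_apply_mk]
    simp only [Circle.coe_exp, circ]
    push_cast
    simp only [div_one, sub_zero, one_mul, zero_add]
    congr 1; ring
  set g : C(AddCircle (1 : ℝ), ℂ) := ⟨_, hc⟩ with hg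
  have : Fact ((0 : ℝ) < 1) := ⟨one_pos⟩
  have h0 : fourierCoeff g = 0 := by
    funext n
    rw [fourierCoeff_eq_intervalIntegral _ _ 0, zero_add, Pi.zero_apply, one_div, inv_one, one_smul]
    have hn := laurentCoeff_eq hf n hr
    rw [h n] at hn
    have : ∀ x : ℝ, (fourier (-n) (x : AddCircle (1 : ℝ)) : ℂ) • g (x : AddCircle (1 : ℝ)) =
        r ^ n * (f (circ 0 r x) * circ 0 r x ^ (-n)) := fun x => by
      have : (fourier (-n) (x : AddCircle (1 : ℝ)) : ℂ) = circ 0 1 x ^ (-n) := by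
        rw [← hcirc, fourier_apply, AddCircle.toCircle_zsmul, Circle.coe_zpow]
      rw [this, smul_eq_mul, hg, ContinuousMap.coe_mk, hcirc, ← circ_zero_eq_mul,
        circ_zero_eq_mul r, mul_zpow, zpow_neg r, ]
      have := zpow_ne_zero n hr
      field_simp
    simp only [this, intervalIntegral.integral_const_mul]
    rw [← hn, mul_zero]
  have hs := has_pointwise_sum_fourier_series_of_summable (f := g) (by rw [h0]; exact summable_zero)
    ((0 : ℝ) : AddCircle (1 : ℝ))
  rw [h0] at hs
  simp only [Pi.zero_apply, zero_smul] at hs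
  have h1 := hs.unique hasSum_zero
  rw [hg, ContinuousMap.coe_mk, hcirc, ← circ_zero_eq_mul] at h1
  rwa [circ_zero] at h1

/-- Compare the circles through `q` and through `1` by means of the functional equation. The factor
`z⁻²` makes the recurrence skip two indices. -/
theorem laurentCoeff_step {q c : ℂ} (hq0 : q ≠ 0) {f : ℂ → ℂ} (hf : f ∈ thetaSpace q c) (n : ℤ) :
    laurentCoeff f n = c * q ^ (-n) * laurentCoeff f (n + 2) := by
  rw [laurentCoeff_eq hf.1 n hq0, laurentCoeff_eq hf.1 (n + 2) one_ne_zero,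
    ← intervalIntegral.integral_const_mul]
  refine intervalIntegral.integral_congr fun x _ => ?_
  have h0 : circ 0 1 x ≠ 0 := norm_pos_iff.1 (by rw [norm_circ_zero]; simp)
  rw [circ_zero_eq_mul, hf.2 _ h0, mul_zpow, neg_add, zpow_add₀ h0, zpow_neg _ 2]
  norm_cast
  ring

/-- The functions in `thetaSpace q c` are determined by two Laurent coefficients. -/
theorem eq_zero_of_mem_thetaSpace {q c : ℂ} (hq0 : q ≠ 0) (hc : c ≠ 0) {f : ℂ → ℂ}
    (hf : f ∈ thetaSpace q c) (h0 : laurentCoeff f 0 = 0) (h1 : laurentCoeff f 1 = 0) {z : ℂ}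
    (hz : z ≠ 0) : f z = 0 := by
  have up : ∀ n, laurentCoeff f n = 0 ↔ laurentCoeff f (n + 2) = 0 := fun n => by
    rw [laurentCoeff_step hq0 hf n]
    simp [hc, zpow_ne_zero _ hq0]
  have key : ∀ n : ℤ, laurentCoeff f n = 0 ∧ laurentCoeff f (n + 1) = 0 := fun n => by
    induction n using Int.induction_on with
    | zero => exact ⟨h0, h1⟩
    | succ n ih => exact ⟨ih.2, by rw [add_assoc]; exact (up n).1 ih.1⟩
    | pred n ih =>
      refine ⟨(up _).2 ?_, by simpa using ih.1⟩
      convert ih.2 using 2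
      ring
  exact eq_zero_of_laurentCoeff_eq_zero hf.1 (fun n => (key n).1) hz

/-- The function `x⁻¹ θ(x y) θ(x / y)`. -/
def thetaPair (q x y : ℂ) : ℂ := x⁻¹ * theta q (x * y) * theta q (x / y)

section

variable {q : ℂ} (hq0 : q ≠ 0)
include hq0

/-- The space is at most two-dimensional, two coefficients being enough to determine a function. The
combination of `f`, `g`, `h` with the `2 × 2` minors as coefficients has vanishing coefficients `0`
and `1`. -/
theorem thetaSpace_det {f g h : ℂ → ℂ} (hf : f ∈ thetaSpace q q⁻¹) (hg : g ∈ thetaSpace q q⁻¹)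
    (hh : h ∈ thetaSpace q q⁻¹) {x : ℂ} (hx : x ≠ 0) :
    (laurentCoeff g 0 * laurentCoeff h 1 - laurentCoeff g 1 * laurentCoeff h 0) * f x -
    (laurentCoeff f 0 * laurentCoeff h 1 - laurentCoeff f 1 * laurentCoeff h 0) * g x +
    (laurentCoeff f 0 * laurentCoeff g 1 - laurentCoeff f 1 * laurentCoeff g 0) * h x = 0 := by
  set A := laurentCoeff g 0 * laurentCoeff h 1 - laurentCoeff g 1 * laurentCoeff h 0
  set B := laurentCoeff f 0 * laurentCoeff h 1 - laurentCoeff f 1 * laurentCoeff h 0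
  set C := laurentCoeff f 0 * laurentCoeff g 1 - laurentCoeff f 1 * laurentCoeff g 0
  have hm : A • f + (-B) • g ∈ thetaSpace q q⁻¹ :=
    (thetaSpace q q⁻¹).add_mem ((thetaSpace q q⁻¹).smul_mem _ hf)
      ((thetaSpace q q⁻¹).smul_mem _ hg)
  have hm' : (1 : ℂ) • (A • f + (-B) • g) + C • h ∈ thetaSpace q q⁻¹ :=
    (thetaSpace q q⁻¹).add_mem ((thetaSpace q q⁻¹).smul_mem _ hm)
      ((thetaSpace q q⁻¹).smul_mem _ hh)
  have := eq_zero_of_mem_thetaSpace hq0 (inv_ne_zero hq0) hm'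
    (by rw [laurentCoeff_lin hm.1 hh.1, laurentCoeff_lin hf.1 hg.1]; ring)
    (by rw [laurentCoeff_lin hm.1 hh.1, laurentCoeff_lin hf.1 hg.1]; ring) hx
  simp only [Pi.add_apply, Pi.smul_apply, smul_eq_mul] at this
  linear_combination this

/-- When the determinant of the coefficients vanishes, `f` and `g` are linearly dependent. The
conclusion is stated as a cross product so that `f = 0` or `g = 0` needs no exception. -/
theorem thetaSpace_proportional {f g : ℂ → ℂ} (hf : f ∈ thetaSpace q q⁻¹)
    (hg : g ∈ thetaSpace q q⁻¹)
    (h : laurentCoeff f 0 * laurentCoeff g 1 - laurentCoeff f 1 * laurentCoeff g 0 = 0) {x y : ℂ}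
    (hx : x ≠ 0) (hy : y ≠ 0) : f x * g y = f y * g x := by
  have h1 : ∀ n : ℤ, n = 0 ∨ n = 1 → ∀ x, x ≠ 0 →
      laurentCoeff f n * g x - laurentCoeff g n * f x = 0 := fun n hn x hx => by
    have hm : laurentCoeff f n • g + (-laurentCoeff g n) • f ∈ thetaSpace q q⁻¹ :=
      (thetaSpace q q⁻¹).add_mem ((thetaSpace q q⁻¹).smul_mem _ hg)
        ((thetaSpace q q⁻¹).smul_mem _ hf)
    have := eq_zero_of_mem_thetaSpace hq0 (inv_ne_zero hq0) hm
      (by rw [laurentCoeff_lin hg.1 hf.1]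
          rcases hn with rfl | rfl
          · ring
          · linear_combination -h)
      (by rw [laurentCoeff_lin hg.1 hf.1]
          rcases hn with rfl | rfl
          · linear_combination h
          · ring) hx
    simp only [Pi.add_apply, Pi.smul_apply, smul_eq_mul] at this
    linear_combination this
  by_cases hz : laurentCoeff f 0 = 0 ∧ laurentCoeff f 1 = 0
  · rw [eq_zero_of_mem_thetaSpace hq0 (inv_ne_zero hq0) hf hz.1 hz.2 hx,
      eq_zero_of_mem_thetaSpace hq0 (inv_ne_zero hq0) hf hz.1 hz.2 hy]
    ring
  · obtain ⟨n, hn, hne⟩ : ∃ n : ℤ, (n = 0 ∨ n = 1) ∧ laurentCoeff f n ≠ 0 := by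
      by_contra! hcon
      exact hz ⟨hcon 0 (Or.inl rfl), hcon 1 (Or.inr rfl)⟩
    refine mul_left_cancel₀ hne ?_
    linear_combination f x * h1 n hn y hy - f y * h1 n hn x hx

variable (hq : ‖q‖ < 1)
include hq

theorem thetaPair_mem {y : ℂ} (hy : y ≠ 0) : (fun x => thetaPair q x y) ∈ thetaSpace q q⁻¹ := by
  refine ⟨fun z hz => ?_, fun z hz => ?_⟩
  · have h1 : DifferentiableAt ℂ (fun x => theta q (x * y)) z :=
      DifferentiableAt.fun_comp' z (differentiableAt_theta hq (mul_ne_zero hz hy))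
        (differentiableAt_id.mul_const y)
    have h2 : DifferentiableAt ℂ (fun x => theta q (x / y)) z :=
      DifferentiableAt.fun_comp' z (differentiableAt_theta hq (div_ne_zero hz hy))
        (differentiableAt_id.div_const y)
    exact ((differentiableAt_inv hz).fun_mul h1).fun_mul h2
  · simp only [thetaPair]
    rw [show q * z * y = z * y * q by ring, show q * z / y = z / y * q by ring,
      theta_mul_q hq0 hq (mul_ne_zero hz hy), theta_mul_q hq0 hq (div_ne_zero hz hy)]
    field_simp

theorem thetaPair_swap {x y : ℂ} (hx : x ≠ 0) (hy : y ≠ 0) :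
    thetaPair q y x = -thetaPair q x y := by
  rw [thetaPair, thetaPair, ← inv_div y x, theta_inv hq0 hq (div_ne_zero hy hx), mul_comm y x]
  field_simp

theorem thetaPair_self (x : ℂ) (hx : x ≠ 0) : thetaPair q x x = 0 := by
  have h := thetaPair_swap hq0 hq hx hx
  linear_combination h / 2

/-- The three-term relation for theta functions. -/
theorem thetaPair_three_term {x y u v : ℂ} (hx : x ≠ 0) (hy : y ≠ 0) (hu : u ≠ 0) (hv : v ≠ 0) :
    thetaPair q x y * thetaPair q u v - thetaPair q x u * thetaPair q y v +
      thetaPair q x v * thetaPair q y u = 0 := by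
  have my := thetaPair_mem hq0 hq hy
  have mu := thetaPair_mem hq0 hq hu
  have mv := thetaPair_mem hq0 hq hv
  have k := fun {z : ℂ} (hz : z ≠ 0) => thetaSpace_det hq0 my mu mv hz
  set D := laurentCoeff (fun x => thetaPair q x u) 0 * laurentCoeff (fun x => thetaPair q x v) 1 -
    laurentCoeff (fun x => thetaPair q x u) 1 * laurentCoeff (fun x => thetaPair q x v) 0 with hD
  -- At `u` and at `v` one of the three terms vanishes. These two relations eliminate the other
  -- unknown minors from the relation at `x`, leaving a multiple of `D`.
  have kx := k hx
  have ku := k hu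
  have kv := k hv
  simp only [thetaPair_self hq0 hq u hu] at ku
  simp only [thetaPair_self hq0 hq v hv] at kv
  rw [thetaPair_swap hq0 hq hy hu] at ku
  rw [thetaPair_swap hq0 hq hy hv, thetaPair_swap hq0 hq hu hv] at kv
  -- If `D = 0`, the functions with parameters `u` and `v` are proportional; comparing at `u` and
  -- `v` forces the pair `(u, v)` to give zero, and comparing at `x` and `y` gives the rest.
  by_cases h : D = 0
  · have p := thetaSpace_proportional hq0 mu mv h hx hy
    have p' := thetaSpace_proportional hq0 mu mv h hv hu
    simp only [thetaPair_self hq0 hq u hu, thetaPair_self hq0 hq v hv,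
      thetaPair_swap hq0 hq hu hv] at p p'
    have : thetaPair q u v = 0 := by
      have : thetaPair q u v * thetaPair q u v = 0 := by linear_combination -p'
      simpa using this
    rw [this]
    linear_combination -p
  · refine (mul_eq_zero.1 (?_ : D * _ = 0)).resolve_left h
    linear_combination thetaPair q u v * kx + thetaPair q x u * kv - thetaPair q x v * ku

/-- The three-term relation at `(r y, u₁/r, r u₃, y/r)` with `r² = u₁ u₂`. The left side is what
appears when an integrand is added to its image under `y ↦ 1/y`. -/
theorem theta_quartic {u₁ u₂ u₃ y : ℂ} (h₁ : u₁ ≠ 0) (h₂ : u₂ ≠ 0) (h₃ : u₃ ≠ 0) (hy : y ≠ 0) :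
    theta q (u₁ * u₂ * u₃ / y) * (theta q (u₁ * y) * theta q (u₂ * y) * theta q (u₃ * y)) -
      y ^ 2 * theta q (u₁ * u₂ * u₃ * y) * (theta q (u₁ / y) * theta q (u₂ / y) * theta q (u₃ / y))
      = theta q (y ^ 2) * (theta q (u₁ * u₂) * theta q (u₁ * u₃) * theta q (u₂ * u₃)) := by
  obtain ⟨r, hr⟩ := IsAlgClosed.exists_pow_nat_eq (u₁ * u₂) two_pos
  replace hr := hr.symm
  have hr0 : r ≠ 0 := fun h => mul_ne_zero h₁ h₂ (by rw [hr, h]; simp)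
  have hu₂ : u₂ = r ^ 2 / u₁ := by rw [← hr]; field_simp
  have key := thetaPair_three_term hq0 hq (x := r * y) (y := u₁ / r) (u := r * u₃) (v := y / r)
    (by positivity) (by positivity) (by positivity) (by positivity)
  simp only [thetaPair] at key
  have i₁ : theta q (r * y * (u₁ / r)) = theta q (u₁ * y) := by congr 1; field_simp
  have i₂ : theta q (r * y / (u₁ / r)) = theta q (u₂ * y) := by rw [hu₂]; congr 1; field_simp
  have i₃ : theta q (r * u₃ * (y / r)) = theta q (u₃ * y) := by congr 1; field_simp
  have i₄ : theta q (r * u₃ / (y / r)) = theta q (u₁ * u₂ * u₃ / y) := by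
    rw [hr]; congr 1; field_simp
  have i₅ : theta q (r * y * (r * u₃)) = theta q (u₁ * u₂ * u₃ * y) := by
    rw [hr]; congr 1; ring
  have i₆ : theta q (r * y / (r * u₃)) = -(u₃ / y)⁻¹ * theta q (u₃ / y) := by
    rw [← theta_inv hq0 hq (by positivity)]; congr 1; field_simp
  have i₇ : theta q (u₁ / r * (y / r)) = -(u₂ / y)⁻¹ * theta q (u₂ / y) := by
    rw [← theta_inv hq0 hq (by positivity), hu₂]; congr 1; field_simp
  have i₈ : theta q (u₁ / r / (y / r)) = theta q (u₁ / y) := by congr 1; field_simp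
  have i₉ : theta q (r * y * (y / r)) = theta q (y ^ 2) := by congr 1; field_simp
  have i₁₀ : theta q (r * y / (y / r)) = theta q (u₁ * u₂) := by rw [hr]; congr 1; field_simp
  have i₁₁ : theta q (u₁ / r * (r * u₃)) = theta q (u₁ * u₃) := by congr 1; field_simp
  have i₁₂ : theta q (u₁ / r / (r * u₃)) = -(u₂ * u₃)⁻¹ * theta q (u₂ * u₃) := by
    rw [← theta_inv hq0 hq (by positivity), hu₂]; congr 1; field_simp
  rw [i₁, i₂, i₃, i₄, i₅, i₆, i₇, i₈, i₉, i₁₀, i₁₁, i₁₂] at key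
  have e : (u₁ / r)⁻¹ = u₂ / r := by rw [hu₂]; field_simp
  rw [e] at key
  clear i₁ i₂ i₃ i₄ i₅ i₆ i₇ i₈ i₉ i₁₀ i₁₁ i₁₂ e
  generalize theta q (u₁ * u₂ * u₃ / y) = a0 at key ⊢
  generalize theta q (u₁ * y) = a1 at key ⊢
  generalize theta q (u₂ * y) = a2 at key ⊢
  generalize theta q (u₃ * y) = a3 at key ⊢
  generalize theta q (u₁ * u₂ * u₃ * y) = a4 at key ⊢
  generalize theta q (u₁ / y) = a5 at key ⊢
  generalize theta q (u₂ / y) = a6 at key ⊢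
  generalize theta q (u₃ / y) = a7 at key ⊢
  generalize theta q (y ^ 2) = a8 at key ⊢
  generalize theta q (u₁ * u₂) = a9 at key ⊢
  generalize theta q (u₁ * u₃) = a10 at key ⊢
  generalize theta q (u₂ * u₃) = a11 at key ⊢
  have key' := congrArg (fun w => r ^ 2 * y * u₃ * w) key
  simp only [mul_zero] at key'
  field_simp at key'
  linear_combination key'

/-- The three-term relation at `(z/r, r/μ, T/r, r/ν)` with `r² = T t`. The dependence on `z` on the
right side is `θ(z/T) θ(t/z)`, which vanishes at the inner poles `T qⁿ`, `t qⁿ` of the integrand. -/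
theorem theta_interchange {T t μ ν z : ℂ} (hT : T ≠ 0) (ht : t ≠ 0) (hμ : μ ≠ 0) (hν : ν ≠ 0)
    (hz : z ≠ 0) :
    theta q (T * t / (μ * z)) * theta q (z / μ) * (theta q (T / ν) * theta q (t / ν)) -
      theta q (T * t / (ν * z)) * theta q (z / ν) * (theta q (T / μ) * theta q (t / μ)) =
    -(T / ν) * theta q (T * t / (μ * ν)) * theta q (ν / μ) * (theta q (z / T) * theta q (t / z)) := by
  obtain ⟨r, hr⟩ := IsAlgClosed.exists_pow_nat_eq (T * t) two_pos
  replace hr := hr.symm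
  have hr0 : r ≠ 0 := fun h => mul_ne_zero hT ht (by rw [hr, h]; simp)
  have hu : t = r ^ 2 / T := by rw [← hr]; field_simp
  have key := thetaPair_three_term hq0 hq (x := z / r) (y := r / μ) (u := T / r) (v := r / ν)
    (by positivity) (by positivity) (by positivity) (by positivity)
  simp only [thetaPair] at key
  have i₁ : theta q (z / r * (r / μ)) = theta q (z / μ) := by congr 1; field_simp
  have i₂ : theta q (z / r / (r / μ)) = -(T * t / (μ * z))⁻¹ * theta q (T * t / (μ * z)) := by
    rw [← theta_inv hq0 hq (by positivity), hr]; congr 1; field_simp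
  have i₃ : theta q (T / r * (r / ν)) = theta q (T / ν) := by congr 1; field_simp
  have i₄ : theta q (T / r / (r / ν)) = -(t / ν)⁻¹ * theta q (t / ν) := by
    rw [← theta_inv hq0 hq (by positivity), hu]; congr 1; field_simp
  have i₅ : theta q (z / r * (T / r)) = -(t / z)⁻¹ * theta q (t / z) := by
    rw [← theta_inv hq0 hq (by positivity), hu]; congr 1; field_simp
  have i₆ : theta q (z / r / (T / r)) = theta q (z / T) := by congr 1; field_simp
  have i₇ : theta q (r / μ * (r / ν)) = theta q (T * t / (μ * ν)) := by
    rw [hr]; congr 1; field_simp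
  have i₈ : theta q (r / μ / (r / ν)) = theta q (ν / μ) := by congr 1; field_simp
  have i₉ : theta q (z / r * (r / ν)) = theta q (z / ν) := by congr 1; field_simp
  have i₁₀ : theta q (z / r / (r / ν)) = -(T * t / (ν * z))⁻¹ * theta q (T * t / (ν * z)) := by
    rw [← theta_inv hq0 hq (by positivity), hr]; congr 1; field_simp
  have i₁₁ : theta q (r / μ * (T / r)) = theta q (T / μ) := by congr 1; field_simp
  have i₁₂ : theta q (r / μ / (T / r)) = theta q (t / μ) := by rw [hu]; congr 1; field_simp
  rw [i₁, i₂, i₃, i₄, i₅, i₆, i₇, i₈, i₉, i₁₀, i₁₁, i₁₂] at key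
  clear i₁ i₂ i₃ i₄ i₅ i₆ i₇ i₈ i₉ i₁₀ i₁₁ i₁₂
  generalize theta q (T * t / (μ * z)) = a0 at key ⊢
  generalize theta q (z / μ) = a1 at key ⊢
  generalize theta q (T / ν) = a2 at key ⊢
  generalize theta q (t / ν) = a3 at key ⊢
  generalize theta q (T * t / (ν * z)) = a4 at key ⊢
  generalize theta q (z / ν) = a5 at key ⊢
  generalize theta q (T / μ) = a6 at key ⊢
  generalize theta q (t / μ) = a7 at key ⊢
  generalize theta q (T * t / (μ * ν)) = a8 at key ⊢
  generalize theta q (ν / μ) = a9 at key ⊢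
  generalize theta q (z / T) = a10 at key ⊢
  generalize theta q (t / z) = a11 at key ⊢
  have key' := congrArg (fun w => T * t / (μ * ν) * w) key
  simp only [mul_zero] at key'
  field_simp at key' ⊢
  refine mul_left_cancel₀ (mul_ne_zero hT ht) ?_
  linear_combination key' + ν * a1 * a0 * a2 * a3 * hr

end

end TrigHyp
end

noncomputable section
namespace TrigHyp

/-! ### The Nassrallah–Rahman integral -/

/-- The mean of `f` over the circle with centre `0` through `b`. -/
def circleMean (f : ℂ → ℂ) (b : ℂ) : ℂ := ∫ x in (0 : ℝ)..1, f (circ 0 b x)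

theorem circ_zero_ne_zero {b : ℂ} (hb : b ≠ 0) (x : ℝ) : circ 0 b x ≠ 0 :=
  norm_pos_iff.1 (by rw [norm_circ_zero]; exact norm_pos_iff.2 hb)

theorem contourIntegral_div_circ (f : ℂ → ℂ) {b : ℂ} (hb : b ≠ 0) :
    contourIntegral (fun z => f z / z) (circ 0 b) = circleMean f b := by
  rw [contourIntegral_circ_zero]
  exact intervalIntegral.integral_congr fun x _ => div_mul_cancel₀ _ (circ_zero_ne_zero hb x)

theorem circleMean_congr {f g : ℂ → ℂ} {b : ℂ} (h : ∀ z, ‖z‖ = ‖b‖ → f z = g z) :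
    circleMean f b = circleMean g b :=
  intervalIntegral.integral_congr fun x _ => h _ (norm_circ_zero b x)

theorem circleMean_const_mul (f : ℂ → ℂ) (a b : ℂ) :
    circleMean (fun z => a * f z) b = a * circleMean f b :=
  intervalIntegral.integral_const_mul _ _

theorem circleMean_lin {f g : ℂ → ℂ} {b : ℂ} (u v : ℂ) (hf : ∀ z, ‖z‖ = ‖b‖ → ContinuousAt f z)
    (hg : ∀ z, ‖z‖ = ‖b‖ → ContinuousAt g z) :
    circleMean (fun z => u * f z + v * g z) b = u * circleMean f b + v * circleMean g b := by
  have hi : ∀ {f : ℂ → ℂ}, (∀ z, ‖z‖ = ‖b‖ → ContinuousAt f z) → Continuous fun x =>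
      f (circ 0 b x) := fun hf => continuous_iff_continuousAt.2 fun x =>
    (hf _ (norm_circ_zero b x)).comp (contDiff_circ 0 b).continuous.continuousAt
  rw [circleMean, intervalIntegral.integral_add
    ((hi hf).const_mul u |>.intervalIntegrable _ _) ((hi hg).const_mul v |>.intervalIntegrable _ _),
    intervalIntegral.integral_const_mul, intervalIntegral.integral_const_mul]
  rfl

theorem circleMean_mul (f : ℂ → ℂ) (a b : ℂ) :
    circleMean f (a * b) = circleMean (fun z => f (a * z)) b := by
  refine intervalIntegral.integral_congr fun x _ => ?_
  simp only [circ, sub_zero, zero_add, mul_assoc]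

theorem circleMean_zpow {n : ℤ} (hn : n ≠ 0) : circleMean (fun z => z ^ n) 1 = 0 := by
  have : ∀ x : ℝ, circ 0 1 x ^ n = Complex.exp ((2 * Real.pi * Complex.I * n) * x) := fun x => by
    rw [circ, zero_add, sub_zero, one_mul, ← Complex.exp_int_mul]
    congr 1
    ring
  have hc : (2 * Real.pi * Complex.I * n : ℂ) ≠ 0 :=
    mul_ne_zero Complex.two_pi_I_ne_zero (by exact_mod_cast hn)
  simp only [circleMean, this]
  rw [integral_exp_mul_complex hc]
  have : Complex.exp (2 * Real.pi * Complex.I * n * (1 : ℝ)) = 1 := by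
    rw [Complex.ofReal_one, mul_one, mul_comm]
    exact Complex.exp_int_mul_two_pi_mul_I n
  rw [this]
  simp

/-- The integrand of the Nassrallah–Rahman integral. -/
def nrIntegrand (q a b c d e z : ℂ) : ℂ :=
  qPoch q (z ^ 2) * qPoch q ((z ^ 2)⁻¹) * (qPoch q (a * b * c * d * e * z) *
    qPoch q (a * b * c * d * e / z)) /
  ((qPoch q (a / z) * qPoch q (b / z) * qPoch q (c / z) * qPoch q (d / z) * qPoch q (e / z)) *
    (qPoch q (a * z) * qPoch q (b * z) * qPoch q (c * z) * qPoch q (d * z) * qPoch q (e * z)))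

/-- The integral is evaluated as a constant times `nrQuads / nrPairs`. -/
def nrPairs (q a b c d e : ℂ) : ℂ :=
  qPoch q (a * b) * qPoch q (a * c) * qPoch q (a * d) * qPoch q (a * e) * qPoch q (b * c) *
    qPoch q (b * d) * qPoch q (b * e) * qPoch q (c * d) * qPoch q (c * e) * qPoch q (d * e)

def nrQuads (q a b c d e : ℂ) : ℂ :=
  qPoch q (b * c * d * e) * qPoch q (a * c * d * e) * qPoch q (a * b * d * e) *
    qPoch q (a * b * c * e) * qPoch q (a * b * c * d)

/-- The normalized Nassrallah–Rahman integral. -/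
def nrNormalized (q a b c d e : ℂ) : ℂ :=
  circleMean (nrIntegrand q a b c d e) 1 * nrPairs q a b c d e / nrQuads q a b c d e

/-- All ingredients are symmetric; a cyclic shift is enough to bring each parameter in turn to the
first place. -/
theorem nrNormalized_rotate (q a b c d e : ℂ) :
    nrNormalized q a b c d e = nrNormalized q b c d e a := by
  have h1 : nrIntegrand q a b c d e = nrIntegrand q b c d e a := by
    funext z
    rw [nrIntegrand, nrIntegrand, show a * b * c * d * e = b * c * d * e * a by ring]
    congr 1
    ring
  have h2 : nrPairs q a b c d e = nrPairs q b c d e a := by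
    simp only [nrPairs, mul_comm _ a]; ring
  have h3 : nrQuads q a b c d e = nrQuads q b c d e a := by
    simp only [nrQuads]
    rw [show a * c * d * e = c * d * e * a by ring, show a * b * d * e = b * d * e * a by ring,
      show a * b * c * e = b * c * e * a by ring, show a * b * c * d = b * c * d * a by ring]
    ring
  rw [nrNormalized, nrNormalized, h1, h2, h3]

/-- The rational certificate behind the shift `a ↦ aq`: it is what remains of the telescoping
identity after removal of the common infinite products. -/
theorem nr_polynomial_identity {a b c d e z : ℂ} (hz : z ≠ 0) :
    -(a * (1 - a * (a * b * c * d * e))) * (z⁻¹ * (1 - (z ^ 2)⁻¹) * (1 - a * b * c * d * e / z) *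
        ((1 - a * z) * (1 - b * z) * (1 - c * z) * (1 - d * z) * (1 - e * z)) +
      z * (1 - z ^ 2) * (1 - a * b * c * d * e * z) *
        ((1 - a / z) * (1 - b / z) * (1 - c / z) * (1 - d / z) * (1 - e / z))) =
    (1 - z ^ 2) * (1 - (z ^ 2)⁻¹) *
      ((1 - a * c * d * e) * (1 - a * b * d * e) * (1 - a * b * c * e) * (1 - a * b * c * d) *
        ((1 - a * z) * (1 - a / z)) -
      (1 - a * b) * (1 - a * c) * (1 - a * d) * (1 - a * e) *
        ((1 - a * b * c * d * e * z) * (1 - a * b * c * d * e / z))) := by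
  field_simp
  ring

section

variable {q : ℂ} (hq : ‖q‖ < 1)
include hq

/-- Multiplying the factors of `a` and `-a` doubles the base to `q²`; the even and odd factors then
reassemble. With the parameters `±√q`, `±q` this makes the integrand elementary. -/
theorem qPoch_mul_neg_mul {r : ℂ} (hr : r ^ 2 = q) (z : ℂ) :
    qPoch q (r * z) * qPoch q (-r * z) * qPoch q (q * z) * qPoch q (-q * z) =
      qPoch q (q * z ^ 2) := by
  have hsq : ∀ a : ℂ, qPoch q a * qPoch q (-a) = qPoch (q ^ 2) (a ^ 2) := fun a => by
    rw [qPoch, qPoch, ← (multipliable_qPoch hq a).tprod_mul (multipliable_qPoch hq (-a)), qPoch]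
    refine tprod_congr fun n => ?_
    ring
  have hq2 : ‖q ^ 2‖ < 1 := by
    rw [norm_pow]; exact pow_lt_one₀ (norm_nonneg _) hq two_ne_zero
  have hs : qPoch (q ^ 2) (q * z ^ 2) * qPoch (q ^ 2) (q ^ 2 * z ^ 2) = qPoch q (q * z ^ 2) := by
    have h1 : ∀ n : ℕ, 1 - q * z ^ 2 * (q ^ 2) ^ n = 1 - q * z ^ 2 * q ^ (2 * n) := fun n => by
      rw [pow_mul]
    have h2 : ∀ n : ℕ, 1 - q ^ 2 * z ^ 2 * (q ^ 2) ^ n = 1 - q * z ^ 2 * q ^ (2 * n + 1) :=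
      fun n => by rw [← pow_mul]; ring
    have m1 := multipliable_qPoch hq2 (q * z ^ 2)
    have m2 := multipliable_qPoch hq2 (q ^ 2 * z ^ 2)
    simp only [h1] at m1
    simp only [h2] at m2
    rw [qPoch, qPoch, tprod_congr h1, tprod_congr h2, qPoch]
    exact tprod_even_mul_odd (f := fun n => 1 - q * z ^ 2 * q ^ n) m1 m2
  rw [← hs]
  have e1 := hsq (r * z)
  have e2 := hsq (q * z)
  rw [show (r * z) ^ 2 = q * z ^ 2 by rw [mul_pow, hr], ← neg_mul] at e1
  rw [mul_pow, ← neg_mul] at e2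
  rw [← e1, ← e2]
  ring

theorem nrQuads_ne_zero {a b c d e : ℂ} (ha : ‖a‖ < 1) (hb : ‖b‖ < 1) (hc : ‖c‖ < 1)
    (hd : ‖d‖ < 1) (he : ‖e‖ < 1) : nrQuads q a b c d e ≠ 0 := by
  have h4 : ∀ {a b c d : ℂ}, ‖a‖ < 1 → ‖b‖ < 1 → ‖c‖ < 1 → ‖d‖ < 1 →
      qPoch q (a * b * c * d) ≠ 0 := fun ha hb hc hd => qPoch_ne_zero_of_norm_lt hq (by
    simp only [norm_mul]
    exact mul_lt_one_of_nonneg_of_lt_one_right (mul_le_one₀ (mul_le_one₀ ha.le (norm_nonneg _) hb.le)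
      (norm_nonneg _) hc.le) (norm_nonneg _) hd)
  exact mul_ne_zero (mul_ne_zero (mul_ne_zero (mul_ne_zero (h4 hb hc hd he) (h4 ha hc hd he))
    (h4 ha hb hd he)) (h4 ha hb hc he)) (h4 ha hb hc hd)

theorem nrPairs_ne_zero {a b c d e : ℂ} (ha : ‖a‖ < 1) (hb : ‖b‖ < 1) (hc : ‖c‖ < 1)
    (hd : ‖d‖ < 1) (he : ‖e‖ < 1) : nrPairs q a b c d e ≠ 0 := by
  have h2 : ∀ {a b : ℂ}, ‖a‖ < 1 → ‖b‖ < 1 → qPoch q (a * b) ≠ 0 := fun ha hb =>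
    qPoch_ne_zero_of_norm_lt hq (by
      rw [norm_mul]; exact mul_lt_one_of_nonneg_of_lt_one_right ha.le (norm_nonneg _) hb)
  simp only [nrPairs, mul_ne_zero_iff]
  exact ⟨⟨⟨⟨⟨⟨⟨⟨⟨h2 ha hb, h2 ha hc⟩, h2 ha hd⟩, h2 ha he⟩, h2 hb hc⟩, h2 hb hd⟩, h2 hb he⟩,
    h2 hc hd⟩, h2 hc he⟩, h2 hd he⟩

theorem continuousAt_nrIntegrand {a b c d e z : ℂ} (ha : ‖a‖ < 1) (hb : ‖b‖ < 1) (hc : ‖c‖ < 1)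
    (hd : ‖d‖ < 1) (he : ‖e‖ < 1) (hz : ‖z‖ = 1) : ContinuousAt (nrIntegrand q a b c d e) z := by
  have hz0 : z ≠ 0 := norm_pos_iff.1 (by rw [hz]; exact one_pos)
  have hQ := continuous_qPoch hq
  have h1 : ∀ a : ℂ, ContinuousAt (fun z => qPoch q (a / z)) z := fun a =>
    hQ.continuousAt.comp' (f := fun z => a / z) (by fun_prop (disch := assumption))
  have h2 : ∀ a : ℂ, ContinuousAt (fun z => qPoch q (a * z)) z := fun a =>
    hQ.continuousAt.comp' (f := fun z => a * z) (by fun_prop)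
  have h3 : ContinuousAt (fun z => qPoch q (z ^ 2)) z :=
    hQ.continuousAt.comp' (f := fun z => z ^ 2) (by fun_prop)
  have h4 : ContinuousAt (fun z => qPoch q ((z ^ 2)⁻¹)) z :=
    hQ.continuousAt.comp' (f := fun z => (z ^ 2)⁻¹)
      ((continuousAt_id.pow 2).inv₀ (pow_ne_zero 2 hz0))
  have n1 : ∀ {a : ℂ}, ‖a‖ < 1 → qPoch q (a / z) ≠ 0 := fun ha =>
    qPoch_ne_zero_of_norm_lt hq (by rwa [norm_div, hz, div_one])
  have n2 : ∀ {a : ℂ}, ‖a‖ < 1 → qPoch q (a * z) ≠ 0 := fun ha =>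
    qPoch_ne_zero_of_norm_lt hq (by rwa [norm_mul, hz, mul_one])
  refine ((h3.mul h4).mul ((h2 _).mul (h1 _))).div
    (((((h1 a).mul (h1 b)).mul (h1 c)).mul (h1 d)).mul (h1 e) |>.mul
      (((((h2 a).mul (h2 b)).mul (h2 c)).mul (h2 d)).mul (h2 e))) ?_
  exact mul_ne_zero (mul_ne_zero (mul_ne_zero (mul_ne_zero (mul_ne_zero (n1 ha) (n1 hb)) (n1 hc))
    (n1 hd)) (n1 he)) (mul_ne_zero (mul_ne_zero (mul_ne_zero (mul_ne_zero (n2 ha) (n2 hb)) (n2 hc))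
    (n2 hd)) (n2 he))

theorem continuousAt_circleMean_nrIntegrand {b c d e : ℂ} (hb : ‖b‖ < 1) (hc : ‖c‖ < 1)
    (hd : ‖d‖ < 1) (he : ‖e‖ < 1) :
    ContinuousAt (fun a => circleMean (nrIntegrand q a b c d e) 1) 0 := by
  have hn : ∀ z : ℂ, ‖z‖ = ‖(1 : ℂ)‖ → z ≠ 0 := fun z hz =>
    norm_pos_iff.1 (by rw [hz, norm_one]; exact one_pos)
  have := analyticAt_contourIntegral_circ hq (I := (Finset.univ : Finset (Fin 5)))
    (J := (Finset.univ : Finset (Fin 5))) (a := fun i a => ![a, b, c, d, e] i)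
    (b := fun i a => ![a, b, c, d, e] i) (H := fun y : ℂ × ℂ => qPoch q (y.2 ^ 2) *
      qPoch q ((y.2 ^ 2)⁻¹) * (qPoch q (y.1 * b * c * d * e * y.2) *
        qPoch q (y.1 * b * c * d * e / y.2)) / y.2) (τ := 0) (r := 1)
    (fun i _ => by fin_cases i <;> first | exact analyticAt_const | exact analyticAt_id)
    (fun i _ => by fin_cases i <;> first | exact analyticAt_const | exact analyticAt_id) one_ne_zero
    (fun z hz => by
      have hs : AnalyticAt ℂ (fun y : ℂ × ℂ => y.2) ((0 : ℂ), z) := analyticAt_snd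
      have hf : AnalyticAt ℂ (fun y : ℂ × ℂ => y.1 * b * c * d * e) ((0 : ℂ), z) :=
        (((analyticAt_fst.mul analyticAt_const).mul analyticAt_const).mul
          analyticAt_const).mul analyticAt_const
      exact (((((hs.pow 2).qPoch hq).mul (((hs.pow 2).inv (pow_ne_zero 2 (hn z hz))).qPoch hq)).mul
        (((hf.mul hs).qPoch hq).mul ((hf.div hs (hn z hz)).qPoch hq)))).div hs (hn z hz))
    (fun i _ => by fin_cases i <;> simp [hb, hc, hd, he])
    (fun i _ => by fin_cases i <;> simp [hb, hc, hd, he])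
  refine this.continuousAt.congr (Eventually.of_forall fun a => ?_)
  beta_reduce
  rw [← contourIntegral_div_circ _ one_ne_zero]
  refine congrArg (fun f => contourIntegral f (circ 0 1)) (funext fun z => ?_)
  simp [Fin.prod_univ_five, nrIntegrand]
  ring

variable (hq0 : q ≠ 0)
include hq0

set_option maxHeartbeats 1000000 in
-- The difference of the two integrands is a multiple of `ψ(z) - ψ(z/q)`. Since `ψ` has no poles for
-- `1 ≤ |z| ≤ 1/|q|`, its means over the two boundary circles agree and the difference integrates to
-- zero.
theorem circleMean_nrIntegrand_step {a b c d e : ℂ} (ha : ‖a‖ < 1) (hb : ‖b‖ < 1) (hc : ‖c‖ < 1)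
    (hd : ‖d‖ < 1) (he : ‖e‖ < 1) (ha0 : a ≠ 0) (hb0 : b ≠ 0) (hc0 : c ≠ 0) (hd0 : d ≠ 0)
    (he0 : e ≠ 0) :
    (1 - a * b) * (1 - a * c) * (1 - a * d) * (1 - a * e) *
        circleMean (nrIntegrand q a b c d e) 1 =
      (1 - a * c * d * e) * (1 - a * b * d * e) * (1 - a * b * c * e) * (1 - a * b * c * d) *
        circleMean (nrIntegrand q (a * q) b c d e) 1 := by
  obtain ⟨A, hA⟩ : ∃ A, A = a * b * c * d * e := ⟨_, rfl⟩
  have hQ := differentiable_qPoch hq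
  set H : ℂ → ℂ := fun z => z⁻¹ * (qPoch q (z ^ 2 * q) * qPoch q ((z ^ 2)⁻¹) *
    (qPoch q (A * z * q) * qPoch q (A / z))) with hH
  have hHd : ∀ z, z ≠ 0 → DifferentiableAt ℂ H z := fun z hz => by
    have hi : DifferentiableAt ℂ (fun z : ℂ => z⁻¹) z := differentiableAt_inv hz
    have hi2 : DifferentiableAt ℂ (fun z : ℂ => (z ^ 2)⁻¹) z :=
      (differentiableAt_id.pow 2).inv (pow_ne_zero 2 hz)
    have hAz : DifferentiableAt ℂ (fun z : ℂ => A / z) z :=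
      (differentiableAt_const A).div differentiableAt_id hz
    exact hi.fun_mul (((DifferentiableAt.fun_comp' z (hQ _) (by fun_prop)).fun_mul
      (DifferentiableAt.fun_comp' z (hQ _) hi2)).fun_mul
      ((DifferentiableAt.fun_comp' z (hQ _) (by fun_prop)).fun_mul
      (DifferentiableAt.fun_comp' z (hQ _) hAz)))
  -- The parameters of the second product carry an extra `q`, so its zeros lie beyond `|z| = 1/|q|`;
  -- the zeros of the first lie inside the unit circle.
  set ψ : ℂ → ℂ := fun z => H z /
    ((∏ i, qPoch q (![a, b, c, d, e] i / z)) * ∏ i, qPoch q (![a, b, c, d, e] i * q * z)) with hψ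
  have hn : ∀ i, ‖![a, b, c, d, e] i‖ < 1 := fun i => by fin_cases i <;> simpa
  have h0 : ∀ i, ![a, b, c, d, e] i ≠ 0 := fun i => by fin_cases i <;> simpa
  have hsep : ∀ r : ℂ, 1 ≤ ‖r‖ → ‖q‖ * ‖r‖ ≤ 1 → Separates q (Finset.univ : Finset (Fin 5))
      (Finset.univ : Finset (Fin 5)) ![a, b, c, d, e] (fun i => ![a, b, c, d, e] i * q)
      (circ 0 r) := fun r h1 h2 => by
    refine separates_circ hq0 hq (norm_pos_iff.1 (by linarith)) (fun i _ => mul_ne_zero (h0 i) hq0)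
      (fun i _ => (hn i).trans_le h1) (fun i _ => ?_)
    rw [norm_mul, mul_assoc]
    exact (mul_le_of_le_one_right (norm_nonneg _) h2).trans_lt (hn i)
  have hψc : ∀ z, 1 ≤ ‖z‖ → ‖q‖ * ‖z‖ ≤ 1 → ContinuousAt ψ z := fun z h1 h2 => by
    have hz : z ≠ 0 := norm_pos_iff.1 (by linarith)
    refine (hHd z hz).continuousAt.div ((tendsto_finsetProd _ fun i _ => ?_).mul
      (tendsto_finsetProd _ fun k _ => ?_)) ?_
    · exact hQ.continuous.continuousAt.comp' (f := fun z => ![a, b, c, d, e] i / z)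
        (continuousAt_const.div continuousAt_id hz)
    · exact hQ.continuous.continuousAt.comp' (f := fun z => ![a, b, c, d, e] k * q * z)
        (continuousAt_const.mul continuousAt_id)
    · refine mul_ne_zero (Finset.prod_ne_zero_iff.2 fun i hi => qPoch_ne_zero_of_norm_lt hq ?_)
        (Finset.prod_ne_zero_iff.2 fun k hk => qPoch_ne_zero_of_norm_lt hq ?_)
      · rw [norm_div, div_lt_one (by linarith)]
        exact (hn i).trans_le h1
      · rw [norm_mul, norm_mul, mul_assoc]
        exact (mul_le_of_le_one_right (norm_nonneg _) h2).trans_lt (hn k)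
  have hq' : ‖q⁻¹ * 1‖ = ‖q‖⁻¹ := by rw [mul_one, norm_inv]
  have hr1 : 1 ≤ ‖q‖⁻¹ := (one_le_inv₀ (norm_pos_iff.2 hq0)).2 hq.le
  have hr2 : ‖q‖ * ‖q‖⁻¹ ≤ 1 := (mul_inv_cancel₀ (norm_ne_zero_iff.2 hq0)).le
  have hψm : circleMean ψ 1 = circleMean (fun z => ψ (q⁻¹ * z)) 1 := by
    rw [← circleMean_mul, ← contourIntegral_div_circ _ one_ne_zero, ← contourIntegral_div_circ _
      (mul_ne_zero (inv_ne_zero hq0) one_ne_zero)]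
    have := Separates.contourIntegral_eq hq0 hq (I := (Finset.univ : Finset (Fin 5)))
      (J := (Finset.univ : Finset (Fin 5))) (α := ![a, b, c, d, e])
      (β := fun i => ![a, b, c, d, e] i * q) (fun i _ => mul_ne_zero (h0 i) hq0)
      (H := fun z => H z / z) (fun z hz => (hHd z hz).div differentiableAt_id hz)
      (hsep 1 (by simp) (by simpa using hq.le)) (hsep (q⁻¹ * 1) (by rwa [hq']) (by rwa [hq']))
    simp only [div_right_comm _ _ (_ * _)] at this
    exact this
  have key : ∀ z, ‖z‖ = ‖(1 : ℂ)‖ →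
      (1 - a * b) * (1 - a * c) * (1 - a * d) * (1 - a * e) * nrIntegrand q a b c d e z =
      1 * ((1 - a * c * d * e) * (1 - a * b * d * e) * (1 - a * b * c * e) * (1 - a * b * c * d) *
        nrIntegrand q (a * q) b c d e z) +
        a * (1 - a * A) * (1 * ψ z + (-1) * ψ (q⁻¹ * z)) := fun z hz => by
    rw [norm_one] at hz
    have hz0 : z ≠ 0 := norm_pos_iff.1 (by rw [hz]; exact one_pos)
    have n1 : ∀ {t : ℂ}, ‖t‖ < 1 → qPoch q (t / z) ≠ 0 := fun ht =>
      qPoch_ne_zero_of_norm_lt hq (by rwa [norm_div, hz, div_one])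
    have n2 : ∀ {t : ℂ}, ‖t‖ < 1 → qPoch q (t * z) ≠ 0 := fun ht =>
      qPoch_ne_zero_of_norm_lt hq (by rwa [norm_mul, hz, mul_one])
    have pol := nr_polynomial_identity (a := a) (b := b) (c := c) (d := d) (e := e) hz0
    have s1 := qPoch_succ hq (z ^ 2)
    have s2 := qPoch_succ hq ((z ^ 2)⁻¹)
    have s3 := qPoch_succ hq (z ^ 2 / q)
    have s4 := qPoch_succ hq ((z ^ 2)⁻¹ * q)
    have s5 := qPoch_succ hq (A * z)
    have s6 := qPoch_succ hq (A / z)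
    rw [div_mul_cancel₀ _ hq0] at s3
    simp only [hψ, hH, nrIntegrand, Fin.prod_univ_five, Matrix.cons_val]
    rw [← hA, show a * q * b * c * d * e = A * q by rw [hA]; ring,
      show A * q * z = A * z * q by ring, show A * q / z = A / z * q by ring]
    have g1 : ∀ t : ℂ, t * q * z = t * z * q := fun t => by ring
    have g2 : ∀ t : ℂ, t * q / z = t / z * q := fun t => by ring
    have g3 : ∀ t : ℂ, t / (q⁻¹ * z) = t / z * q := fun t => by field_simp
    have g4 : ∀ t : ℂ, t * q * (q⁻¹ * z) = t * z := fun t => by field_simp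
    have g5 : (q⁻¹ * z) ^ 2 * q = z ^ 2 / q := by field_simp
    have g6 : ((q⁻¹ * z) ^ 2)⁻¹ = (z ^ 2)⁻¹ * q * q := by field_simp
    have g7 : A * (q⁻¹ * z) * q = A * z := by field_simp
    have g8 : (q⁻¹ * z)⁻¹ = z⁻¹ * q := by field_simp
    simp only [g3, g4, g5, g6, g7, g8, g1, g2]
    rw [← hA] at pol
    have u1 := n1 ha
    have u2 := n1 hb
    have u3 := n1 hc
    have u4 := n1 hd
    have u5 := n1 he
    have v1 := n2 ha
    have v2 := n2 hb
    have v3 := n2 hc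
    have v4 := n2 hd
    have v5 := n2 he
    rw [qPoch_succ hq (a / z)] at u1 ⊢
    rw [qPoch_succ hq (b / z)] at u2 ⊢
    rw [qPoch_succ hq (c / z)] at u3 ⊢
    rw [qPoch_succ hq (d / z)] at u4 ⊢
    rw [qPoch_succ hq (e / z)] at u5 ⊢
    rw [qPoch_succ hq (a * z)] at v1 ⊢
    rw [qPoch_succ hq (b * z)] at v2 ⊢
    rw [qPoch_succ hq (c * z)] at v3 ⊢
    rw [qPoch_succ hq (d * z)] at v4 ⊢
    rw [qPoch_succ hq (e * z)] at v5 ⊢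
    rw [s3, s5, s6, s2, s1, s4]
    have g9 : 1 - z ^ 2 / q = -(z ^ 2 / q) * (1 - (z ^ 2)⁻¹ * q) := by field_simp; ring
    rw [g9]
    clear_value ψ H
    clear s1 s2 s3 s4 s5 s6 g1 g2 g3 g4 g5 g6 g7 g8 g9 n1 n2 hψm hψc hsep hHd hψ hH
    generalize qPoch q (a / z * q) = Ua at *
    generalize qPoch q (b / z * q) = Ub at *
    generalize qPoch q (c / z * q) = Uc at *
    generalize qPoch q (d / z * q) = Ud at *
    generalize qPoch q (e / z * q) = Ue at *
    generalize qPoch q (a * z * q) = Va at *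
    generalize qPoch q (b * z * q) = Vb at *
    generalize qPoch q (c * z * q) = Vc at *
    generalize qPoch q (d * z * q) = Vd at *
    generalize qPoch q (e * z * q) = Ve at *
    generalize qPoch q (A * z * q) = P₃ at *
    generalize qPoch q (A / z * q) = P₄ at *
    generalize qPoch q (z ^ 2 * q) = P₁ at *
    generalize qPoch q ((z ^ 2)⁻¹ * q * q) = P₂ at *
    generalize 1 - a / z = xa at *
    generalize 1 - b / z = xb at *
    generalize 1 - c / z = xc at *
    generalize 1 - d / z = xd at *
    generalize 1 - e / z = xe at *
    generalize 1 - a * z = ya at *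
    generalize 1 - b * z = yb at *
    generalize 1 - c * z = yc at *
    generalize 1 - d * z = yd at *
    generalize 1 - e * z = ye at *
    generalize 1 - A * z = yA at *
    generalize 1 - A / z = xA at *
    generalize 1 - (z ^ 2)⁻¹ * q = s at *
    generalize 1 - (z ^ 2)⁻¹ = r at *
    simp only [mul_ne_zero_iff] at u1 u2 u3 u4 u5 v1 v2 v3 v4 v5
    obtain ⟨u1, u1'⟩ := u1
    obtain ⟨u2, u2'⟩ := u2
    obtain ⟨u3, u3'⟩ := u3
    obtain ⟨u4, u4'⟩ := u4
    obtain ⟨u5, u5'⟩ := u5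
    obtain ⟨v1, v1'⟩ := v1
    obtain ⟨v2, v2'⟩ := v2
    obtain ⟨v3, v3'⟩ := v3
    obtain ⟨v4, v4'⟩ := v4
    obtain ⟨v5, v5'⟩ := v5
    generalize hp : 1 - z ^ 2 = p at *
    -- `D` is the common factor of all four terms, so the claim becomes `D` times the polynomial
    -- identity.
    obtain ⟨D, hD⟩ : ∃ D, D = P₁ * s * P₂ * P₃ * P₄ /
      ((xa * Ua * (xb * Ub) * (xc * Uc) * (xd * Ud) * (xe * Ue)) *
      (ya * Va * (yb * Vb) * (yc * Vc) * (yd * Vd) * (ye * Ve))) := ⟨_, rfl⟩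
    trans (1 - a * b) * (1 - a * c) * (1 - a * d) * (1 - a * e) * (p * r * (yA * xA) * D)
    · rw [hD]; ring
    trans 1 * ((1 - a * c * d * e) * (1 - a * b * d * e) * (1 - a * b * c * e) *
      (1 - a * b * c * d) * (p * r * (xa * ya) * D)) + a * (1 - a * A) * (1 *
      (z⁻¹ * r * xA * (ya * yb * yc * yd * ye) * D) + (-1) *
      (-(z * p * yA * (xa * xb * xc * xd * xe)) * D))
    · linear_combination D * pol
    · congr 1
      · congr 2
        rw [hD]; field_simp
      · congr 3
        · rw [hD]; field_simp
        · rw [hD]; field_simp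
  have hκ : ∀ z, ‖z‖ = ‖(1 : ℂ)‖ → ContinuousAt (fun z => ψ (q⁻¹ * z)) z := fun z hz =>
    ContinuousAt.comp' (g := ψ) (f := fun z => q⁻¹ * z) (hψc _ (by simpa [hz] using hr1)
      (by simpa [hz] using hr2)) (by fun_prop)
  have hψ1 : ∀ z, ‖z‖ = ‖(1 : ℂ)‖ → ContinuousAt ψ z := fun z hz =>
    hψc z (by simp [hz]) (by simpa [hz] using hq.le)
  have haq : ‖a * q‖ < 1 := by
    rw [norm_mul]; exact mul_lt_one_of_nonneg_of_lt_one_right ha.le (norm_nonneg _) hq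
  rw [← circleMean_const_mul, circleMean_congr key, circleMean_lin _ _
    (fun z hz => (continuousAt_nrIntegrand hq haq hb hc hd he (by simpa using hz)).const_mul _)
    (fun z hz => ((hψ1 z hz).const_mul 1).fun_add ((hκ z hz).const_mul (-1))),
    circleMean_lin _ _ hψ1 hκ, ← hψm, circleMean_const_mul]
  ring

theorem nrNormalized_mul_q {a b c d e : ℂ} (ha : ‖a‖ < 1) (hb : ‖b‖ < 1) (hc : ‖c‖ < 1)
    (hd : ‖d‖ < 1) (he : ‖e‖ < 1) (ha0 : a ≠ 0) (hb0 : b ≠ 0) (hc0 : c ≠ 0) (hd0 : d ≠ 0)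
    (he0 : e ≠ 0) : nrNormalized q (a * q) b c d e = nrNormalized q a b c d e := by
  have haq : ‖a * q‖ < 1 := by
    rw [norm_mul]; exact mul_lt_one_of_nonneg_of_lt_one_right ha.le (norm_nonneg _) hq
  have step := circleMean_nrIntegrand_step hq hq0 ha hb hc hd he ha0 hb0 hc0 hd0 he0
  have n1 := nrQuads_ne_zero hq ha hb hc hd he
  have n2 := nrQuads_ne_zero hq haq hb hc hd he
  rw [nrNormalized, nrNormalized, div_eq_div_iff n2 n1]
  simp only [nrPairs, nrQuads, mul_right_comm a q, mul_right_comm (a * b) q,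
    mul_right_comm (a * c) q, mul_right_comm (a * b * c) q, mul_right_comm (a * b * d) q,
    mul_right_comm (a * c * d) q]
  rw [qPoch_succ hq (a * b), qPoch_succ hq (a * c), qPoch_succ hq (a * d), qPoch_succ hq (a * e),
    qPoch_succ hq (a * c * d * e), qPoch_succ hq (a * b * d * e), qPoch_succ hq (a * b * c * e),
    qPoch_succ hq (a * b * c * d)]
  generalize circleMean (nrIntegrand q (a * q) b c d e) 1 = I' at *
  generalize circleMean (nrIntegrand q a b c d e) 1 = I at *
  generalize qPoch q (a * b * q) = p1 at *
  generalize qPoch q (a * c * q) = p2 at *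
  generalize qPoch q (a * d * q) = p3 at *
  generalize qPoch q (a * e * q) = p4 at *
  generalize qPoch q (a * c * d * e * q) = p5 at *
  generalize qPoch q (a * b * d * e * q) = p6 at *
  generalize qPoch q (a * b * c * e * q) = p7 at *
  generalize qPoch q (a * b * c * d * q) = p8 at *
  generalize qPoch q (b * c) = r1 at *
  generalize qPoch q (b * d) = r2 at *
  generalize qPoch q (b * e) = r3 at *
  generalize qPoch q (c * d) = r4 at *
  generalize qPoch q (c * e) = r5 at *
  generalize qPoch q (d * e) = r6 at *
  generalize qPoch q (b * c * d * e) = r7 at *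
  linear_combination -(p1 * p2 * p3 * p4 * r1 * r2 * r3 * r4 * r5 * r6 * r7 * p5 * p6 * p7 * p8)
    * step

omit hq0 in
theorem continuousAt_nrNormalized {b c d e : ℂ} (hb : ‖b‖ < 1) (hc : ‖c‖ < 1)
    (hd : ‖d‖ < 1) (he : ‖e‖ < 1) : ContinuousAt (fun a => nrNormalized q a b c d e) 0 := by
  have hQ := continuous_qPoch hq
  refine ((continuousAt_circleMean_nrIntegrand hq hb hc hd he).mul ?_).div ?_
    (nrQuads_ne_zero hq (by simp) hb hc hd he)
  · unfold nrPairs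
    exact Continuous.continuousAt (by fun_prop)
  · unfold nrQuads
    exact Continuous.continuousAt (by fun_prop)

/-- The value is constant along `a qⁿ`, which tends to `0`, and it is continuous at `a = 0`. -/
theorem nrNormalized_eq_zero_left {a b c d e : ℂ} (ha : ‖a‖ < 1) (hb : ‖b‖ < 1) (hc : ‖c‖ < 1)
    (hd : ‖d‖ < 1) (he : ‖e‖ < 1) (ha0 : a ≠ 0) (hb0 : b ≠ 0) (hc0 : c ≠ 0) (hd0 : d ≠ 0)
    (he0 : e ≠ 0) : nrNormalized q a b c d e = nrNormalized q 0 b c d e := by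
  have hn : ∀ n : ℕ, ‖a * q ^ n‖ < 1 := fun n => by
    rw [norm_mul, norm_pow]
    exact (mul_le_of_le_one_right (norm_nonneg _) (pow_le_one₀ (norm_nonneg _) hq.le)).trans_lt ha
  have h : ∀ n : ℕ, nrNormalized q (a * q ^ n) b c d e = nrNormalized q a b c d e := fun n => by
    induction n with
    | zero => simp
    | succ n ih =>
      rw [pow_succ, ← mul_assoc, nrNormalized_mul_q hq hq0 (hn n) hb hc hd he
        (mul_ne_zero ha0 (pow_ne_zero n hq0)) hb0 hc0 hd0 he0, ih]
  have ht : Tendsto (fun n : ℕ => a * q ^ n) atTop (𝓝 0) := by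
    simpa using (tendsto_pow_atTop_nhds_zero_of_norm_lt_one hq).const_mul a
  have := (continuousAt_nrNormalized hq hb hc hd he).tendsto.comp ht
  exact tendsto_nhds_unique (by simp only [Function.comp_def, h]; exact tendsto_const_nhds) this

theorem nrNormalized_eq_left {a a' b c d e : ℂ} (ha : ‖a‖ < 1) (ha' : ‖a'‖ < 1) (hb : ‖b‖ < 1)
    (hc : ‖c‖ < 1) (hd : ‖d‖ < 1) (he : ‖e‖ < 1) (ha0 : a ≠ 0) (ha0' : a' ≠ 0) (hb0 : b ≠ 0)
    (hc0 : c ≠ 0) (hd0 : d ≠ 0) (he0 : e ≠ 0) :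
    nrNormalized q a b c d e = nrNormalized q a' b c d e := by
  rw [nrNormalized_eq_zero_left hq hq0 ha hb hc hd he ha0 hb0 hc0 hd0 he0,
    nrNormalized_eq_zero_left hq hq0 ha' hb hc hd he ha0' hb0 hc0 hd0 he0]

/-- The Nassrallah–Rahman integral evaluation, up to the value of a nonzero constant depending
only on `q`. -/
theorem exists_circleMean_nrIntegrand_eq : ∃ K : ℂ, K ≠ 0 ∧ ∀ a b c d e : ℂ, ‖a‖ < 1 → ‖b‖ < 1 →
    ‖c‖ < 1 → ‖d‖ < 1 → ‖e‖ < 1 → a ≠ 0 → b ≠ 0 → c ≠ 0 → d ≠ 0 → e ≠ 0 →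
    circleMean (nrIntegrand q a b c d e) 1 * nrPairs q a b c d e = K * nrQuads q a b c d e := by
  obtain ⟨r, hr⟩ := IsAlgClosed.exists_pow_nat_eq q two_pos
  have hr0 : r ≠ 0 := fun h => hq0 (by rw [← hr, h]; simp)
  have hr1 : ‖r‖ < 1 := by
    rw [← hr, norm_pow] at hq
    exact (pow_lt_one_iff_of_nonneg (norm_nonneg _) two_ne_zero).1 hq
  have hrn : ‖-r‖ < 1 := by rwa [norm_neg]
  have hqn : ‖-q‖ < 1 := by rwa [norm_neg]
  -- At these parameters `qPoch_mul_neg_mul` reduces the integrand to `(1 - z²)(1 - z⁻²) = 2 - z² -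
  -- z⁻²`, whose mean is `2`.
  refine ⟨nrNormalized q 0 r (-r) q (-q), ?_, fun a b c d e ha hb hc hd he ha0 hb0 hc0 hd0 he0 => ?_⟩
  · have h0 : ‖(0 : ℂ)‖ < 1 := by simp
    refine div_ne_zero (mul_ne_zero ?_ (nrPairs_ne_zero hq h0 hr1 hrn hq hqn))
      (nrQuads_ne_zero hq h0 hr1 hrn hq hqn)
    have : ∀ z, ‖z‖ = ‖(1 : ℂ)‖ → nrIntegrand q 0 r (-r) q (-q) z =
        1 * (2 * z ^ (0 : ℤ) + (-1) * z ^ (2 : ℤ)) + (-1) * z ^ (-2 : ℤ) := fun z hz => by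
      rw [norm_one] at hz
      have hz0 : z ≠ 0 := norm_pos_iff.1 (by rw [hz]; exact one_pos)
      have e1 := qPoch_mul_neg_mul hq hr z
      have e2 := qPoch_mul_neg_mul hq hr z⁻¹
      have n1 : qPoch q (q * z ^ 2) ≠ 0 := qPoch_ne_zero_of_norm_lt hq (by simpa [hz])
      have n2 : qPoch q (q * z⁻¹ ^ 2) ≠ 0 := qPoch_ne_zero_of_norm_lt hq (by simpa [hz])
      have s1 := qPoch_succ hq (z ^ 2)
      have s2 := qPoch_succ hq (z⁻¹ ^ 2)
      rw [mul_comm _ q] at s1 s2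
      simp only [nrIntegrand, zero_mul, qPoch_zero, one_mul, mul_one, div_eq_mul_inv _ z]
      rw [e1, e2, ← inv_pow, s1, s2, zpow_zero, zpow_neg, zpow_ofNat]
      generalize qPoch q (q * z ^ 2) = X at *
      generalize qPoch q (q * z⁻¹ ^ 2) = Y at *
      field_simp
      ring
    rw [circleMean_congr this]
    have hc : ∀ n : ℤ, ∀ z, ‖z‖ = ‖(1 : ℂ)‖ → ContinuousAt (fun z : ℂ => z ^ n) z := fun n z hz =>
      continuousAt_zpow₀ _ _ (Or.inl (norm_pos_iff.1 (by rw [hz]; simp)))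
    rw [circleMean_lin _ _ (fun z hz => ((hc 0 z hz).const_mul 2).fun_add
      ((hc 2 z hz).const_mul (-1))) (hc (-2)), circleMean_lin _ _ (hc 0) (hc 2),
      circleMean_zpow (n := 2) (by norm_num), circleMean_zpow (n := -2) (by norm_num)]
    simp [circleMean]
  -- The special parameters are exchanged for `a, …, e` one at a time, with a rotation after each
  -- exchange. The entry `0` is first turned into `r`, because `nrNormalized_eq_left` exchanges
  -- nonzero parameters only.
  · rw [← nrNormalized_eq_zero_left hq hq0 hr1 hr1 hrn hq hqn hr0 hr0 (neg_ne_zero.2 hr0) hq0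
      (neg_ne_zero.2 hq0), ← nrNormalized_eq_left hq hq0 ha hr1 hr1 hrn hq hqn ha0 hr0 hr0
      (neg_ne_zero.2 hr0) hq0 (neg_ne_zero.2 hq0), nrNormalized_rotate,
      ← nrNormalized_eq_left hq hq0 hb hr1 hrn hq hqn ha hb0 hr0 (neg_ne_zero.2 hr0) hq0
      (neg_ne_zero.2 hq0) ha0, nrNormalized_rotate,
      ← nrNormalized_eq_left hq hq0 hc hrn hq hqn ha hb hc0 (neg_ne_zero.2 hr0) hq0
      (neg_ne_zero.2 hq0) ha0 hb0, nrNormalized_rotate,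
      ← nrNormalized_eq_left hq hq0 hd hq hqn ha hb hc hd0 hq0 (neg_ne_zero.2 hq0) ha0 hb0 hc0,
      nrNormalized_rotate,
      ← nrNormalized_eq_left hq hq0 he hqn ha hb hc hd he0 (neg_ne_zero.2 hq0) ha0 hb0 hc0 hd0,
      nrNormalized_rotate, nrNormalized, div_mul_cancel₀ _ (nrQuads_ne_zero hq ha hb hc hd he)]

end

end TrigHyp
end

noncomputable section
namespace TrigHyp

/-! ### The transformation of the symmetric integral on the unit circle -/

theorem circleMean_swap {F : ℂ → ℂ → ℂ} {r r' : ℂ}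
    (hF : ∀ x z, ‖x‖ = ‖r‖ → ‖z‖ = ‖r'‖ → ContinuousAt (fun y : ℂ × ℂ => F y.1 y.2) (x, z)) :
    circleMean (fun x => circleMean (fun z => F x z) r') r =
      circleMean (fun z => circleMean (fun x => F x z) r) r' := by
  have hc : Continuous fun y : ℝ × ℝ => F (circ 0 r y.1) (circ 0 r' y.2) :=
    continuous_iff_continuousAt.2 fun y => ContinuousAt.comp' (g := fun y : ℂ × ℂ => F y.1 y.2)
      (f := fun y : ℝ × ℝ => (circ 0 r y.1, circ 0 r' y.2))
      (hF _ _ (norm_circ_zero _ _) (norm_circ_zero _ _))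
      (((contDiff_circ 0 r).continuous.comp continuous_fst).prodMk
        ((contDiff_circ 0 r').continuous.comp continuous_snd)).continuousAt
  simp only [circleMean, intervalIntegral.integral_of_le zero_le_one]
  refine MeasureTheory.integral_integral_swap
    (f := fun x z => F (circ 0 r x) (circ 0 r' z)) ?_
  rw [MeasureTheory.Measure.prod_restrict]
  exact (hc.continuousOn.integrableOn_compact (isCompact_Icc.prod isCompact_Icc)).mono_set
    (Set.prod_mono Set.Ioc_subset_Icc_self Set.Ioc_subset_Icc_self)

/-- The function `(z^{±2}, P z^{±1}, Q z^{±1}) / ∏ (m z^{±1})`, the product being over six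
parameters. -/
def symIntegrand (q P Q a b c d e f z : ℂ) : ℂ :=
  qPoch q (z ^ 2) * qPoch q ((z ^ 2)⁻¹) * (qPoch q (P * z) * qPoch q (P / z)) *
    (qPoch q (Q * z) * qPoch q (Q / z)) /
  ((qPoch q (a / z) * qPoch q (b / z) * qPoch q (c / z) * qPoch q (d / z) * qPoch q (e / z) *
      qPoch q (f / z)) *
    (qPoch q (a * z) * qPoch q (b * z) * qPoch q (c * z) * qPoch q (d * z) * qPoch q (e * z) *
      qPoch q (f * z)))

/-- The factor of the double integrand which depends on a single variable. -/
def symFactor (q Q d e f z : ℂ) : ℂ :=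
  qPoch q (z ^ 2) * qPoch q ((z ^ 2)⁻¹) * (qPoch q (Q * z) * qPoch q (Q / z)) /
  ((qPoch q (d / z) * qPoch q (e / z) * qPoch q (f / z)) *
    (qPoch q (d * z) * qPoch q (e * z) * qPoch q (f * z)))

/-- The constant relating the inner integral to `symIntegrand`. -/
def symConst (q s a b c : ℂ) : ℂ :=
  qPoch q (s ^ 2 * a * b) * qPoch q (s ^ 2 * a * c) * qPoch q (s ^ 2 * b * c) /
    (qPoch q (a * b) * qPoch q (a * c) * qPoch q (b * c) * qPoch q (s ^ 2))

/-- The symmetry of the double integrand under exchange of `(a, b, c, x)` and `(d, e, f, z)`. The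
products coupling `x` and `z` are `(s x^{±1} z^{±1})`, and `s z · s/z = s²` makes the numerators
match. -/
theorem symFactor_mul_nrIntegrand {q s a b c d e f x z : ℂ} (hx : x ≠ 0) (hz : z ≠ 0) :
    symFactor q (s ^ 2 * d * e * f) d e f z * nrIntegrand q a b c (s * z) (s / z) x =
      symFactor q (s ^ 2 * a * b * c) a b c x * nrIntegrand q d e f (s * x) (s / x) z := by
  simp only [symFactor, nrIntegrand]
  rw [show a * b * c * (s * z) * (s / z) = s ^ 2 * a * b * c by field_simp,
    show d * e * f * (s * x) * (s / x) = s ^ 2 * d * e * f by field_simp,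
    show s * z / x = s / x * z by ring, show s / z / x = s / x / z by ring,
    show s / z * x = s * x / z by ring, show s * z * x = s * x * z by ring]
  simp only [div_mul_div_comm]
  congr 1 <;> ring

section

variable {q : ℂ} (hq : ‖q‖ < 1)
include hq

theorem continuousAt_nrIntegrand_comp {X : Type*} [TopologicalSpace X] {a b c d e z : X → ℂ}
    {x : X} (ca : ContinuousAt a x) (cb : ContinuousAt b x) (cc : ContinuousAt c x)
    (cd : ContinuousAt d x) (ce : ContinuousAt e x) (cz : ContinuousAt z x) (ha : ‖a x‖ < 1)
    (hb : ‖b x‖ < 1) (hc : ‖c x‖ < 1) (hd : ‖d x‖ < 1) (he : ‖e x‖ < 1) (hz : ‖z x‖ = 1) :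
    ContinuousAt (fun y => nrIntegrand q (a y) (b y) (c y) (d y) (e y) (z y)) x := by
  have hz0 : z x ≠ 0 := norm_pos_iff.1 (by rw [hz]; exact one_pos)
  have hQ : ∀ {f : X → ℂ}, ContinuousAt f x → ContinuousAt (fun y => qPoch q (f y)) x := fun hf =>
    ContinuousAt.comp' (continuous_qPoch hq).continuousAt hf
  have hA := (((ca.mul cb).mul cc).mul cd).mul ce
  have n1 : ∀ {a : ℂ}, ‖a‖ < 1 → qPoch q (a / z x) ≠ 0 := fun ha =>
    qPoch_ne_zero_of_norm_lt hq (by rwa [norm_div, hz, div_one])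
  have n2 : ∀ {a : ℂ}, ‖a‖ < 1 → qPoch q (a * z x) ≠ 0 := fun ha =>
    qPoch_ne_zero_of_norm_lt hq (by rwa [norm_mul, hz, mul_one])
  refine (((hQ (cz.pow 2)).mul (hQ ((cz.pow 2).inv₀ (pow_ne_zero 2 hz0)))).mul
    ((hQ (hA.mul cz)).mul (hQ (hA.div cz hz0)))).div
    ((((((hQ (ca.div cz hz0)).mul (hQ (cb.div cz hz0))).mul (hQ (cc.div cz hz0))).mul
      (hQ (cd.div cz hz0))).mul (hQ (ce.div cz hz0))).mul
    (((((hQ (ca.mul cz)).mul (hQ (cb.mul cz))).mul (hQ (cc.mul cz))).mul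
      (hQ (cd.mul cz))).mul (hQ (ce.mul cz)))) ?_
  exact mul_ne_zero (mul_ne_zero (mul_ne_zero (mul_ne_zero (mul_ne_zero (n1 ha) (n1 hb)) (n1 hc))
    (n1 hd)) (n1 he)) (mul_ne_zero (mul_ne_zero (mul_ne_zero (mul_ne_zero (n2 ha) (n2 hb)) (n2 hc))
    (n2 hd)) (n2 he))

theorem continuousAt_symFactor {Q d e f z : ℂ} (hd : ‖d‖ < 1) (he : ‖e‖ < 1) (hf : ‖f‖ < 1)
    (hz : ‖z‖ = 1) : ContinuousAt (symFactor q Q d e f) z := by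
  have hz0 : z ≠ 0 := norm_pos_iff.1 (by rw [hz]; exact one_pos)
  have hQ : ∀ {f : ℂ → ℂ}, ContinuousAt f z → ContinuousAt (fun y => qPoch q (f y)) z := fun hf =>
    ContinuousAt.comp' (continuous_qPoch hq).continuousAt hf
  have n1 : ∀ {a : ℂ}, ‖a‖ < 1 → qPoch q (a / z) ≠ 0 := fun ha =>
    qPoch_ne_zero_of_norm_lt hq (by rwa [norm_div, hz, div_one])
  have n2 : ∀ {a : ℂ}, ‖a‖ < 1 → qPoch q (a * z) ≠ 0 := fun ha =>
    qPoch_ne_zero_of_norm_lt hq (by rwa [norm_mul, hz, mul_one])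
  have c1 : ∀ a : ℂ, ContinuousAt (fun y => qPoch q (a * y)) z := fun a =>
    hQ (continuousAt_const.mul continuousAt_id)
  have c2 : ∀ a : ℂ, ContinuousAt (fun y => qPoch q (a / y)) z := fun a =>
    hQ (continuousAt_const.div continuousAt_id hz0)
  refine (((hQ (continuousAt_id.pow 2)).mul (hQ ((continuousAt_id.pow 2).inv₀
    (pow_ne_zero 2 hz0)))).mul ((c1 Q).mul (c2 Q))).div ((((c2 d).mul (c2 e)).mul (c2 f)).mul
    (((c1 d).mul (c1 e)).mul (c1 f))) ?_
  exact mul_ne_zero (mul_ne_zero (mul_ne_zero (n1 hd) (n1 he)) (n1 hf))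
    (mul_ne_zero (mul_ne_zero (n2 hd) (n2 he)) (n2 hf))

/-- The evaluation of the inner integral. -/
theorem symFactor_mul_circleMean {K : ℂ} (hK : ∀ a b c d e : ℂ, ‖a‖ < 1 → ‖b‖ < 1 →
    ‖c‖ < 1 → ‖d‖ < 1 → ‖e‖ < 1 → a ≠ 0 → b ≠ 0 → c ≠ 0 → d ≠ 0 → e ≠ 0 →
    circleMean (nrIntegrand q a b c d e) 1 * nrPairs q a b c d e = K * nrQuads q a b c d e)
    {s a b c z : ℂ} (Q d e f : ℂ) (hs : ‖s‖ < 1) (ha : ‖a‖ < 1) (hb : ‖b‖ < 1) (hc : ‖c‖ < 1)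
    (hs0 : s ≠ 0) (ha0 : a ≠ 0) (hb0 : b ≠ 0) (hc0 : c ≠ 0) (hz : ‖z‖ = 1) :
    symFactor q Q d e f z * circleMean (nrIntegrand q a b c (s * z) (s / z)) 1 =
      K * symConst q s a b c * symIntegrand q (s * a * b * c) Q (s * a) (s * b) (s * c) d e f z := by
  have hz0 : z ≠ 0 := norm_pos_iff.1 (by rw [hz]; exact one_pos)
  have n1 : ‖s * z‖ < 1 := by rwa [norm_mul, hz, mul_one]
  have n2 : ‖s / z‖ < 1 := by rwa [norm_div, hz, div_one]
  have h := hK a b c (s * z) (s / z) ha hb hc n1 n2 ha0 hb0 hc0 (mul_ne_zero hs0 hz0)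
    (div_ne_zero hs0 hz0)
  have hp := nrPairs_ne_zero hq ha hb hc n1 n2
  rw [eq_div_of_mul_eq hp h, symConst, symIntegrand, symFactor]
  simp only [nrPairs, nrQuads]
  rw [show b * c * (s * z) * (s / z) = s ^ 2 * b * c by field_simp,
    show a * c * (s * z) * (s / z) = s ^ 2 * a * c by field_simp,
    show a * b * (s * z) * (s / z) = s ^ 2 * a * b by field_simp,
    show a * b * c * (s / z) = s * a * b * c / z by ring,
    show a * b * c * (s * z) = s * a * b * c * z by ring,
    show a * (s * z) = s * a * z by ring, show b * (s * z) = s * b * z by ring,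
    show c * (s * z) = s * c * z by ring, show a * (s / z) = s * a / z by ring,
    show b * (s / z) = s * b / z by ring, show c * (s / z) = s * c / z by ring,
    show s * z * (s / z) = s ^ 2 by field_simp]
  rw [div_mul_div_comm, ← mul_div_assoc K, div_mul_div_comm]
  congr 1 <;> ring

/-- Integrate the double integrand over one variable and then the other, in both orders. The
constant `K` occurs on both sides and cancels. -/
theorem symConst_mul_circleMean_symIntegrand (hq0 : q ≠ 0) {s a b c d e f : ℂ} (hs : ‖s‖ < 1)
    (ha : ‖a‖ < 1) (hb : ‖b‖ < 1) (hc : ‖c‖ < 1) (hd : ‖d‖ < 1) (he : ‖e‖ < 1) (hf : ‖f‖ < 1)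
    (hs0 : s ≠ 0) (ha0 : a ≠ 0) (hb0 : b ≠ 0) (hc0 : c ≠ 0) (hd0 : d ≠ 0) (he0 : e ≠ 0)
    (hf0 : f ≠ 0) :
    symConst q s a b c * circleMean (symIntegrand q (s * a * b * c) (s ^ 2 * d * e * f)
      (s * a) (s * b) (s * c) d e f) 1 =
    symConst q s d e f * circleMean (symIntegrand q (s * d * e * f) (s ^ 2 * a * b * c)
      (s * d) (s * e) (s * f) a b c) 1 := by
  obtain ⟨K, hK0, hK⟩ := exists_circleMean_nrIntegrand_eq hq hq0
  have side : ∀ {a b c d e f : ℂ}, ‖a‖ < 1 → ‖b‖ < 1 → ‖c‖ < 1 → a ≠ 0 → b ≠ 0 → c ≠ 0 →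
      K * (symConst q s a b c * circleMean (symIntegrand q (s * a * b * c) (s ^ 2 * d * e * f)
        (s * a) (s * b) (s * c) d e f) 1) = circleMean (fun z => circleMean (fun x =>
          symFactor q (s ^ 2 * d * e * f) d e f z * nrIntegrand q a b c (s * z) (s / z) x) 1) 1 :=
    fun {a b c d e f} ha hb hc ha0 hb0 hc0 => by
      rw [← mul_assoc, ← circleMean_const_mul]
      refine circleMean_congr fun z hz => ?_
      rw [circleMean_const_mul, symFactor_mul_circleMean hq hK _ _ _ _ hs ha hb hc hs0 ha0 hb0 hc0
        (by simpa using hz)]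
  refine mul_left_cancel₀ hK0 ?_
  rw [side ha hb hc ha0 hb0 hc0, side hd he hf hd0 he0 hf0, circleMean_swap]
  · refine circleMean_congr fun x hx => circleMean_congr fun z hz => ?_
    exact symFactor_mul_nrIntegrand (norm_pos_iff.1 (by rw [hx]; simp))
      (norm_pos_iff.1 (by rw [hz]; simp))
  · intro z x hz hx
    rw [norm_one] at hz hx
    have hz0 : z ≠ 0 := norm_pos_iff.1 (by rw [hz]; exact one_pos)
    refine ContinuousAt.mul (ContinuousAt.comp' (continuousAt_symFactor hq hd he hf hz)
      continuousAt_fst) (continuousAt_nrIntegrand_comp hq continuousAt_const continuousAt_const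
        continuousAt_const (continuousAt_const.mul continuousAt_fst)
        (continuousAt_const.div continuousAt_fst hz0) continuousAt_snd ha hb hc ?_ ?_ hx)
    · simpa [hz] using hs
    · simpa [hz] using hs

omit hq in
theorem integrandS_eq_symIntegrand (t : Fin 8 → ℂ) :
    integrandS q t = symIntegrand q (t 0)⁻¹ (t 7)⁻¹ (t 1) (t 2) (t 3) (t 4) (t 5) (t 6) := by
  funext z
  simp only [integrandS, symIntegrand, endIdx, midIdx, div_eq_mul_inv (_ : ℂ) z]
  rw [Finset.prod_pair (by decide), Finset.prod_insert (by decide), Finset.prod_insert (by decide),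
    Finset.prod_insert (by decide), Finset.prod_insert (by decide), Finset.prod_insert (by decide),
    Finset.prod_singleton]
  congr 1 <;> ring

/-- The `w`-symmetry of the integrals `S_t` over the unit circle. -/
theorem circleMean_integrandS_wAct (hq0 : q ≠ 0) {t : Fin 8 → ℂ} (ht : t ∈ paramSpace) {s : ℂ}
    (hs : s ^ 2 * (t 0 * t 1 * t 2 * t 3) = 1) (hs1 : 1 < ‖s‖) (h : ∀ j ∈ midIdx, ‖t j‖ < 1)
    (hw : ∀ j ∈ midIdx, ‖wAct s t j‖ < 1) :
    circleMean (integrandS q t) 1 = circleMean (integrandS q (wAct s t)) 1 *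
        ((qPoch q (1 / (t 0 * t 1)) * qPoch q (1 / (t 0 * t 2)) * qPoch q (1 / (t 0 * t 3)) *
          qPoch q (1 / (t 7 * t 4)) * qPoch q (1 / (t 7 * t 5)) * qPoch q (1 / (t 7 * t 6))) /
        (qPoch q (t 1 * t 2) * qPoch q (t 1 * t 3) * qPoch q (t 2 * t 3) *
          qPoch q (t 4 * t 5) * qPoch q (t 4 * t 6) * qPoch q (t 5 * t 6))) := by
  have ht' : t 0 * t 1 * t 2 * t 3 * t 4 * t 5 * t 6 * t 7 = 1 := by
    have : ∏ j, t j = 1 := ht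
    rwa [Fin.prod_univ_eight] at this
  have h0 : ∀ j, t j ≠ 0 := fun j => by
    have : ∏ j, t j ≠ 0 := by rw [show ∏ j, t j = 1 from ht]; exact one_ne_zero
    exact Finset.prod_ne_zero_iff.1 this j (Finset.mem_univ j)
  have hs0 : s ≠ 0 := norm_pos_iff.1 (one_pos.trans hs1)
  have m : ∀ j ∈ midIdx, ‖t j‖ < 1 ∧ ‖wAct s t j‖ < 1 := fun j hj => ⟨h j hj, hw j hj⟩
  simp only [midIdx, Finset.forall_mem_insert, Finset.mem_singleton, forall_eq] at m
  obtain ⟨⟨m1, w1⟩, ⟨m2, w2⟩, ⟨m3, w3⟩, ⟨m4, w4⟩, ⟨m5, w5⟩, m6, w6⟩ := m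
  have w : ∀ j : Fin 8, wAct s t j = if (j : ℕ) < 4 then s * t j else s⁻¹ * t j := fun _ => rfl
  norm_num [w] at w1 w2 w3 w4 w5 w6
  obtain ⟨σ, hσ⟩ : ∃ σ, σ = s⁻¹ := ⟨_, rfl⟩
  obtain rfl : s = σ⁻¹ := by rw [hσ, inv_inv]
  have hσ0 : σ ≠ 0 := by simpa using hs0
  have hσ1 : ‖σ‖ < 1 := by
    rw [norm_inv] at hs1
    exact (one_lt_inv₀ (norm_pos_iff.2 hσ0)).1 hs1
  clear hσ hs1 hs0 h hw ht
  have p0 : t 0 = (σ * (σ⁻¹ * t 1) * (σ⁻¹ * t 2) * (σ⁻¹ * t 3))⁻¹ := by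
    refine eq_inv_of_mul_eq_one_left ?_
    rw [← hs]
    field_simp
  have p7 : t 7 = (σ ^ 2 * t 4 * t 5 * t 6)⁻¹ := by
    refine eq_inv_of_mul_eq_one_left ?_
    rw [← ht']
    have : t 0 * t 1 * t 2 * t 3 = σ ^ 2 := by field_simp at hs; exact hs
    rw [this]; ring
  -- With `σ = 1/s`, the first triple is taken from `wt` and the second from `t`. Then `σa, σb, σc`
  -- are the entries `1, 2, 3` of `t`, and `σd, σe, σf` are the entries `4, 5, 6` of `wt`.
  have key := symConst_mul_circleMean_symIntegrand hq hq0 (s := σ) (a := σ⁻¹ * t 1)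
    (b := σ⁻¹ * t 2) (c := σ⁻¹ * t 3) (d := t 4) (e := t 5) (f := t 6) hσ1
    (by simpa using w1) (by simpa using w2) (by simpa using w3) m4 m5 m6 hσ0
    (mul_ne_zero (inv_ne_zero hσ0) (h0 1)) (mul_ne_zero (inv_ne_zero hσ0) (h0 2))
    (mul_ne_zero (inv_ne_zero hσ0) (h0 3)) (h0 4) (h0 5) (h0 6)
  have e1 : integrandS q t = symIntegrand q (σ * (σ⁻¹ * t 1) * (σ⁻¹ * t 2) * (σ⁻¹ * t 3))
      (σ ^ 2 * t 4 * t 5 * t 6) (σ * (σ⁻¹ * t 1)) (σ * (σ⁻¹ * t 2)) (σ * (σ⁻¹ * t 3))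
      (t 4) (t 5) (t 6) := by
    rw [integrandS_eq_symIntegrand, mul_inv_cancel_left₀ hσ0, mul_inv_cancel_left₀ hσ0,
      mul_inv_cancel_left₀ hσ0, p0, p7, inv_inv, inv_inv, mul_inv_cancel_left₀ hσ0]
  have e2 : integrandS q (wAct σ⁻¹ t) = symIntegrand q (σ * t 4 * t 5 * t 6)
      (σ ^ 2 * (σ⁻¹ * t 1) * (σ⁻¹ * t 2) * (σ⁻¹ * t 3)) (σ * t 4) (σ * t 5) (σ * t 6)
      (σ⁻¹ * t 1) (σ⁻¹ * t 2) (σ⁻¹ * t 3) := by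
    rw [integrandS_eq_symIntegrand]
    have i0 : (wAct σ⁻¹ t 0)⁻¹ = σ ^ 2 * (σ⁻¹ * t 1) * (σ⁻¹ * t 2) * (σ⁻¹ * t 3) := by
      norm_num [w]; rw [p0, inv_inv]; ring
    have i7 : (wAct σ⁻¹ t 7)⁻¹ = σ * t 4 * t 5 * t 6 := by
      norm_num [w]; rw [p7, inv_inv]; field_simp
    rw [i0, i7]
    norm_num [w]
    funext z
    simp only [symIntegrand]
    congr 1 <;> ring
  rw [← e1, ← e2] at key
  have f1 : (σ⁻¹ * t 1) * (σ⁻¹ * t 2) = 1 / (t 0 * t 3) := by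
    rw [p0]; have := h0 3; have := h0 1; have := h0 2; field_simp
  have f2 : (σ⁻¹ * t 1) * (σ⁻¹ * t 3) = 1 / (t 0 * t 2) := by
    rw [p0]; have := h0 3; have := h0 1; have := h0 2; field_simp
  have f3 : (σ⁻¹ * t 2) * (σ⁻¹ * t 3) = 1 / (t 0 * t 1) := by
    rw [p0]; have := h0 3; have := h0 1; have := h0 2; field_simp
  have g1 : σ ^ 2 * t 4 * t 5 = 1 / (t 7 * t 6) := by
    rw [p7]; have := h0 4; have := h0 5; have := h0 6; field_simp
  have g2 : σ ^ 2 * t 4 * t 6 = 1 / (t 7 * t 5) := by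
    rw [p7]; have := h0 4; have := h0 5; have := h0 6; field_simp
  have g3 : σ ^ 2 * t 5 * t 6 = 1 / (t 7 * t 4) := by
    rw [p7]; have := h0 4; have := h0 5; have := h0 6; field_simp
  have l1 : σ ^ 2 * (σ⁻¹ * t 1) * (σ⁻¹ * t 2) = t 1 * t 2 := by field_simp
  have l2 : σ ^ 2 * (σ⁻¹ * t 1) * (σ⁻¹ * t 3) = t 1 * t 3 := by field_simp
  have l3 : σ ^ 2 * (σ⁻¹ * t 2) * (σ⁻¹ * t 3) = t 2 * t 3 := by field_simp
  have n : ∀ {a b : ℂ}, ‖a‖ < 1 → ‖b‖ < 1 → qPoch q (a * b) ≠ 0 := fun ha hb =>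
    qPoch_ne_zero_of_norm_lt hq (by
      rw [norm_mul]; exact mul_lt_one_of_nonneg_of_lt_one_right ha.le (norm_nonneg _) hb)
  have k1 := n m1 m2
  have k2 := n m1 m3
  have k3 := n m2 m3
  have k4 := n m4 m5
  have k5 := n m4 m6
  have k6 := n m5 m6
  have k7 : qPoch q (σ ^ 2) ≠ 0 := by rw [sq]; exact n hσ1 hσ1
  have k8 : qPoch q (σ⁻¹ * t 1 * (σ⁻¹ * t 2)) ≠ 0 := n (by simpa using w1) (by simpa using w2)
  have k9 : qPoch q (σ⁻¹ * t 1 * (σ⁻¹ * t 3)) ≠ 0 := n (by simpa using w1) (by simpa using w3)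
  have k10 : qPoch q (σ⁻¹ * t 2 * (σ⁻¹ * t 3)) ≠ 0 := n (by simpa using w2) (by simpa using w3)
  simp only [symConst] at key
  rw [l1, l2, l3, g1, g2, g3, f1, f2, f3] at key
  rw [f1] at k8
  rw [f2] at k9
  rw [f3] at k10
  generalize circleMean (integrandS q t) 1 = I₁ at *
  generalize circleMean (integrandS q (wAct σ⁻¹ t)) 1 = I₂ at *
  generalize qPoch q (t 1 * t 2) = a1 at *
  generalize qPoch q (t 1 * t 3) = a2 at *
  generalize qPoch q (t 2 * t 3) = a3 at *
  generalize qPoch q (t 4 * t 5) = a4 at *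
  generalize qPoch q (t 4 * t 6) = a5 at *
  generalize qPoch q (t 5 * t 6) = a6 at *
  generalize qPoch q (1 / (t 0 * t 1)) = b1 at *
  generalize qPoch q (1 / (t 0 * t 2)) = b2 at *
  generalize qPoch q (1 / (t 0 * t 3)) = b3 at *
  generalize qPoch q (1 / (t 7 * t 4)) = b4 at *
  generalize qPoch q (1 / (t 7 * t 5)) = b5 at *
  generalize qPoch q (1 / (t 7 * t 6)) = b6 at *
  generalize qPoch q (σ ^ 2) = r at *
  field_simp at key ⊢
  linear_combination key

end

end TrigHyp
end

noncomputable section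
namespace TrigHyp

/-! ### Independence of the auxiliary parameter -/

/-- The quotient of theta functions in the integrand of `U_t`. -/
def thetaKer (q T t μ z : ℂ) : ℂ :=
  theta q (T * t / (μ * z)) * theta q (z / μ) / (theta q (T / μ) * theta q (t / μ))

theorem Separates.empty_left {ι κ : Type*} {q : ℂ} {I : Finset ι} {J : Finset κ} {α : ι → ℂ}
    {β : κ → ℂ} {γ : ℝ → ℂ} (h : Separates q I J α β γ) : Separates q ∅ J α β γ :=
  ⟨h.curve, h.origin, fun _ hi => absurd hi (Finset.notMem_empty _), h.outside⟩

section

variable {q : ℂ} (hq0 : q ≠ 0) (hq : ‖q‖ < 1)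
include hq

theorem differentiableAt_thetaKer {T t μ z : ℂ} (hT : T ≠ 0) (ht : t ≠ 0) (hμ : μ ≠ 0)
    (hz : z ≠ 0) : DifferentiableAt ℂ (thetaKer q T t μ) z := by
  have h1 : DifferentiableAt ℂ (fun z => theta q (T * t / (μ * z))) z :=
    DifferentiableAt.fun_comp' z
      (differentiableAt_theta hq (div_ne_zero (mul_ne_zero hT ht) (mul_ne_zero hμ hz)))
      ((differentiableAt_const _).fun_div (differentiableAt_id.const_mul μ) (mul_ne_zero hμ hz))
  have h2 : DifferentiableAt ℂ (fun z => theta q (z / μ)) z :=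
    DifferentiableAt.fun_comp' z (differentiableAt_theta hq (div_ne_zero hz hμ))
      (differentiableAt_id.div_const μ)
  exact (h1.fun_mul h2).div_const _

include hq0

/-- There are no inner poles, so the contour shrinks to a small circle bounding a disc on which the
integrand is holomorphic. -/
theorem contourIntegral_eq_zero_of_separates {ι κ : Type*} {J : Finset κ} {α : ι → ℂ} {β : κ → ℂ}
    (hβ : ∀ k ∈ J, β k ≠ 0) {h : ℂ → ℂ} (hh : Differentiable ℂ h) {γ : ℝ → ℂ}
    (hγ : Separates q ∅ J α β γ) :
    contourIntegral (fun z => h z / ∏ k ∈ J, qPoch q (β k * z)) γ = 0 := by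
  obtain ⟨ε, hε, hεb⟩ : ∃ ε : ℝ, 0 < ε ∧ ∀ k ∈ J, ‖β k‖ * ε < 1 := by
    have : ∀ᶠ ε : ℝ in 𝓝[>] 0, ∀ k ∈ J, ‖β k‖ * ε < 1 := by
      rw [Filter.eventually_all_finset]
      intro k _
      have : Tendsto (fun ε : ℝ => ‖β k‖ * ε) (𝓝[>] 0) (𝓝 (‖β k‖ * 0)) :=
        (tendsto_nhdsWithin_of_tendsto_nhds tendsto_id).const_mul _
      exact this.eventually (gt_mem_nhds (by simp))
    exact (this.and self_mem_nhdsWithin).exists.imp fun x hx => ⟨hx.2, hx.1⟩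
  have hε0 : (ε : ℂ) ≠ 0 := by exact_mod_cast hε.ne'
  have hεn : ‖(ε : ℂ)‖ = ε := by simp [abs_of_pos hε]
  have := hγ.contourIntegral_eq hq0 hq hβ (fun z _ => hh z)
    (separates_circ (I := ∅) hq0 hq hε0 hβ (fun i hi => absurd hi (Finset.notMem_empty _))
      (by simpa only [hεn] using hεb))
  simp only [Finset.prod_empty, one_mul] at this
  rw [this, contourIntegral_circ]
  have hd : ∀ w ∈ Metric.closedBall (0 : ℂ) 1, DifferentiableAt ℂ (fun w => ((ε : ℂ) - 0) *
      (h (0 + ((ε : ℂ) - 0) * w) / ∏ k ∈ J, qPoch q (β k * (0 + ((ε : ℂ) - 0) * w)))) w := by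
    intro w hw
    have hw1 : ‖w‖ ≤ 1 := by simpa using hw
    refine (DifferentiableAt.div (DifferentiableAt.fun_comp' w (hh _) (by fun_prop))
      (DifferentiableAt.fun_finsetProd fun k _ => DifferentiableAt.fun_comp' w
        (differentiable_qPoch hq _) (by fun_prop)) ?_).const_mul _
    refine Finset.prod_ne_zero_iff.2 fun k hk => qPoch_ne_zero_of_norm_lt hq ?_
    rw [zero_add, sub_zero, norm_mul, norm_mul, hεn, ← mul_assoc]
    exact (mul_le_of_le_one_right (by positivity) hw1).trans_lt (hεb k hk)
  rw [Complex.circleIntegral_eq_zero_of_differentiable_on_off_countable zero_le_one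
    Set.countable_empty (fun w hw => (hd w hw).continuousAt.continuousWithinAt)
    (fun w hw => hd w (Metric.ball_subset_closedBall hw.1)), mul_zero]

/-- The integrals of the relevant form do not depend on the auxiliary parameter. -/
theorem contourIntegral_thetaKer_eq {ι κ : Type*} {J : Finset κ} {α : ι → ℂ} {β : κ → ℂ}
    (hβ : ∀ k ∈ J, β k ≠ 0) {h : ℂ → ℂ} (hh : Differentiable ℂ h) {γ : ℝ → ℂ}
    (hγ : Separates q ∅ J α β γ) {T t μ ν : ℂ} (hT : T ≠ 0) (ht : t ≠ 0) (hμ : μ ≠ 0) (hν : ν ≠ 0)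
    (hγT : ∀ x ∈ Set.Icc (0 : ℝ) 1, ∀ n : ℕ, γ x ≠ T * q ^ n)
    (hγt : ∀ x ∈ Set.Icc (0 : ℝ) 1, ∀ n : ℕ, γ x ≠ t * q ^ n)
    (hGμ : theta q (T / μ) * theta q (t / μ) ≠ 0) (hGν : theta q (T / ν) * theta q (t / ν) ≠ 0) :
    contourIntegral (fun z => thetaKer q T t μ z * (h z / (∏ k ∈ J, qPoch q (β k * z)) /
      (qPoch q (T / z) * qPoch q (t / z))) / z) γ =
    contourIntegral (fun z => thetaKer q T t ν z * (h z / (∏ k ∈ J, qPoch q (β k * z)) /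
      (qPoch q (T / z) * qPoch q (t / z))) / z) γ := by
  have hg : Differentiable ℂ fun z => qPoch q (q * z / T) * qPoch q (q * z / t) * h z := by
    have hQ := differentiable_qPoch hq
    exact ((hQ.comp (by fun_prop : Differentiable ℂ fun z => q * z / T)).mul
      (hQ.comp (by fun_prop : Differentiable ℂ fun z => q * z / t))).mul hh
  obtain ⟨n0, -, nβ⟩ := hγ.ne
  have nT : ∀ x ∈ Set.Icc (0 : ℝ) 1, qPoch q (T / γ x) ≠ 0 := fun x hx =>
    qPoch_div_ne_zero hq (n0 _ ⟨x, hx, rfl⟩) (hγT x hx)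
  have nt : ∀ x ∈ Set.Icc (0 : ℝ) 1, qPoch q (t / γ x) ≠ 0 := fun x hx =>
    qPoch_div_ne_zero hq (n0 _ ⟨x, hx, rfl⟩) (hγt x hx)
  have nJ : ∀ z ∈ γ '' Set.Icc 0 1, ∏ k ∈ J, qPoch q (β k * z) ≠ 0 := fun z hz =>
    Finset.prod_ne_zero_iff.2 fun k hk => qPoch_mul_ne_zero hq (nβ z hz k hk)
  have dJ : ∀ z, DifferentiableAt ℂ (fun z => ∏ k ∈ J, qPoch q (β k * z)) z := fun z =>
    DifferentiableAt.fun_finsetProd fun k _ => DifferentiableAt.fun_comp' z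
        (differentiable_qPoch hq _) (by fun_prop)
  have c1 : ContinuousOn (fun z => thetaKer q T t ν z * (h z / (∏ k ∈ J, qPoch q (β k * z)) /
      (qPoch q (T / z) * qPoch q (t / z))) / z) (γ '' Set.Icc 0 1) := by
    rintro _ ⟨x, hx, rfl⟩
    have hz := n0 _ ⟨x, hx, rfl⟩
    have d : ∀ a : ℂ, DifferentiableAt ℂ (fun z => qPoch q (a / z)) (γ x) := fun a =>
      DifferentiableAt.fun_comp' _ (differentiable_qPoch hq _)
        ((differentiableAt_const a).div differentiableAt_id hz)
    exact (((differentiableAt_thetaKer hq hT ht hν hz).fun_mul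
      (((hh _).div (dJ _) (nJ _ ⟨x, hx, rfl⟩)).fun_div ((d T).fun_mul (d t))
        (mul_ne_zero (nT x hx) (nt x hx)))).fun_div
          differentiableAt_id hz).continuousAt.continuousWithinAt
  have c2 : ContinuousOn (fun z => (qPoch q (q * z / T) * qPoch q (q * z / t) * h z) /
      ∏ k ∈ J, qPoch q (β k * z)) (γ '' Set.Icc 0 1) := fun z hz =>
    ((hg z).fun_div (dJ z) (nJ z hz)).continuousAt.continuousWithinAt
  -- By `theta_interchange` the two integrands differ by a multiple of a function whose factors
  -- `(T/z)` and `(t/z)` in the denominator have cancelled; its integral vanishes.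
  rw [contourIntegral_lin hγ.curve (a := 1) (b := theta q (T * t / (μ * ν)) * theta q (ν / μ) /
    (ν * ((theta q (T / μ) * theta q (t / μ)) * (theta q (T / ν) * theta q (t / ν))))) c1 c2,
    contourIntegral_eq_zero_of_separates hq0 hq hβ hg hγ, one_mul, mul_zero, add_zero]
  intro x hx
  have hz := n0 _ ⟨x, hx, rfl⟩
  have nTx := nT x hx
  have ntx := nt x hx
  generalize γ x = z at hz nTx ntx ⊢
  have key := theta_interchange hq0 hq hT ht hμ hν hz
  have e1 : theta q (z / T) = -(z / T) * (qPoch q (T / z) * qPoch q (q * z / T)) := by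
    rw [← inv_div, theta_inv hq0 hq (div_ne_zero hT hz), theta, inv_div, div_div_eq_mul_div]
  have e2 : theta q (t / z) = qPoch q (t / z) * qPoch q (q * z / t) := by
    rw [theta, div_div_eq_mul_div]
  rw [e1, e2] at key
  simp only [thetaKer]
  generalize ∏ k ∈ J, qPoch q (β k * z) = P
  generalize theta q (T / μ) * theta q (t / μ) = Gμ at *
  generalize theta q (T / ν) * theta q (t / ν) = Gν at *
  generalize theta q (T * t / (μ * z)) * theta q (z / μ) = Fμ at *
  generalize theta q (T * t / (ν * z)) * theta q (z / ν) = Fν at *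
  generalize qPoch q (T / z) = A at *
  generalize qPoch q (t / z) = B at *
  generalize qPoch q (q * z / T) = A' at *
  generalize qPoch q (q * z / t) = B' at *
  generalize theta q (T * t / (μ * ν)) = C at *
  generalize theta q (ν / μ) = C' at *
  have key' : Fμ / Gμ = Fν / Gν + z * C * C' * A * A' * B * B' / (ν * (Gμ * Gν)) := by
    field_simp at key ⊢
    linear_combination key
  rw [key']
  field_simp

end

/-! ### The beta integral -/

/-- The factor `(1 - x²) ∏ (u x) / (q x / u) / (T x^{±1})` of the integrands. -/
def uWeight (q T a b c x : ℂ) : ℂ :=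
  (1 - x ^ 2) * (qPoch q (a * x) * qPoch q (b * x) * qPoch q (c * x)) /
    (qPoch q (q / a * x) * qPoch q (q / b * x) * qPoch q (q / c * x) *
      (qPoch q (T * x) * qPoch q (T / x)))

/-- The integrand of the beta integral. -/
def betaIntegrand (q m T t a b c d x : ℂ) : ℂ :=
  thetaKer q T t m x * (uWeight q T a b c x *
    (qPoch q (d * x) / (qPoch q (q / d * x) * (qPoch q (t * x) * qPoch q (t / x)))))

theorem circleMean_inv (f : ℂ → ℂ) : circleMean (fun z => f z⁻¹) 1 = circleMean f 1 := by
  have h : ∀ x : ℝ, (circ 0 1 x)⁻¹ = circ 0 1 (1 - x) := fun x => by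
    simp only [circ, zero_add, sub_zero, one_mul, ← Complex.exp_neg]
    rw [← Complex.exp_periodic]
    congr 1
    push_cast
    ring
  simp only [circleMean, h]
  rw [intervalIntegral.integral_comp_sub_left (fun x => f (circ 0 1 x)) 1]
  simp

section

variable {q : ℂ} (hq0 : q ≠ 0) (hq : ‖q‖ < 1)
include hq0 hq

theorem circleMean_betaIntegrand_eq {T t a b c d μ ν : ℂ} (hT : T ≠ 0) (ht : t ≠ 0) (ha : a ≠ 0)
    (hb : b ≠ 0) (hc : c ≠ 0) (hd : d ≠ 0) (hT1 : ‖T‖ < 1) (ht1 : ‖t‖ < 1) (ha1 : ‖q / a‖ < 1)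
    (hb1 : ‖q / b‖ < 1) (hc1 : ‖q / c‖ < 1) (hd1 : ‖q / d‖ < 1) (hμ : μ ≠ 0) (hν : ν ≠ 0)
    (hGμ : theta q (T / μ) * theta q (t / μ) ≠ 0) (hGν : theta q (T / ν) * theta q (t / ν) ≠ 0) :
    circleMean (betaIntegrand q μ T t a b c d) 1 =
      circleMean (betaIntegrand q ν T t a b c d) 1 := by
  have hJ0 : ∀ i, ![q / a, q / b, q / c, q / d, T, t] i ≠ 0 := fun i => by
    fin_cases i <;> simp [*]
  have hJ1 : ∀ i, ‖![q / a, q / b, q / c, q / d, T, t] i‖ < 1 := fun i => by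
    fin_cases i <;> assumption
  have hsep : Separates q (∅ : Finset ℕ) (Finset.univ : Finset (Fin 6)) (fun _ => 0)
      ![q / a, q / b, q / c, q / d, T, t] (circ 0 1) :=
    separates_circ hq0 hq one_ne_zero (fun k _ => hJ0 k)
      (fun i hi => absurd hi (Finset.notMem_empty _)) (fun k _ => by simpa using hJ1 k)
  have hQ := differentiable_qPoch hq
  have hne : ∀ {T : ℂ}, ‖T‖ < 1 → ∀ x ∈ Set.Icc (0 : ℝ) 1, ∀ n : ℕ, circ 0 1 x ≠ T * q ^ n :=
    fun hT x _ n h => by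
      have h1 := norm_circ_zero 1 x
      rw [h, norm_one, norm_mul, norm_pow] at h1
      exact ((mul_le_of_le_one_right (norm_nonneg _) (pow_le_one₀ (norm_nonneg _)
        hq.le)).trans_lt hT).ne h1
  have h := contourIntegral_thetaKer_eq hq0 hq (fun k _ => hJ0 k)
    (h := fun x => (1 - x ^ 2) * (qPoch q (a * x) * qPoch q (b * x) * qPoch q (c * x) *
      qPoch q (d * x)))
    ((by fun_prop : Differentiable ℂ fun x : ℂ => 1 - x ^ 2).mul
      ((((hQ.comp (by fun_prop : Differentiable ℂ fun z => a * z)).mul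
      (hQ.comp (by fun_prop : Differentiable ℂ fun z => b * z))).mul
      (hQ.comp (by fun_prop : Differentiable ℂ fun z => c * z))).mul
      (hQ.comp (by fun_prop : Differentiable ℂ fun z => d * z)))) hsep hT ht hμ hν (hne hT1)
      (hne ht1) hGμ hGν
  rw [contourIntegral_div_circ _ one_ne_zero, contourIntegral_div_circ _ one_ne_zero] at h
  have e : ∀ m, betaIntegrand q m T t a b c d = fun x => thetaKer q T t m x *
      ((1 - x ^ 2) * (qPoch q (a * x) * qPoch q (b * x) * qPoch q (c * x) * qPoch q (d * x)) /
      (∏ k, qPoch q (![q / a, q / b, q / c, q / d, T, t] k * x)) /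
      (qPoch q (T / x) * qPoch q (t / x))) := fun m => by
    funext x
    simp only [betaIntegrand, uWeight, Fin.prod_univ_six, Matrix.cons_val]
    rw [div_mul_div_comm, div_div]
    congr 2 <;> ring
  rw [e, e]
  exact h

/-- For a special value of the auxiliary parameter, the integrand of the beta integral becomes,
upon symmetrization, the Nassrallah–Rahman integrand. -/
theorem betaIntegrand_eq {T t a b c d y : ℂ} (ha : a ≠ 0) (hb : b ≠ 0)
    (hc : c ≠ 0) (hd : d ≠ 0) (hy : ‖y‖ = 1) (hT1 : ‖T‖ < 1) (ht1 : ‖t‖ < 1) (ha1 : ‖q / a‖ < 1)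
    (hb1 : ‖q / b‖ < 1) (hc1 : ‖q / c‖ < 1) (hd1 : ‖q / d‖ < 1)
    (hbal : q ^ 3 * (T * t) = a * b * c * d) :
    betaIntegrand q d T t a b c d y = (a * b * c) ^ 3 / (q ^ 6 * d) /
      (theta q (T / d) * theta q (t / d)) * (y⁻¹ ^ 2 - 1) *
      (theta q (a * b * c / y) * (theta q (a * y) * theta q (b * y) * theta q (c * y))) *
      (qPoch q (d * y) * qPoch q (d / y) /
      ((qPoch q (T / y) * qPoch q (t / y) * qPoch q (q / a / y) * qPoch q (q / b / y) *
        qPoch q (q / c / y)) * (qPoch q (T * y) * qPoch q (t * y) * qPoch q (q / a * y) *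
        qPoch q (q / b * y) * qPoch q (q / c * y)))) := by
  have hy0 : y ≠ 0 := norm_pos_iff.1 (by rw [hy]; exact one_pos)
  have n1 : ∀ {a : ℂ}, ‖a‖ < 1 → qPoch q (a / y) ≠ 0 := fun ha =>
    qPoch_ne_zero_of_norm_lt hq (by rwa [norm_div, hy, div_one])
  have n2 : ∀ {a : ℂ}, ‖a‖ < 1 → qPoch q (a * y) ≠ 0 := fun ha =>
    qPoch_ne_zero_of_norm_lt hq (by rwa [norm_mul, hy, mul_one])
  have e1 : theta q (T * t / (d * y)) = -(a * b * c / y) ^ 3 / q ^ 6 * theta q (a * b * c / y) := by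
    have hX : a * b * c / y ≠ 0 := by positivity
    have : T * t / (d * y) = a * b * c / y / q / q / q := by
      field_simp
      linear_combination hbal
    rw [this, theta_div_q hq0 hq (by positivity), theta_div_q hq0 hq (by positivity),
      theta_div_q hq0 hq hX]
    field_simp
  have e2 : theta q (y / d) = -(y / d) * (qPoch q (d / y) * qPoch q (q / d * y)) := by
    rw [← inv_div, theta_inv hq0 hq (div_ne_zero hd hy0), theta, inv_div, div_div_eq_mul_div,
      mul_div_right_comm]
  have e3 : ∀ {a : ℂ}, theta q (a * y) = qPoch q (a * y) * qPoch q (q / a / y) := fun {a} => by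
    rw [theta, div_div]
  simp only [betaIntegrand, thetaKer, uWeight]
  rw [e1, e2, e3, e3, e3]
  have p1 := n1 hT1
  have p2 := n1 ht1
  have p3 := n1 ha1
  have p4 := n1 hb1
  have p5 := n1 hc1
  have p6 := n2 hT1
  have p7 := n2 ht1
  have p8 := n2 ha1
  have p9 := n2 hb1
  have p10 := n2 hc1
  have p11 := n2 hd1
  generalize theta q (a * b * c / y) = X
  generalize qPoch q (T / y) = P1 at *
  generalize qPoch q (t / y) = P2 at *
  generalize qPoch q (q / a / y) = P3 at *
  generalize qPoch q (q / b / y) = P4 at *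
  generalize qPoch q (q / c / y) = P5 at *
  generalize qPoch q (T * y) = P6 at *
  generalize qPoch q (t * y) = P7 at *
  generalize qPoch q (q / a * y) = P8 at *
  generalize qPoch q (q / b * y) = P9 at *
  generalize qPoch q (q / c * y) = P10 at *
  generalize qPoch q (q / d * y) = P11 at *
  generalize qPoch q (d / y) = P12 at *
  generalize qPoch q (d * y) = P13 at *
  generalize qPoch q (a * y) = P14 at *
  generalize qPoch q (b * y) = P15 at *
  generalize qPoch q (c * y) = P16 at *
  rw [show theta q (T / d) * theta q (t / d) = ((theta q (T / d) * theta q (t / d))⁻¹)⁻¹ by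
    rw [inv_inv]]
  generalize (theta q (T / d) * theta q (t / d))⁻¹ = G
  simp only [div_inv_eq_mul]
  field_simp

omit hq0 in
theorem continuousAt_qPoch_comp {X : Type*} [TopologicalSpace X] {f : X → ℂ} {x : X}
    (hf : ContinuousAt f x) : ContinuousAt (fun y => qPoch q (f y)) x :=
  ContinuousAt.comp' (continuous_qPoch hq).continuousAt hf

omit hq0 in
theorem continuousAt_uWeight {T a b c y : ℂ} (hy : ‖y‖ = 1) (hT1 : ‖T‖ < 1) (ha1 : ‖q / a‖ < 1)
    (hb1 : ‖q / b‖ < 1) (hc1 : ‖q / c‖ < 1) : ContinuousAt (uWeight q T a b c) y := by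
  have hy0 : y ≠ 0 := norm_pos_iff.1 (by rw [hy]; exact one_pos)
  have n1 : ∀ {a : ℂ}, ‖a‖ < 1 → qPoch q (a / y) ≠ 0 := fun ha =>
    qPoch_ne_zero_of_norm_lt hq (by rwa [norm_div, hy, div_one])
  have n2 : ∀ {a : ℂ}, ‖a‖ < 1 → qPoch q (a * y) ≠ 0 := fun ha =>
    qPoch_ne_zero_of_norm_lt hq (by rwa [norm_mul, hy, mul_one])
  have c1 : ∀ a : ℂ, ContinuousAt (fun y => qPoch q (a * y)) y := fun a =>
    continuousAt_qPoch_comp hq (continuousAt_const.mul continuousAt_id)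
  have c2 : ∀ a : ℂ, ContinuousAt (fun y => qPoch q (a / y)) y := fun a =>
    continuousAt_qPoch_comp hq (continuousAt_const.div continuousAt_id hy0)
  exact (ContinuousAt.mul (by fun_prop : ContinuousAt (fun y : ℂ => 1 - y ^ 2) y)
    (((c1 a).mul (c1 b)).mul (c1 c))).div ((((c1 _).mul (c1 _)).mul (c1 _)).mul
    ((c1 T).mul (c2 T))) (mul_ne_zero (mul_ne_zero (mul_ne_zero (n2 ha1) (n2 hb1)) (n2 hc1))
    (mul_ne_zero (n2 hT1) (n1 hT1)))

/-- The only part of `betaIntegrand_eq` not invariant under inversion is `y⁻² - 1` times four theta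
functions, and `theta_quartic` evaluates the sum of its two values. The factor `θ(y²)` supplies the
products `(y^{±2})` of the Nassrallah–Rahman integrand. -/
theorem betaIntegrand_add_inv {T t a b c d y : ℂ} (ha : a ≠ 0) (hb : b ≠ 0)
    (hc : c ≠ 0) (hd : d ≠ 0) (hy : ‖y‖ = 1) (hT1 : ‖T‖ < 1) (ht1 : ‖t‖ < 1) (ha1 : ‖q / a‖ < 1)
    (hb1 : ‖q / b‖ < 1) (hc1 : ‖q / c‖ < 1) (hd1 : ‖q / d‖ < 1)
    (hbal : q ^ 3 * (T * t) = a * b * c * d) :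
    betaIntegrand q d T t a b c d y + betaIntegrand q d T t a b c d y⁻¹ =
      -((a * b * c) ^ 3 / (q ^ 6 * d) / (theta q (T / d) * theta q (t / d)) *
      (theta q (a * b) * theta q (a * c) * theta q (b * c))) *
      nrIntegrand q T t (q / a) (q / b) (q / c) y := by
  have hy0 : y ≠ 0 := norm_pos_iff.1 (by rw [hy]; exact one_pos)
  have hy' : ‖y⁻¹‖ = 1 := by rw [norm_inv, hy, inv_one]
  rw [betaIntegrand_eq hq0 hq ha hb hc hd hy hT1 ht1 ha1 hb1 hc1 hd1 hbal,
    betaIntegrand_eq hq0 hq ha hb hc hd hy' hT1 ht1 ha1 hb1 hc1 hd1 hbal]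
  simp only [div_inv_eq_mul, ← div_eq_mul_inv, inv_inv]
  have hA : T * t * (q / a) * (q / b) * (q / c) = d := by
    field_simp
    linear_combination hbal
  have key := theta_quartic hq0 hq ha hb hc hy0
  have e1 : theta q (y ^ 2) = qPoch q (y ^ 2) * qPoch q ((y ^ 2)⁻¹ * q) := by
    rw [theta, div_eq_inv_mul]
  have e2 := qPoch_succ hq ((y ^ 2)⁻¹)
  rw [e1] at key
  simp only [nrIntegrand]
  rw [hA, e2]
  generalize (a * b * c) ^ 3 / (q ^ 6 * d) / (theta q (T / d) * theta q (t / d)) = G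
  generalize theta q (a * b) * theta q (a * c) * theta q (b * c) = C at *
  generalize qPoch q (y ^ 2) = Y at *
  generalize qPoch q ((y ^ 2)⁻¹ * q) = Y' at *
  simp only [div_eq_mul_inv _ (_ * _ : ℂ), mul_inv]
  generalize theta q (a * b * c / y) = X at *
  generalize theta q (a * b * c * y) = X' at *
  rw [show y⁻¹ ^ 2 = (y ^ 2)⁻¹ by rw [inv_pow]]
  have hyy : (y ^ 2)⁻¹ * y ^ 2 = 1 := inv_mul_cancel₀ (pow_ne_zero 2 hy0)
  generalize (y ^ 2)⁻¹ = w at *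
  generalize y ^ 2 = v at *
  generalize qPoch q (d * y) = N
  generalize qPoch q (d / y) = M
  generalize (qPoch q (T / y))⁻¹ = x1
  generalize (qPoch q (t / y))⁻¹ = x2
  generalize (qPoch q (q / a / y))⁻¹ = x3
  generalize (qPoch q (q / b / y))⁻¹ = x4
  generalize (qPoch q (q / c / y))⁻¹ = x5
  generalize (qPoch q (T * y))⁻¹ = x6
  generalize (qPoch q (t * y))⁻¹ = x7
  generalize (qPoch q (q / a * y))⁻¹ = x8
  generalize (qPoch q (q / b * y))⁻¹ = x9
  generalize (qPoch q (q / c * y))⁻¹ = x10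
  linear_combination (G * (w - 1) * N * M * x1 * x2 * x3 * x4 * x5 * x6 * x7 * x8 * x9 * x10) * key +
    (G * N * M * x1 * x2 * x3 * x4 * x5 * x6 * x7 * x8 * x9 * x10 * X' *
      (theta q (a / y) * theta q (b / y) * theta q (c / y))) * hyy

theorem theta_div_eq {a b : ℂ} (ha : a ≠ 0) (hb : b ≠ 0) :
    theta q (a / b) = -(a / b) * (qPoch q (b / a) * qPoch q (q * a / b)) := by
  rw [← inv_div, theta_inv hq0 hq (div_ne_zero hb ha), inv_div, theta, div_div_eq_mul_div]

/-- The theta functions of the constant are split into q-shifted factorials; the balancing condition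
makes the remaining monomial equal to `1`. -/
theorem betaConst_identity {T t a b c d : ℂ} (hT : T ≠ 0) (ht : t ≠ 0) (ha : a ≠ 0) (hb : b ≠ 0)
    (hc : c ≠ 0) (hd : d ≠ 0) (hbal : q ^ 3 * (T * t) = a * b * c * d) :
    -((a * b * c) ^ 3 / (q ^ 6 * d) / (theta q (T / d) * theta q (t / d)) *
      (theta q (a * b) * theta q (a * c) * theta q (b * c))) =
    qPoch q (a * b / q) * qPoch q (a * c / q) * qPoch q (b * c / q) *
      (qPoch q (q / a * (q / b)) * qPoch q (q / a * (q / c)) * qPoch q (q / b * (q / c))) /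
      (qPoch q (d / T) * qPoch q (d / t) * (qPoch q (q * T / d) * qPoch q (q * t / d))) := by
  have e1 : ∀ {a b : ℂ}, a ≠ 0 → b ≠ 0 → theta q (a * b) =
      -(q / (a * b)) * (qPoch q (a * b / q) * qPoch q (q / a * (q / b))) := fun {a b} ha hb => by
    have h := theta_div_q hq0 hq (mul_ne_zero ha hb)
    rw [theta, show q / (a * b / q) = q / a * (q / b) by field_simp] at h
    rw [h]
    field_simp
  have hs : (a * b * c) ^ 3 / (q ^ 6 * d) / (T / d * (t / d)) *
      (q / (a * b) * (q / (a * c)) * (q / (b * c))) = 1 := by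
    field_simp
    linear_combination -hbal
  rw [e1 ha hb, e1 ha hc, e1 hb hc, theta_div_eq hq0 hq hT hd, theta_div_eq hq0 hq ht hd]
  generalize qPoch q (d / T) = g1
  generalize qPoch q (d / t) = g2
  generalize qPoch q (q * T / d) = g3
  generalize qPoch q (q * t / d) = g4
  generalize qPoch q (a * b / q) = x1
  generalize qPoch q (a * c / q) = x2
  generalize qPoch q (b * c / q) = x3
  generalize qPoch q (q / a * (q / b)) = x4
  generalize qPoch q (q / a * (q / c)) = x5
  generalize qPoch q (q / b * (q / c)) = x6
  linear_combination (x1 * x2 * x3 * x4 * x5 * x6 * g1⁻¹ * g2⁻¹ * g3⁻¹ * g4⁻¹) * hs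

/-- Move the auxiliary parameter to `d`, symmetrize under inversion and apply the Nassrallah–Rahman
evaluation. The averaging accounts for the factor `1/2`. -/
theorem circleMean_betaIntegrand {K : ℂ} (hK : ∀ a b c d e : ℂ, ‖a‖ < 1 → ‖b‖ < 1 →
    ‖c‖ < 1 → ‖d‖ < 1 → ‖e‖ < 1 → a ≠ 0 → b ≠ 0 → c ≠ 0 → d ≠ 0 → e ≠ 0 →
    circleMean (nrIntegrand q a b c d e) 1 * nrPairs q a b c d e = K * nrQuads q a b c d e)
    {m T t a b c d : ℂ} (hT : T ≠ 0) (ht : t ≠ 0) (ha : a ≠ 0) (hb : b ≠ 0)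
    (hc : c ≠ 0) (hd : d ≠ 0) (hm : m ≠ 0) (hT1 : ‖T‖ < 1) (ht1 : ‖t‖ < 1) (ha1 : ‖q / a‖ < 1)
    (hb1 : ‖q / b‖ < 1) (hc1 : ‖q / c‖ < 1) (hd1 : ‖q / d‖ < 1)
    (hbal : q ^ 3 * (T * t) = a * b * c * d)
    (hGd : theta q (T / d) * theta q (t / d) ≠ 0) (hGm : theta q (T / m) * theta q (t / m) ≠ 0) :
    circleMean (betaIntegrand q m T t a b c d) 1 =
      K / 2 * (qPoch q (a * b / q) * qPoch q (a * c / q) * qPoch q (b * c / q) *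
        (qPoch q (a * d / q) * qPoch q (b * d / q) * qPoch q (c * d / q))) /
      (qPoch q (T * t) * (qPoch q (q * T / a) * qPoch q (q * T / b) * qPoch q (q * T / c)) *
        qPoch q (q * T / d) * (qPoch q (q * t / a) * qPoch q (q * t / b) * qPoch q (q * t / c)) *
        qPoch q (q * t / d)) := by
  -- For the auxiliary parameter `d`, the factor `θ(y/d)` cancels the denominator `(qy/d)`, leaving
  -- only numerators in `d`.
  rw [circleMean_betaIntegrand_eq hq0 hq hT ht ha hb hc hd hT1 ht1 ha1 hb1 hc1 hd1 hm hd hGm hGd]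
  have hcont : ∀ y, ‖y‖ = ‖(1 : ℂ)‖ → ContinuousAt (betaIntegrand q d T t a b c d) y :=
    fun y hy => by
    rw [norm_one] at hy
    have hy0 : y ≠ 0 := norm_pos_iff.1 (by rw [hy]; exact one_pos)
    have n1 : ∀ {a : ℂ}, ‖a‖ < 1 → qPoch q (a / y) ≠ 0 := fun ha =>
      qPoch_ne_zero_of_norm_lt hq (by rwa [norm_div, hy, div_one])
    have n2 : ∀ {a : ℂ}, ‖a‖ < 1 → qPoch q (a * y) ≠ 0 := fun ha =>
      qPoch_ne_zero_of_norm_lt hq (by rwa [norm_mul, hy, mul_one])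
    have c1 : ∀ a : ℂ, ContinuousAt (fun y => qPoch q (a * y)) y := fun a =>
      continuousAt_qPoch_comp hq (continuousAt_const.mul continuousAt_id)
    have c2 : ∀ a : ℂ, ContinuousAt (fun y => qPoch q (a / y)) y := fun a =>
      continuousAt_qPoch_comp hq (continuousAt_const.div continuousAt_id hy0)
    exact (differentiableAt_thetaKer hq hT ht hd hy0).continuousAt.mul
      ((continuousAt_uWeight hq hy hT1 ha1 hb1 hc1).mul ((c1 d).div ((c1 _).mul ((c1 t).mul (c2 t)))
      (mul_ne_zero (n2 hd1) (mul_ne_zero (n2 ht1) (n1 ht1)))))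
  have hcont' : ∀ y, ‖y‖ = ‖(1 : ℂ)‖ →
      ContinuousAt (fun y => betaIntegrand q d T t a b c d y⁻¹) y := fun y hy =>
    ContinuousAt.comp' (hcont _ (by rw [norm_inv, hy]; simp))
      (continuousAt_inv₀ (norm_pos_iff.1 (by rw [hy]; simp)))
  have h2 : circleMean (betaIntegrand q d T t a b c d) 1 =
      circleMean (fun y => 1 / 2 * betaIntegrand q d T t a b c d y +
        1 / 2 * betaIntegrand q d T t a b c d y⁻¹) 1 := by
    rw [circleMean_lin _ _ hcont hcont', circleMean_inv]
    ring
  have h3 := betaConst_identity hq0 hq hT ht ha hb hc hd hbal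
  have h4 : ∀ y, ‖y‖ = ‖(1 : ℂ)‖ → 1 / 2 * betaIntegrand q d T t a b c d y +
      1 / 2 * betaIntegrand q d T t a b c d y⁻¹ = -(1 / 2 * ((a * b * c) ^ 3 / (q ^ 6 * d) /
      (theta q (T / d) * theta q (t / d)) * (theta q (a * b) * theta q (a * c) * theta q (b * c)))) *
      nrIntegrand q T t (q / a) (q / b) (q / c) y := fun y hy => by
    rw [← mul_add, betaIntegrand_add_inv hq0 hq ha hb hc hd (by simpa using hy) hT1 ht1 ha1 hb1 hc1
      hd1 hbal]
    ring
  have h5 := hK T t (q / a) (q / b) (q / c) hT1 ht1 ha1 hb1 hc1 hT ht (div_ne_zero hq0 ha)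
    (div_ne_zero hq0 hb) (div_ne_zero hq0 hc)
  have h6 := nrPairs_ne_zero hq hT1 ht1 ha1 hb1 hc1
  rw [theta_div_eq hq0 hq hT hd, theta_div_eq hq0 hq ht hd] at hGd
  rw [h2, circleMean_congr h4, circleMean_const_mul, eq_div_of_mul_eq h6 h5, neg_mul_eq_mul_neg, h3]
  simp only [nrPairs, nrQuads] at h6 ⊢
  rw [show t * (q / a) * (q / b) * (q / c) = d / T by field_simp; linear_combination hbal,
    show T * (q / a) * (q / b) * (q / c) = d / t by field_simp; linear_combination hbal,
    show T * t * (q / b) * (q / c) = a * d / q by field_simp; linear_combination hbal,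
    show T * t * (q / a) * (q / c) = b * d / q by field_simp; linear_combination hbal,
    show T * t * (q / a) * (q / b) = c * d / q by field_simp; linear_combination hbal]
  rw [show T * (q / a) = q * T / a by ring, show T * (q / b) = q * T / b by ring,
    show T * (q / c) = q * T / c by ring, show t * (q / a) = q * t / a by ring,
    show t * (q / b) = q * t / b by ring, show t * (q / c) = q * t / c by ring] at h6 ⊢
  generalize qPoch q (d / T) = g1 at *
  generalize qPoch q (d / t) = g2 at *
  generalize qPoch q (q * T / d) = g3 at *
  generalize qPoch q (q * t / d) = g4 at *
  generalize qPoch q (a * b / q) = x1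
  generalize qPoch q (a * c / q) = x2
  generalize qPoch q (b * c / q) = x3
  generalize qPoch q (q / a * (q / b)) = x4 at *
  generalize qPoch q (q / a * (q / c)) = x5 at *
  generalize qPoch q (q / b * (q / c)) = x6 at *
  generalize qPoch q (a * d / q) = x7
  generalize qPoch q (b * d / q) = x8
  generalize qPoch q (c * d / q) = x9
  generalize qPoch q (T * t) = y0 at *
  generalize qPoch q (q * T / a) = y1 at *
  generalize qPoch q (q * T / b) = y2 at *
  generalize qPoch q (q * T / c) = y3 at *
  generalize qPoch q (q * t / a) = y4 at *
  generalize qPoch q (q * t / b) = y5 at *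
  generalize qPoch q (q * t / c) = y6 at *
  simp only [mul_ne_zero_iff] at hGd h6
  obtain ⟨⟨-, k1, k2⟩, -, k3, k4⟩ := hGd
  obtain ⟨⟨⟨⟨⟨⟨⟨⟨⟨l1, l2⟩, l3⟩, l4⟩, l5⟩, l6⟩, l7⟩, l8⟩, l9⟩, l10⟩ := h6
  clear h3 h4 h5
  field_simp

end

end TrigHyp
end

noncomputable section
namespace TrigHyp

/-! ### The transformation of the second integral -/

/-- The kernel of the double integral. -/
def doubleKernel (q s x z : ℂ) : ℂ :=
  qPoch q (q / s * x * z) / (qPoch q (s * x * z) * qPoch q (s * x / z) * qPoch q (s * z / x))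

/-- The integrand of the second integral in the variables adapted to the unit circle. -/
def sixIntegrand (q μ T t a b c d e f z : ℂ) : ℂ :=
  thetaKer q T t μ z * (uWeight q t d e f z *
    (qPoch q (a * z) * qPoch q (b * z) * qPoch q (c * z) /
      (qPoch q (q / a * z) * qPoch q (q / b * z) * qPoch q (q / c * z) *
        (qPoch q (T * z) * qPoch q (T / z)))))

/-- The constant relating the inner integral to `sixIntegrand`. -/
def sixConst (q s T a b c : ℂ) : ℂ :=
  qPoch q (a * b / q) * qPoch q (a * c / q) * qPoch q (b * c / q) /
    (qPoch q (q * T / a) * qPoch q (q * T / b) * qPoch q (q * T / c) * qPoch q (s ^ 2))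

/-- The double integrand. -/
def doubleIntegrand (q s ζ T t a b c d e f x z : ℂ) : ℂ :=
  thetaKer q T (s * z) (ζ * z) x * thetaKer q (s * T) t (T / (ζ * q)) z *
    (doubleKernel q s x z * (uWeight q T a b c x * uWeight q t d e f z))

/-- The non-vanishing conditions on theta functions required of the parameters of the double
integral. -/
structure ThetaGeneric (q s ζ T t : ℂ) : Prop where
  inner_special : ∀ z, ‖z‖ = 1 → theta q (T * s / (q * z)) ≠ 0
  special : theta q (s ^ 2 / q) ≠ 0
  inner : ∀ z, ‖z‖ = 1 → theta q (T / (ζ * z)) ≠ 0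
  left : theta q (s / ζ) ≠ 0
  right : theta q (s * ζ * q) ≠ 0
  outer : theta q (t * ζ * q / T) ≠ 0

section

variable {q : ℂ} (hq0 : q ≠ 0)
include hq0

/-- The auxiliary parameters `ζz` and `T/(ζq)` are coupled so that `θ(T/(ζz))` occurs both above and
below. After cancellation, no theta function in the denominator depends on `x` or `z`. -/
theorem thetaKer_mul_thetaKer {s ζ T t x z : ℂ} (hs : s ≠ 0) (hζ : ζ ≠ 0) (hT : T ≠ 0)
    (hx : x ≠ 0) (hz : z ≠ 0) (h : theta q (T / (ζ * z)) ≠ 0) :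
    thetaKer q T (s * z) (ζ * z) x * thetaKer q (s * T) t (T / (ζ * q)) z =
      theta q (T * s / (ζ * x)) * theta q (x / (ζ * z)) * theta q (s * t * ζ * q / z) /
        (theta q (s / ζ) * theta q (s * ζ * q) * theta q (t * ζ * q / T)) := by
  simp only [thetaKer]
  rw [show T * (s * z) / (ζ * z * x) = T * s / (ζ * x) by field_simp,
    show s * z / (ζ * z) = s / ζ by field_simp,
    show s * T * t / (T / (ζ * q) * z) = s * t * ζ * q / z by field_simp,
    show z / (T / (ζ * q)) = q / (T / (ζ * z)) by field_simp, theta_q_div hq0,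
    show s * T / (T / (ζ * q)) = s * ζ * q by field_simp,
    show t / (T / (ζ * q)) = t * ζ * q / T by field_simp]
  generalize theta q (T / (ζ * z)) = A at *
  rw [div_mul_div_comm, ← mul_div_mul_right _ (theta q (s / ζ) * theta q (s * ζ * q) *
    theta q (t * ζ * q / T)) h]
  congr 1 <;> ring

/-- Exchanging the roles of the two variables replaces `ζ` by `1/(qζ)`; the theta functions match
through `θ(q/a) = θ(a)`. -/
theorem doubleIntegrand_swap {s ζ T t a b c d e f x z : ℂ} (hs : s ≠ 0) (hζ : ζ ≠ 0) (hT : T ≠ 0)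
    (ht : t ≠ 0) (hx : ‖x‖ = 1) (hz : ‖z‖ = 1) (h : ThetaGeneric q s ζ T t)
    (h' : ThetaGeneric q s (1 / (q * ζ)) t T) :
    doubleIntegrand q s ζ T t a b c d e f x z =
      doubleIntegrand q s (1 / (q * ζ)) t T d e f a b c z x := by
  have hx0 : x ≠ 0 := norm_pos_iff.1 (by rw [hx]; exact one_pos)
  have hz0 : z ≠ 0 := norm_pos_iff.1 (by rw [hz]; exact one_pos)
  simp only [doubleIntegrand, doubleKernel]
  rw [thetaKer_mul_thetaKer hq0 hs hζ hT hx0 hz0 (h.inner z hz), thetaKer_mul_thetaKer hq0 hs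
    (one_div_ne_zero (mul_ne_zero hq0 hζ)) ht hz0 hx0 (h'.inner x hx),
    show t * s / (1 / (q * ζ) * z) = s * t * ζ * q / z by field_simp,
    show z / (1 / (q * ζ) * x) = q / (x / (ζ * z)) by field_simp, theta_q_div hq0,
    show s * T * (1 / (q * ζ)) * q / x = T * s / (ζ * x) by field_simp,
    show s / (1 / (q * ζ)) = s * ζ * q by field_simp,
    show s * (1 / (q * ζ)) * q = s / ζ by field_simp,
    show T * (1 / (q * ζ)) * q / t = q / (t * ζ * q / T) by field_simp, theta_q_div hq0,
    mul_right_comm _ z x, mul_right_comm s z x]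
  congr 1
  · congr 1 <;> ring
  · congr 1
    · congr 1; ring
    · ring

variable (hq : ‖q‖ < 1)
include hq

/-- For fixed `z` this is the beta integral with `t` replaced by `s z` and fourth parameter `d = q
z/s`. The dependence on `z` drops out of its balancing condition, leaving `q² s² T = a b c`. -/
theorem circleMean_doubleIntegrand {K : ℂ} (hK : ∀ a b c d e : ℂ, ‖a‖ < 1 → ‖b‖ < 1 →
    ‖c‖ < 1 → ‖d‖ < 1 → ‖e‖ < 1 → a ≠ 0 → b ≠ 0 → c ≠ 0 → d ≠ 0 → e ≠ 0 →
    circleMean (nrIntegrand q a b c d e) 1 * nrPairs q a b c d e = K * nrQuads q a b c d e)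
    {s ζ T t a b c z : ℂ} (d e f : ℂ) (hs : s ≠ 0) (hζ : ζ ≠ 0) (hT : T ≠ 0) (ha : a ≠ 0)
    (hb : b ≠ 0) (hc : c ≠ 0) (hz : ‖z‖ = 1) (hT1 : ‖T‖ < 1) (hs1 : ‖s‖ < 1) (ha1 : ‖q / a‖ < 1)
    (hb1 : ‖q / b‖ < 1) (hc1 : ‖q / c‖ < 1) (hbal : q ^ 2 * s ^ 2 * T = a * b * c)
    (h : ThetaGeneric q s ζ T t) :
    circleMean (fun x => doubleIntegrand q s ζ T t a b c d e f x z) 1 =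
      K / 2 * sixConst q s T a b c *
        sixIntegrand q (T / (ζ * q)) (s * T) t (a / s) (b / s) (c / s) d e f z := by
  have hz0 : z ≠ 0 := norm_pos_iff.1 (by rw [hz]; exact one_pos)
  have hd1 : q / (q * z / s) = s / z := by field_simp
  have key := circleMean_betaIntegrand hq0 hq hK (m := ζ * z) (T := T) (t := s * z) (a := a)
    (b := b) (c := c) (d := q * z / s) hT (mul_ne_zero hs hz0) ha hb hc (by positivity)
    (by positivity) hT1 (by rwa [norm_mul, hz, mul_one]) ha1 hb1 hc1
    (by rw [hd1, norm_div, hz, div_one]; exact hs1)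
    (by field_simp; linear_combination hbal)
    (mul_ne_zero (by
        rw [show T / (q * z / s) = T * s / (q * z) by field_simp]
        exact h.inner_special z hz) (by
        rw [show s * z / (q * z / s) = s ^ 2 / q by field_simp]
        exact h.special))
    (mul_ne_zero (h.inner z hz) (by
        rw [show s * z / (ζ * z) = s / ζ by field_simp]
        exact h.left))
  have e1 : ∀ x, doubleIntegrand q s ζ T t a b c d e f x z =
      (thetaKer q (s * T) t (T / (ζ * q)) z * uWeight q t d e f z) *
        betaIntegrand q (ζ * z) T (s * z) a b c (q * z / s) x := fun x => by
    simp only [doubleIntegrand, doubleKernel, betaIntegrand]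
    rw [hd1, show q * z / s * x = q / s * x * z by ring, show s / z * x = s * x / z by ring,
      show s * z * x = s * x * z by ring,
      show qPoch q (s * x * z) * qPoch q (s * x / z) * qPoch q (s * z / x) =
        qPoch q (s * x / z) * (qPoch q (s * x * z) * qPoch q (s * z / x)) by ring]
    ring
  simp only [e1]
  rw [circleMean_const_mul, key, sixConst, sixIntegrand]
  rw [show a * (q * z / s) / q = a / s * z by field_simp,
    show b * (q * z / s) / q = b / s * z by field_simp,
    show c * (q * z / s) / q = c / s * z by field_simp,
    show T * (s * z) = s * T * z by ring,
    show q * T / (q * z / s) = s * T / z by field_simp,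
    show q * (s * z) / a = q / (a / s) * z by field_simp,
    show q * (s * z) / b = q / (b / s) * z by field_simp,
    show q * (s * z) / c = q / (c / s) * z by field_simp,
    show q * (s * z) / (q * z / s) = s ^ 2 by field_simp]
  generalize thetaKer q (s * T) t (T / (ζ * q)) z = θ₀
  generalize uWeight q t d e f z = w
  ring

omit hq0 in
theorem continuousAt_theta_comp {X : Type*} [TopologicalSpace X] {f : X → ℂ} {x : X}
    (hf : ContinuousAt f x) (h0 : f x ≠ 0) : ContinuousAt (fun y => theta q (f y)) x :=
  (continuousAt_qPoch_comp hq hf).mul (continuousAt_qPoch_comp hq (continuousAt_const.div hf h0))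

theorem continuousAt_doubleIntegrand {s ζ T t a b c d e f x z : ℂ} (hs : s ≠ 0) (hζ : ζ ≠ 0)
    (hT : T ≠ 0) (ht : t ≠ 0) (hx : ‖x‖ = 1) (hz : ‖z‖ = 1) (hs1 : ‖s‖ < 1) (hT1 : ‖T‖ < 1)
    (ht1 : ‖t‖ < 1) (ha1 : ‖q / a‖ < 1) (hb1 : ‖q / b‖ < 1) (hc1 : ‖q / c‖ < 1)
    (hd1 : ‖q / d‖ < 1) (he1 : ‖q / e‖ < 1) (hf1 : ‖q / f‖ < 1) (h : ThetaGeneric q s ζ T t) :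
    ContinuousAt (fun y : ℂ × ℂ => doubleIntegrand q s ζ T t a b c d e f y.1 y.2) (x, z) := by
  have hx0 : x ≠ 0 := norm_pos_iff.1 (by rw [hx]; exact one_pos)
  have hz0 : z ≠ 0 := norm_pos_iff.1 (by rw [hz]; exact one_pos)
  have c1 : ContinuousAt (fun y : ℂ × ℂ => y.1) (x, z) := continuousAt_fst
  have c2 : ContinuousAt (fun y : ℂ × ℂ => y.2) (x, z) := continuousAt_snd
  have cc : ∀ a : ℂ, ContinuousAt (fun _ : ℂ × ℂ => a) (x, z) := fun a => continuousAt_const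
  have hsz : s * z / (ζ * z) = s / ζ := by field_simp
  refine ContinuousAt.mul (ContinuousAt.mul (ContinuousAt.div (ContinuousAt.mul ?_ ?_)
    (ContinuousAt.mul ?_ ?_) ?_) ?_) (ContinuousAt.mul (ContinuousAt.div ?_
    ((ContinuousAt.mul ?_ ?_).mul ?_) ?_) (ContinuousAt.mul ?_ ?_))
  · exact continuousAt_theta_comp hq (((cc T).mul ((cc s).mul c2)).div (((cc ζ).mul c2).mul c1)
      (by simp [*])) (by simp [*])
  · exact continuousAt_theta_comp hq (c1.div ((cc ζ).mul c2) (by simp [*])) (by simp [*])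
  · exact continuousAt_theta_comp hq ((cc T).div ((cc ζ).mul c2) (by simp [*])) (by simp [*])
  · exact continuousAt_theta_comp hq (((cc s).mul c2).div ((cc ζ).mul c2) (by simp [*]))
      (by simp [*])
  · exact mul_ne_zero (h.inner z hz) (by simp only [hsz]; exact h.left)
  · exact ContinuousAt.comp' (differentiableAt_thetaKer hq (mul_ne_zero hs hT) ht
      (div_ne_zero hT (mul_ne_zero hζ hq0)) hz0).continuousAt c2
  · exact continuousAt_qPoch_comp hq (((cc _).mul c1).mul c2)
  · exact continuousAt_qPoch_comp hq (((cc s).mul c1).mul c2)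
  · exact continuousAt_qPoch_comp hq (((cc s).mul c1).div c2 hz0)
  · exact continuousAt_qPoch_comp hq (((cc s).mul c2).div c1 hx0)
  · refine mul_ne_zero (mul_ne_zero ?_ ?_) ?_ <;> exact qPoch_ne_zero_of_norm_lt hq (by simpa [hx, hz])
  · exact ContinuousAt.comp' (continuousAt_uWeight hq hx hT1 ha1 hb1 hc1) c1
  · exact ContinuousAt.comp' (continuousAt_uWeight hq hz ht1 hd1 he1 hf1) c2

/-- Evaluate the double integral in both orders, using `doubleIntegrand_swap` for the second; the
common constant `K / 2` cancels. -/
theorem sixConst_mul_circleMean {s ζ T t a b c d e f : ℂ} (hs : s ≠ 0) (hζ : ζ ≠ 0) (hT : T ≠ 0)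
    (ht : t ≠ 0) (ha : a ≠ 0) (hb : b ≠ 0) (hc : c ≠ 0) (hd : d ≠ 0) (he : e ≠ 0) (hf : f ≠ 0)
    (hs1 : ‖s‖ < 1) (hT1 : ‖T‖ < 1)
    (ht1 : ‖t‖ < 1) (ha1 : ‖q / a‖ < 1) (hb1 : ‖q / b‖ < 1) (hc1 : ‖q / c‖ < 1)
    (hd1 : ‖q / d‖ < 1) (he1 : ‖q / e‖ < 1) (hf1 : ‖q / f‖ < 1)
    (hbal : q ^ 2 * s ^ 2 * T = a * b * c) (hbal' : q ^ 2 * s ^ 2 * t = d * e * f)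
    (h : ThetaGeneric q s ζ T t) (h' : ThetaGeneric q s (1 / (q * ζ)) t T) :
    sixConst q s T a b c * circleMean
        (sixIntegrand q (T / (ζ * q)) (s * T) t (a / s) (b / s) (c / s) d e f) 1 =
      sixConst q s t d e f * circleMean
        (sixIntegrand q (t / (1 / (q * ζ) * q)) (s * t) T (d / s) (e / s) (f / s) a b c) 1 := by
  obtain ⟨K, hK0, hK⟩ := exists_circleMean_nrIntegrand_eq hq hq0
  have hζ' : 1 / (q * ζ) ≠ 0 := one_div_ne_zero (mul_ne_zero hq0 hζ)
  refine mul_left_cancel₀ (div_ne_zero hK0 two_ne_zero) ?_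
  rw [← mul_assoc, ← mul_assoc, ← circleMean_const_mul, ← circleMean_const_mul]
  trans circleMean (fun z => circleMean
    (fun x => doubleIntegrand q s ζ T t a b c d e f x z) 1) 1
  · refine circleMean_congr fun z hz => ?_
    rw [norm_one] at hz
    exact (circleMean_doubleIntegrand hq0 hq hK d e f hs hζ hT ha hb hc hz hT1 hs1 ha1 hb1 hc1
      hbal h).symm
  · rw [circleMean_swap fun z x hz hx => ?_]
    · refine circleMean_congr fun x hx => ?_
      rw [norm_one] at hx
      rw [← circleMean_doubleIntegrand hq0 hq hK a b c hs hζ' ht hd he hf hx ht1 hs1 hd1 he1 hf1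
        hbal' h']
      exact circleMean_congr fun z hz => doubleIntegrand_swap hq0 hs hζ hT ht hx
        (by simpa using hz) h h'
    · rw [norm_one] at hz hx
      exact ContinuousAt.comp' (f := Prod.swap) (x := (z, x)) (continuousAt_doubleIntegrand hq0 hq
        hs hζ hT ht hx hz hs1 hT1 ht1 ha1 hb1 hc1 hd1 he1 hf1 h) continuous_swap.continuousAt

/-- With `|q| = ρ¹²`, the modulus of `a` lies strictly between two consecutive powers of `|q|`, so
`a` is not a power of `q`. -/
theorem theta_ne_zero_of_zpow_lt {ρ : ℝ} (hρ0 : 0 < ρ) (hρ1 : ρ < 1) (hρ : ρ ^ 12 = ‖q‖) {a : ℂ}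
    (ha : a ≠ 0) {k l : ℤ} (n : ℤ) (h : ρ ^ k < ‖a‖ ∧ ‖a‖ < ρ ^ l) (hk : k ≤ 12 * (n + 1))
    (hl : 12 * n ≤ l) : theta q a ≠ 0 := by
  rw [theta_ne_zero_iff hq0 hq ha]
  rintro m rfl
  have e : ‖q ^ m‖ = ρ ^ (12 * m) := by
    rw [norm_zpow, ← hρ, zpow_mul]
    norm_cast
  rw [e, zpow_lt_zpow_iff_right_of_lt_one₀ hρ0 hρ1, zpow_lt_zpow_iff_right_of_lt_one₀ hρ0 hρ1] at h
  omega

omit hq0 hq in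
theorem zpow_lt_mul {ρ : ℝ} (hρ0 : 0 < ρ) {k l k' l' : ℤ} {x y : ℝ} (hx : ρ ^ k < x ∧ x < ρ ^ l)
    (hy : ρ ^ k' < y ∧ y < ρ ^ l') : ρ ^ (k + k') < x * y ∧ x * y < ρ ^ (l + l') := by
  have p : ∀ k : ℤ, 0 < ρ ^ k := fun k => zpow_pos hρ0 k
  rw [zpow_add₀ hρ0.ne', zpow_add₀ hρ0.ne']
  exact ⟨mul_lt_mul'' hx.1 hy.1 (p k).le (p k').le,
    mul_lt_mul'' hx.2 hy.2 ((p k).trans hx.1).le ((p k').trans hy.1).le⟩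

omit hq0 hq in
theorem zpow_lt_inv {ρ : ℝ} (hρ0 : 0 < ρ) {k l : ℤ} {x : ℝ} (hx : ρ ^ k < x ∧ x < ρ ^ l) :
    ρ ^ (-l) < x⁻¹ ∧ x⁻¹ < ρ ^ (-k) := by
  have p : ∀ k : ℤ, 0 < ρ ^ k := fun k => zpow_pos hρ0 k
  rw [zpow_neg, zpow_neg]
  exact ⟨inv_strictAnti₀ ((p k).trans hx.1) hx.2, inv_strictAnti₀ (p k) hx.1⟩

omit hq0 hq in
theorem zpow_lt_mul_zpow {ρ : ℝ} (hρ0 : 0 < ρ) {k l : ℤ} {x : ℝ} (m : ℤ)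
    (hx : ρ ^ k < x ∧ x < ρ ^ l) : ρ ^ (k + m) < x * ρ ^ m ∧ x * ρ ^ m < ρ ^ (l + m) := by
  rw [zpow_add₀ hρ0.ne', zpow_add₀ hρ0.ne']
  exact ⟨mul_lt_mul_of_pos_right hx.1 (zpow_pos hρ0 m),
    mul_lt_mul_of_pos_right hx.2 (zpow_pos hρ0 m)⟩

/-- The exponents `6` and `-18` are those of `|ζ| = |q|^{1/2}` and of its partner `1/(qζ)`. With `s,
T, t` between `ρ³` and `ρ`, every argument has an exponent in a window free of multiples of `12`. -/
theorem thetaGeneric_of_norm {ρ : ℝ} (hρ0 : 0 < ρ) (hρ1 : ρ < 1) (hρ : ρ ^ 12 = ‖q‖) {s ζ T t : ℂ}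
    (hs : ρ ^ (3 : ℤ) < ‖s‖ ∧ ‖s‖ < ρ ^ (1 : ℤ)) (hT : ρ ^ (3 : ℤ) < ‖T‖ ∧ ‖T‖ < ρ ^ (1 : ℤ))
    (ht : ρ ^ (3 : ℤ) < ‖t‖ ∧ ‖t‖ < ρ ^ (1 : ℤ)) {m : ℤ} (hζ : ‖ζ‖ = ρ ^ m)
    (hm : m = 6 ∨ m = -18) : ThetaGeneric q s ζ T t := by
  have n0 : ∀ {x : ℂ} {k : ℤ}, ρ ^ k < ‖x‖ → x ≠ 0 := fun h =>
    norm_pos_iff.1 ((zpow_pos hρ0 _).trans h)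
  have hζ0 : ζ ≠ 0 := norm_pos_iff.1 (by rw [hζ]; exact zpow_pos hρ0 m)
  have hqn : ‖q‖ = ρ ^ (12 : ℤ) := by rw [← hρ]; norm_cast
  have s0 := n0 hs.1
  have T0 := n0 hT.1
  have t0 := n0 ht.1
  have hζi : ‖ζ‖⁻¹ = ρ ^ (-m) := by rw [hζ, zpow_neg]
  have hqi : ‖q‖⁻¹ = ρ ^ (-12 : ℤ) := by rw [hqn, zpow_neg]
  refine ⟨fun z hz => ?_, ?_, fun z hz => ?_, ?_, ?_, ?_⟩
  · have hz0 : z ≠ 0 := norm_pos_iff.1 (by rw [hz]; exact one_pos)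
    refine theta_ne_zero_of_zpow_lt hq0 hq hρ0 hρ1 hρ (by positivity) (-1) (k := 3 + 3 + -12)
      (l := 1 + 1 + -12) ?_ (by norm_num) (by norm_num)
    rw [norm_div, norm_mul, norm_mul, hz, mul_one, div_eq_mul_inv, hqi]
    exact zpow_lt_mul_zpow hρ0 _ (zpow_lt_mul hρ0 hT hs)
  · refine theta_ne_zero_of_zpow_lt hq0 hq hρ0 hρ1 hρ (by positivity) (-1) (k := 3 + 3 + -12)
      (l := 1 + 1 + -12) ?_ (by norm_num) (by norm_num)
    rw [norm_div, norm_pow, sq, div_eq_mul_inv, hqi]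
    exact zpow_lt_mul_zpow hρ0 _ (zpow_lt_mul hρ0 hs hs)
  · have hz0 : z ≠ 0 := norm_pos_iff.1 (by rw [hz]; exact one_pos)
    have : ρ ^ (3 + -m) < ‖T / (ζ * z)‖ ∧ ‖T / (ζ * z)‖ < ρ ^ (1 + -m) := by
      rw [norm_div, norm_mul, hz, mul_one, div_eq_mul_inv, hζi]
      exact zpow_lt_mul_zpow hρ0 _ hT
    rcases hm with rfl | rfl
    · exact theta_ne_zero_of_zpow_lt hq0 hq hρ0 hρ1 hρ (by positivity) (-1) this (by norm_num)
        (by norm_num)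
    · exact theta_ne_zero_of_zpow_lt hq0 hq hρ0 hρ1 hρ (by positivity) 1 this (by norm_num)
        (by norm_num)
  · have : ρ ^ (3 + -m) < ‖s / ζ‖ ∧ ‖s / ζ‖ < ρ ^ (1 + -m) := by
      rw [norm_div, div_eq_mul_inv, hζi]
      exact zpow_lt_mul_zpow hρ0 _ hs
    rcases hm with rfl | rfl
    · exact theta_ne_zero_of_zpow_lt hq0 hq hρ0 hρ1 hρ (by positivity) (-1) this (by norm_num)
        (by norm_num)
    · exact theta_ne_zero_of_zpow_lt hq0 hq hρ0 hρ1 hρ (by positivity) 1 this (by norm_num)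
        (by norm_num)
  · have : ρ ^ (3 + m + 12) < ‖s * ζ * q‖ ∧ ‖s * ζ * q‖ < ρ ^ (1 + m + 12) := by
      rw [norm_mul, norm_mul, hζ, hqn]
      exact zpow_lt_mul_zpow hρ0 _ (zpow_lt_mul_zpow hρ0 _ hs)
    rcases hm with rfl | rfl
    · exact theta_ne_zero_of_zpow_lt hq0 hq hρ0 hρ1 hρ (by positivity) 1 this (by norm_num)
        (by norm_num)
    · exact theta_ne_zero_of_zpow_lt hq0 hq hρ0 hρ1 hρ (by positivity) (-1) this (by norm_num)
        (by norm_num)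
  · have : ρ ^ (3 + m + 12 + -1) < ‖t * ζ * q / T‖ ∧ ‖t * ζ * q / T‖ < ρ ^ (1 + m + 12 + -3) := by
      rw [norm_div, norm_mul, norm_mul, hζ, hqn, div_eq_mul_inv]
      exact zpow_lt_mul hρ0 (zpow_lt_mul_zpow hρ0 _ (zpow_lt_mul_zpow hρ0 _ ht))
        (zpow_lt_inv hρ0 hT)
    rcases hm with rfl | rfl
    · exact theta_ne_zero_of_zpow_lt hq0 hq hρ0 hρ1 hρ (by positivity) 1 this (by norm_num)
        (by norm_num)
    · exact theta_ne_zero_of_zpow_lt hq0 hq hρ0 hρ1 hρ (by positivity) (-1) this (by norm_num)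
        (by norm_num)

end

end TrigHyp
end

noncomputable section
namespace TrigHyp

/-! ### The `w`-symmetry of `U_t` on a circle -/

theorem sixIntegrand_swap (q μ T t a b c d e f z : ℂ) :
    sixIntegrand q μ T t a b c d e f z = sixIntegrand q μ t T d e f a b c z := by
  simp only [sixIntegrand, thetaKer, uWeight]
  rw [mul_comm T t, mul_comm (theta q (T / μ)), div_mul_div_comm, div_mul_div_comm]
  ring

/-- Rescaling by `r = √q` moves the circle `|z| = |q|^{1/2}` to the unit circle and replaces the
pairing `t, q/t` by a reciprocal one. -/
theorem integrandU_eq_sixIntegrand {q r : ℂ} (hr : r ^ 2 = q) (hr0 : r ≠ 0) {t : Fin 8 → ℂ}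
    (ht : ∀ j, t j ≠ 0) {μ z : ℂ} (hμ : μ ≠ 0) (hz : z ≠ 0) :
    integrandU q μ t (r * z) = 2 * sixIntegrand q (μ / r) (t 0 / r) (t 7 / r) (r / t 1) (r / t 2)
      (r / t 3) (r / t 4) (r / t 5) (r / t 6) z := by
  have hq0 : q ≠ 0 := by rw [← hr]; exact pow_ne_zero 2 hr0
  simp only [integrandU, sixIntegrand, thetaKer, uWeight, endIdx, midIdx]
  rw [Finset.prod_pair (by decide), Finset.prod_insert (by decide), Finset.prod_insert (by decide),
    Finset.prod_insert (by decide), Finset.prod_insert (by decide), Finset.prod_insert (by decide),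
    Finset.prod_singleton]
  have e1 : ∀ j, qPoch q (r * z / t j) = qPoch q (r / t j * z) := fun j => by congr 1; ring
  have e2 : ∀ j, qPoch q (t j * (r * z)) = qPoch q (q / (r / t j) * z) := fun j => by
    have := ht j
    congr 1; rw [← hr]; field_simp
  have e3 : ∀ j, qPoch q (t j * (r * z) / q) = qPoch q (t j / r * z) := fun j => by
    congr 1; rw [← hr]; field_simp
  have e4 : ∀ j, qPoch q (t j / (r * z)) = qPoch q (t j / r / z) := fun j => by
    rw [div_div]
  rw [show t 0 * t 7 / (μ * (r * z)) = t 0 / r * (t 7 / r) / (μ / r * z) by field_simp,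
    show r * z / μ = z / (μ / r) by field_simp, show (r * z) ^ 2 / q = z ^ 2 by
      rw [← hr]; field_simp,
    show t 0 / μ = t 0 / r / (μ / r) by field_simp, show t 7 / μ = t 7 / r / (μ / r) by field_simp]
  simp only [e1, e2, e3, e4]
  ring

/-- The region of parameters in which the `w`-symmetry of `U_t` is derived. -/
structure InURegion (r : ℂ) (ρ : ℝ) (t : Fin 8 → ℂ) (w : ℂ) : Prop where
  first : ρ ^ (3 : ℤ) < ‖w * t 0 / r‖ ∧ ‖w * t 0 / r‖ < ρ ^ (1 : ℤ)
  last : ρ ^ (3 : ℤ) < ‖t 7 / r‖ ∧ ‖t 7 / r‖ < ρ ^ (1 : ℤ)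
  scale : ρ ^ (3 : ℤ) < ‖w⁻¹‖ ∧ ‖w⁻¹‖ < ρ ^ (1 : ℤ)
  one : ‖r * w * t 1‖ < 1
  two : ‖r * w * t 2‖ < 1
  three : ‖r * w * t 3‖ < 1
  four : ‖r * t 4‖ < 1
  five : ‖r * t 5‖ < 1
  six : ‖r * t 6‖ < 1

theorem paramSpace_ne_zero {t : Fin 8 → ℂ} (ht : t ∈ paramSpace) (j : Fin 8) : t j ≠ 0 := by
  have : ∏ j, t j ≠ 0 := by rw [show ∏ j, t j = 1 from ht]; exact one_ne_zero
  exact Finset.prod_ne_zero_iff.1 this j (Finset.mem_univ j)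

/-- The `w`-symmetry of the integrals `U_t` over a circle. -/
theorem circleMean_integrandU_wAct {q : ℂ} (hq0 : q ≠ 0) (hq : ‖q‖ < 1) {r : ℂ} (hr : r ^ 2 = q)
    {ρ : ℝ} (hρ0 : 0 < ρ) (hρ1 : ρ < 1) (hρ : ρ ^ 12 = ‖q‖) {t : Fin 8 → ℂ} (ht : t ∈ paramSpace)
    {w : ℂ} (hw : w ^ 2 * (t 0 * t 1 * t 2 * t 3) = 1) (h : InURegion r ρ t w) :
    ∃ μ₁ μ₂ : ℂ, (μ₁ ≠ 0 ∧ theta q (t 0 / μ₁) * theta q (t 7 / μ₁) ≠ 0) ∧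
      (μ₂ ≠ 0 ∧ theta q (wAct w t 0 / μ₂) * theta q (wAct w t 7 / μ₂) ≠ 0) ∧
      circleMean (integrandU q μ₁ t) r = circleMean (integrandU q μ₂ (wAct w t)) r *
        ((qPoch q (1 / (t 1 * t 2)) * qPoch q (1 / (t 1 * t 3)) * qPoch q (1 / (t 2 * t 3)) *
          qPoch q (1 / (t 4 * t 5)) * qPoch q (1 / (t 4 * t 6)) * qPoch q (1 / (t 5 * t 6))) /
        (qPoch q (t 0 * t 1) * qPoch q (t 0 * t 2) * qPoch q (t 0 * t 3) *
          qPoch q (t 4 * t 7) * qPoch q (t 5 * t 7) * qPoch q (t 6 * t 7))) := by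
  have ht' : t 0 * t 1 * t 2 * t 3 * t 4 * t 5 * t 6 * t 7 = 1 := by
    have : ∏ j, t j = 1 := ht
    rwa [Fin.prod_univ_eight] at this
  have h0 := paramSpace_ne_zero ht
  have hr0 : r ≠ 0 := fun h => hq0 (by rw [← hr, h]; simp)
  have hw0 : w ≠ 0 := fun h => by simp [h] at hw
  have hw' : ∀ j, wAct w t j ≠ 0 := fun j => by
    unfold wAct
    split_ifs
    · exact mul_ne_zero hw0 (h0 j)
    · exact mul_ne_zero (inv_ne_zero hw0) (h0 j)
  obtain ⟨ζ, hζ⟩ : ∃ ζ : ℂ, ‖ζ‖ = ρ ^ (6 : ℤ) := ⟨((ρ ^ (6 : ℤ) : ℝ) : ℂ), by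
    rw [Complex.norm_real, Real.norm_of_nonneg (zpow_pos hρ0 6).le]⟩
  have hζ0 : ζ ≠ 0 := norm_pos_iff.1 (by rw [hζ]; exact zpow_pos hρ0 6)
  have hζ' : ‖1 / (q * ζ)‖ = ρ ^ (-18 : ℤ) := by
    rw [norm_div, norm_mul, hζ, ← hρ, norm_one, one_div, zpow_neg]
    norm_cast
    rw [← pow_add]
  have g := thetaGeneric_of_norm hq0 hq hρ0 hρ1 hρ h.scale h.first h.last hζ (Or.inl rfl)
  have g' := thetaGeneric_of_norm hq0 hq hρ0 hρ1 hρ h.scale h.last h.first hζ' (Or.inr rfl)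
  have hlt : ∀ {x : ℂ}, ‖x‖ < ρ ^ (1 : ℤ) → ‖x‖ < 1 := fun hx => hx.trans (by rwa [zpow_one])
  have T1 := hlt h.first.2
  have t1 := hlt h.last.2
  have s1 := hlt h.scale.2
  have hq1 : ∀ {x : ℂ}, q / (r / x) = r * x := fun {x} => by
    rw [← hr, div_div_eq_mul_div]; field_simp
  have b3 : t 1 * t 2 * t 3 = (w ^ 2 * t 0)⁻¹ := eq_inv_of_mul_eq_one_left (by rw [← hw]; ring)
  have b4 : t 4 * t 5 * t 6 * t 7 = w ^ 2 := by
    refine mul_left_cancel₀ (mul_ne_zero (mul_ne_zero (mul_ne_zero (h0 0) (h0 1)) (h0 2)) (h0 3)) ?_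
    linear_combination ht' - hw
  have n0 := h0 0
  have n1 := h0 1
  have n2 := h0 2
  have n3 := h0 3
  have n4 := h0 4
  have n5 := h0 5
  have n6 := h0 6
  have n7 := h0 7
  -- The scaling parameter is `s = w⁻¹`. Both balancing conditions are consequences of `w² t₀ t₁ t₂
  -- t₃ = 1` and of the product of all entries being `1`.
  have key := sixConst_mul_circleMean hq0 hq (s := w⁻¹) (ζ := ζ) (T := w * t 0 / r) (t := t 7 / r)
    (a := r / (w * t 1)) (b := r / (w * t 2)) (c := r / (w * t 3)) (d := r / t 4) (e := r / t 5)
    (f := r / t 6) (by positivity) hζ0 (by positivity) (by positivity) (by positivity)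
    (by positivity) (by positivity) (by positivity) (by positivity) (by positivity)
    s1 T1 t1 (by rw [hq1, ← mul_assoc]; exact h.one) (by rw [hq1, ← mul_assoc]; exact h.two)
    (by rw [hq1, ← mul_assoc]; exact h.three) (by rw [hq1]; exact h.four)
    (by rw [hq1]; exact h.five) (by rw [hq1]; exact h.six)
    (by rw [← hr]; field_simp; linear_combination hw)
    (by rw [← hr]; field_simp; linear_combination b4) g g'
  -- The auxiliary parameters are dictated by the two orders of integration. Their admissibility is
  -- given by the `right` and `outer` conditions of `ThetaGeneric`.
  set μ₁ := r * (w * t 0 / r / (ζ * q)) with hμ₁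
  set μ₂ := r * (t 7 / r / (1 / (q * ζ) * q)) with hμ₂
  have hμ₁0 : μ₁ ≠ 0 := by rw [hμ₁]; positivity
  have hμ₂0 : μ₂ ≠ 0 := mul_ne_zero hr0 (div_ne_zero (div_ne_zero n7 hr0)
    (mul_ne_zero (one_div_ne_zero (mul_ne_zero hq0 hζ0)) hq0))
  have v : ∀ j : Fin 8, wAct w t j = if (j : ℕ) < 4 then w * t j else w⁻¹ * t j := fun _ => rfl
  have v0 : wAct w t 0 = w * t 0 := by simp [v]
  have v1 : wAct w t 1 = w * t 1 := by simp [v]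
  have v2 : wAct w t 2 = w * t 2 := by simp [v]
  have v3 : wAct w t 3 = w * t 3 := by simp [v]
  have v4 : wAct w t 4 = w⁻¹ * t 4 := by simp [v]
  have v5 : wAct w t 5 = w⁻¹ * t 5 := by simp [v]
  have v6 : wAct w t 6 = w⁻¹ * t 6 := by simp [v]
  have v7 : wAct w t 7 = w⁻¹ * t 7 := by simp [v]
  have mean : ∀ {t : Fin 8 → ℂ} {μ : ℂ}, (∀ j, t j ≠ 0) → μ ≠ 0 → circleMean (integrandU q μ t) r =
      2 * circleMean (sixIntegrand q (μ / r) (t 0 / r) (t 7 / r) (r / t 1) (r / t 2)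
      (r / t 3) (r / t 4) (r / t 5) (r / t 6)) 1 := fun {t μ} ht hμ => by
    rw [← mul_one r, circleMean_mul, mul_one, ← circleMean_const_mul]
    exact circleMean_congr fun z hz => integrandU_eq_sixIntegrand hr hr0 ht hμ
      (norm_pos_iff.1 (by rw [hz]; simp))
  refine ⟨μ₁, μ₂, ⟨hμ₁0, mul_ne_zero ?_ ?_⟩, ⟨hμ₂0, mul_ne_zero ?_ ?_⟩, ?_⟩
  · rw [show t 0 / μ₁ = w⁻¹ * ζ * q by rw [hμ₁]; field_simp]; exact g.right
  · rw [show t 7 / μ₁ = t 7 / r * ζ * q / (w * t 0 / r) by rw [hμ₁]; field_simp]; exact g.outer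
  · rw [v0, show w * t 0 / μ₂ = w * t 0 / r * (1 / (q * ζ)) * q / (t 7 / r) by
      rw [hμ₂]; field_simp]
    exact g'.outer
  · rw [v7, show w⁻¹ * t 7 / μ₂ = w⁻¹ * (1 / (q * ζ)) * q by rw [hμ₂]; field_simp]; exact g'.right
  · rw [mean h0 hμ₁0, mean hw' hμ₂0, v0, v1, v2, v3, v4, v5, v6, v7]
    have sw := fun μ T t a b c d e f => funext (sixIntegrand_swap q μ T t a b c d e f)
    rw [sw (μ₂ / r)]
    rw [show w⁻¹ * (w * t 0 / r) = t 0 / r by field_simp,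
      show r / (w * t 1) / w⁻¹ = r / t 1 by field_simp,
      show r / (w * t 2) / w⁻¹ = r / t 2 by field_simp,
      show r / (w * t 3) / w⁻¹ = r / t 3 by field_simp,
      show w * t 0 / r / (ζ * q) = μ₁ / r by rw [hμ₁]; field_simp,
      show t 7 / r / (1 / (q * ζ) * q) = μ₂ / r by rw [hμ₂]; field_simp,
      show w⁻¹ * (t 7 / r) = w⁻¹ * t 7 / r by ring,
      show r / t 4 / w⁻¹ = r / (w⁻¹ * t 4) by field_simp,
      show r / t 5 / w⁻¹ = r / (w⁻¹ * t 5) by field_simp,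
      show r / t 6 / w⁻¹ = r / (w⁻¹ * t 6) by field_simp] at key
    generalize circleMean (sixIntegrand q (μ₁ / r) _ _ _ _ _ _ _ _) 1 = I₁ at *
    generalize circleMean (sixIntegrand q (μ₂ / r) _ _ _ _ _ _ _ _) 1 = I₂ at *
    simp only [sixConst] at key
    have lt2 : ∀ {x y : ℂ}, ‖x‖ < 1 → ‖y‖ < 1 → ‖x * y‖ < 1 := fun hx hy => by
      rw [norm_mul]; exact mul_lt_one_of_nonneg_of_lt_one_right hx.le (norm_nonneg _) hy
    have pn : ∀ {x : ℂ}, ‖x‖ < 1 → qPoch q x ≠ 0 := fun hx => qPoch_ne_zero_of_norm_lt hq hx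
    have f1 : ∀ {x y : ℂ}, r / x * (r / y) / q = 1 / (x * y) := fun {x y} => by
      rw [← hr]; field_simp
    rw [f1, f1, f1, f1, f1, f1] at key
    have c1 : w * t 0 / r * (r * w * t 1) = 1 / (t 2 * t 3) := by
      field_simp; linear_combination hw
    have c2 : w * t 0 / r * (r * w * t 2) = 1 / (t 1 * t 3) := by
      field_simp; linear_combination hw
    have c3 : w * t 0 / r * (r * w * t 3) = 1 / (t 1 * t 2) := by
      field_simp; linear_combination hw
    have c4 : t 7 / r * (r * t 4) = t 4 * t 7 := by field_simp
    have c5 : t 7 / r * (r * t 5) = t 5 * t 7 := by field_simp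
    have c6 : t 7 / r * (r * t 6) = t 6 * t 7 := by field_simp
    have c7 : w⁻¹ * (w⁻¹ * (w * t 0 / r * (r * w * t 1))) = t 0 * t 1 := by field_simp
    have c8 : w⁻¹ * (w⁻¹ * (w * t 0 / r * (r * w * t 2))) = t 0 * t 2 := by field_simp
    have c9 : w⁻¹ * (w⁻¹ * (w * t 0 / r * (r * w * t 3))) = t 0 * t 3 := by field_simp
    have d1 := pn (lt2 T1 h.one)
    have d2 := pn (lt2 T1 h.two)
    have d3 := pn (lt2 T1 h.three)
    have d4 := pn (lt2 t1 h.four)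
    have d5 := pn (lt2 t1 h.five)
    have d6 := pn (lt2 t1 h.six)
    have d7 := pn (lt2 s1 (lt2 s1 (lt2 T1 h.one)))
    have d8 := pn (lt2 s1 (lt2 s1 (lt2 T1 h.two)))
    have d9 := pn (lt2 s1 (lt2 s1 (lt2 T1 h.three)))
    have d10 := pn (lt2 s1 s1)
    rw [c7] at d7
    rw [c8] at d8
    rw [c9] at d9
    rw [c1] at d1
    rw [c2] at d2
    rw [c3] at d3
    rw [c4] at d4
    rw [c5] at d5
    rw [c6] at d6
    rw [show q * (w * t 0 / r) / (r / (w * t 1)) = 1 / (t 2 * t 3) by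
        rw [← c1, ← hr]; field_simp,
      show q * (w * t 0 / r) / (r / (w * t 2)) = 1 / (t 1 * t 3) by
        rw [← c2, ← hr]; field_simp,
      show q * (w * t 0 / r) / (r / (w * t 3)) = 1 / (t 1 * t 2) by
        rw [← c3, ← hr]; field_simp,
      show q * (t 7 / r) / (r / t 4) = t 4 * t 7 by rw [← hr]; field_simp,
      show q * (t 7 / r) / (r / t 5) = t 5 * t 7 by rw [← hr]; field_simp,
      show q * (t 7 / r) / (r / t 6) = t 6 * t 7 by rw [← hr]; field_simp,
      show 1 / (w * t 1 * (w * t 2)) = t 0 * t 3 by field_simp; linear_combination -hw,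
      show 1 / (w * t 1 * (w * t 3)) = t 0 * t 2 by field_simp; linear_combination -hw,
      show 1 / (w * t 2 * (w * t 3)) = t 0 * t 1 by field_simp; linear_combination -hw,
      sq] at key
    generalize qPoch q (1 / (t 2 * t 3)) = x1 at *
    generalize qPoch q (1 / (t 1 * t 3)) = x2 at *
    generalize qPoch q (1 / (t 1 * t 2)) = x3 at *
    generalize qPoch q (1 / (t 4 * t 5)) = x4 at *
    generalize qPoch q (1 / (t 4 * t 6)) = x5 at *
    generalize qPoch q (1 / (t 5 * t 6)) = x6 at *
    generalize qPoch q (t 0 * t 1) = y1 at *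
    generalize qPoch q (t 0 * t 2) = y2 at *
    generalize qPoch q (t 0 * t 3) = y3 at *
    generalize qPoch q (t 4 * t 7) = y4 at *
    generalize qPoch q (t 5 * t 7) = y5 at *
    generalize qPoch q (t 6 * t 7) = y6 at *
    generalize qPoch q (w⁻¹ * w⁻¹) = y7 at *
    field_simp at key ⊢
    linear_combination key

end TrigHyp
end

noncomputable section
namespace TrigHyp

/-! ### Curves in the parameter space -/

/-- The curve `u ↦ (t_j exp (u d_j))_j`. -/
def expCurve (t d : Fin 8 → ℂ) (u : ℂ) : Fin 8 → ℂ := fun j => t j * Complex.exp (u * d j)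

theorem expCurve_zero (t d : Fin 8 → ℂ) : expCurve t d 0 = t := by
  funext j; simp [expCurve]

theorem expCurve_mem_paramSpace {t d : Fin 8 → ℂ} (ht : t ∈ paramSpace) (hd : ∑ j, d j = 0)
    (u : ℂ) : expCurve t d u ∈ paramSpace := by
  change ∏ j, t j * Complex.exp (u * d j) = 1
  rw [Finset.prod_mul_distrib, show ∏ j, t j = 1 from ht, ← Complex.exp_sum, ← Finset.mul_sum, hd]
  simp

theorem analyticAt_expCurve (t d : Fin 8 → ℂ) (u : ℂ) : AnalyticAt ℂ (expCurve t d) u :=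
  analyticAt_pi_iff.2 fun _ => analyticAt_const.mul (analyticAt_id.mul analyticAt_const).cexp

theorem continuous_expCurve (t d : Fin 8 → ℂ) : Continuous (expCurve t d) :=
  continuous_iff_continuousAt.2 fun u => (analyticAt_expCurve t d u).continuousAt

theorem countable_setOf_mul_exp_eq_one {C δ : ℂ} (h : C * Complex.exp δ ≠ 1) :
    {u : ℂ | C * Complex.exp (u * δ) = 1}.Countable := by
  rcases eq_or_ne δ 0 with rfl | hδ
  · simp only [Complex.exp_zero, mul_one] at h
    simp [h]
  rcases eq_or_ne C 0 with rfl | hC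
  · simp
  refine (Set.countable_range fun n : ℤ =>
    (Complex.log C⁻¹ + n * (2 * Real.pi * Complex.I)) / δ).mono fun u hu => ?_
  have : Complex.exp (u * δ) = Complex.exp (Complex.log C⁻¹) := by
    rw [Complex.exp_log (inv_ne_zero hC)]
    exact eq_inv_of_mul_eq_one_right hu
  obtain ⟨n, hn⟩ := Complex.exp_eq_exp_iff_exists_int.1 this
  exact ⟨n, by simp only [← hn]; field_simp⟩

/-! ### Families of contour integrals over the parameter space -/

/-- The parameters `t` for which the points `t_i qⁿ` (`i ∈ I`) differ from the points
`(c_k t_k qⁿ)⁻¹` (`k ∈ J`). -/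
def separable (q : ℂ) (I J : Finset (Fin 8)) (c : Fin 8 → ℂ) : Set (Fin 8 → ℂ) :=
  {t | t ∈ paramSpace ∧ ∀ i ∈ I, ∀ k ∈ J, ∀ n : ℕ, t i * (c k * t k) * q ^ n ≠ 1}

section

variable {q : ℂ} {I J : Finset (Fin 8)} {c : Fin 8 → ℂ}

theorem separable_eq_inter (hq : ‖q‖ < 1) : separable q I J c =
    {t | ∏ i ∈ I, ∏ k ∈ J, qPoch q (t i * (c k * t k)) ≠ 0} ∩ paramSpace := by
  ext t
  simp only [separable, Set.mem_ofPred_eq, Set.mem_inter_iff, Finset.prod_ne_zero_iff,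
    qPoch_ne_zero_iff hq]
  exact and_comm

theorem isOpen_setOf_prod_qPoch_ne_zero (hq : ‖q‖ < 1) :
    IsOpen {t : Fin 8 → ℂ | ∏ i ∈ I, ∏ k ∈ J, qPoch q (t i * (c k * t k)) ≠ 0} := by
  refine isOpen_ne_fun (continuous_finsetProd _ fun i _ => continuous_finsetProd _ fun k _ =>
    (continuous_qPoch hq).comp ?_) continuous_const
  fun_prop

theorem separable_of_norm_lt (hq : ‖q‖ < 1) {t : Fin 8 → ℂ} (ht : t ∈ paramSpace)
    (h : ∀ i ∈ I, ∀ k ∈ J, ‖t i * (c k * t k)‖ < 1) : t ∈ separable q I J c := by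
  refine ⟨ht, fun i hi k hk n hn => ?_⟩
  have := congr_arg norm hn
  rw [norm_mul, norm_one, norm_pow] at this
  have h2 : ‖q‖ ^ n ≤ 1 := pow_le_one₀ (norm_nonneg _) hq.le
  have h3 := h i hi k hk
  nlinarith [norm_nonneg (t i * (c k * t k)), norm_nonneg q]

/-- Being non-separable means satisfying one of countably many equations `C exp(uδ) = 1`. None of
them holds identically, since all fail at `u = 1`, so each has countably many solutions. -/
theorem countable_expCurve_notMem_separable {t d : Fin 8 → ℂ}
    (ht : t ∈ paramSpace) (hd : ∑ j, d j = 0) (h : expCurve t d 1 ∈ separable q I J c) :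
    {u | expCurve t d u ∉ separable q I J c}.Countable := by
  have h1 : {u | expCurve t d u ∉ separable q I J c} ⊆ ⋃ i ∈ I, ⋃ k ∈ J, ⋃ n : ℕ,
      {u | t i * (c k * t k) * q ^ n * Complex.exp (u * (d i + d k)) = 1} := by
    intro u hu
    by_contra hu'
    refine hu ⟨expCurve_mem_paramSpace ht hd u, fun i hi k hk n hn => hu' ?_⟩
    simp only [Set.mem_iUnion]
    refine ⟨i, hi, k, hk, n, ?_⟩
    rw [Set.mem_ofPred_eq, ← hn, mul_add, Complex.exp_add]
    simp only [expCurve]; ring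
  refine Set.Countable.mono h1 (Set.Countable.biUnion (Finset.countable_toSet I) fun i hi =>
    Set.Countable.biUnion (Finset.countable_toSet J) fun k hk => Set.countable_iUnion fun n =>
      countable_setOf_mul_exp_eq_one fun h' => h.2 i hi k hk n ?_)
  simp only [expCurve, one_mul]
  rw [Complex.exp_add] at h'
  linear_combination h'

theorem mem_closure_separable {t d : Fin 8 → ℂ} (ht : t ∈ paramSpace) (hd : ∑ j, d j = 0)
    (h : expCurve t d 1 ∈ separable q I J c) : t ∈ closure (separable q I J c) := by
  have h0 : (0 : ℂ) ∈ closure {u | expCurve t d u ∉ separable q I J c}ᶜ :=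
    (countable_expCurve_notMem_separable ht hd h).dense_compl ℂ 0
  have := image_closure_subset_closure_image (continuous_expCurve t d) ⟨0, h0, rfl⟩
  rw [expCurve_zero] at this
  refine closure_mono ?_ this
  rintro _ ⟨u, hu, rfl⟩
  simpa using hu

/-- `F t` is, locally in `t`, a contour integral of a function whose numerator depends
holomorphically on `t`. -/
def IsContourFamily (q : ℂ) (I J : Finset (Fin 8)) (c : Fin 8 → ℂ) (F : (Fin 8 → ℂ) → ℂ) : Prop :=
  ∀ τ ∈ paramSpace, ∃ (H : (Fin 8 → ℂ) × ℂ → ℂ) (O : Set (Fin 8 → ℂ)), IsOpen O ∧ τ ∈ O ∧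
    (∀ t ∈ O, ∀ k, t k ≠ 0) ∧ (∀ t ∈ O, ∀ z, z ≠ 0 → AnalyticAt ℂ H (t, z)) ∧
    ∀ t ∈ O, t ∈ separable q I J c → ∃ γ, Separates q I J t (fun k => c k * t k) γ ∧
      F t = contourIntegral (fun z => H (t, z) /
        ((∏ i ∈ I, qPoch q (t i / z)) * ∏ k ∈ J, qPoch q (c k * t k * z))) γ

/-- The denominator is the finite product of factors `1 - t_i c_k t_k qⁿ` from the Bézout argument.
It is nonzero at every separable parameter, which gives holomorphy there as well as meromorphy
elsewhere. -/
theorem IsContourFamily.exists_prod_mul_eq (hq0 : q ≠ 0) (hq : ‖q‖ < 1) (hc : ∀ k, c k ≠ 0)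
    {F : (Fin 8 → ℂ) → ℂ} (hF : IsContourFamily q I J c F) {τ : Fin 8 → ℂ} (hτ : τ ∈ paramSpace) :
    ∃ f g : (Fin 8 → ℂ) → ℂ, AnalyticAt ℂ f τ ∧ AnalyticAt ℂ g τ ∧
      (∀ t ∈ separable q I J c, g t ≠ 0) ∧ ∀ᶠ t in 𝓝 τ, t ∈ separable q I J c → g t * F t = f t := by
  obtain ⟨H, O, hO, hτO, h0, hH, hγ⟩ := hF τ hτ
  have hp : ∀ j (t : Fin 8 → ℂ), AnalyticAt ℂ (fun t : Fin 8 → ℂ => t j) t := fun j t =>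
    (ContinuousLinearMap.proj (R := ℂ) (φ := fun _ : Fin 8 => ℂ) j).analyticAt t
  have hp' : ∀ k (t : Fin 8 → ℂ), AnalyticAt ℂ (fun t : Fin 8 → ℂ => c k * t k) t := fun k t =>
    analyticAt_const.mul (hp k t)
  obtain ⟨N, f, hf, hfe⟩ := exists_analyticAt_prod_mul_contourIntegral hq0 hq I J
    (fun i t => t i) (fun k t => c k * t k) H hO (fun t _ i _ => hp i t)
    (fun t _ k _ => hp' k t) (fun t ht k _ => mul_ne_zero (hc k) (h0 t ht k))
    hH hτO
  refine ⟨f, fun t => ∏ k ∈ J ×ˢ Finset.range N, ∏ i ∈ I ×ˢ Finset.range N,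
        (1 - t i.1 * (c k.1 * t k.1) * q ^ (i.2 + k.2)), hf, ?_, ?_, ?_⟩
  · exact Finset.analyticAt_fun_prod _ fun k _ => Finset.analyticAt_fun_prod _ fun i _ =>
      analyticAt_const.sub (((hp _ _).mul (analyticAt_const.mul (hp _ _))).mul analyticAt_const)
  · intro t ht
    refine Finset.prod_ne_zero_iff.2 fun k hk => Finset.prod_ne_zero_iff.2 fun i hi => ?_
    exact sub_ne_zero.2 (ht.2 _ (Finset.mem_product.1 hi).1 _ (Finset.mem_product.1 hk).1 _).symm
  · filter_upwards [hfe, hO.mem_nhds hτO] with t ht htO htD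
    obtain ⟨γ, hs, he⟩ := hγ t htO htD
    rw [he]
    exact ht γ hs

theorem IsContourFamily.representsMeromorphic (hq0 : q ≠ 0) (hq : ‖q‖ < 1) (hc : ∀ k, c k ≠ 0)
    {F : (Fin 8 → ℂ) → ℂ} (hF : IsContourFamily q I J c F)
    (hd : paramSpace ⊆ closure (separable q I J c)) :
    RepresentsMeromorphic (separable q I J c) F where
  isOpen := ⟨_, isOpen_setOf_prod_qPoch_ne_zero hq, separable_eq_inter hq⟩
  dense := hd
  holomorphic := fun τ hτ => by
    obtain ⟨f, g, hf, hg, hg0, h⟩ := hF.exists_prod_mul_eq hq0 hq hc hτ.1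
    refine ⟨fun t => f t / g t, hf.div hg (hg0 τ hτ), ?_⟩
    have hO : ∀ᶠ t in 𝓝[paramSpace] τ, t ∈ separable q I J c := by
      rw [separable_eq_inter hq] at hτ ⊢
      exact Filter.inter_mem (mem_nhdsWithin_of_mem_nhds
        ((isOpen_setOf_prod_qPoch_ne_zero hq).mem_nhds hτ.1)) self_mem_nhdsWithin
    filter_upwards [hO, mem_nhdsWithin_of_mem_nhds h] with t ht h'
    rw [← h' ht, mul_div_cancel_left₀ _ (hg0 t ht)]
  quotient := fun τ hτ => by
    obtain ⟨f, g, hf, hg, hg0, h⟩ := hF.exists_prod_mul_eq hq0 hq hc hτ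
    refine ⟨f, g, hf, hg, ?_, ?_⟩
    · rw [frequently_nhdsWithin_iff]
      exact (mem_closure_iff_frequently.1 (hd hτ)).mono fun t ht => ⟨hg0 t ht, ht.1⟩
    · rw [eventually_nhdsWithin_iff]
      exact h

/-- Analytic continuation along a curve from a point where an identity is known. -/
theorem eq_mul_of_eq_near_one {D : Set (Fin 8 → ℂ)} {F : (Fin 8 → ℂ) → ℂ}
    (hF : RepresentsMeromorphic D F) {x y : ℂ → Fin 8 → ℂ} {R : ℂ → ℂ}
    (hx : ∀ u, AnalyticAt ℂ x u) (hy : ∀ u, AnalyticAt ℂ y u)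
    (hxp : ∀ u, x u ∈ paramSpace) (hyp : ∀ u, y u ∈ paramSpace)
    (hxc : {u | x u ∉ D}.Countable) (hyc : {u | y u ∉ D}.Countable)
    (hR : ∀ u, x u ∈ D → AnalyticAt ℂ R u)
    (h1 : x 1 ∈ D ∧ y 1 ∈ D) (h : ∀ᶠ u in 𝓝 1, F (x u) = F (y u) * R u)
    (h0 : x 0 ∈ D ∧ y 0 ∈ D) : F (x 0) = F (y 0) * R 0 := by
  have hA : ∀ {w : ℂ → Fin 8 → ℂ} {u : ℂ}, AnalyticAt ℂ w u → (∀ u, w u ∈ paramSpace) → w u ∈ D →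
      AnalyticAt ℂ (fun u => F (w u)) u := fun {w u} hw hwp hu => by
    obtain ⟨f, hf, he⟩ := hF.holomorphic _ hu
    refine (hf.fun_comp hw).congr ?_
    have : Tendsto w (𝓝 u) (𝓝[paramSpace] (w u)) :=
      tendsto_nhdsWithin_iff.2 ⟨hw.continuousAt, Eventually.of_forall hwp⟩
    filter_upwards [this.eventually he] with v hv using hv.symm
  have hW : {u | x u ∈ D ∧ y u ∈ D} = ({u | x u ∉ D} ∪ {u | y u ∉ D})ᶜ := by
    ext u; simp
  -- The domain is the plane with a countable set removed, which is connected because the plane has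
  -- real dimension two.
  have hconn : IsPreconnected {u | x u ∈ D ∧ y u ∈ D} := by
    rw [hW]
    refine ((hxc.union hyc).isConnected_compl_of_one_lt_rank ?_).isPreconnected
    rw [← Module.finrank_eq_rank, Complex.finrank_real_complex]; norm_num
  exact AnalyticOnNhd.eqOn_of_preconnected_of_eventuallyEq
    (f := fun u => F (x u)) (g := fun u => F (y u) * R u)
    (fun u hu => hA (hx u) hxp hu.1) (fun u hu => (hA (hy u) hyp hu.2).mul (hR u hu.1))
    hconn h1 h h0

end

end TrigHyp
end

noncomputable section
namespace TrigHyp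

/-! ### Admissible contours as separating curves -/

theorem isDeformedCircle_iff_separates {ι κ : Type*} {q : ℂ} {I : Finset ι} {J : Finset κ}
    {α : ι → ℂ} {β : κ → ℂ} {γ : ℝ → ℂ} :
    IsDeformedCircle γ {p | ∃ i ∈ I, ∃ n : ℕ, p = α i * q ^ n}
      {p | ∃ k ∈ J, ∃ n : ℕ, p = (β k * q ^ n)⁻¹} ↔ Separates q I J α β γ :=
  ⟨fun h => ⟨h.curve, h.origin, fun i hi n => h.includes _ ⟨i, hi, n, rfl⟩,
    fun k hk n => h.excludes _ ⟨k, hk, n, rfl⟩⟩,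
   fun h => ⟨h.curve, h.origin, by rintro _ ⟨i, hi, n, rfl⟩; exact h.inside i hi n,
    by rintro _ ⟨k, hk, n, rfl⟩; exact h.outside k hk n⟩⟩

theorem exists_separates {q : ℂ} (hq0 : q ≠ 0) (hq : ‖q‖ < 1) {I J : Finset (Fin 8)}
    {c : Fin 8 → ℂ} (hc : ∀ k, c k ≠ 0) {t : Fin 8 → ℂ} (ht : t ∈ separable q I J c) :
    ∃ γ, Separates q I J t (fun k => c k * t k) γ := by
  have h0 := paramSpace_ne_zero ht.1
  obtain ⟨γ, hγ⟩ := exists_isDeformedCircle hq0 hq I J t (fun k => c k * t k) (fun i _ => h0 i)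
    (fun k _ => mul_ne_zero (hc k) (h0 k)) ht.2
  exact ⟨γ, isDeformedCircle_iff_separates.1 hγ⟩

/-! ### The integral `S_t` -/

theorem genericS_eq_separable (q : ℂ) : genericS q = separable q midIdx midIdx fun _ => 1 := by
  ext t; simp [genericS, separable]

theorem isContourS_iff_separates {q : ℂ} {t : Fin 8 → ℂ} {γ : ℝ → ℂ} :
    IsContourS q t γ ↔ Separates q midIdx midIdx t (fun k => 1 * t k) γ := by
  rw [← isDeformedCircle_iff_separates]
  simp only [one_mul]
  rfl

/-- The numerator of `I_t(t;z) / z`. -/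
def numeratorS (q : ℂ) (y : (Fin 8 → ℂ) × ℂ) : ℂ :=
  qPoch q (y.2 ^ 2) * qPoch q ((y.2 ^ 2)⁻¹) *
    (∏ j ∈ endIdx, qPoch q ((y.1 j)⁻¹ * y.2) * qPoch q ((y.1 j)⁻¹ * y.2⁻¹)) / y.2

theorem integrandS_div (q : ℂ) (t : Fin 8 → ℂ) (z : ℂ) : integrandS q t z / z =
    numeratorS q (t, z) /
      ((∏ i ∈ midIdx, qPoch q (t i / z)) * ∏ k ∈ midIdx, qPoch q (1 * t k * z)) := by
  simp only [integrandS, numeratorS, Finset.prod_mul_distrib, one_mul, div_eq_mul_inv (t _) z]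
  rw [div_div, div_div, mul_comm z, mul_comm (∏ j ∈ midIdx, qPoch q (t j * z))]

theorem analyticAt_apply (j : Fin 8) (t : Fin 8 → ℂ) :
    AnalyticAt ℂ (fun t : Fin 8 → ℂ => t j) t :=
  (ContinuousLinearMap.proj (R := ℂ) (φ := fun _ : Fin 8 => ℂ) j).analyticAt t

theorem analyticAt_fst_apply (j : Fin 8) (y : (Fin 8 → ℂ) × ℂ) :
    AnalyticAt ℂ (fun y : (Fin 8 → ℂ) × ℂ => y.1 j) y :=
  (analyticAt_apply j y.1).fun_comp analyticAt_fst

theorem analyticAt_numeratorS {q : ℂ} (hq : ‖q‖ < 1) {t : Fin 8 → ℂ} (ht : ∀ j, t j ≠ 0) {z : ℂ}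
    (hz : z ≠ 0) : AnalyticAt ℂ (numeratorS q) (t, z) := by
  have h2 : AnalyticAt ℂ (fun y : (Fin 8 → ℂ) × ℂ => y.2) (t, z) := analyticAt_snd
  have hi : ∀ j, AnalyticAt ℂ (fun y : (Fin 8 → ℂ) × ℂ => (y.1 j)⁻¹) (t, z) := fun j =>
    (analyticAt_fst_apply j _).fun_inv (ht j)
  exact ((((h2.fun_pow 2).qPoch hq).mul (((h2.fun_pow 2).fun_inv (pow_ne_zero 2 hz)).qPoch hq)).mul
    (Finset.analyticAt_fun_prod _ fun j _ => (((hi j).mul h2).qPoch hq).mul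
      (((hi j).mul (h2.fun_inv hz)).qPoch hq))).div h2 hz

theorem exists_isContourS {q : ℂ} (hq0 : q ≠ 0) (hq : ‖q‖ < 1) {t : Fin 8 → ℂ}
    (ht : t ∈ genericS q) : ∃ γ, IsContourS q t γ := by
  rw [genericS_eq_separable] at ht
  obtain ⟨γ, hγ⟩ := exists_separates hq0 hq (fun _ => one_ne_zero) ht
  exact ⟨γ, isContourS_iff_separates.2 hγ⟩

theorem integralS_eq_of_isContourS {q : ℂ} (hq0 : q ≠ 0) (hq : ‖q‖ < 1) {t : Fin 8 → ℂ}
    (ht : t ∈ paramSpace) {γ₁ γ₂ : ℝ → ℂ} (h₁ : IsContourS q t γ₁) (h₂ : IsContourS q t γ₂) :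
    integralS q t γ₁ = integralS q t γ₂ := by
  have h0 := paramSpace_ne_zero ht
  unfold integralS
  simp only [integrandS_div]
  exact Separates.contourIntegral_eq hq0 hq (fun k _ => mul_ne_zero one_ne_zero (h0 k))
    (H := fun z => numeratorS q (t, z)) (fun z hz => ((analyticAt_numeratorS hq h0 hz).fun_comp
      (analyticAt_const.prod analyticAt_id)).differentiableAt)
    (isContourS_iff_separates.1 h₁) (isContourS_iff_separates.1 h₂)

theorem integralS_eq_trigS {q : ℂ} (hq0 : q ≠ 0) (hq : ‖q‖ < 1) {t : Fin 8 → ℂ}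
    (ht : t ∈ paramSpace) {γ : ℝ → ℂ} (h : IsContourS q t γ) : integralS q t γ = trigS q t := by
  have hex : ∃ γ, IsContourS q t γ := ⟨γ, h⟩
  rw [trigS, dif_pos hex]
  exact integralS_eq_of_isContourS hq0 hq ht h hex.choose_spec

/-- The numerator is analytic wherever no coordinate vanishes, so one open set serves all
parameters. -/
theorem isContourFamily_trigS {q : ℂ} (hq0 : q ≠ 0) (hq : ‖q‖ < 1) :
    IsContourFamily q midIdx midIdx (fun _ => 1) (trigS q) := by
  intro τ hτ
  refine ⟨numeratorS q, {t | ∀ k, t k ≠ 0}, ?_, paramSpace_ne_zero hτ, fun t ht => ht,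
    fun t ht z hz => analyticAt_numeratorS hq ht hz, fun t _ ht => ?_⟩
  · simp only [Set.ofPred_forall]
    exact isOpen_iInter_of_finite fun k => isOpen_ne_fun (continuous_apply k) continuous_const
  · obtain ⟨γ, hγ⟩ := exists_separates hq0 hq (fun _ => one_ne_zero) ht
    refine ⟨γ, hγ, ?_⟩
    rw [← integralS_eq_trigS hq0 hq ht.1 (isContourS_iff_separates.2 hγ), integralS]
    simp only [integrandS_div]

/-! ### The integral `U_t` -/

/-- The factors `c_k` for which the points excluded in the definition of `U_t` are
`(c_k t_k qⁿ)⁻¹`. -/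
def scaleU (q : ℂ) (k : Fin 8) : ℂ := if k ∈ endIdx then q⁻¹ else 1

theorem scaleU_of_mem_end (q : ℂ) {k : Fin 8} (h : k ∈ endIdx) : scaleU q k = q⁻¹ := if_pos h

theorem notMem_endIdx_iff {k : Fin 8} : k ∉ endIdx ↔ k ∈ midIdx := by revert k; decide

theorem scaleU_of_mem_mid (q : ℂ) {k : Fin 8} (h : k ∈ midIdx) : scaleU q k = 1 :=
  if_neg (notMem_endIdx_iff.2 h)

theorem scaleU_ne_zero {q : ℂ} (hq0 : q ≠ 0) (k : Fin 8) : scaleU q k ≠ 0 := by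
  unfold scaleU; split_ifs
  exacts [inv_ne_zero hq0, one_ne_zero]

theorem mem_end_or_mid (k : Fin 8) : k ∈ endIdx ∨ k ∈ midIdx := by revert k; decide

theorem genericU_eq_separable {q : ℂ} (hq0 : q ≠ 0) :
    genericU q = separable q endIdx Finset.univ (scaleU q) := by
  have e : ∀ x y (n : ℕ), x * (q⁻¹ * y) * q ^ n = 1 ↔ x * y * q ^ n = q := fun x y n => by
    rw [← div_eq_one_iff_eq hq0]
    exact iff_of_eq (by congr 1; field_simp)
  ext t
  refine and_congr_right fun _ => ⟨fun h i hi k _ n => ?_, fun h => ⟨fun i hi k hk n => ?_,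
    fun i hi k hk n => ?_⟩⟩
  · rcases mem_end_or_mid k with hk | hk
    · rw [scaleU_of_mem_end q hk, Ne, e]; exact h.1 i hi k hk n
    · rw [scaleU_of_mem_mid q hk, one_mul]; exact h.2 i hi k hk n
  · have := h i hi k (Finset.mem_univ k) n
    rwa [scaleU_of_mem_end q hk, Ne, e] at this
  · have := h i hi k (Finset.mem_univ k) n
    rwa [scaleU_of_mem_mid q hk, one_mul] at this

theorem polesOutU_eq {q : ℂ} (hq0 : q ≠ 0) (t : Fin 8 → ℂ) : polesOutU q t =
    {p | ∃ k ∈ (Finset.univ : Finset (Fin 8)), ∃ n : ℕ, p = (scaleU q k * t k * q ^ n)⁻¹} := by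
  have e : ∀ x (n : ℕ), (q⁻¹ * x * q ^ n)⁻¹ = x⁻¹ * q ^ (1 - n : ℤ) := fun x n => by
    rw [zpow_sub₀ hq0, zpow_one, zpow_natCast, mul_inv, mul_inv, inv_inv]; ring
  have e' : ∀ x (n : ℕ), (1 * x * q ^ n)⁻¹ = x⁻¹ * q ^ (-n : ℤ) := fun x n => by
    rw [zpow_neg, zpow_natCast, mul_inv, one_mul]
  ext p
  constructor
  · rintro (⟨j, hj, m, hm, rfl⟩ | ⟨j, hj, m, hm, rfl⟩)
    · refine ⟨j, Finset.mem_univ j, (1 - m).toNat, ?_⟩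
      rw [scaleU_of_mem_end q hj, e, Int.toNat_of_nonneg (by omega), sub_sub_cancel]
    · refine ⟨j, Finset.mem_univ j, (-m).toNat, ?_⟩
      rw [scaleU_of_mem_mid q hj, e', Int.toNat_of_nonneg (by omega), neg_neg]
  · rintro ⟨k, -, n, rfl⟩
    rcases mem_end_or_mid k with hk | hk
    · exact Or.inl ⟨k, hk, 1 - n, by omega, by rw [scaleU_of_mem_end q hk, e]⟩
    · exact Or.inr ⟨k, hk, -n, by omega, by rw [scaleU_of_mem_mid q hk, e']⟩

theorem isContourU_iff_separates {q : ℂ} (hq0 : q ≠ 0) {t : Fin 8 → ℂ} {μ : ℂ} {γ : ℝ → ℂ} :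
    IsContourU q t μ γ ↔ μ ≠ 0 ∧ theta q (t 0 / μ) * theta q (t 7 / μ) ≠ 0 ∧
      Separates q endIdx Finset.univ t (fun k => scaleU q k * t k) γ := by
  rw [← isDeformedCircle_iff_separates, ← polesOutU_eq hq0]
  rfl

/-- The values of `μ` to be avoided form two countable families together with zero. -/
theorem exists_theta_ne_zero {q : ℂ} (hq0 : q ≠ 0) (hq : ‖q‖ < 1) {a b : ℂ} (ha : a ≠ 0)
    (hb : b ≠ 0) : ∃ μ : ℂ, μ ≠ 0 ∧ theta q (a / μ) * theta q (b / μ) ≠ 0 := by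
  have hc : ({0} ∪ (Set.range (fun n : ℤ => a / q ^ n) ∪ Set.range fun n : ℤ => b / q ^ n) :
      Set ℂ).Countable := (Set.countable_singleton _).union
    ((Set.countable_range _).union (Set.countable_range _))
  obtain ⟨μ, hμ⟩ := (hc.dense_compl ℂ).nonempty
  simp only [Set.mem_compl_iff, Set.mem_union, Set.mem_singleton_iff, Set.mem_range, not_or,
    not_exists] at hμ
  obtain ⟨h0, h1, h2⟩ := hμ
  have h : ∀ x : ℂ, x ≠ 0 → (∀ n : ℤ, x / q ^ n ≠ μ) → theta q (x / μ) ≠ 0 := fun x hx hn => by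
    rw [theta_ne_zero_iff hq0 hq (div_ne_zero hx h0)]
    intro n h'
    refine hn n ?_
    rw [← h', div_div_cancel₀ hx]
  exact ⟨μ, h0, mul_ne_zero (h a ha h1) (h b hb h2)⟩

/-- The part of the numerator of `J_t^μ(t;z)` that does not depend on `μ`. -/
def numeratorU (q : ℂ) (y : (Fin 8 → ℂ) × ℂ) : ℂ :=
  2 * (1 - y.2 ^ 2 / q) * ∏ i ∈ midIdx, qPoch q (y.2 / y.1 i)

theorem prod_univ_eq_end_mul_mid (f : Fin 8 → ℂ) :
    ∏ k, f k = (∏ k ∈ endIdx, f k) * ∏ k ∈ midIdx, f k := by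
  rw [show (Finset.univ : Finset (Fin 8)) = endIdx ∪ midIdx by decide,
    Finset.prod_union (by decide)]

theorem integrandU_eq (q μ : ℂ) (t : Fin 8 → ℂ) (z : ℂ) : integrandU q μ t z =
    thetaKer q (t 0) (t 7) μ z * (numeratorU q (t, z) /
      (∏ k, qPoch q (scaleU q k * t k * z)) / (qPoch q (t 0 / z) * qPoch q (t 7 / z))) := by
  have h1 : ∏ k ∈ endIdx, qPoch q (scaleU q k * t k * z) = ∏ k ∈ endIdx, qPoch q (t k * z / q) :=
    Finset.prod_congr rfl fun k hk => by
      rw [scaleU_of_mem_end q hk]; congr 1; rw [div_eq_mul_inv]; ring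
  have h2 : ∏ k ∈ midIdx, qPoch q (scaleU q k * t k * z) = ∏ k ∈ midIdx, qPoch q (t k * z) :=
    Finset.prod_congr rfl fun k hk => by rw [scaleU_of_mem_mid q hk, one_mul]
  have h3 : qPoch q (t 0 / z) * qPoch q (t 7 / z) = ∏ k ∈ endIdx, qPoch q (t k / z) := by
    rw [endIdx, Finset.prod_pair (by decide)]
  rw [prod_univ_eq_end_mul_mid, h1, h2, h3]
  simp only [integrandU, thetaKer, numeratorU, Finset.prod_div_distrib, Finset.prod_mul_distrib,
    Finset.prod_const_one]
  simp only [div_eq_mul_inv, mul_inv]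
  ring

theorem integrandU_div (q μ : ℂ) (t : Fin 8 → ℂ) (z : ℂ) : integrandU q μ t z / z =
    thetaKer q (t 0) (t 7) μ z * numeratorU q (t, z) / z /
      ((∏ i ∈ endIdx, qPoch q (t i / z)) * ∏ k, qPoch q (scaleU q k * t k * z)) := by
  rw [integrandU_eq, endIdx, Finset.prod_pair (by decide)]
  simp only [div_eq_mul_inv, mul_inv]
  ring

theorem exists_isContourU {q : ℂ} (hq0 : q ≠ 0) (hq : ‖q‖ < 1) {t : Fin 8 → ℂ}
    (ht : t ∈ genericU q) : ∃ μ γ, IsContourU q t μ γ := by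
  rw [genericU_eq_separable hq0] at ht
  obtain ⟨γ, hγ⟩ := exists_separates hq0 hq (scaleU_ne_zero hq0) ht
  obtain ⟨μ, h0, hμ⟩ := exists_theta_ne_zero hq0 hq (paramSpace_ne_zero ht.1 0)
    (paramSpace_ne_zero ht.1 7)
  exact ⟨μ, γ, (isContourU_iff_separates hq0).2 ⟨h0, hμ, hγ⟩⟩

/-- The auxiliary parameter is changed on a fixed contour, by the theta relation; then the contour
is changed for fixed `ν`, by winding numbers. -/
theorem integralU_eq_of_isContourU {q : ℂ} (hq0 : q ≠ 0) (hq : ‖q‖ < 1) {t : Fin 8 → ℂ}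
    (ht : t ∈ paramSpace) {μ ν : ℂ} {γ₁ γ₂ : ℝ → ℂ} (h₁ : IsContourU q t μ γ₁)
    (h₂ : IsContourU q t ν γ₂) : integralU q μ t γ₁ = integralU q ν t γ₂ := by
  have h0 := paramSpace_ne_zero ht
  have hs : ∀ k ∈ (Finset.univ : Finset (Fin 8)), scaleU q k * t k ≠ 0 := fun k _ =>
    mul_ne_zero (scaleU_ne_zero hq0 k) (h0 k)
  rw [isContourU_iff_separates hq0] at h₁ h₂
  have hQ := differentiable_qPoch hq
  have hn : Differentiable ℂ fun z => numeratorU q (t, z) := by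
    unfold numeratorU
    refine Differentiable.mul (by fun_prop) (Differentiable.fun_finsetProd fun i _ =>
      hQ.comp (differentiable_id.div_const (t i)))
  trans integralU q ν t γ₁
  · unfold integralU
    simp only [integrandU_eq]
    have hγ := h₁.2.2
    exact contourIntegral_thetaKer_eq hq0 hq hs hn hγ.empty_left (h0 0) (h0 7) h₁.1 h₂.1
      (fun x hx n => (hγ.inside 0 (by decide) n).1 x hx)
      (fun x hx n => (hγ.inside 7 (by decide) n).1 x hx) h₁.2.1 h₂.2.1
  · unfold integralU
    simp only [integrandU_div]
    exact Separates.contourIntegral_eq hq0 hq hs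
      (H := fun z => thetaKer q (t 0) (t 7) ν z * numeratorU q (t, z) / z)
      (fun z hz => ((differentiableAt_thetaKer hq (h0 0) (h0 7) h₂.1 hz).fun_mul (hn z)).fun_div
        differentiableAt_id hz) h₁.2.2 h₂.2.2

theorem integralU_eq_trigU {q : ℂ} (hq0 : q ≠ 0) (hq : ‖q‖ < 1) {t : Fin 8 → ℂ}
    (ht : t ∈ paramSpace) {μ : ℂ} {γ : ℝ → ℂ} (h : IsContourU q t μ γ) :
    integralU q μ t γ = trigU q t := by
  have hex : ∃ c : ℂ × (ℝ → ℂ), IsContourU q t c.1 c.2 := ⟨(μ, γ), h⟩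
  rw [trigU, dif_pos hex]
  exact integralU_eq_of_isContourU hq0 hq ht h hex.choose_spec

theorem isContourFamily_trigU {q : ℂ} (hq0 : q ≠ 0) (hq : ‖q‖ < 1) :
    IsContourFamily q endIdx Finset.univ (scaleU q) (trigU q) := by
  intro τ hτ
  obtain ⟨μ, hμ0, hμ⟩ := exists_theta_ne_zero hq0 hq (paramSpace_ne_zero hτ 0)
    (paramSpace_ne_zero hτ 7)
  have hth : ∀ j {t : Fin 8 → ℂ}, (∀ k, t k ≠ 0) →
      AnalyticAt ℂ (fun t : Fin 8 → ℂ => theta q (t j / μ)) t := fun j t ht =>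
    ((analyticAt_apply j t).div analyticAt_const hμ0).theta hq (div_ne_zero (ht j) hμ0)
  have hO1 : IsOpen {t : Fin 8 → ℂ | ∀ k, t k ≠ 0} := by
    simp only [Set.ofPred_forall]
    exact isOpen_iInter_of_finite fun k => isOpen_ne_fun (continuous_apply k) continuous_const
  -- The `μ` chosen for `τ` is admissible only in a neighbourhood of `τ`; this is why the numerator
  -- of a contour family may depend on the base point.
  refine ⟨fun y => thetaKer q (y.1 0) (y.1 7) μ y.2 * numeratorU q y / y.2,
    {t | ∀ k, t k ≠ 0} ∩ (fun t => theta q (t 0 / μ) * theta q (t 7 / μ)) ⁻¹' {0}ᶜ, ?_,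
    ⟨paramSpace_ne_zero hτ, hμ⟩, fun t ht => ht.1, fun t ht z hz => ?_, fun t htO ht => ?_⟩
  · exact ContinuousOn.isOpen_inter_preimage (fun t ht =>
      ((hth 0 ht).mul (hth 7 ht)).continuousAt.continuousWithinAt) hO1 isOpen_compl_singleton
  · have h2 : AnalyticAt ℂ (fun y : (Fin 8 → ℂ) × ℂ => y.2) (t, z) := analyticAt_snd
    have h1 := fun j => analyticAt_fst_apply j (t, z)
    have hd : ∀ j, AnalyticAt ℂ (fun y : (Fin 8 → ℂ) × ℂ => theta q (y.1 j / μ)) (t, z) :=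
      fun j => ((h1 j).div analyticAt_const hμ0).theta hq (div_ne_zero (ht.1 j) hμ0)
    have hk : AnalyticAt ℂ (fun y : (Fin 8 → ℂ) × ℂ => thetaKer q (y.1 0) (y.1 7) μ y.2) (t, z) :=
      (((((h1 0).mul (h1 7)).div (analyticAt_const.mul h2) (mul_ne_zero hμ0 hz)).theta hq
        (div_ne_zero (mul_ne_zero (ht.1 0) (ht.1 7)) (mul_ne_zero hμ0 hz))).mul
        ((h2.div analyticAt_const hμ0).theta hq (div_ne_zero hz hμ0))).div
        ((hd 0).mul (hd 7)) ht.2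
    have hn : AnalyticAt ℂ (numeratorU q) (t, z) :=
      (analyticAt_const.mul (analyticAt_const.sub ((h2.fun_pow 2).div analyticAt_const hq0))).mul
        (Finset.analyticAt_fun_prod _ fun j _ => (h2.div (h1 j) (ht.1 j)).qPoch hq)
    exact (hk.mul hn).div h2 hz
  · obtain ⟨γ, hγ⟩ := exists_separates hq0 hq (scaleU_ne_zero hq0) ht
    refine ⟨γ, hγ, ?_⟩
    rw [← integralU_eq_trigU hq0 hq ht.1 ((isContourU_iff_separates hq0).2 ⟨hμ0, htO.2, hγ⟩),
      integralU]
    simp only [integrandU_div]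

end TrigHyp
end

noncomputable section
namespace TrigHyp

/-! ### The symmetry `t ↦ -t` -/

theorem contourIntegral_neg (f : ℂ → ℂ) (γ : ℝ → ℂ) :
    contourIntegral f (-γ) = contourIntegral (fun z => -f (-z)) γ := by
  unfold contourIntegral
  congr 1
  refine intervalIntegral.integral_congr fun x _ => ?_
  simp [deriv.neg]

theorem HasWinding.neg {γ : ℝ → ℂ} {p : ℂ} {m : ℤ} (h : HasWinding γ p m) :
    HasWinding (-γ) (-p) m := by
  refine ⟨fun x hx he => h.1 x hx (neg_injective he), ?_⟩
  rw [contourIntegral_neg, ← h.2]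
  congr 1
  funext z
  rw [← inv_neg]
  congr 1; ring

theorem IsClosedCurve.neg {γ : ℝ → ℂ} (h : IsClosedCurve γ) : IsClosedCurve (-γ) where
  continuousOn := h.continuousOn.neg
  closed := congr_arg Neg.neg h.closed
  piecewise := by
    obtain ⟨P, M, hM⟩ := h.piecewise
    refine ⟨P, M, fun x hx hxP => ⟨(hM x hx hxP).1.neg, ?_⟩⟩
    rw [deriv.neg, norm_neg]
    exact (hM x hx hxP).2

theorem Separates.neg {q : ℂ} {I J : Finset (Fin 8)} {c t : Fin 8 → ℂ} {γ : ℝ → ℂ}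
    (h : Separates q I J t (fun k => c k * t k) γ) :
    Separates q I J (-t) (fun k => c k * (-t) k) (-γ) where
  curve := h.curve.neg
  origin := by simpa using h.origin.neg
  inside := fun i hi n => by simpa using (h.inside i hi n).neg
  outside := fun k hk n => by
    have := (h.outside k hk n).neg
    rwa [show -(c k * t k * q ^ n)⁻¹ = (c k * (-t) k * q ^ n)⁻¹ by
      rw [← inv_neg, Pi.neg_apply]; congr 1; ring] at this

/-- The form `dz/z` is invariant under `z ↦ -z`. Reflecting contour and parameters together gives
the invariance under `t ↦ -t`. -/
theorem contourIntegral_div_neg {f g : ℂ → ℂ} (h : ∀ z, f (-z) = g z) (γ : ℝ → ℂ) :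
    contourIntegral (fun z => f z / z) (-γ) = contourIntegral (fun z => g z / z) γ := by
  rw [contourIntegral_neg]
  congr 1
  funext z
  rw [h, div_neg, neg_neg]

theorem neg_mem_paramSpace {t : Fin 8 → ℂ} (ht : t ∈ paramSpace) : -t ∈ paramSpace := by
  have : ∏ j, t j = 1 := ht
  rw [Fin.prod_univ_eight] at this
  change ∏ j, (-t) j = 1
  rw [Fin.prod_univ_eight, ← this]
  simp only [Pi.neg_apply]; ring

theorem neg_mem_separable {q : ℂ} {I J : Finset (Fin 8)} {c t : Fin 8 → ℂ}
    (ht : t ∈ separable q I J c) : -t ∈ separable q I J c :=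
  ⟨neg_mem_paramSpace ht.1, fun i hi k hk n => by simpa using ht.2 i hi k hk n⟩

theorem trigS_neg {q : ℂ} (hq0 : q ≠ 0) (hq : ‖q‖ < 1) {t : Fin 8 → ℂ} (ht : t ∈ genericS q) :
    -t ∈ genericS q ∧ trigS q (-t) = trigS q t := by
  obtain ⟨γ, hγ⟩ := exists_isContourS hq0 hq ht
  have hγ' : IsContourS q (-t) (-γ) :=
    isContourS_iff_separates.2 (isContourS_iff_separates.1 hγ).neg
  refine ⟨?_, ?_⟩
  · rw [genericS_eq_separable] at ht ⊢; exact neg_mem_separable ht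
  · rw [← integralS_eq_trigS hq0 hq ht.1 hγ,
      ← integralS_eq_trigS hq0 hq (neg_mem_paramSpace ht.1) hγ']
    refine contourIntegral_div_neg (fun z => ?_) γ
    simp only [integrandS, Pi.neg_apply, inv_neg, neg_mul_neg, even_two.neg_pow]

theorem trigU_neg {q : ℂ} (hq0 : q ≠ 0) (hq : ‖q‖ < 1) {t : Fin 8 → ℂ} (ht : t ∈ genericU q) :
    -t ∈ genericU q ∧ trigU q (-t) = trigU q t := by
  obtain ⟨μ, γ, hγ⟩ := exists_isContourU hq0 hq ht
  have hγ' : IsContourU q (-t) (-μ) (-γ) := by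
    rw [isContourU_iff_separates hq0] at hγ ⊢
    refine ⟨neg_ne_zero.2 hγ.1, ?_, hγ.2.2.neg⟩
    simpa only [Pi.neg_apply, neg_div_neg_eq] using hγ.2.1
  refine ⟨?_, ?_⟩
  · rw [genericU_eq_separable hq0] at ht ⊢; exact neg_mem_separable ht
  · rw [← integralU_eq_trigU hq0 hq ht.1 hγ,
      ← integralU_eq_trigU hq0 hq (neg_mem_paramSpace ht.1) hγ']
    refine contourIntegral_div_neg (fun z => ?_) γ
    simp only [integrandU, Pi.neg_apply, neg_mul_neg, even_two.neg_pow, neg_div_neg_eq]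

/-! ### Permutations of the parameters -/

section

variable {σ : Equiv.Perm (Fin 8)} (hσ : ∀ j, σ j ∈ endIdx ↔ j ∈ endIdx)

include hσ

theorem perm_mem_midIdx_iff (j : Fin 8) : σ j ∈ midIdx ↔ j ∈ midIdx := by
  rw [← notMem_endIdx_iff, ← notMem_endIdx_iff, hσ]

theorem prod_endIdx_perm (f : Fin 8 → ℂ) : ∏ j ∈ endIdx, f (σ j) = ∏ j ∈ endIdx, f j :=
  Finset.prod_equiv σ (fun j => (hσ j).symm) fun _ _ => rfl

theorem prod_midIdx_perm (f : Fin 8 → ℂ) : ∏ j ∈ midIdx, f (σ j) = ∏ j ∈ midIdx, f j :=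
  Finset.prod_equiv σ (fun j => (perm_mem_midIdx_iff hσ j).symm) fun _ _ => rfl

theorem mul_zero_seven_perm (f : Fin 8 → ℂ) : f (σ 0) * f (σ 7) = f 0 * f 7 := by
  have := prod_endIdx_perm hσ f
  rwa [endIdx, Finset.prod_pair (by decide), Finset.prod_pair (by decide)] at this

end

theorem comp_perm_mem_paramSpace {t : Fin 8 → ℂ} (ht : t ∈ paramSpace) (σ : Equiv.Perm (Fin 8)) :
    t ∘ σ ∈ paramSpace :=
  (Equiv.prod_comp σ t).trans ht

theorem separable_comp_perm {q : ℂ} {I J : Finset (Fin 8)} {c t : Fin 8 → ℂ}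
    {σ : Equiv.Perm (Fin 8)} (hI : ∀ i ∈ I, σ i ∈ I) (hJ : ∀ k ∈ J, σ k ∈ J)
    (hc : ∀ k, c (σ k) = c k) (ht : t ∈ separable q I J c) : t ∘ σ ∈ separable q I J c := by
  refine ⟨comp_perm_mem_paramSpace ht.1 σ, fun i hi k hk n => ?_⟩
  rw [← hc]
  exact ht.2 _ (hI i hi) _ (hJ k hk) n

theorem Separates.comp_perm {q : ℂ} {I J : Finset (Fin 8)} {c t : Fin 8 → ℂ} {γ : ℝ → ℂ}
    {σ : Equiv.Perm (Fin 8)} (hI : ∀ i ∈ I, σ i ∈ I) (hJ : ∀ k ∈ J, σ k ∈ J)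
    (hc : ∀ k, c (σ k) = c k) (h : Separates q I J t (fun k => c k * t k) γ) :
    Separates q I J (t ∘ σ) (fun k => c k * (t ∘ σ) k) γ where
  curve := h.curve
  origin := h.origin
  inside := fun i hi n => h.inside _ (hI i hi) n
  outside := fun k hk n => by rw [← hc]; exact h.outside _ (hJ k hk) n

theorem trigS_comp_perm {q : ℂ} (hq0 : q ≠ 0) (hq : ‖q‖ < 1) {σ : Equiv.Perm (Fin 8)}
    (hσ : ∀ j, σ j ∈ endIdx ↔ j ∈ endIdx) {t : Fin 8 → ℂ} (ht : t ∈ genericS q) :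
    t ∘ σ ∈ genericS q ∧ trigS q (t ∘ σ) = trigS q t := by
  have hm : ∀ j ∈ midIdx, σ j ∈ midIdx := fun j => (perm_mem_midIdx_iff hσ j).2
  obtain ⟨γ, hγ⟩ := exists_isContourS hq0 hq ht
  have hγ' : IsContourS q (t ∘ σ) γ := isContourS_iff_separates.2
    ((isContourS_iff_separates.1 hγ).comp_perm hm hm fun _ => rfl)
  refine ⟨?_, ?_⟩
  · rw [genericS_eq_separable] at ht ⊢; exact separable_comp_perm hm hm (fun _ => rfl) ht
  · rw [← integralS_eq_trigS hq0 hq ht.1 hγ,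
      ← integralS_eq_trigS hq0 hq (comp_perm_mem_paramSpace ht.1 σ) hγ']
    unfold integralS
    congr 1
    funext z
    simp only [integrandS, Function.comp_apply]
    rw [prod_endIdx_perm hσ fun j => qPoch q ((t j)⁻¹ * z) * qPoch q ((t j)⁻¹ * z⁻¹),
      prod_midIdx_perm hσ fun j => qPoch q (t j * z) * qPoch q (t j * z⁻¹)]

theorem trigU_comp_perm {q : ℂ} (hq0 : q ≠ 0) (hq : ‖q‖ < 1) {σ : Equiv.Perm (Fin 8)}
    (hσ : ∀ j, σ j ∈ endIdx ↔ j ∈ endIdx) {t : Fin 8 → ℂ} (ht : t ∈ genericU q) :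
    t ∘ σ ∈ genericU q ∧ trigU q (t ∘ σ) = trigU q t := by
  have he : ∀ j ∈ endIdx, σ j ∈ endIdx := fun j => (hσ j).2
  have hu : ∀ j ∈ (Finset.univ : Finset (Fin 8)), σ j ∈ (Finset.univ : Finset (Fin 8)) :=
    fun j _ => Finset.mem_univ _
  have hc : ∀ k, scaleU q (σ k) = scaleU q k := fun k => by simp only [scaleU, hσ]
  obtain ⟨μ, γ, hγ⟩ := exists_isContourU hq0 hq ht
  have hθ : theta q (t (σ 0) / μ) * theta q (t (σ 7) / μ) =
      theta q (t 0 / μ) * theta q (t 7 / μ) := mul_zero_seven_perm hσ fun j => theta q (t j / μ)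
  have hγ' : IsContourU q (t ∘ σ) μ γ := by
    rw [isContourU_iff_separates hq0] at hγ ⊢
    exact ⟨hγ.1, hθ ▸ hγ.2.1, hγ.2.2.comp_perm he hu hc⟩
  refine ⟨?_, ?_⟩
  · rw [genericU_eq_separable hq0] at ht ⊢; exact separable_comp_perm he hu hc ht
  · rw [← integralU_eq_trigU hq0 hq ht.1 hγ,
      ← integralU_eq_trigU hq0 hq (comp_perm_mem_paramSpace ht.1 σ) hγ']
    unfold integralU
    congr 1
    funext z
    simp only [integrandU, Function.comp_apply]
    rw [hθ, mul_zero_seven_perm hσ t,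
      prod_endIdx_perm hσ fun j => 1 / (qPoch q (t j * z / q) * qPoch q (t j / z)),
      prod_midIdx_perm hσ fun j => qPoch q (z / t j) / qPoch q (t j * z)]

end TrigHyp
end

noncomputable section
namespace TrigHyp

/-! ### Analytic continuation of the `w`-symmetries -/

theorem wAct_mem_paramSpace {s : ℂ} (hs : s ≠ 0) {t : Fin 8 → ℂ} (ht : t ∈ paramSpace) :
    wAct s t ∈ paramSpace := by
  have : ∏ j, t j = 1 := ht
  rw [Fin.prod_univ_eight] at this
  change ∏ j, wAct s t j = 1
  rw [Fin.prod_univ_eight, ← this]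
  simp only [wAct]
  norm_num
  field_simp

/-- The image of an exponential curve under `w` is again an exponential curve, provided that the
scaling parameter moves exponentially too. -/
theorem wAct_expCurve (s e : ℂ) (t d : Fin 8 → ℂ) (u : ℂ) :
    wAct (s * Complex.exp (u * e)) (expCurve t d u) =
      expCurve (wAct s t) (fun j => if (j : ℕ) < 4 then d j + e else d j - e) u := by
  funext j
  simp only [wAct, expCurve]
  split_ifs
  · rw [mul_add, Complex.exp_add]; ring
  · rw [mul_sub, Complex.exp_sub, mul_inv]; ring

/-- If an identity between `F t` and `F (wAct s t)` holds near the points `(t, s)` whose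
coordinates have prescribed absolute values, then it holds throughout. -/
theorem eq_wAct_mul_of_eventually {q : ℂ} {I J : Finset (Fin 8)} {c : Fin 8 → ℂ}
    {F R : (Fin 8 → ℂ) → ℂ} (hF : RepresentsMeromorphic (separable q I J c) F)
    (hR : ∀ t ∈ separable q I J c, AnalyticAt ℂ R t) {P : (Fin 8 → ℂ) → ℂ → Prop}
    (hP : ∀ t ∈ paramSpace, ∀ s : ℂ, s ^ 2 * (t 0 * t 1 * t 2 * t 3) = 1 → P t s →
      t ∈ separable q I J c ∧ wAct s t ∈ separable q I J c ∧ F t = F (wAct s t) * R t)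
    {r : Fin 8 → ℝ} (hr : ∀ j, 0 < r j) (hr1 : ∏ j, r j = 1) {σ : ℝ} (hσ : 0 < σ)
    (hσ1 : σ ^ 2 * (r 0 * r 1 * r 2 * r 3) = 1)
    (hPr : ∀ t s, (∀ j, ‖t j‖ = r j) → ‖s‖ = σ → ∀ᶠ y in 𝓝 (t, s), P y.1 y.2)
    {t : Fin 8 → ℂ} (ht : t ∈ separable q I J c) {s : ℂ}
    (hs : s ^ 2 * (t 0 * t 1 * t 2 * t 3) = 1) (hst : wAct s t ∈ separable q I J c) :
    F t = F (wAct s t) * R t := by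
  have ht0 := paramSpace_ne_zero ht.1
  have hs0 : s ≠ 0 := fun h => by simp [h] at hs
  -- The exponents are real and chosen so that the coordinates have moduli `r j` at `u = 1`. They
  -- sum to zero because both products of moduli are `1`.
  set d : Fin 8 → ℂ := fun j => (Real.log (r j / ‖t j‖) : ℂ) with hd
  have hpos : ∀ j, 0 < r j / ‖t j‖ := fun j => div_pos (hr j) (norm_pos_iff.2 (ht0 j))
  have hd0 : ∑ j, d j = 0 := by
    rw [← Complex.ofReal_sum, ← Real.log_prod fun j _ => (hpos j).ne', Finset.prod_div_distrib, hr1,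
      ← norm_prod, show ∏ j, t j = 1 from ht.1]
    simp
  -- This exponent keeps `s² t₀ t₁ t₂ t₃ = 1` along the curve, with the given square root `s` at `u
  -- = 0`.
  set e : ℂ := -(d 0 + d 1 + d 2 + d 3) / 2 with he
  set d' : Fin 8 → ℂ := fun j => if (j : ℕ) < 4 then d j + e else d j - e with hd'
  have hd'0 : ∑ j, d' j = 0 := by
    rw [← hd0, Fin.sum_univ_eight, Fin.sum_univ_eight]
    simp only [hd']
    norm_num
    ring
  have hsu : ∀ u, (s * Complex.exp (u * e)) ^ 2 * (expCurve t d u 0 * expCurve t d u 1 *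
      expCurve t d u 2 * expCurve t d u 3) = 1 := fun u => by
    have h1 : Complex.exp (u * e) ^ 2 * (Complex.exp (u * d 0) * Complex.exp (u * d 1) *
        Complex.exp (u * d 2) * Complex.exp (u * d 3)) = 1 := by
      rw [← Complex.exp_nat_mul, ← Complex.exp_add, ← Complex.exp_add, ← Complex.exp_add,
        ← Complex.exp_add, Complex.exp_eq_one_iff]
      exact ⟨0, by rw [he]; push_cast; ring⟩
    simp only [expCurve]
    linear_combination (Complex.exp (u * e) ^ 2 * (Complex.exp (u * d 0) * Complex.exp (u * d 1) *
        Complex.exp (u * d 2) * Complex.exp (u * d 3))) * hs + h1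
  have hnt : ∀ j, ‖expCurve t d 1 j‖ = r j := fun j => by
    rw [expCurve, one_mul, norm_mul, Complex.norm_exp, hd, Complex.ofReal_re,
      Real.exp_log (hpos j), mul_div_cancel₀ _ (norm_ne_zero_iff.2 (ht0 j))]
  have hns : ‖s * Complex.exp (1 * e)‖ = σ := by
    have h := congr_arg norm (hsu 1)
    rw [norm_mul, norm_pow, norm_mul (_ * _ * _), norm_mul (_ * _), norm_mul (expCurve t d 1 0),
      hnt, hnt, hnt, hnt, norm_one] at h
    have h2 : r 0 * r 1 * r 2 * r 3 ≠ 0 := right_ne_zero_of_mul_eq_one hσ1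
    exact (pow_left_inj₀ (norm_nonneg _) hσ.le two_ne_zero).1
      (mul_right_cancel₀ h2 (h.trans hσ1.symm))
  have hxp := expCurve_mem_paramSpace ht.1 hd0
  have hy : ∀ u, expCurve (wAct s t) d' u = wAct (s * Complex.exp (u * e)) (expCurve t d u) :=
    fun u => (wAct_expCurve s e t d u).symm
  have hev : ∀ᶠ u in 𝓝 1, P (expCurve t d u) (s * Complex.exp (u * e)) := by
    have hc : ContinuousAt (fun u => (expCurve t d u, s * Complex.exp (u * e))) 1 :=
      (continuous_expCurve t d).continuousAt.prodMk (by fun_prop)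
    exact hc.eventually (hPr _ _ hnt hns)
  have h1 := hP _ (hxp 1) _ (hsu 1) hev.self_of_nhds
  have hx1 : expCurve t d 1 ∈ separable q I J c := h1.1
  have hy1 : expCurve (wAct s t) d' 1 ∈ separable q I J c := by rw [hy]; exact h1.2.1
  have := eq_mul_of_eq_near_one hF (R := fun u => R (expCurve t d u)) (analyticAt_expCurve t d)
    (analyticAt_expCurve (wAct s t) d') hxp (expCurve_mem_paramSpace hst.1 hd'0)
    (countable_expCurve_notMem_separable ht.1 hd0 hx1)
    (countable_expCurve_notMem_separable hst.1 hd'0 hy1)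
    (fun u hu => (hR _ hu).fun_comp (analyticAt_expCurve t d u)) ⟨hx1, hy1⟩ ?_
    (by rw [expCurve_zero, expCurve_zero]; exact ⟨ht, hst⟩)
  · simpa only [expCurve_zero] using this
  · filter_upwards [hev] with u hu
    rw [hy]
    exact (hP _ (hxp u) _ (hsu u) hu).2.2

/-- The set `separable` is dense if it contains all points whose coordinates have prescribed
absolute values. -/
theorem paramSpace_subset_closure_separable {q : ℂ} {I J : Finset (Fin 8)} {c : Fin 8 → ℂ}
    {r : Fin 8 → ℝ} (hr : ∀ j, 0 < r j) (hr1 : ∏ j, r j = 1)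
    (h : ∀ t ∈ paramSpace, (∀ j, ‖t j‖ = r j) → t ∈ separable q I J c) :
    paramSpace ⊆ closure (separable q I J c) := by
  intro t ht
  have ht0 := paramSpace_ne_zero ht
  have hpos : ∀ j, 0 < r j / ‖t j‖ := fun j => div_pos (hr j) (norm_pos_iff.2 (ht0 j))
  have hd0 : ∑ j, (Real.log (r j / ‖t j‖) : ℂ) = 0 := by
    rw [← Complex.ofReal_sum, ← Real.log_prod fun j _ => (hpos j).ne', Finset.prod_div_distrib, hr1,
      ← norm_prod, show ∏ j, t j = 1 from ht]
    simp
  refine mem_closure_separable ht hd0 (h _ (expCurve_mem_paramSpace ht hd0 1) fun j => ?_)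
  rw [expCurve, one_mul, norm_mul, Complex.norm_exp, Complex.ofReal_re,
    Real.exp_log (hpos j), mul_div_cancel₀ _ (norm_ne_zero_iff.2 (ht0 j))]

theorem separable_of_norm_lt_circ {q : ℂ} (hq : ‖q‖ < 1) {I J : Finset (Fin 8)}
    {c t : Fin 8 → ℂ} (ht : t ∈ paramSpace) {r : ℂ} (hI : ∀ i ∈ I, ‖t i‖ < ‖r‖)
    (hJ : ∀ k ∈ J, ‖c k * t k‖ * ‖r‖ < 1) : t ∈ separable q I J c :=
  separable_of_norm_lt hq ht fun i hi k hk => by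
    rw [norm_mul, mul_comm]
    exact (mul_le_mul_of_nonneg_left (hI i hi).le (norm_nonneg _)).trans_lt (hJ k hk)

/-! ### The `w`-symmetry of `S_t` -/

/-- The factor in the `w`-symmetry of `S_t`. -/
def ratioS (q : ℂ) (t : Fin 8 → ℂ) : ℂ :=
  (qPoch q (1 / (t 0 * t 1)) * qPoch q (1 / (t 0 * t 2)) * qPoch q (1 / (t 0 * t 3)) *
    qPoch q (1 / (t 7 * t 4)) * qPoch q (1 / (t 7 * t 5)) * qPoch q (1 / (t 7 * t 6))) /
  (qPoch q (t 1 * t 2) * qPoch q (t 1 * t 3) * qPoch q (t 2 * t 3) *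
    qPoch q (t 4 * t 5) * qPoch q (t 4 * t 6) * qPoch q (t 5 * t 6))

/-- The factor in the `w`-symmetry of `U_t`. -/
def ratioU (q : ℂ) (t : Fin 8 → ℂ) : ℂ :=
  (qPoch q (1 / (t 1 * t 2)) * qPoch q (1 / (t 1 * t 3)) * qPoch q (1 / (t 2 * t 3)) *
    qPoch q (1 / (t 4 * t 5)) * qPoch q (1 / (t 4 * t 6)) * qPoch q (1 / (t 5 * t 6))) /
  (qPoch q (t 0 * t 1) * qPoch q (t 0 * t 2) * qPoch q (t 0 * t 3) *
    qPoch q (t 4 * t 7) * qPoch q (t 5 * t 7) * qPoch q (t 6 * t 7))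

theorem analyticAt_qPoch_mul {q : ℂ} (hq : ‖q‖ < 1) (i k : Fin 8) (t : Fin 8 → ℂ) :
    AnalyticAt ℂ (fun t : Fin 8 → ℂ => qPoch q (t i * t k)) t :=
  ((analyticAt_apply i t).mul (analyticAt_apply k t)).qPoch hq

theorem analyticAt_qPoch_inv_mul {q : ℂ} (hq : ‖q‖ < 1) (i k : Fin 8) {t : Fin 8 → ℂ}
    (ht : ∀ j, t j ≠ 0) : AnalyticAt ℂ (fun t : Fin 8 → ℂ => qPoch q (1 / (t i * t k))) t :=
  (analyticAt_const.div ((analyticAt_apply i t).mul (analyticAt_apply k t))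
    (mul_ne_zero (ht i) (ht k))).qPoch hq

theorem analyticAt_ratioS {q : ℂ} (hq : ‖q‖ < 1) {t : Fin 8 → ℂ} (ht : t ∈ genericS q) :
    AnalyticAt ℂ (ratioS q) t := by
  have h1 := fun i k => analyticAt_qPoch_mul hq i k t
  have h2 := fun i k => analyticAt_qPoch_inv_mul hq i k (paramSpace_ne_zero ht.1)
  have h3 : ∀ i ∈ midIdx, ∀ k ∈ midIdx, qPoch q (t i * t k) ≠ 0 := fun i hi k hk =>
    (qPoch_ne_zero_iff hq).2 (ht.2 i hi k hk)
  refine AnalyticAt.div ((((((h2 0 1).mul (h2 0 2)).mul (h2 0 3)).mul (h2 7 4)).mul (h2 7 5)).mul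
    (h2 7 6)) ((((((h1 1 2).mul (h1 1 3)).mul (h1 2 3)).mul (h1 4 5)).mul (h1 4 6)).mul
    (h1 5 6)) ?_
  simp only [ne_eq, mul_eq_zero, not_or]
  exact ⟨⟨⟨⟨⟨h3 1 (by decide) 2 (by decide), h3 1 (by decide) 3 (by decide)⟩,
    h3 2 (by decide) 3 (by decide)⟩, h3 4 (by decide) 5 (by decide)⟩,
    h3 4 (by decide) 6 (by decide)⟩, h3 5 (by decide) 6 (by decide)⟩

theorem analyticAt_ratioU {q : ℂ} (hq : ‖q‖ < 1) {t : Fin 8 → ℂ} (ht : t ∈ genericU q) :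
    AnalyticAt ℂ (ratioU q) t := by
  have h1 := fun i k => analyticAt_qPoch_mul hq i k t
  have h2 := fun i k => analyticAt_qPoch_inv_mul hq i k (paramSpace_ne_zero ht.1)
  have h3 : ∀ i ∈ endIdx, ∀ k ∈ midIdx, qPoch q (t i * t k) ≠ 0 := fun i hi k hk =>
    (qPoch_ne_zero_iff hq).2 (ht.2.2 i hi k hk)
  have h4 : ∀ i ∈ midIdx, qPoch q (t i * t 7) ≠ 0 := fun i hi => by
    rw [mul_comm]; exact h3 7 (by decide) i hi
  refine AnalyticAt.div ((((((h2 1 2).mul (h2 1 3)).mul (h2 2 3)).mul (h2 4 5)).mul (h2 4 6)).mul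
    (h2 5 6)) ((((((h1 0 1).mul (h1 0 2)).mul (h1 0 3)).mul (h1 4 7)).mul (h1 5 7)).mul
    (h1 6 7)) ?_
  simp only [ne_eq, mul_eq_zero, not_or]
  exact ⟨⟨⟨⟨⟨h3 0 (by decide) 1 (by decide), h3 0 (by decide) 2 (by decide)⟩,
    h3 0 (by decide) 3 (by decide)⟩, h4 4 (by decide)⟩, h4 5 (by decide)⟩, h4 6 (by decide)⟩

/-- When the six middle parameters lie in the unit disc, the unit circle itself is an admissible
contour. -/
theorem separable_and_trigS_eq_circleMean {q : ℂ} (hq0 : q ≠ 0) (hq : ‖q‖ < 1) {t : Fin 8 → ℂ}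
    (ht : t ∈ paramSpace) (h : ∀ j ∈ midIdx, ‖t j‖ < 1) :
    t ∈ separable q midIdx midIdx (fun _ => 1) ∧ trigS q t = circleMean (integrandS q t) 1 := by
  have h1 : ∀ j ∈ midIdx, ‖t j‖ < ‖(1 : ℂ)‖ := by simpa using h
  have h2 : ∀ j ∈ midIdx, ‖1 * t j‖ * ‖(1 : ℂ)‖ < 1 := by simpa using h
  refine ⟨separable_of_norm_lt_circ hq ht h1 h2, ?_⟩
  have hs := separates_circ hq0 hq one_ne_zero
    (fun k _ => mul_ne_zero one_ne_zero (paramSpace_ne_zero ht k)) h1 h2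
  rw [← integralS_eq_trigS hq0 hq ht (isContourS_iff_separates.2 hs)]
  exact contourIntegral_div_circ _ one_ne_zero

/-- Absolute values of parameters for which the unit circle is admissible both for `S_t(t)` and
for `S_t(wt)`. -/
def radiiS : Fin 8 → ℝ := ![16, 1 / 4, 1 / 4, 1 / 4, 1 / 4, 1 / 4, 1 / 4, 256]

theorem radiiS_pos (j : Fin 8) : 0 < radiiS j := by
  fin_cases j <;> norm_num [radiiS, Matrix.cons_val]

theorem prod_radiiS : ∏ j, radiiS j = 1 := by
  rw [Fin.prod_univ_eight]
  simp only [radiiS, Matrix.cons_val]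
  norm_num

theorem radiiS_of_mem_mid {j : Fin 8} (hj : j ∈ midIdx) : radiiS j = 1 / 4 := by
  revert hj
  fin_cases j <;> simp [radiiS, midIdx, Matrix.cons_val]

theorem paramSpace_subset_closure_genericS {q : ℂ} (hq0 : q ≠ 0) (hq : ‖q‖ < 1) :
    paramSpace ⊆ closure (separable q midIdx midIdx fun _ => 1) :=
  paramSpace_subset_closure_separable radiiS_pos prod_radiiS fun t ht h =>
    (separable_and_trigS_eq_circleMean hq0 hq ht fun j hj => by
      rw [h, radiiS_of_mem_mid hj]; norm_num).1

theorem representsMeromorphic_trigS {q : ℂ} (hq0 : q ≠ 0) (hq : ‖q‖ < 1) :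
    RepresentsMeromorphic (separable q midIdx midIdx fun _ => 1) (trigS q) :=
  (isContourFamily_trigS hq0 hq).representsMeromorphic hq0 hq (fun _ => one_ne_zero)
    (paramSpace_subset_closure_genericS hq0 hq)

theorem continuousAt_wAct_apply (j : Fin 8) {t : Fin 8 → ℂ} {s : ℂ} (hs : s ≠ 0) :
    ContinuousAt (fun y : (Fin 8 → ℂ) × ℂ => wAct y.2 y.1 j) (t, s) := by
  have h1 : ContinuousAt (fun y : (Fin 8 → ℂ) × ℂ => y.1 j) (t, s) :=
    (analyticAt_fst_apply j _).continuousAt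
  have h2 : ContinuousAt (fun y : (Fin 8 → ℂ) × ℂ => y.2) (t, s) := continuousAt_snd
  unfold wAct
  split_ifs
  exacts [h2.mul h1, (h2.inv₀ hs).mul h1]

theorem trigS_wAct {q : ℂ} (hq0 : q ≠ 0) (hq : ‖q‖ < 1) {t : Fin 8 → ℂ} (ht : t ∈ genericS q)
    {s : ℂ} (hs : s ^ 2 * (t 0 * t 1 * t 2 * t 3) = 1) (hst : wAct s t ∈ genericS q) :
    trigS q t = trigS q (wAct s t) * ratioS q t := by
  rw [genericS_eq_separable] at ht hst
  -- The value `σ = 2` is forced by `radiiS`, since `2² · 16 · 4⁻³ = 1`. The middle entries of `wt`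
  -- then have moduli `1/2` and `1/8`.
  refine eq_wAct_mul_of_eventually (representsMeromorphic_trigS hq0 hq)
    (fun t ht => analyticAt_ratioS hq (by rwa [genericS_eq_separable]))
    (P := fun t s => 1 < ‖s‖ ∧ ∀ j ∈ midIdx, ‖t j‖ < 1 ∧ ‖wAct s t j‖ < 1) ?_ radiiS_pos
    prod_radiiS (σ := 2) two_pos ?_ ?_ ht hs hst
  · rintro t ht s hs ⟨hs1, h⟩
    have hs0 : s ≠ 0 := fun h => by simp [h] at hs
    obtain ⟨d1, e1⟩ := separable_and_trigS_eq_circleMean hq0 hq ht fun j hj => (h j hj).1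
    obtain ⟨d2, e2⟩ := separable_and_trigS_eq_circleMean hq0 hq (wAct_mem_paramSpace hs0 ht)
      fun j hj => (h j hj).2
    refine ⟨d1, d2, ?_⟩
    rw [e1, e2]
    exact circleMean_integrandS_wAct hq hq0 ht hs hs1 (fun j hj => (h j hj).1)
      fun j hj => (h j hj).2
  · simp only [radiiS, Matrix.cons_val]
    norm_num
  · intro t s ht hs
    have hs0 : s ≠ 0 := norm_pos_iff.1 (by rw [hs]; norm_num)
    have h2 : ContinuousAt (fun y : (Fin 8 → ℂ) × ℂ => ‖y.2‖) (t, s) := continuousAt_snd.norm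
    refine (h2.eventually_const_lt (by simp only [hs]; norm_num)).and
      ((Filter.eventually_all_finset _).2 fun j hj => ?_)
    refine ((analyticAt_fst_apply j (t, s)).continuousAt.norm.eventually_lt_const ?_).and
      ((continuousAt_wAct_apply j hs0).norm.eventually_lt_const ?_)
    · simp only [ht, radiiS_of_mem_mid hj]; norm_num
    · simp only [wAct]
      split_ifs <;> norm_num [ht, hs, radiiS_of_mem_mid hj]

end TrigHyp
end

noncomputable section
namespace TrigHyp

/-! ### The `w`-symmetry of `U_t` -/

/-- The circle of radius `|q|^{1/2}` is admissible: for the end parameters, lying inside it means at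
the same time that `q/t_j` lies outside it. -/
theorem separable_of_norm_lt_sqrt {q : ℂ} (hq0 : q ≠ 0) (hq : ‖q‖ < 1) {r : ℂ} (hr : r ^ 2 = q)
    {t : Fin 8 → ℂ} (ht : t ∈ paramSpace) (he : ∀ j ∈ endIdx, ‖t j‖ < ‖r‖)
    (hm : ∀ j ∈ midIdx, ‖t j‖ * ‖r‖ < 1) :
    t ∈ separable q endIdx Finset.univ (scaleU q) ∧
      ∀ μ : ℂ, μ ≠ 0 → theta q (t 0 / μ) * theta q (t 7 / μ) ≠ 0 →
        trigU q t = circleMean (integrandU q μ t) r := by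
  have hr0 : r ≠ 0 := fun h => hq0 (by rw [← hr, h]; simp)
  have hb : ∀ k ∈ (Finset.univ : Finset (Fin 8)), ‖scaleU q k * t k‖ * ‖r‖ < 1 := fun k _ => by
    rcases mem_end_or_mid k with hk | hk
    · rw [scaleU_of_mem_end q hk, norm_mul, norm_inv, ← hr, norm_pow]
      have := norm_pos_iff.2 hr0
      rw [show (‖r‖ ^ 2)⁻¹ * ‖t k‖ * ‖r‖ = ‖t k‖ / ‖r‖ by field_simp, div_lt_one this]
      exact he k hk
    · rw [scaleU_of_mem_mid q hk, one_mul]; exact hm k hk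
  refine ⟨separable_of_norm_lt_circ hq ht he hb, fun μ hμ0 hμ => ?_⟩
  have hs := separates_circ hq0 hq hr0
    (fun k _ => mul_ne_zero (scaleU_ne_zero hq0 k) (paramSpace_ne_zero ht k)) he hb
  rw [← integralU_eq_trigU hq0 hq ht ((isContourU_iff_separates hq0).2 ⟨hμ0, hμ, hs⟩)]
  exact contourIntegral_div_circ _ hr0

theorem forall_mem_endIdx {p : Fin 8 → Prop} : (∀ j ∈ endIdx, p j) ↔ p 0 ∧ p 7 := by
  simp [endIdx]

theorem forall_mem_midIdx {p : Fin 8 → Prop} :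
    (∀ j ∈ midIdx, p j) ↔ p 1 ∧ p 2 ∧ p 3 ∧ p 4 ∧ p 5 ∧ p 6 := by
  simp [midIdx]

theorem InURegion.norm_bounds {r : ℂ} {ρ : ℝ} (hρ0 : 0 < ρ) (hρ1 : ρ < 1) {t : Fin 8 → ℂ} {w : ℂ}
    (hw0 : w ≠ 0) (h : InURegion r ρ t w) :
    ((∀ j ∈ endIdx, ‖t j‖ < ‖r‖) ∧ ∀ j ∈ midIdx, ‖t j‖ * ‖r‖ < 1) ∧
    (∀ j ∈ endIdx, ‖wAct w t j‖ < ‖r‖) ∧ ∀ j ∈ midIdx, ‖wAct w t j‖ * ‖r‖ < 1 := by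
  have hw1 : ‖w⁻¹‖ < 1 := h.scale.2.trans (by simpa using hρ1)
  have hr0 : 0 < ‖r‖ := by
    refine norm_pos_iff.2 fun hr => ?_
    have := h.last.1
    rw [hr, div_zero, norm_zero] at this
    exact absurd this (zpow_pos hρ0 3).le.not_gt
  have hfirst : ‖w * t 0‖ < ‖r‖ := by
    have := h.first.2.trans (show ρ ^ (1 : ℤ) < 1 by simpa using hρ1)
    rwa [norm_div, div_lt_one hr0] at this
  have hlast : ‖t 7‖ < ‖r‖ := by
    have := h.last.2.trans (show ρ ^ (1 : ℤ) < 1 by simpa using hρ1)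
    rwa [norm_div, div_lt_one hr0] at this
  have hmul : ∀ {x : ℂ} {b : ℝ}, ‖x‖ < b → ‖w⁻¹ * x‖ < b := fun {x b} hx => by
    rw [norm_mul]
    exact (mul_le_of_le_one_left (norm_nonneg _) hw1.le).trans_lt hx
  have hmul' : ∀ {x : ℂ} {b : ℝ}, ‖w * x‖ < b → ‖x‖ < b := fun {x b} hx => by
    have := hmul hx
    rwa [inv_mul_cancel_left₀ hw0] at this
  have hc : ∀ {x : ℂ}, ‖r * x‖ < 1 → ‖x‖ * ‖r‖ < 1 := fun {x} hx => by
    rwa [norm_mul, mul_comm] at hx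
  have hc1 : ∀ {x : ℂ}, ‖r * w * x‖ < 1 → ‖r * x‖ < 1 := fun {x} hx => hmul' (by
    rwa [show w * (r * x) = r * w * x by ring])
  have hc2 : ∀ {x : ℂ}, ‖r * w * x‖ < 1 → ‖r * (w * x)‖ < 1 := fun {x} hx => by rwa [← mul_assoc]
  have hc3 : ∀ {x : ℂ}, ‖r * x‖ < 1 → ‖r * (w⁻¹ * x)‖ < 1 := fun {x} hx => by
    rw [mul_left_comm]; exact hmul hx
  simp only [forall_mem_endIdx, forall_mem_midIdx]
  exact ⟨⟨⟨hmul' hfirst, hlast⟩, hc (hc1 h.one), hc (hc1 h.two), hc (hc1 h.three), hc h.four,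
    hc h.five, hc h.six⟩, ⟨hfirst, hmul hlast⟩, hc (hc2 h.one), hc (hc2 h.two), hc (hc2 h.three),
    hc (hc3 h.four), hc (hc3 h.five), hc (hc3 h.six)⟩

/-- Absolute values of parameters in the region `InURegion`. -/
def radiiU (ρ : ℝ) : Fin 8 → ℝ :=
  ![ρ ^ 10, (ρ ^ 2)⁻¹, (ρ ^ 2)⁻¹, (ρ ^ 2)⁻¹, (ρ ^ 4)⁻¹, (ρ ^ 4)⁻¹, (ρ ^ 4)⁻¹, ρ ^ 8]

theorem radiiU_pos {ρ : ℝ} (hρ : 0 < ρ) (j : Fin 8) : 0 < radiiU ρ j := by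
  fin_cases j <;> simp only [radiiU, Fin.reduceFinMk, Fin.isValue, Fin.zero_eta, Fin.mk_one,
    Matrix.cons_val] <;> positivity

theorem prod_radiiU {ρ : ℝ} (hρ : 0 < ρ) : ∏ j, radiiU ρ j = 1 := by
  rw [Fin.prod_univ_eight]
  simp only [radiiU, Matrix.cons_val]
  field_simp

/-- At the prescribed moduli all nine quantities in `InURegion` have modulus exactly `ρ²`, which
lies strictly between `ρ³` and `ρ` and below `1`. The conditions therefore persist nearby. -/
theorem eventually_inURegion {r : ℂ} {ρ : ℝ} (hρ0 : 0 < ρ) (hρ1 : ρ < 1) (hr : ‖r‖ = ρ ^ 6)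
    {t : Fin 8 → ℂ} {s : ℂ} (ht : ∀ j, ‖t j‖ = radiiU ρ j) (hs : ‖s‖ = (ρ ^ 2)⁻¹) :
    ∀ᶠ y in 𝓝 (t, s), InURegion r ρ y.1 y.2 := by
  have hs0 : s ≠ 0 := norm_pos_iff.1 (by rw [hs]; positivity)
  have hc : ∀ j, ContinuousAt (fun y : (Fin 8 → ℂ) × ℂ => y.1 j) (t, s) := fun j =>
    (analyticAt_fst_apply j _).continuousAt
  have hc2 : ContinuousAt (fun y : (Fin 8 → ℂ) × ℂ => y.2) (t, s) := continuousAt_snd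
  have h2 : ρ ^ (3 : ℤ) < ρ ^ 2 ∧ ρ ^ 2 < ρ ^ (1 : ℤ) := by
    constructor
    · exact_mod_cast pow_lt_pow_right_of_lt_one₀ hρ0 hρ1 (by norm_num : 2 < 3)
    · exact_mod_cast pow_lt_pow_right_of_lt_one₀ hρ0 hρ1 (by norm_num : 1 < 2)
  have h21 : ρ ^ 2 < 1 := pow_lt_one₀ hρ0.le hρ1 two_ne_zero
  have key : ∀ {f : (Fin 8 → ℂ) × ℂ → ℂ}, ContinuousAt f (t, s) → ‖f (t, s)‖ = ρ ^ 2 →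
      ∀ᶠ y in 𝓝 (t, s), ρ ^ (3 : ℤ) < ‖f y‖ ∧ ‖f y‖ < ρ ^ (1 : ℤ) := fun {f} hf he =>
    (hf.norm.eventually_const_lt (by simp only [he]; exact h2.1)).and
      (hf.norm.eventually_lt_const (by simp only [he]; exact h2.2))
  have key1 : ∀ {f : (Fin 8 → ℂ) × ℂ → ℂ}, ContinuousAt f (t, s) → ‖f (t, s)‖ = ρ ^ 2 →
      ∀ᶠ y in 𝓝 (t, s), ‖f y‖ < 1 := fun {f} hf he =>
    hf.norm.eventually_lt_const (by simp only [he]; exact h21)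
  have k1 : ∀ j, radiiU ρ j = (ρ ^ 2)⁻¹ → ∀ᶠ y : (Fin 8 → ℂ) × ℂ in 𝓝 (t, s),
      ‖r * y.2 * y.1 j‖ < 1 := fun j hj =>
    key1 ((continuousAt_const.mul hc2).mul (hc j)) (by
      rw [norm_mul, norm_mul, hr, hs, ht, hj]; field_simp)
  have k4 : ∀ j, radiiU ρ j = (ρ ^ 4)⁻¹ → ∀ᶠ y : (Fin 8 → ℂ) × ℂ in 𝓝 (t, s),
      ‖r * y.1 j‖ < 1 := fun j hj =>
    key1 (continuousAt_const.mul (hc j)) (by rw [norm_mul, hr, ht, hj]; field_simp)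
  have k0 := key (f := fun y => y.2 * y.1 0 / r) ((hc2.mul (hc 0)).div_const r) (by
    rw [norm_div, norm_mul, hr, hs, ht, show radiiU ρ 0 = ρ ^ 10 from rfl]; field_simp)
  have k7 := key (f := fun y => y.1 7 / r) ((hc 7).div_const r) (by
    rw [norm_div, hr, ht, show radiiU ρ 7 = ρ ^ 8 from rfl]; field_simp)
  have ks := key (f := fun y => y.2⁻¹) (hc2.inv₀ hs0) (by rw [norm_inv, hs, inv_inv])
  filter_upwards [k0, k7, ks, k1 1 rfl, k1 2 rfl, k1 3 rfl, k4 4 rfl, k4 5 rfl, k4 6 rfl]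
    with y a b c d e f g h i using ⟨a, b, c, d, e, f, g, h, i⟩

/-- A twelfth root of `q` provides the square root `r` and a base `ρ` in which all moduli needed are
integral powers. -/
theorem exists_pow_eq_norm {q : ℂ} (hq0 : q ≠ 0) (hq : ‖q‖ < 1) :
    ∃ (r : ℂ) (ρ : ℝ), r ^ 2 = q ∧ 0 < ρ ∧ ρ < 1 ∧ ρ ^ 12 = ‖q‖ ∧ ‖r‖ = ρ ^ 6 := by
  obtain ⟨p, hp⟩ := IsAlgClosed.exists_pow_nat_eq q (by norm_num : 0 < 12)
  have hn : ‖p‖ ^ 12 = ‖q‖ := by rw [← norm_pow, hp]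
  have hp0 : p ≠ 0 := fun h => hq0 (by rw [← hp, h]; simp)
  exact ⟨p ^ 6, ‖p‖, by rw [← pow_mul, hp], norm_pos_iff.2 hp0,
    (pow_lt_one_iff_of_nonneg (norm_nonneg p) (by norm_num)).1 (hn ▸ hq), hn, norm_pow p 6⟩

theorem radiiU_bounds {ρ : ℝ} (hρ0 : 0 < ρ) (hρ1 : ρ < 1) :
    (∀ j ∈ endIdx, radiiU ρ j < ρ ^ 6) ∧ ∀ j ∈ midIdx, radiiU ρ j * ρ ^ 6 < 1 := by
  simp only [forall_mem_endIdx, forall_mem_midIdx, radiiU, Matrix.cons_val]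
  have h : ∀ {m n : ℕ}, m < n → ρ ^ n < ρ ^ m := pow_lt_pow_right_of_lt_one₀ hρ0 hρ1
  have h2 : (ρ ^ 2)⁻¹ * ρ ^ 6 < 1 := by
    rw [inv_mul_lt_iff₀ (by positivity), mul_one]; exact h (by norm_num)
  have h4 : (ρ ^ 4)⁻¹ * ρ ^ 6 < 1 := by
    rw [inv_mul_lt_iff₀ (by positivity), mul_one]; exact h (by norm_num)
  exact ⟨⟨h (by norm_num), h (by norm_num)⟩, h2, h2, h2, h4, h4, h4⟩

theorem representsMeromorphic_trigU {q : ℂ} (hq0 : q ≠ 0) (hq : ‖q‖ < 1) :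
    RepresentsMeromorphic (separable q endIdx Finset.univ (scaleU q)) (trigU q) := by
  obtain ⟨r, ρ, hr, hρ0, hρ1, -, hrρ⟩ := exists_pow_eq_norm hq0 hq
  obtain ⟨b1, b2⟩ := radiiU_bounds hρ0 hρ1
  refine (isContourFamily_trigU hq0 hq).representsMeromorphic hq0 hq (scaleU_ne_zero hq0)
    (paramSpace_subset_closure_separable (radiiU_pos hρ0) (prod_radiiU hρ0) fun t ht h =>
      (separable_of_norm_lt_sqrt hq0 hq hr ht ?_ ?_).1)
  · simpa only [h, hrρ] using b1
  · simpa only [h, hrρ] using b2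

theorem trigU_wAct {q : ℂ} (hq0 : q ≠ 0) (hq : ‖q‖ < 1) {t : Fin 8 → ℂ} (ht : t ∈ genericU q)
    {s : ℂ} (hs : s ^ 2 * (t 0 * t 1 * t 2 * t 3) = 1) (hst : wAct s t ∈ genericU q) :
    trigU q t = trigU q (wAct s t) * ratioU q t := by
  obtain ⟨r, ρ, hr, hρ0, hρ1, hρ, hrρ⟩ := exists_pow_eq_norm hq0 hq
  rw [genericU_eq_separable hq0] at ht hst
  -- The modulus `ρ⁻²` of the scaling parameter is forced by `radiiU`, since the first four radii
  -- multiply to `ρ⁴`.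
  refine eq_wAct_mul_of_eventually (representsMeromorphic_trigU hq0 hq)
    (fun t ht => analyticAt_ratioU hq (by rwa [genericU_eq_separable hq0]))
    (P := InURegion r ρ) ?_ (radiiU_pos hρ0) (prod_radiiU hρ0)
    (σ := (ρ ^ 2)⁻¹) (by positivity) ?_ ?_ ht hs hst
  · intro t ht s hs h
    have hs0 : s ≠ 0 := fun h => by simp [h] at hs
    obtain ⟨⟨b1, b2⟩, b3, b4⟩ := h.norm_bounds hρ0 hρ1 hs0
    obtain ⟨d1, e1⟩ := separable_of_norm_lt_sqrt hq0 hq hr ht b1 b2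
    obtain ⟨d2, e2⟩ := separable_of_norm_lt_sqrt hq0 hq hr (wAct_mem_paramSpace hs0 ht) b3 b4
    obtain ⟨μ, ν, hμ, hν, he⟩ := circleMean_integrandU_wAct hq0 hq hr hρ0 hρ1 hρ ht hs h
    refine ⟨d1, d2, ?_⟩
    rw [e1 μ hμ.1 hμ.2, e2 ν hν.1 hν.2]
    exact he
  · simp only [radiiU, Matrix.cons_val]
    field_simp
  · exact fun t s ht hs => eventually_inURegion hρ0 hρ1 hrρ ht hs

end TrigHyp
end

/-! ### The main theorem -/

open TrigHyp in
theorem proposition5p6 (q : ℂ) (hq0 : q ≠ 0) (hq1 : ‖q‖ < 1) :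
    -- `S_t` and `U_t` are well defined: contours exist for generic parameters, and the value of
    -- the integral depends neither on the contour nor on `μ`
    (∀ t ∈ genericS q, (∃ γ, IsContourS q t γ) ∧
      ∀ γ, IsContourS q t γ → integralS q t γ = trigS q t) ∧
    (∀ t ∈ genericU q, (∃ μ γ, IsContourU q t μ γ) ∧
      ∀ μ γ, IsContourU q t μ γ → integralU q μ t γ = trigU q t) ∧
    -- they are meromorphic functions on the quotient of the parameter space by `t ↦ -t`
    RepresentsMeromorphic (genericS q) (trigS q) ∧
    RepresentsMeromorphic (genericU q) (trigU q) ∧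
    (∀ t ∈ genericS q, -t ∈ genericS q ∧ trigS q (-t) = trigS q t) ∧
    (∀ t ∈ genericU q, -t ∈ genericU q ∧ trigU q (-t) = trigU q t) ∧
    -- permutations of `(t_1, t_8)` and of `(t_2, …, t_7)`
    (∀ σ : Equiv.Perm (Fin 8), (∀ j, σ j ∈ endIdx ↔ j ∈ endIdx) →
      (∀ t ∈ genericS q, t ∘ σ ∈ genericS q ∧ trigS q (t ∘ σ) = trigS q t) ∧
      (∀ t ∈ genericU q, t ∘ σ ∈ genericU q ∧ trigU q (t ∘ σ) = trigU q t)) ∧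
    -- the `w`-symmetry of `S_t`
    (∀ t ∈ genericS q, ∀ s : ℂ, s ^ 2 * (t 0 * t 1 * t 2 * t 3) = 1 → wAct s t ∈ genericS q →
      trigS q t = trigS q (wAct s t) *
        ((qPoch q (1 / (t 0 * t 1)) * qPoch q (1 / (t 0 * t 2)) * qPoch q (1 / (t 0 * t 3)) *
          qPoch q (1 / (t 7 * t 4)) * qPoch q (1 / (t 7 * t 5)) * qPoch q (1 / (t 7 * t 6))) /
        (qPoch q (t 1 * t 2) * qPoch q (t 1 * t 3) * qPoch q (t 2 * t 3) *
          qPoch q (t 4 * t 5) * qPoch q (t 4 * t 6) * qPoch q (t 5 * t 6)))) ∧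
    -- the `w`-symmetry of `U_t`
    (∀ t ∈ genericU q, ∀ s : ℂ, s ^ 2 * (t 0 * t 1 * t 2 * t 3) = 1 → wAct s t ∈ genericU q →
      trigU q t = trigU q (wAct s t) *
        ((qPoch q (1 / (t 1 * t 2)) * qPoch q (1 / (t 1 * t 3)) * qPoch q (1 / (t 2 * t 3)) *
          qPoch q (1 / (t 4 * t 5)) * qPoch q (1 / (t 4 * t 6)) * qPoch q (1 / (t 5 * t 6))) /
        (qPoch q (t 0 * t 1) * qPoch q (t 0 * t 2) * qPoch q (t 0 * t 3) *
          qPoch q (t 4 * t 7) * qPoch q (t 5 * t 7) * qPoch q (t 6 * t 7)))) := by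
  refine ⟨fun t ht => ⟨exists_isContourS hq0 hq1 ht, fun γ hγ => integralS_eq_trigS hq0 hq1 ht.1 hγ⟩,
    fun t ht => ⟨exists_isContourU hq0 hq1 ht, fun μ γ hγ => integralU_eq_trigU hq0 hq1 ht.1 hγ⟩,
    ?_, ?_, fun t ht => trigS_neg hq0 hq1 ht, fun t ht => trigU_neg hq0 hq1 ht,
    fun σ hσ => ⟨fun t ht => trigS_comp_perm hq0 hq1 hσ ht,
      fun t ht => trigU_comp_perm hq0 hq1 hσ ht⟩,
    fun t ht s hs hst => trigS_wAct hq0 hq1 ht hs hst,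
    fun t ht s hs hst => trigU_wAct hq0 hq1 ht hs hst⟩
  · rw [genericS_eq_separable]; exact representsMeromorphic_trigS hq0 hq1
  · rw [genericU_eq_separable hq0]; exact representsMeromorphic_trigU hq0 hq1
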